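/- **Corollary 2.2.** A Lie algebra of $n\times n$ matrices over a field $F$ is a linear subspace $L\subseteq M_n(F)$ closed under $[A,B]=AB-BA$; it is *abelian* if its elements commute, and *diagonalizable* if there is $g\in GL_n(F)$ such that $gXg^{-1}$ is diagonal for all $X\in L$. Two such Lie algebras $L_1,L_2$ are *conjugate* if $gL_1g^{-1}=L_2$ for some $g\in GL_n(F)$. Programs are programs of a random access machine over a field: it has registers for natural numbers (assignment of constants, addition, truncated subtraction, comparison), arrays of elements of $F$ with indirect addressing (the constants $0$ and $1$, the four field operations, test for $0$), branching, and loops that are repeated the number of times given by a register. Each instruction, test and turn of a loop takes one time step. A program with *root extraction* may moreover replace a list of $m$ field elements $c_0,\dots,c_{m-1}$, in $m+1$ time steps, by a root in $F$ of $\sum_{i<m} c_iT^i$, if this polynomial is nonzero and has a root in $F$ (if not, the value obtained may be any element of $F$). Let $D\in\mathbb N$ be a constant. Then conjugacy of abelian diagonalizable Lie algebras of $n\times n$ matrices of dimension at most $D$ can be solved over every field in time polynomial in $n$. Precisely: 1. (Decision.) There are a program without root extraction and a polynomial $T$, both depending only on $D$, such that for every field $F$, every $n\ge 0$ and any two abelian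 diagonalizable Lie algebras $L_1,L_2\subseteq M_n(F)$ of dimension at most $D$, given by bases, the program decides in at most $T(n)$ time steps whether $L_1$ and $L_2$ are conjugate. 2. (Search.) There are a program with root extraction and a polynomial $T$, both depending only on $D$, such that for every field $F$, every $n\ge 0$ and any two such $L_1,L_2\subseteq M_n(F)$, given by bases, the program outputs in at most $T(n)$ time steps a matrix $g\in GL_n(F)$ with $gL_1g^{-1}=L_2$ if there is one, and otherwise reports that $L_1$ and $L_2$ are not conjugate. -/

import Mathlib

/-!
A random access machine over a field: programs handle natural numbers (sizes, counters, indices)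
and elements of an arbitrary field. The text of a program does not mention the field: its only
field constants are `0` and `1`, so that one program runs over every field.
-/

namespace FieldRAM

/-- The memory: registers for natural numbers, and cells for field elements. The cells form
arrays `fld 0, fld 1, …`; a cell of an array is addressed by a finite list of natural numbers. -/
structure State (F : Type*) where
  nat : ℕ → ℕ
  fld : ℕ → List ℕ → F

/-- A reference to a field cell as it is written in a program: the number of an array, and the list
of the natural-number registers that hold the indices (indirect addressing). Both the array number
and the number of indices are fixed in the program. -/
structure Loc where
  arr : ℕ
  idx : List ℕ

/-- Programs. -/
inductive Prog where
  /-- do nothing -/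
  | skip : Prog
  /-- `x := k` for a literal `k` -/
  | natConst (x k : ℕ) : Prog
  /-- `x := y + z` for registers `x, y, z` -/
  | natAdd (x y z : ℕ) : Prog
  /-- `x := y - z` for registers `x, y, z` (truncated at `0`) -/
  | natSub (x y z : ℕ) : Prog
  /-- `a := 0` for a field cell `a` -/
  | fldZero (a : Loc) : Prog
  /-- `a := 1` for a field cell `a` -/
  | fldOne (a : Loc) : Prog
  /-- `a := b + c` for field cells `a, b, c` -/
  | fldAdd (a b c : Loc) : Prog
  /-- `a := b - c` for field cells `a, b, c` -/
  | fldSub (a b c : Loc) : Prog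
  /-- `a := b * c` for field cells `a, b, c` -/
  | fldMul (a b c : Loc) : Prog
  /-- `a := b / c` for field cells `a, b, c` -/
  | fldDiv (a b c : Loc) : Prog
  /-- root extraction: `a :=` a root of the univariate polynomial `∑ i < x, b[i] T ^ i`, whose
  number `x` of coefficients is read in a register, the index `i` being appended to those of `b` -/
  | root (a b : Loc) (x : ℕ) : Prog
  /-- run the first program, then the second -/
  | seq (p q : Prog) : Prog
  /-- if register `x` is less than register `y`, run the first program, else the second -/
  | ifLt (x y : ℕ) (p q : Prog) : Prog
  /-- if the field cell `a` holds `0`, run the first program, else the second -/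
  | ifZero (a : Loc) (p q : Prog) : Prog
  /-- repeat the program as many times as register `x` says when the loop is entered -/
  | loop (x : ℕ) (p : Prog) : Prog

namespace State

variable {F : Type*}

/-- The value of the field cell that `a` refers to. -/
def get (s : State F) (a : Loc) : F := s.fld a.arr (a.idx.map s.nat)

/-- Overwrite the field cell that `a` refers to. -/
def put (s : State F) (a : Loc) (v : F) : State F where
  nat := s.nat
  fld := Function.update s.fld a.arr (Function.update (s.fld a.arr) (a.idx.map s.nat) v)

/-- Overwrite a natural-number register. -/
def putNat (s : State F) (x k : ℕ) : State F where
  nat := Function.update s.nat x k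
  fld := s.fld

/-- The polynomial with coefficients `b[0], …, b[m - 1]`. -/
noncomputable def poly [Field F] (s : State F) (b : Loc) (m : ℕ) : Polynomial F :=
  ∑ i ∈ Finset.range m, Polynomial.monomial i (s.fld b.arr (b.idx.map s.nat ++ [i]))

end State

/-- `ρ` answers the root extractions correctly: it sends every nonzero univariate polynomial that
has a root in `F` to one of its roots in `F`. Nothing is required of the other values. -/
def IsRootFinder {F : Type*} [Field F] (ρ : Polynomial F → F) : Prop :=
  ∀ f : Polynomial F, f ≠ 0 → (∃ x, f.IsRoot x) → f.IsRoot (ρ f)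

namespace Prog

/-- The program contains no root extraction: all it does with field elements is `0`, `1`, the four
field operations and tests for zero. -/
def FieldOperationsOnly : Prog → Prop
  | root _ _ _ => False
  | seq p q => p.FieldOperationsOnly ∧ q.FieldOperationsOnly
  | ifLt _ _ p q => p.FieldOperationsOnly ∧ q.FieldOperationsOnly
  | ifZero _ p q => p.FieldOperationsOnly ∧ q.FieldOperationsOnly
  | loop _ p => p.FieldOperationsOnly
  | _ => True

variable {F : Type*} [Field F]

open Classical in
/-- The state after the program has been run from the state `s`, root extractions being answered
by `ρ`. -/
noncomputable def exec (ρ : Polynomial F → F) : Prog → State F → State F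
  | skip, s => s
  | natConst x k, s => s.putNat x k
  | natAdd x y z, s => s.putNat x (s.nat y + s.nat z)
  | natSub x y z, s => s.putNat x (s.nat y - s.nat z)
  | fldZero a, s => s.put a 0
  | fldOne a, s => s.put a 1
  | fldAdd a b c, s => s.put a (s.get b + s.get c)
  | fldSub a b c, s => s.put a (s.get b - s.get c)
  | fldMul a b c, s => s.put a (s.get b * s.get c)
  | fldDiv a b c, s => s.put a (s.get b / s.get c)
  | root a b x, s => s.put a (ρ (s.poly b (s.nat x)))
  | seq p q, s => exec ρ q (exec ρ p s)
  | ifLt x y p q, s => if s.nat x < s.nat y then exec ρ p s else exec ρ q s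
  | ifZero a p q, s => if s.get a = 0 then exec ρ p s else exec ρ q s
  | loop x p, s => (exec ρ p)^[s.nat x] s

open Classical in
/-- The running time from the state `s`: every elementary instruction, every test and every turn
of a loop counts one step; a root extraction counts one step more for each coefficient. -/
noncomputable def time (ρ : Polynomial F → F) : Prog → State F → ℕ
  | root _ _ x, s => s.nat x + 1
  | seq p q, s => time ρ p s + time ρ q (exec ρ p s)
  | ifLt x y p q, s => (if s.nat x < s.nat y then time ρ p s else time ρ q s) + 1
  | ifZero a p q, s => (if s.get a = 0 then time ρ p s else time ρ q s) + 1
  | loop x p, s => (∑ i ∈ Finset.range (s.nat x), (time ρ p ((exec ρ p)^[i] s) + 1)) + 1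
  | _, _ => 1

end Prog

end FieldRAM

/- The Lie bracket of square matrices is `⁅A, B⁆ = A * B - B * A`. -/
attribute [local instance 100] LieRing.ofAssociativeRing

namespace MatrixLie

open Matrix

variable {F : Type*} [Field F] {n : ℕ}

/-- A Lie algebra of `n × n` matrices is abelian and diagonalizable: its elements commute, and
it is conjugate over `F` to a set of diagonal matrices. -/
structure AbelianDiagonalizable (L : LieSubalgebra F (Matrix (Fin n) (Fin n) F)) : Prop where
  abelian : IsLieAbelian L
  diagonalizable : ∃ g : GL (Fin n) F, ∀ X ∈ L,
    ((g : Matrix (Fin n) (Fin n) F) * X * ((g⁻¹ : GL (Fin n) F) : Matrix (Fin n) (Fin n) F)).IsDiag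

/-- `g L₁ g⁻¹ = L₂`. -/
def ConjugatedBy (g : GL (Fin n) F) (L₁ L₂ : LieSubalgebra F (Matrix (Fin n) (Fin n) F)) : Prop :=
  (fun X : Matrix (Fin n) (Fin n) F =>
    (g : Matrix (Fin n) (Fin n) F) * X * ((g⁻¹ : GL (Fin n) F) : Matrix (Fin n) (Fin n) F)) ''
      (L₁ : Set (Matrix (Fin n) (Fin n) F)) = (L₂ : Set (Matrix (Fin n) (Fin n) F))

/-- Two matrix Lie algebras are conjugate. -/
def Conjugate (L₁ L₂ : LieSubalgebra F (Matrix (Fin n) (Fin n) F)) : Prop :=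
  ∃ g : GL (Fin n) F, ConjugatedBy g L₁ L₂

/-- The content of the cells of an array that holds the matrices `M 0, …, M (d - 1)`: entry
`(r, c)` of matrix `i` is the cell with indices `i, r, c`, and every other cell is `0`. -/
def matrixCells {d : ℕ} (M : Fin d → Matrix (Fin n) (Fin n) F) : List ℕ → F
  | [i, r, c] =>
      if h : i < d ∧ r < n ∧ c < n then M ⟨i, h.1⟩ ⟨r, h.2.1⟩ ⟨c, h.2.2⟩ else 0
  | _ => 0

/-- The initial state of a program on two matrix Lie algebras, given by bases: registers `0, 1, 2`
hold `n` and the numbers of basis elements, arrays `0` and `1` hold the basis elements of the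
first and of the second Lie algebra, and everything else is `0`. -/
noncomputable def input {d₁ d₂ : ℕ} {L₁ L₂ : LieSubalgebra F (Matrix (Fin n) (Fin n) F)}
    (b₁ : Module.Basis (Fin d₁) F L₁) (b₂ : Module.Basis (Fin d₂) F L₂) : FieldRAM.State F where
  nat
    | 0 => n
    | 1 => d₁
    | 2 => d₂
    | _ => 0
  fld
    | 0 => matrixCells fun i => (b₁ i : Matrix (Fin n) (Fin n) F)
    | 1 => matrixCells fun i => (b₂ i : Matrix (Fin n) (Fin n) F)
    | _ => fun _ => 0

/-- The `n × n` matrix that a final state shows in array `2`. -/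
def outputMatrix (n : ℕ) (s : FieldRAM.State F) : Matrix (Fin n) (Fin n) F :=
  Matrix.of fun r c => s.fld 2 [(r : ℕ), (c : ℕ)]

/-- A final state gives the right answer to the decision problem: register `0` holds `1` if the Lie
algebras are conjugate, and `0` if they are not. -/
def Decides (L₁ L₂ : LieSubalgebra F (Matrix (Fin n) (Fin n) F)) (s : FieldRAM.State F) : Prop :=
  (s.nat 0 = 1 ∧ Conjugate L₁ L₂) ∨ (s.nat 0 = 0 ∧ ¬ Conjugate L₁ L₂)

/-- A final state gives a right answer to the search problem: either register `0` holds `1` and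
array `2` shows an invertible matrix `g` with `g L₁ g⁻¹ = L₂`, or register `0` holds `0` and the
Lie algebras are not conjugate. -/
def Finds (L₁ L₂ : LieSubalgebra F (Matrix (Fin n) (Fin n) F)) (s : FieldRAM.State F) : Prop :=
  (s.nat 0 = 1 ∧ ∃ g : GL (Fin n) F,
    (g : Matrix (Fin n) (Fin n) F) = outputMatrix n s ∧ ConjugatedBy g L₁ L₂) ∨
  (s.nat 0 = 0 ∧ ¬ Conjugate L₁ L₂)

end MatrixLie

universe u

/-! Let `A i` and `B j` be the given bases. A simultaneous diagonalization attaches a weight in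
`F^d` to each of the n points of an eigenbasis. The weights of the first algebra span `F^d`, since
the `A i` are linearly independent (`Weights.span_eq_top`). Algebras of the same dimension d are
conjugate exactly if some linear automorphism of `F^d` carries the weights of the first, with
multiplicities, to those of the second. Such a map is determined by the images of d independent
weights. It is therefore encoded by invertible matrices `W` and `U`, whose rows are these weights
and their images; it sends `χ` to `χ ᵥ* W⁻¹ ᵥ* U`. Column i of `W` consists of eigenvalues of `A i`,
column i of `U` of eigenvalues of `B i`, so there are at most n^(2d²) candidates. For each of them
it suffices to compare, for the at most n^d tuples `χ` of eigenvalues of the `A i`, the dimension of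
the weight space of `χ` with that of its image (`CheckOK`, `conjugate_iff_exists_checkOK`). All of
this is polynomial in n for bounded d.

The comparison suffices because it produces a conjugating matrix (`conjugating_matrix`). Take a
basis φ_t of the row vectors of weight `χ` for `A`, and a basis v_t of the column vectors of the
image weight for `B`. The sum G of the rank-one matrices v_t φ_t over all `χ` and t satisfies `G * A
i = (∑ j, (U⁻¹ * W) j i • B j) * G`. It is injective because weight spaces of distinct weights are
independent and every weight of `A` occurs among the `χ`. Conversely, a conjugation yields suitable
`W` and `U` (`exists_checkOK`). Kernels and weight spaces are computed by a row reduction that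
changes a second table in parallel and so records the linear relations it finds (`rowReduce_eval`,
`IsReduction.kernel`).

For the search, the eigenvalues are listed: the relation between the powers of a matrix gives an
annihilating polynomial, whose roots are extracted and divided out one by one (`eigenvalues_eval`).
All candidates are then tried.

For the decision, eigenvalues cannot be computed, but a program that uses an eigenvalue of a
diagonalizable matrix M can be run on all of them at once. In place of field elements one computes
with matrices `dg P Q v` that are diagonal in an unknown eigenbasis of M, with one value `v p` per
point `p`: M itself stands for the eigenvalue, scalar matrices for the other input. Sums and
products are those of matrices, and division is a pseudo-inverse that is found by row reduction
(`dg_inv_eq`, `pinv_eval`). If a test for zero fails at some points of the current component, the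
points where the value is zero are dropped and the computation goes on with the idempotent of the
others (`shrink_sim`). The points that survive to the end have all followed the same path and share
its answer (`lift_sim`). They are removed, and the run is repeated on what remains; n runs exhaust
all points (`guessRun_step`, `exGuess_correct`). The simulating program again uses field operations
only, so that simulations can be nested (`exGuesses_correct`): there are 2d² existential guesses for
`W` and `U`, and d universal ones for `χ`, which are negated existential ones (`notP`). The depth
depends on d alone, and each level turns a polynomial time bound into another one.

The concrete programs are written in a small language of expressions and statements.
`Stm.compile_correct` gives once and for all the effect and a polynomial time bound of the compiled
program. The bound D allows one program per dimension. -/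

namespace FieldRAM

set_option linter.unusedSectionVars false

/-! ### A language of expressions and loops that compiles to programs -/

/-- The contents of the field cells. -/
abbrev Mem (F : Type*) := ℕ → List ℕ → F

/-- Overwrite one cell. -/
def Mem.set {F : Type*} (f : Mem F) (a : ℕ) (l : List ℕ) (v : F) : Mem F :=
  fun a' l' => if a' = a ∧ l' = l then v else f a' l'

/-- Expressions for field elements. -/
inductive Ex where
  | zero : Ex
  | one : Ex
  | cell (a : Loc) : Ex
  | add (e₁ e₂ : Ex) : Ex
  | sub (e₁ e₂ : Ex) : Ex
  | mul (e₁ e₂ : Ex) : Ex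
  | div (e₁ e₂ : Ex) : Ex
  /-- the second expression if the first is zero, else the third -/
  | ifz (e e₁ e₂ : Ex) : Ex
  /-- `1` if the two registers agree, else `0` -/
  | delta (x y : ℕ) : Ex
  /-- the sum over the values of register `k` below register `x` -/
  | sum (k x : ℕ) (e : Ex) : Ex
  /-- `1` if the expression is nonzero for some value of register `k` below register `x` -/
  | any (k x : ℕ) (e : Ex) : Ex
  /-- `1` if the two expressions are nonzero equally often -/
  | cntEq (k c₁ c₂ x y : ℕ) (e₁ e₂ : Ex) : Ex

namespace Ex

variable {F : Type*} [Field F]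

open Classical in
/-- The value of an expression. -/
noncomputable def eval : Ex → (ℕ → ℕ) → Mem F → F
  | zero, _, _ => 0
  | one, _, _ => 1
  | cell a, r, f => f a.arr (a.idx.map r)
  | add a b, r, f => a.eval r f + b.eval r f
  | sub a b, r, f => a.eval r f - b.eval r f
  | mul a b, r, f => a.eval r f * b.eval r f
  | div a b, r, f => a.eval r f / b.eval r f
  | ifz e a b, r, f => if e.eval r f = 0 then a.eval r f else b.eval r f
  | delta x y, r, _ => if r x = r y then 1 else 0
  | sum k x e, r, f => ∑ i ∈ Finset.range (r x), e.eval (Function.update r k i) f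
  | any k x e, r, f => if ∃ i < r x, e.eval (Function.update r k i) f ≠ 0 then 1 else 0
  | cntEq k _ _ x y a b, r, f =>
      if Nat.count (fun i => a.eval (Function.update r k i) f ≠ 0) (r x) =
        Nat.count (fun i => b.eval (Function.update r k i) f ≠ 0) (r y) then 1 else 0

/-- Every register that is read lies in `V`, every bound of a loop in `B`, and the registers that
are written do not lie in `V`. -/
def WF : Ex → Set ℕ → Set ℕ → Prop
  | zero, _, _ => True
  | one, _, _ => True
  | cell a, V, _ => a.arr ≠ 3 ∧ ∀ x ∈ a.idx, x ∈ V
  | add a b, V, B => a.WF V B ∧ b.WF V B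
  | sub a b, V, B => a.WF V B ∧ b.WF V B
  | mul a b, V, B => a.WF V B ∧ b.WF V B
  | div a b, V, B => a.WF V B ∧ b.WF V B
  | ifz e a b, V, B => e.WF V B ∧ a.WF V B ∧ b.WF V B
  | delta x y, V, _ => x ∈ V ∧ y ∈ V
  -- Register `1` is excluded as a loop counter because `incr` overwrites it with the constant one.
  | sum k x e, V, B => x ∈ V ∧ x ∈ B ∧ k ∉ V ∧ k ≠ 1 ∧ e.WF (insert k V) (insert k B)
  | any k x e, V, B => x ∈ V ∧ x ∈ B ∧ k ∉ V ∧ k ≠ 1 ∧ e.WF (insert k V) (insert k B)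
  -- The operands must be well-formed in two ways: over `V` alone, so that their values cannot
  -- depend on the counters, and with the counters added to `V`, so that evaluating the operands
  -- does not disturb the running counts.
  | cntEq k c₁ c₂ x y a b, V, B => x ∈ V ∧ x ∈ B ∧ y ∈ V ∧ y ∈ B ∧ k ∉ V ∧ k ≠ 1 ∧
      c₁ ∉ V ∧ c₁ ∉ B ∧ c₁ ≠ 1 ∧ c₂ ∉ V ∧ c₂ ∉ B ∧ c₂ ≠ 1 ∧ k ≠ c₁ ∧ k ≠ c₂ ∧ c₁ ≠ c₂ ∧
      a.WF (insert k V) (insert k B) ∧ b.WF (insert k V) (insert k B) ∧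
      a.WF (insert k (insert c₁ (insert c₂ V))) (insert k B) ∧
      b.WF (insert k (insert c₁ (insert c₂ V))) (insert k B)

end Ex

/-- Statements: they change field cells only. The registers bound by loops are local. -/
inductive Stm where
  | skip : Stm
  | asg (a : Loc) (e : Ex) : Stm
  | seq (p q : Stm) : Stm
  | ifz (e : Ex) (p q : Stm) : Stm
  | loop (k x : ℕ) (p : Stm) : Stm
  | letAdd (k x y : ℕ) (p : Stm) : Stm
  | letSub (k x y : ℕ) (p : Stm) : Stm
  | letConst (k c : ℕ) (p : Stm) : Stm
  | root (a b : Loc) (x : ℕ) : Stm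

namespace Stm

variable {F : Type*} [Field F]

open Classical in
/-- The cells after a statement. -/
noncomputable def eval (ρ : Polynomial F → F) : Stm → (ℕ → ℕ) → Mem F → Mem F
  | skip, _, f => f
  | asg a e, r, f => f.set a.arr (a.idx.map r) (e.eval r f)
  | seq p q, r, f => q.eval ρ r (p.eval ρ r f)
  | ifz e p q, r, f => if e.eval r f = 0 then p.eval ρ r f else q.eval ρ r f
  | loop k x p, r, f => Nat.rec f (fun i f => p.eval ρ (Function.update r k i) f) (r x)
  | letAdd k x y p, r, f => p.eval ρ (Function.update r k (r x + r y)) f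
  | letSub k x y p, r, f => p.eval ρ (Function.update r k (r x - r y)) f
  | letConst k c p, r, f => p.eval ρ (Function.update r k c) f
  | root a b x, r, f => f.set a.arr (a.idx.map r)
      (ρ (∑ i ∈ Finset.range (r x), Polynomial.monomial i (f b.arr (b.idx.map r ++ [i]))))

/-- Well-formedness, see `Ex.WF`. -/
def WF : Stm → Set ℕ → Set ℕ → Prop
  | skip, _, _ => True
  | asg a e, V, B => a.arr ≠ 3 ∧ (∀ x ∈ a.idx, x ∈ V) ∧ e.WF V B
  | seq p q, V, B => p.WF V B ∧ q.WF V B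
  | ifz e p q, V, B => e.WF V B ∧ p.WF V B ∧ q.WF V B
  | loop k x p, V, B => x ∈ V ∧ x ∈ B ∧ k ∉ V ∧ k ≠ 1 ∧ p.WF (insert k V) (insert k B)
  | letAdd k x y p, V, B =>
      x ∈ V ∧ x ∈ B ∧ y ∈ V ∧ y ∈ B ∧ k ∉ V ∧ k ≠ 1 ∧ p.WF (insert k V) (insert k B)
  | letSub k x y p, V, B =>
      x ∈ V ∧ x ∈ B ∧ y ∈ V ∧ k ∉ V ∧ k ≠ 1 ∧ p.WF (insert k V) (insert k B)
  | letConst k _ p, V, B => k ∉ V ∧ k ≠ 1 ∧ p.WF (insert k V) (insert k B)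
  | root a b x, V, B =>
      a.arr ≠ 3 ∧ (∀ y ∈ a.idx, y ∈ V) ∧ b.arr ≠ 3 ∧ (∀ y ∈ b.idx, y ∈ V) ∧ x ∈ V ∧ x ∈ B

/-- No root extraction. -/
def NoRoot : Stm → Prop
  | root _ _ _ => False
  | seq p q => p.NoRoot ∧ q.NoRoot
  | ifz _ p q => p.NoRoot ∧ q.NoRoot
  | loop _ _ p => p.NoRoot
  | letAdd _ _ _ p => p.NoRoot
  | letSub _ _ _ p => p.NoRoot
  | letConst _ _ p => p.NoRoot
  | _ => True

end Stm

/-! ### Compilation -/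

/-- The cell for the intermediate result number `t`. -/
def tmp (t : ℕ) : Loc := ⟨3, List.replicate t 0⟩

/-- Increment a register; register `1` is used for the constant `1`. -/
def incr (c : ℕ) : Prog := .seq (.natConst 1 1) (.natAdd c c 1)

/-- Run `p` for the values of register `k` below register `x`. -/
def forP (k x : ℕ) (p : Prog) : Prog :=
  .seq (.natConst k 0) (.loop x (.seq p (incr k)))

/-- The program that leaves the value of an expression in the cell `tmp t`. -/
def Ex.compile : Ex → ℕ → Prog
  | zero, t => .fldZero (tmp t)
  | one, t => .fldOne (tmp t)
  -- There is no move instruction; a cell is copied by adding it to zero.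
  | cell a, t => .seq (.fldZero (tmp t)) (.fldAdd (tmp t) a (tmp t))
  | add a b, t =>
      .seq (a.compile t) (.seq (b.compile (t + 1)) (.fldAdd (tmp t) (tmp t) (tmp (t + 1))))
  | sub a b, t =>
      .seq (a.compile t) (.seq (b.compile (t + 1)) (.fldSub (tmp t) (tmp t) (tmp (t + 1))))
  | mul a b, t =>
      .seq (a.compile t) (.seq (b.compile (t + 1)) (.fldMul (tmp t) (tmp t) (tmp (t + 1))))
  | div a b, t =>
      .seq (a.compile t) (.seq (b.compile (t + 1)) (.fldDiv (tmp t) (tmp t) (tmp (t + 1))))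
  | ifz e a b, t => .seq (e.compile t) (.ifZero (tmp t) (a.compile t) (b.compile t))
  | delta x y, t =>
      .ifLt x y (.fldZero (tmp t)) (.ifLt y x (.fldZero (tmp t)) (.fldOne (tmp t)))
  | sum k x e, t => .seq (.fldZero (tmp t))
      (forP k x (.seq (e.compile (t + 1)) (.fldAdd (tmp t) (tmp t) (tmp (t + 1)))))
  | any k x e, t => .seq (.fldZero (tmp t))
      (forP k x (.seq (e.compile (t + 1)) (.ifZero (tmp (t + 1)) .skip (.fldOne (tmp t)))))
  | cntEq k c₁ c₂ x y a b, t => .seq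
      (.seq (.natConst c₁ 0) (forP k x (.seq (a.compile t) (.ifZero (tmp t) .skip (incr c₁)))))
      (.seq
        (.seq (.natConst c₂ 0) (forP k y (.seq (b.compile t) (.ifZero (tmp t) .skip (incr c₂)))))
        (.ifLt c₁ c₂ (.fldZero (tmp t)) (.ifLt c₂ c₁ (.fldZero (tmp t)) (.fldOne (tmp t)))))

open Polynomial in
/-- A bound for the running time of `Ex.compile` in terms of the bounds of the loops. -/
noncomputable def Ex.cost : Ex → Polynomial ℕ
  | zero => 1
  | one => 1
  | cell _ => 2
  | add a b => a.cost + b.cost + 1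
  | sub a b => a.cost + b.cost + 1
  | mul a b => a.cost + b.cost + 1
  | div a b => a.cost + b.cost + 1
  | ifz e a b => e.cost + a.cost + b.cost + 1
  | delta _ _ => 3
  | sum _ _ e => X * (e.cost + 4) + 3
  | any _ _ e => X * (e.cost + 5) + 3
  | cntEq _ _ _ _ _ a b => X * (a.cost + 6) + 3 + (X * (b.cost + 6) + 3) + 3

/-- The program of a statement. -/
def Stm.compile : Stm → Prog
  | skip => .skip
  | asg a e => .seq (e.compile 0) (.seq (.fldZero (tmp 1)) (.fldAdd a (tmp 0) (tmp 1)))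
  | seq p q => .seq p.compile q.compile
  | ifz e p q => .seq (e.compile 0) (.ifZero (tmp 0) p.compile q.compile)
  | loop k x p => forP k x p.compile
  | letAdd k x y p => .seq (.natAdd k x y) p.compile
  | letSub k x y p => .seq (.natSub k x y) p.compile
  | letConst k c p => .seq (.natConst k c) p.compile
  | root a b x => .root a b x

open Polynomial in
/-- A bound for the running time of `Stm.compile`. -/
noncomputable def Stm.cost : Stm → Polynomial ℕ
  | skip => 1
  | asg _ e => e.cost + 2
  | seq p q => p.cost + q.cost
  | ifz e p q => e.cost + p.cost + q.cost + 1
  | loop _ _ p => X * (p.cost + 3) + 2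
  -- The new register may be twice as large as the old bound, and it may in turn bound loops in the
  -- body.
  | letAdd _ _ _ p => 1 + p.cost.comp (X + X)
  | letSub _ _ _ p => 1 + p.cost
  | letConst _ c p => 1 + p.cost.comp (X + C c)
  | root _ _ _ => X + 1

theorem Ex.compile_fieldOperationsOnly (e : Ex) : ∀ t, (e.compile t).FieldOperationsOnly := by
  induction e <;> intro t <;> simp_all [Ex.compile, Prog.FieldOperationsOnly, forP, incr]

theorem Stm.compile_fieldOperationsOnly (p : Stm) (h : p.NoRoot) :
    p.compile.FieldOperationsOnly := by
  induction p <;>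
    simp_all [Stm.compile, Prog.FieldOperationsOnly, forP, incr, Stm.NoRoot,
      Ex.compile_fieldOperationsOnly]

/-! ### Correctness and running time of compiled expressions and statements. -/

section correctness

variable {F : Type*}

@[simp] theorem State.putNat_nat (s : State F) (x k : ℕ) :
    (s.putNat x k).nat = Function.update s.nat x k := rfl
@[simp] theorem State.putNat_fld (s : State F) (x k : ℕ) : (s.putNat x k).fld = s.fld := rfl
@[simp] theorem State.put_nat (s : State F) (a : Loc) (v : F) : (s.put a v).nat = s.nat := rfl
theorem State.put_fld (s : State F) (a : Loc) (v : F) :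
    (s.put a v).fld = Mem.set s.fld a.arr (a.idx.map s.nat) v := by
  funext x l
  by_cases hx : x = a.arr
  · subst hx
    by_cases hl : l = a.idx.map s.nat <;> simp [State.put, Mem.set, hl]
  · simp [State.put, Mem.set, hx]

variable [Field F] (ρ : Polynomial F → F)

theorem Prog.exec_seq (p q : Prog) (s : State F) :
    (Prog.seq p q).exec ρ s = q.exec ρ (p.exec ρ s) := rfl

theorem Prog.time_seq (p q : Prog) (s : State F) :
    (Prog.seq p q).time ρ s = p.time ρ s + q.time ρ (p.exec ρ s) := rfl

/-- An invariant for the loop together with its time. The step hypothesis speaks of the state after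
the increment, which overwrites register `1` as well as `k`. A turn costs three steps on top of the
body: two for the increment and one for the turn itself. -/
theorem forP_spec (I : ℕ → State F → Prop) {k x m t : ℕ} {p : Prog} {s : State F}
    (hk : k ≠ 1) (hx : x ≠ k) (hm : s.nat x = m) (h0 : I 0 (s.putNat k 0))
    (hs : ∀ i < m, ∀ s, I i s → p.time ρ s ≤ t ∧
      I (i + 1) (((p.exec ρ s).putNat 1 1).putNat k ((p.exec ρ s).nat k + 1))) :
    (forP k x p).time ρ s ≤ m * (t + 3) + 2 ∧ I m ((forP k x p).exec ρ s) := by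
  set q : Prog := .seq p (incr k) with hq
  have hstep : ∀ s, q.exec ρ s =
      ((p.exec ρ s).putNat 1 1).putNat k ((p.exec ρ s).nat k + 1) := by
    intro s
    simp [hq, incr, Prog.exec, Function.update_of_ne hk]
  have hI : ∀ i ≤ m, I i ((q.exec ρ)^[i] (s.putNat k 0)) := by
    intro i hi
    induction i with
    | zero => simpa using h0
    | succ i ih =>
      rw [Function.iterate_succ_apply', hstep]
      exact (hs i (by omega) _ (ih (by omega))).2
  have hx' : (s.putNat k 0).nat x = m := by simp [Function.update_of_ne hx, hm]
  constructor
  · have hsum : ∑ i ∈ Finset.range m, (q.time ρ ((q.exec ρ)^[i] (s.putNat k 0)) + 1)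
        ≤ ∑ _i ∈ Finset.range m, (t + 3) := by
      refine Finset.sum_le_sum fun i hi => ?_
      have := (hs i (Finset.mem_range.1 hi) _ (hI i (Finset.mem_range.1 hi).le)).1
      rw [hq, Prog.time, ← hq]
      simp only [incr, Prog.time]
      omega
    simp only [Finset.sum_const, Finset.card_range, smul_eq_mul] at hsum
    simp only [forP, Prog.time, Prog.exec, ← hq, hx']
    omega
  · have := hI m le_rfl
    simpa only [forP, Prog.exec, ← hq, hx'] using this

/-- The state `s` shows the registers `r` on `V`, and the cells `f` except for the intermediate
results. -/
def Shows (V : Set ℕ) (r : ℕ → ℕ) (f : Mem F) (s : State F) : Prop :=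
  (∀ y ∈ V, s.nat y = r y) ∧ ∀ a ≠ 3, s.fld a = f a

/-- The intermediate results below `t` are those of `g`. -/
def KeepsTmp (n t : ℕ) (g : Mem F) (s : State F) : Prop :=
  ∀ u < t, s.fld 3 (List.replicate u n) = g 3 (List.replicate u n)

variable {ρ}

theorem Shows.putTmp {V : Set ℕ} {r : ℕ → ℕ} {f : Mem F} {s : State F} (h : Shows V r f s)
    (t : ℕ) (v : F) : Shows V r f (s.put (tmp t) v) := by
  refine ⟨h.1, fun a ha => ?_⟩
  rw [State.put_fld, ← h.2 a ha]
  funext l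
  simp [Mem.set, tmp, ha]

theorem Shows.putNat {V : Set ℕ} {r : ℕ → ℕ} {f : Mem F} {s : State F} (h : Shows V r f s)
    {k : ℕ} (hk : k ∉ V) (v : ℕ) : Shows V r f (s.putNat k v) := by
  refine ⟨fun y hy => ?_, h.2⟩
  rw [← h.1 y hy, State.putNat_nat, Function.update_of_ne]
  rintro rfl
  exact hk hy

theorem Shows.insert {V : Set ℕ} {r : ℕ → ℕ} {f : Mem F} {s : State F} (h : Shows V r f s)
    {k i : ℕ} (hi : s.nat k = i) (hk : k ∉ V) :
    Shows (insert k V) (Function.update r k i) f s := by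
  refine ⟨fun y hy => ?_, h.2⟩
  rcases hy with rfl | hy
  · simp [hi]
  · rw [h.1 y hy, Function.update_of_ne]
    rintro rfl
    exact hk hy

theorem Shows.of_insert {V : Set ℕ} {r : ℕ → ℕ} {f : Mem F} {s : State F}
    {k i : ℕ} (h : Shows (Insert.insert k V) (Function.update r k i) f s) (hk : k ∉ V) :
    Shows V r f s := by
  refine ⟨fun y hy => ?_, h.2⟩
  rw [h.1 y (Or.inr hy), Function.update_of_ne]
  rintro rfl
  exact hk hy

theorem Shows.map {V : Set ℕ} {r : ℕ → ℕ} {f : Mem F} {s : State F} (h : Shows V r f s)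
    {l : List ℕ} (hl : ∀ x ∈ l, x ∈ V) : l.map s.nat = l.map r :=
  List.map_congr_left fun x hx => h.1 x (hl x hx)

theorem Shows.put_tmp_get {V : Set ℕ} {r : ℕ → ℕ} {f : Mem F} {s : State F} (h : Shows V r f s)
    (h0 : 0 ∈ V) (t : ℕ) (v : F) :
    (s.put (tmp t) v).fld 3 (List.replicate t (r 0)) = v := by
  simp [State.put_fld, Mem.set, tmp, h.1 0 h0]

theorem Shows.get_tmp {V : Set ℕ} {r : ℕ → ℕ} {f : Mem F} {s : State F} (h : Shows V r f s)
    (h0 : 0 ∈ V) (t : ℕ) : s.get (tmp t) = s.fld 3 (List.replicate t (r 0)) := by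
  simp [State.get, tmp, h.1 0 h0]

/-- Slots for intermediate results are told apart by the length of their index list; the number that
register `0` contributes to the list plays no role. -/
theorem KeepsTmp.put {n t : ℕ} {g : Mem F} {s : State F} (h : KeepsTmp n t g s) {u : ℕ}
    (hu : t ≤ u) (v : F) : KeepsTmp n t g (s.put (tmp u) v) := by
  intro w hw
  rw [← h w hw, State.put_fld]
  simp only [Mem.set, tmp, List.map_replicate, true_and, ite_eq_right_iff]
  intro h'
  have := congrArg List.length h'
  simp at this
  omega

theorem KeepsTmp.trans {n t u : ℕ} {g : Mem F} {s s' : State F} (h : KeepsTmp n t g s)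
    (h' : KeepsTmp n u s.fld s') (hu : t ≤ u) : KeepsTmp n t g s' := fun w hw => by
  rw [h' w (by omega), h w hw]

-- Used for the counters of `cntEq`: the program of an operand runs in an environment that knows the
-- current counts, whereas its value is defined in the environment without them.
open Classical in
theorem Ex.eval_congr (e : Ex) : ∀ {V B : Set ℕ} {r r' : ℕ → ℕ} (f : Mem F), e.WF V B →
    (∀ y ∈ V, r y = r' y) → e.eval r f = e.eval r' f := by
  have upd : ∀ {V : Set ℕ} {r r' : ℕ → ℕ} (k i : ℕ), (∀ y ∈ V, r y = r' y) →
      ∀ y ∈ insert k V, Function.update r k i y = Function.update r' k i y := by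
    intro V r r' k i h y hy
    by_cases hyk : y = k
    · subst hyk; simp
    · rw [Function.update_of_ne hyk, Function.update_of_ne hyk]
      exact h y (hy.resolve_left hyk)
  induction e with
  | zero => intros; rfl
  | one => intros; rfl
  | cell a =>
    intro V B r r' f hw h
    simp only [eval, List.map_congr_left fun x hx => h x (hw.2 x hx)]
  | add a b ha hb => intro V B r r' f hw h; simp only [eval, ha f hw.1 h, hb f hw.2 h]
  | sub a b ha hb => intro V B r r' f hw h; simp only [eval, ha f hw.1 h, hb f hw.2 h]
  | mul a b ha hb => intro V B r r' f hw h; simp only [eval, ha f hw.1 h, hb f hw.2 h]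
  | div a b ha hb => intro V B r r' f hw h; simp only [eval, ha f hw.1 h, hb f hw.2 h]
  | ifz e a b he ha hb =>
    intro V B r r' f hw h
    rw [eval, eval, he f hw.1 h, ha f hw.2.1 h, hb f hw.2.2 h]
  | delta x y => intro V B r r' f hw h; simp only [eval, h _ hw.1, h _ hw.2]
  | sum k x e he =>
    intro V B r r' f hw h
    simp only [eval, h _ hw.1, fun i => he f hw.2.2.2.2 (upd k i h)]
  | any k x e he =>
    intro V B r r' f hw h
    rw [eval, eval]
    refine if_congr ?_ rfl rfl
    simp only [h _ hw.1, fun i => he f hw.2.2.2.2 (upd k i h)]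
  | cntEq k c₁ c₂ x y a b ha hb =>
    intro V B r r' f ⟨hx, _, hy, _, _, _, _, _, _, _, _, _, _, _, _, hwa, hwb, _⟩ h
    rw [eval, eval, h _ hx, h _ hy]
    refine if_congr ?_ rfl rfl
    congr! 3 with i i
    · rw [ha f hwa (upd k i h)]
    · rw [hb f hwb (upd k i h)]

/-- What is to be shown about the program of an expression. -/
def Ex.Correct (ρ : Polynomial F → F) (e : Ex) : Prop :=
  ∀ (V B : Set ℕ) (t N : ℕ) (r : ℕ → ℕ) (f : Mem F) (s : State F), e.WF V B → 0 ∈ V → 1 ∉ V →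
    (∀ y ∈ B, r y ≤ N) → Shows V r f s →
    (e.compile t).time ρ s ≤ e.cost.eval N ∧ Shows V r f ((e.compile t).exec ρ s) ∧
    KeepsTmp (r 0) t s.fld ((e.compile t).exec ρ s) ∧
    ((e.compile t).exec ρ s).fld 3 (List.replicate t (r 0)) = e.eval r f

theorem KeepsTmp.refl {n t : ℕ} (s : State F) : KeepsTmp n t s.fld s := fun _ _ => rfl

theorem update_bound {B : Set ℕ} {r : ℕ → ℕ} {N : ℕ} (h : ∀ y ∈ B, r y ≤ N) {k i : ℕ}
    (hi : i ≤ N) : ∀ y ∈ insert k B, Function.update r k i y ≤ N := by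
  intro y hy
  by_cases hyk : y = k
  · subst hyk; simpa
  · rw [Function.update_of_ne hyk]
    exact h y (hy.resolve_left hyk)

/-- The left operand waits in slot `t` while the right one is computed in slot `t + 1`; `KeepsTmp`
protects it in the meantime. -/
theorem Ex.Correct.binary {a b : Ex} (ha : a.Correct ρ) (hb : b.Correct ρ)
    {V B : Set ℕ} {t N : ℕ} {r : ℕ → ℕ} {f : Mem F} {s : State F} (hw : a.WF V B ∧ b.WF V B)
    (h0 : 0 ∈ V) (h1 : 1 ∉ V) (hB : ∀ y ∈ B, r y ≤ N) (hs : Shows V r f s) :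
    ∃ s', (b.compile (t + 1)).exec ρ ((a.compile t).exec ρ s) = s' ∧
      (a.compile t).time ρ s + (b.compile (t + 1)).time ρ ((a.compile t).exec ρ s) ≤
        a.cost.eval N + b.cost.eval N ∧
      Shows V r f s' ∧ KeepsTmp (r 0) t s.fld s' ∧
      s'.get (tmp t) = a.eval r f ∧ s'.get (tmp (t + 1)) = b.eval r f := by
  obtain ⟨t1, s1, k1, v1⟩ := ha V B t N r f s hw.1 h0 h1 hB hs
  obtain ⟨t2, s2, k2, v2⟩ := hb V B (t + 1) N r f _ hw.2 h0 h1 hB s1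
  refine ⟨_, rfl, by omega, s2, k1.trans k2 (by omega), ?_, ?_⟩
  · rw [s2.get_tmp h0, k2 t (by omega), v1]
  · rw [s2.get_tmp h0, v2]

-- One of the two counting loops of `cntEq`. Here `c` is the counter of this loop, and `c'` is the
-- other one, whose value `v` has to survive.
open Classical in
theorem Ex.Correct.count {e : Ex} (he : e.Correct ρ) {V B : Set ℕ} {k c c' x t N v : ℕ}
    {r : ℕ → ℕ} {f : Mem F} {s : State F} (hxV : x ∈ V) (hxB : x ∈ B) (hkV : k ∉ V) (hk1 : k ≠ 1)
    (hcV : c ∉ V) (hcB : c ∉ B) (hc1 : c ≠ 1) (hcV' : c' ∉ V) (hcB' : c' ∉ B) (hc1' : c' ≠ 1)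
    (hkc : k ≠ c) (hkc' : k ≠ c') (hcc : c ≠ c') (hw : e.WF (insert k V) (insert k B))
    (hw' : e.WF (insert k (insert c (insert c' V))) (insert k B))
    (h0 : 0 ∈ V) (h1 : 1 ∉ V) (hB : ∀ y ∈ B, r y ≤ N) (hs : Shows V r f s) (hv : s.nat c' = v) :
    ∃ s' T, Prog.exec ρ (.seq (.natConst c 0)
        (forP k x (.seq (e.compile t) (.ifZero (tmp t) .skip (incr c))))) s = s' ∧
      Prog.time ρ (.seq (.natConst c 0)
        (forP k x (.seq (e.compile t) (.ifZero (tmp t) .skip (incr c))))) s = T ∧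
      T ≤ N * (e.cost.eval N + 6) + 3 ∧
      Shows V r f s' ∧ KeepsTmp (r 0) t s.fld s' ∧ s'.nat c' = v ∧
      s'.nat c = Nat.count (fun i => e.eval (Function.update r k i) f ≠ 0) (r x) := by
  have hxk : x ≠ k := by rintro rfl; exact hkV hxV
  have hxc : x ≠ c := by rintro rfl; exact hcV hxV
  have := forP_spec ρ (k := k) (x := x) (m := r x) (t := e.cost.eval N + 3)
    (p := .seq (e.compile t) (.ifZero (tmp t) .skip (incr c))) (s := s.putNat c 0)
    (fun i s' => s'.nat k = i ∧ Shows V r f s' ∧ KeepsTmp (r 0) t s.fld s' ∧ s'.nat c' = v ∧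
      s'.nat c = Nat.count (fun i => e.eval (Function.update r k i) f ≠ 0) i)
    hk1 hxk (by simp [Function.update_of_ne hxc, hs.1 _ hxV])
    ⟨by simp, (hs.putNat hcV _).putNat hkV _, KeepsTmp.refl s, by
      simp [Function.update_of_ne hkc'.symm, Function.update_of_ne hcc.symm, hv], by
      simp [Function.update_of_ne hkc.symm]⟩ ?_
  · obtain ⟨ht, -, a, b, d, g⟩ := this
    refine ⟨_, _, rfl, rfl, ?_, a, b, d, g⟩
    have := Nat.mul_le_mul_right (e.cost.eval N + 3 + 3) (hB x hxB)
    rw [show e.cost.eval N + 3 + 3 = e.cost.eval N + 6 from rfl] at this ht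
    simp only [Prog.time, Prog.exec]
    omega
  · rintro i hi s' ⟨hi', hS, hK, hv', hcnt⟩
    have hrx := hB x hxB
    -- The operand is evaluated in an environment that contains the current values of both counters
    -- and of `k`, so that its correctness statement also promises to preserve these three
    -- registers.
    set r' := Function.update (Function.update (Function.update r c' (s'.nat c')) c (s'.nat c)) k i
      with hr'
    have h0k : (0 : ℕ) ≠ k := by rintro rfl; exact hkV h0
    have h0c : (0 : ℕ) ≠ c := by rintro rfl; exact hcV h0
    have h0c' : (0 : ℕ) ≠ c' := by rintro rfl; exact hcV' h0
    have hr0 : r' 0 = r 0 := by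
      rw [hr', Function.update_of_ne h0k, Function.update_of_ne h0c, Function.update_of_ne h0c']
    have hSS : Shows (insert k (insert c (insert c' V))) r' f s' := by
      refine Shows.insert (Shows.insert (hS.insert rfl hcV') rfl ?_) hi' ?_
      · rintro (h | h); exacts [hcc h, hcV h]
      · rintro (h | h | h); exacts [hkc h, hkc' h, hkV h]
    have hB' : ∀ y ∈ insert k B, r' y ≤ N := by
      refine update_bound ?_ (by omega)
      intro y hy
      rw [Function.update_of_ne (by rintro rfl; exact hcB hy),
        Function.update_of_ne (by rintro rfl; exact hcB' hy)]
      exact hB y hy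
    obtain ⟨ht, hS', hK', hval⟩ := he _ _ t N r' f s' hw' (Or.inr (Or.inr (Or.inr h0))) (by
      rintro (h | h | h | h)
      exacts [hk1 h.symm, hc1 h.symm, hc1' h.symm, h1 h]) hB' hSS
    have heval : e.eval r' f = e.eval (Function.update r k i) f := by
      refine (e.eval_congr f hw ?_).symm
      rintro y (rfl | hy)
      · simp [hr']
      · have : y ≠ k := by rintro rfl; exact hkV hy
        rw [hr', Function.update_of_ne this, Function.update_of_ne this,
          Function.update_of_ne (by rintro rfl; exact hcV hy),
          Function.update_of_ne (by rintro rfl; exact hcV' hy)]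
    rw [hr0] at hK' hval
    rw [heval] at hval
    have hSV : Shows V r f ((e.compile t).exec ρ s') := by
      refine ⟨fun y hy => ?_, hS'.2⟩
      have : y ≠ k := by rintro rfl; exact hkV hy
      rw [hS'.1 y (Or.inr (Or.inr (Or.inr hy))), hr', Function.update_of_ne this,
          Function.update_of_ne (by rintro rfl; exact hcV hy),
          Function.update_of_ne (by rintro rfl; exact hcV' hy)]
    have hnc : ((e.compile t).exec ρ s').nat c = s'.nat c := by
      rw [hS'.1 c (Or.inr (Or.inl rfl)), hr', Function.update_of_ne hkc.symm]; simp
    have hnc' : ((e.compile t).exec ρ s').nat c' = v := by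
      rw [hS'.1 c' (Or.inr (Or.inr (Or.inl rfl))), hr', Function.update_of_ne hkc'.symm,
        Function.update_of_ne hcc.symm]; simp [hv']
    have hnk : ((e.compile t).exec ρ s').nat k = i := by
      rw [hS'.1 k (Or.inl rfl), hr']; simp
    have hg : ((e.compile t).exec ρ s').get (tmp t) = e.eval (Function.update r k i) f := by
      rw [hSV.get_tmp h0, hval]
    by_cases h : ((e.compile t).exec ρ s').get (tmp t) = 0
    · have hz := hg.symm.trans h
      simp only [Prog.exec, Prog.time, if_pos h]
      refine ⟨by omega, by simp [hnk], (hSV.putNat h1 _).putNat hkV _, hK.trans hK' le_rfl, ?_, ?_⟩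
      · simp [Function.update_of_ne hkc'.symm, Function.update_of_ne hc1', hnc']
      · simp [Function.update_of_ne hkc.symm, Function.update_of_ne hc1, hnc, hcnt,
          Nat.count_succ, hz]
    · have hz : e.eval (Function.update r k i) f ≠ 0 := fun h' => h (hg.trans h')
      simp only [Prog.exec, Prog.time, if_neg h, incr]
      refine ⟨by omega, ?_, (((hSV.putNat h1 _).putNat hcV _).putNat h1 _).putNat hkV _,
        hK.trans hK' le_rfl, ?_, ?_⟩
      · simp [Function.update_of_ne hkc, Function.update_of_ne hk1, hnk]
      · simp [Function.update_of_ne hkc'.symm, Function.update_of_ne hc1', hnc',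
          Function.update_of_ne hcc.symm]
      · simp [Function.update_of_ne hkc.symm, Function.update_of_ne hc1, hnc, hcnt,
          Nat.count_succ, hz]

-- Induction on the expression. For `sum` and `any` the loop invariant is that slot `t` holds the
-- value over the turns made so far, while the body works in slot `t + 1`.
open Classical in
theorem Ex.compile_correct (e : Ex) : e.Correct ρ := by
  induction e with
  | zero =>
    intro V B t N r f s hw h0 h1 hB hs
    exact ⟨by simp [compile, Prog.time, cost], hs.putTmp t _, (KeepsTmp.refl s).put le_rfl _,
      hs.put_tmp_get h0 _ _⟩
  | one =>
    intro V B t N r f s hw h0 h1 hB hs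
    exact ⟨by simp [compile, Prog.time, cost], hs.putTmp t _, (KeepsTmp.refl s).put le_rfl _,
      hs.put_tmp_get h0 _ _⟩
  | cell a =>
    intro V B t N r f s hw h0 h1 hB hs
    have h := hs.putTmp t 0
    refine ⟨by simp [compile, Prog.time, cost], h.putTmp t _,
      ((KeepsTmp.refl s).put le_rfl _).put le_rfl _, ?_⟩
    simp only [compile, Prog.exec]
    rw [h.put_tmp_get h0, h.get_tmp h0, hs.put_tmp_get h0, add_zero, State.get, h.map hw.2,
      h.2 _ hw.1]
    rfl
  | add a b ha hb =>
    intro V B t N r f s hw h0 h1 hB hs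
    obtain ⟨s', e', ht, h1, h2, h3, h4⟩ := ha.binary hb (t := t) hw h0 h1 hB hs
    simp only [compile, Prog.exec, Prog.time, e', cost, Polynomial.eval_add, Polynomial.eval_one]
    refine ⟨by omega, h1.putTmp _ _, h2.put le_rfl _, ?_⟩
    rw [h1.put_tmp_get h0, h3, h4]; rfl
  | sub a b ha hb =>
    intro V B t N r f s hw h0 h1 hB hs
    obtain ⟨s', e', ht, h1, h2, h3, h4⟩ := ha.binary hb (t := t) hw h0 h1 hB hs
    simp only [compile, Prog.exec, Prog.time, e', cost, Polynomial.eval_add, Polynomial.eval_one]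
    refine ⟨by omega, h1.putTmp _ _, h2.put le_rfl _, ?_⟩
    rw [h1.put_tmp_get h0, h3, h4]; rfl
  | mul a b ha hb =>
    intro V B t N r f s hw h0 h1 hB hs
    obtain ⟨s', e', ht, h1, h2, h3, h4⟩ := ha.binary hb (t := t) hw h0 h1 hB hs
    simp only [compile, Prog.exec, Prog.time, e', cost, Polynomial.eval_add, Polynomial.eval_one]
    refine ⟨by omega, h1.putTmp _ _, h2.put le_rfl _, ?_⟩
    rw [h1.put_tmp_get h0, h3, h4]; rfl
  | div a b ha hb =>
    intro V B t N r f s hw h0 h1 hB hs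
    obtain ⟨s', e', ht, h1, h2, h3, h4⟩ := ha.binary hb (t := t) hw h0 h1 hB hs
    simp only [compile, Prog.exec, Prog.time, e', cost, Polynomial.eval_add, Polynomial.eval_one]
    refine ⟨by omega, h1.putTmp _ _, h2.put le_rfl _, ?_⟩
    rw [h1.put_tmp_get h0, h3, h4]; rfl
  | ifz e a b he ha hb =>
    intro V B t N r f s hw h0 h1 hB hs
    obtain ⟨t1, s1, k1, v1⟩ := he V B t N r f s hw.1 h0 h1 hB hs
    obtain ⟨ta, sa, ka, va⟩ := ha V B t N r f _ hw.2.1 h0 h1 hB s1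
    obtain ⟨tb, sb, kb, vb⟩ := hb V B t N r f _ hw.2.2 h0 h1 hB s1
    have hg : ((e.compile t).exec ρ s).get (tmp t) = e.eval r f := by rw [s1.get_tmp h0, v1]
    by_cases h : ((e.compile t).exec ρ s).get (tmp t) = 0
    · simp only [compile, Prog.exec, Prog.time, cost, Polynomial.eval_add, Polynomial.eval_one,
        eval, if_pos h, if_pos (hg.symm.trans h)]
      exact ⟨by omega, sa, k1.trans ka le_rfl, va⟩
    · simp only [compile, Prog.exec, Prog.time, cost, Polynomial.eval_add, Polynomial.eval_one,
        eval, if_neg h, if_neg (fun h' => h (hg.trans h'))]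
      exact ⟨by omega, sb, k1.trans kb le_rfl, vb⟩
  | delta x y =>
    intro V B t N r f s hw h0 h1 hB hs
    simp only [compile, Prog.exec, Prog.time, hs.1 _ hw.1, hs.1 _ hw.2, eval, cost]
    rcases lt_trichotomy (r x) (r y) with h | h | h
    · simp only [h, if_true, h.ne, if_false]
      exact ⟨by simp, hs.putTmp t _, (KeepsTmp.refl s).put le_rfl _, hs.put_tmp_get h0 _ _⟩
    · simp only [h, if_true, lt_irrefl, if_false]
      exact ⟨by simp, hs.putTmp t _, (KeepsTmp.refl s).put le_rfl _, hs.put_tmp_get h0 _ _⟩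
    · simp only [h, if_true, h.ne', h.le.not_gt, if_false]
      exact ⟨by simp, hs.putTmp t _, (KeepsTmp.refl s).put le_rfl _, hs.put_tmp_get h0 _ _⟩
  | sum k x e he =>
    intro V B t N r f s hw h0 h1 hB hs
    obtain ⟨hxV, hxB, hkV, hk1, hwe⟩ := hw
    have hxk : x ≠ k := by rintro rfl; exact hkV hxV
    have := forP_spec ρ (k := k) (x := x) (m := r x) (t := e.cost.eval N + 1)
      (p := .seq (e.compile (t + 1)) (.fldAdd (tmp t) (tmp t) (tmp (t + 1))))
      (s := s.put (tmp t) 0)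
      (fun i s' => s'.nat k = i ∧ Shows V r f s' ∧ KeepsTmp (r 0) t s.fld s' ∧
        s'.fld 3 (List.replicate t (r 0)) =
          ∑ i ∈ Finset.range i, e.eval (Function.update r k i) f)
      hk1 hxk (hs.1 _ hxV)
      ⟨by simp, (hs.putTmp _ _).putNat hkV _, (KeepsTmp.refl s).put le_rfl _, by
        simpa using hs.put_tmp_get h0 t 0⟩ ?_
    · obtain ⟨ht, -, a, b, c⟩ := this
      refine ⟨?_, a, b, c⟩
      simp only [compile, Prog.time, Prog.exec, cost, Polynomial.eval_add, Polynomial.eval_mul,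
        Polynomial.eval_X, Polynomial.eval_ofNat]
      have := Nat.mul_le_mul_right (e.cost.eval N + 1 + 3) (hB x hxB)
      rw [show e.cost.eval N + 1 + 3 = e.cost.eval N + 4 from rfl] at this ht
      omega
    · rintro i hi s' ⟨hi', hS, hK, hv⟩
      have hrx := hB x hxB
      obtain ⟨ht, hS', hK', hv'⟩ := he (insert k V) (insert k B) (t + 1) N (Function.update r k i) f
        s' hwe (Or.inr h0) (by
          rintro (h | h)
          · exact hk1 h.symm
          · exact h1 h) (update_bound hB (by omega)) (hS.insert hi' hkV)
      have h0k : (0 : ℕ) ≠ k := by rintro rfl; exact hkV h0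
      rw [Function.update_of_ne h0k] at hK' hv'
      have hS'' := hS'.of_insert hkV
      simp only [Prog.time, Prog.exec]
      refine ⟨by omega, ?_, ((hS''.putTmp _ _).putNat h1 _).putNat hkV _, ?_, ?_⟩
      · simp [hS'.1 k (Or.inl rfl)]
      · exact (hK.trans hK' (by omega)).put le_rfl _
      · have := hS''.put_tmp_get h0 t (((e.compile (t + 1)).exec ρ s').get (tmp t) +
          ((e.compile (t + 1)).exec ρ s').get (tmp (t + 1)))
        simp only [State.putNat_fld]
        rw [this, hS''.get_tmp h0, hS''.get_tmp h0, hv', hK' t (by omega), hv,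
          Finset.sum_range_succ]
  | any k x e he =>
    intro V B t N r f s hw h0 h1 hB hs
    obtain ⟨hxV, hxB, hkV, hk1, hwe⟩ := hw
    have hxk : x ≠ k := by rintro rfl; exact hkV hxV
    classical
    have := forP_spec ρ (k := k) (x := x) (m := r x) (t := e.cost.eval N + 2)
      (p := .seq (e.compile (t + 1)) (.ifZero (tmp (t + 1)) .skip (.fldOne (tmp t))))
      (s := s.put (tmp t) 0)
      (fun i s' => s'.nat k = i ∧ Shows V r f s' ∧ KeepsTmp (r 0) t s.fld s' ∧
        s'.fld 3 (List.replicate t (r 0)) =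
          if ∃ j < i, e.eval (Function.update r k j) f ≠ 0 then 1 else 0)
      hk1 hxk (hs.1 _ hxV)
      ⟨by simp, (hs.putTmp _ _).putNat hkV _, (KeepsTmp.refl s).put le_rfl _, by
        simpa using hs.put_tmp_get h0 t 0⟩ ?_
    · obtain ⟨ht, -, a, b, c⟩ := this
      refine ⟨?_, a, b, c⟩
      simp only [compile, Prog.time, Prog.exec, cost, Polynomial.eval_add, Polynomial.eval_mul,
        Polynomial.eval_X, Polynomial.eval_ofNat]
      have := Nat.mul_le_mul_right (e.cost.eval N + 2 + 3) (hB x hxB)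
      rw [show e.cost.eval N + 2 + 3 = e.cost.eval N + 5 from rfl] at this ht
      omega
    · rintro i hi s' ⟨hi', hS, hK, hv⟩
      have hrx := hB x hxB
      obtain ⟨ht, hS', hK', hv'⟩ := he (insert k V) (insert k B) (t + 1) N (Function.update r k i) f
        s' hwe (Or.inr h0) (by
          rintro (h | h)
          · exact hk1 h.symm
          · exact h1 h) (update_bound hB (by omega)) (hS.insert hi' hkV)
      have h0k : (0 : ℕ) ≠ k := by rintro rfl; exact hkV h0
      rw [Function.update_of_ne h0k] at hK' hv'
      have hS'' := hS'.of_insert hkV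
      have hex : (∃ j < i + 1, e.eval (Function.update r k j) f ≠ 0) ↔
          (∃ j < i, e.eval (Function.update r k j) f ≠ 0) ∨
            e.eval (Function.update r k i) f ≠ 0 := by
        constructor
        · rintro ⟨j, hj, h⟩
          rcases Nat.lt_succ_iff_lt_or_eq.1 hj with hj | rfl
          · exact Or.inl ⟨j, hj, h⟩
          · exact Or.inr h
        · rintro (⟨j, hj, h⟩ | h)
          · exact ⟨j, by omega, h⟩
          · exact ⟨i, by omega, h⟩
      simp only [Prog.time, Prog.exec, hS''.get_tmp h0, hv']
      by_cases hz : e.eval (Function.update r k i) f = 0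
      · simp only [hz, if_true]
        refine ⟨by omega, ?_, (hS''.putNat h1 _).putNat hkV _, ?_, ?_⟩
        · simp [hS'.1 k (Or.inl rfl)]
        · exact hK.trans hK' (by omega)
        · simp only [State.putNat_fld]
          rw [hK' t (by omega), hv]
          simp only [hex, hz, ne_eq, not_true_eq_false, or_false]
      · simp only [hz, if_false]
        refine ⟨by omega, ?_, ((hS''.putTmp _ _).putNat h1 _).putNat hkV _, ?_, ?_⟩
        · simp [hS'.1 k (Or.inl rfl)]
        · exact (hK.trans hK' (by omega)).put le_rfl _
        · have := hS''.put_tmp_get h0 t 1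
          simp only [State.putNat_fld]
          rw [this, if_pos (hex.2 (Or.inr hz))]
  | cntEq k c₁ c₂ x y a b ha hb =>
    intro V B t N r f s ⟨hx, hxB, hy, hyB, hk, hk1, hc, hcB, hc1, hd, hdB, hd1, hkc, hkd, hcd,
      hwa, hwb, hwa', hwb'⟩ h0 h1 hB hs
    obtain ⟨s₁, T₁, e₁, w₁, t₁, S₁, K₁, -, n₁⟩ := ha.count (t := t) hx hxB hk hk1 hc hcB hc1 hd hdB hd1
      hkc hkd hcd hwa hwa' h0 h1 hB hs rfl
    -- In the second loop the counters exchange their roles, and the first count becomes the value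
    -- to be kept.
    rw [Set.insert_comm c₁ c₂] at hwb'
    obtain ⟨s₂, T₂, e₂, w₂, t₂, S₂, K₂, n₁', n₂⟩ := hb.count (t := t) hy hyB hk hk1 hd hdB hd1 hc hcB hc1
      hkd hkc hcd.symm hwb hwb' h0 h1 hB S₁ n₁
    rw [compile, Prog.exec_seq, Prog.exec_seq, Prog.time_seq, w₁, Prog.time_seq, e₁, w₂, e₂]
    simp only [Prog.exec, Prog.time, n₁', n₂, cost, Polynomial.eval_add, Polynomial.eval_mul,
      Polynomial.eval_X, Polynomial.eval_ofNat, eval]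
    have hK := K₁.trans K₂ le_rfl
    rcases lt_trichotomy
        (Nat.count (fun i => a.eval (Function.update r k i) f ≠ 0) (r x))
        (Nat.count (fun i => b.eval (Function.update r k i) f ≠ 0) (r y)) with h | h | h
    · rw [if_pos h, if_pos h, if_neg h.ne]
      exact ⟨by omega, S₂.putTmp t _, hK.put le_rfl _, S₂.put_tmp_get h0 _ _⟩
    · rw [if_neg h.not_lt, if_neg h.not_lt, if_neg h.not_gt, if_neg h.not_gt, if_pos h]
      exact ⟨by omega, S₂.putTmp t _, hK.put le_rfl _, S₂.put_tmp_get h0 _ _⟩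
    · rw [if_neg h.le.not_gt, if_neg h.le.not_gt, if_pos h, if_pos h, if_neg h.ne']
      exact ⟨by omega, S₂.putTmp t _, hK.put le_rfl _, S₂.put_tmp_get h0 _ _⟩

/-- The program of a statement runs in polynomial time, and it computes what the statement says. -/
theorem Stm.compile_correct (p : Stm) : ∀ {V B : Set ℕ} {N : ℕ} {r : ℕ → ℕ} {f : Mem F}
    {s : State F}, p.WF V B → 0 ∈ V → 1 ∉ V → (∀ y ∈ B, r y ≤ N) → Shows V r f s →
    p.compile.time ρ s ≤ p.cost.eval N ∧ Shows V r (p.eval ρ r f) (p.compile.exec ρ s) := by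
  induction p with
  | skip =>
    intro V B N r f s hw h0 h1 hB hs
    exact ⟨by simp [compile, Prog.time, cost], hs⟩
  | asg a e =>
    intro V B N r f s hw h0 h1 hB hs
    obtain ⟨ht, S, K, v⟩ := e.compile_correct (ρ := ρ) V B 0 N r f s hw.2.2 h0 h1 hB hs
    have S' := S.putTmp 1 0
    have h0' : ((((e.compile 0).exec ρ s).put (tmp 1) 0)).get (tmp 0) = e.eval r f := by
      rw [S'.get_tmp h0, ← v, State.put_fld]
      simp [Mem.set, tmp]
    refine ⟨?_, S'.1, fun x hx => ?_⟩
    · simp only [compile, Prog.time, cost, Polynomial.eval_add, Polynomial.eval_ofNat]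
      omega
    · simp only [compile, Prog.exec, State.put_fld ((((e.compile 0).exec ρ s).put (tmp 1) 0))]
      rw [h0', S'.get_tmp h0, S.put_tmp_get h0, add_zero, S'.map hw.2.1]
      funext l
      have := congrFun (S'.2 x hx) l
      simp only [Mem.set, eval, this]
  | seq p q hp hq =>
    intro V B N r f s hw h0 h1 hB hs
    obtain ⟨t1, s1⟩ := hp hw.1 h0 h1 hB hs
    obtain ⟨t2, s2⟩ := hq hw.2 h0 h1 hB s1
    refine ⟨?_, s2⟩
    simp only [compile, Prog.time, cost, Polynomial.eval_add]
    omega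
  | ifz e p q hp hq =>
    intro V B N r f s hw h0 h1 hB hs
    obtain ⟨ht, S, K, v⟩ := e.compile_correct (ρ := ρ) V B 0 N r f s hw.1 h0 h1 hB hs
    obtain ⟨t1, s1⟩ := hp hw.2.1 h0 h1 hB S
    obtain ⟨t2, s2⟩ := hq hw.2.2 h0 h1 hB S
    have hg : ((e.compile 0).exec ρ s).get (tmp 0) = e.eval r f := by rw [S.get_tmp h0, v]
    by_cases h : ((e.compile 0).exec ρ s).get (tmp 0) = 0
    · have h' := hg.symm.trans h
      simp only [compile, Prog.exec, Prog.time, cost, Polynomial.eval_add, Polynomial.eval_one,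
        eval, if_pos h, if_pos h']
      exact ⟨by omega, s1⟩
    · have h' : ¬ e.eval r f = 0 := fun h' => h (hg.trans h')
      simp only [compile, Prog.exec, Prog.time, cost, Polynomial.eval_add, Polynomial.eval_one,
        eval, if_neg h, if_neg h']
      exact ⟨by omega, s2⟩
  | loop k x p hp =>
    intro V B N r f s ⟨hxV, hxB, hkV, hk1, hw⟩ h0 h1 hB hs
    have hxk : x ≠ k := by rintro rfl; exact hkV hxV
    have := forP_spec ρ (k := k) (x := x) (m := r x) (t := p.cost.eval N) (p := p.compile) (s := s)
      (fun i s' => s'.nat k = i ∧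
        Shows V r (Nat.rec f (fun i f => p.eval ρ (Function.update r k i) f) i) s')
      hk1 hxk (hs.1 _ hxV) ⟨by simp, hs.putNat hkV _⟩ ?_
    · obtain ⟨ht, -, a⟩ := this
      refine ⟨?_, a⟩
      have := Nat.mul_le_mul_right (p.cost.eval N + 3) (hB x hxB)
      simp only [compile, cost, Polynomial.eval_add, Polynomial.eval_mul,
        Polynomial.eval_X, Polynomial.eval_ofNat]
      omega
    · rintro i hi s' ⟨hi', hS⟩
      have hrx := hB x hxB
      obtain ⟨ht, hS'⟩ := hp hw (Or.inr h0) (by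
          rintro (h | h)
          · exact hk1 h.symm
          · exact h1 h) (update_bound hB (by omega)) (hS.insert hi' hkV)
      refine ⟨ht, ?_, ((hS'.of_insert hkV).putNat h1 _).putNat hkV _⟩
      simp [hS'.1 k (Or.inl rfl)]
  | letAdd k x y p hp =>
    intro V B N r f s ⟨hxV, hxB, hyV, hyB, hkV, hk1, hw⟩ h0 h1 hB hs
    have hx := hB x hxB
    have hy := hB y hyB
    obtain ⟨t, S⟩ := hp (N := N + N) (s := s.putNat k (s.nat x + s.nat y)) hw (Or.inr h0) (by
          rintro (h | h)
          · exact hk1 h.symm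
          · exact h1 h)
      (update_bound (k := k) (i := r x + r y) (fun z hz => (hB z hz).trans (by omega)) (by omega))
      ((hs.putNat hkV _).insert (by simp [hs.1 _ hxV, hs.1 _ hyV]) hkV)
    refine ⟨?_, S.of_insert hkV⟩
    simp only [compile, Prog.time, Prog.exec, cost, Polynomial.eval_add, Polynomial.eval_one,
      Polynomial.eval_comp, Polynomial.eval_X]
    omega
  | letSub k x y p hp =>
    intro V B N r f s ⟨hxV, hxB, hyV, hkV, hk1, hw⟩ h0 h1 hB hs
    have hx := hB x hxB
    obtain ⟨t, S⟩ := hp (N := N) (s := s.putNat k (s.nat x - s.nat y)) hw (Or.inr h0) (by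
          rintro (h | h)
          · exact hk1 h.symm
          · exact h1 h)
      (update_bound (k := k) (i := r x - r y) hB (by omega))
      ((hs.putNat hkV _).insert (by simp [hs.1 _ hxV, hs.1 _ hyV]) hkV)
    refine ⟨?_, S.of_insert hkV⟩
    simp only [compile, Prog.time, Prog.exec, cost, Polynomial.eval_add, Polynomial.eval_one]
    omega
  | letConst k c p hp =>
    intro V B N r f s ⟨hkV, hk1, hw⟩ h0 h1 hB hs
    obtain ⟨t, S⟩ := hp (N := N + c) (s := s.putNat k c) hw (Or.inr h0) (by
          rintro (h | h)
          · exact hk1 h.symm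
          · exact h1 h)
      (update_bound (k := k) (i := c) (fun z hz => (hB z hz).trans (by omega)) (by omega))
      ((hs.putNat hkV _).insert (by simp) hkV)
    refine ⟨?_, S.of_insert hkV⟩
    simp only [compile, Prog.time, Prog.exec, cost, Polynomial.eval_add, Polynomial.eval_one,
      Polynomial.eval_comp, Polynomial.eval_X, Polynomial.eval_C]
    omega
  | root a b x =>
    intro V B N r f s ⟨ha, hai, hb, hbi, hxV, hxB⟩ h0 h1 hB hs
    have hx := hB x hxB
    refine ⟨?_, hs.1, fun y hy => ?_⟩
    · simp only [compile, Prog.time, cost, Polynomial.eval_add, Polynomial.eval_X,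
        Polynomial.eval_one, hs.1 _ hxV]
      omega
    · simp only [compile, Prog.exec, State.put_fld, State.poly, eval, hs.1 _ hxV, hs.map hai,
        hs.map hbi, hs.2 _ hb]
      funext l
      simp only [Mem.set, hs.2 y hy]

end correctness

/-! ### Loops that fill tables -/

section tables

variable {F : Type*} [Field F] {ρ : Polynomial F → F}

theorem Mem.set_same (f : Mem F) (a : ℕ) (l : List ℕ) (v : F) : f.set a l v a l = v := by
  simp [Mem.set]

theorem Mem.set_of_ne (f : Mem F) {a b : ℕ} (h : b ≠ a) (l l' : List ℕ) (v : F) :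
    f.set a l v b l' = f b l' := by
  simp [Mem.set, h]

theorem Mem.set_arr (f : Mem F) {a b : ℕ} (h : b ≠ a) (l : List ℕ) (v : F) :
    f.set a l v b = f b := by
  funext l'
  simp [Mem.set, h]

theorem Stm.loop_induction {k x : ℕ} {p : Stm} {r : ℕ → ℕ} {f : Mem F} (I : ℕ → Mem F → Prop)
    (h0 : I 0 f) (hs : ∀ i < r x, ∀ g, I i g → I (i + 1) (p.eval ρ (Function.update r k i) g)) :
    I (r x) ((Stm.loop k x p).eval ρ r f) := by
  have : ∀ i ≤ r x, I i (Nat.rec f (fun i f => p.eval ρ (Function.update r k i) f) i) := by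
    intro i hi
    induction i with
    | zero => exact h0
    | succ i ih => exact hs i (by omega) _ (ih (by omega))
  exact this _ le_rfl

/-- `f'` arises from `f` by writing `val` into the cells `key` of array `a`. -/
def Tab {ι : Type*} (a : ℕ) (dom : ι → Prop) (key : ι → List ℕ) (val : ι → F) (f f' : Mem F) :
    Prop :=
  (∀ i, dom i → f' a (key i) = val i) ∧
    ∀ b l, (b = a → ∀ i, dom i → l ≠ key i) → f' b l = f b l

theorem Tab.arr {ι : Type*} {a : ℕ} {dom : ι → Prop} {key : ι → List ℕ} {val : ι → F}
    {f f' : Mem F} (h : Tab a dom key val f f') {b : ℕ} (hb : b ≠ a) : f' b = f b :=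
  funext fun l => h.2 b l fun h => absurd h hb

theorem Tab.set (f : Mem F) (a : ℕ) (l : List ℕ) (v : F) :
    Tab a (fun _ : Unit => True) (fun _ => l) (fun _ => v) f (f.set a l v) := by
  refine ⟨fun _ _ => f.set_same a l v, fun b l' h => ?_⟩
  simp only [Mem.set, ite_eq_right_iff, and_imp]
  intro hb hl
  exact absurd hl (h hb () trivial)

/-- Different turns write to disjoint sets of cells by `hkey`, so no turn spoils the work of
another. The body may even read from the array that is being filled, as long as it avoids the cells
written by other turns: that is what `hb` grants about `g`. -/
theorem Tab.loop {ι : Type*} {a k x : ℕ} {p : Stm} {r : ℕ → ℕ} {f : Mem F}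
    {dom : ℕ → ι → Prop} {key : ℕ → ι → List ℕ} {val : ℕ → ι → F}
    (hkey : ∀ i i' j j', key i j = key i' j' → i = i')
    (hb : ∀ i < r x, ∀ g : Mem F,
      (∀ b l, (b = a → ∀ i', i' ≠ i → ∀ j, l ≠ key i' j) → g b l = f b l) →
      Tab a (dom i) (key i) (val i) g (p.eval ρ (Function.update r k i) g)) :
    Tab a (fun y : ℕ × ι => y.1 < r x ∧ dom y.1 y.2) (fun y => key y.1 y.2)
      (fun y => val y.1 y.2) f ((Stm.loop k x p).eval ρ r f) := by
  refine Stm.loop_induction (I := fun m g => Tab a (fun y : ℕ × ι => y.1 < m ∧ dom y.1 y.2)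
    (fun y => key y.1 y.2) (fun y => val y.1 y.2) f g) ?_ ?_
  · exact ⟨fun i hi => absurd hi.1 (by omega), fun _ _ _ => rfl⟩
  · rintro i hi g ⟨h1, h2⟩
    obtain ⟨h3, h4⟩ := hb i hi g fun b l h => h2 b l fun hba y hy =>
      h hba y.1 (by omega) y.2
    refine ⟨fun y hy => ?_, fun b l h => ?_⟩
    · rcases Nat.lt_succ_iff_lt_or_eq.1 hy.1 with h | h
      · rw [h4 _ _ fun _ j _ he => h.ne (hkey _ _ _ _ he)]
        exact h1 y ⟨h, hy.2⟩
      · obtain ⟨y1, y2⟩ := y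
        simp only at h
        subst h
        exact h3 y2 hy.2
    · rw [h4 b l fun hba j hj => h hba (i, j) ⟨by simp, hj⟩]
      exact h2 b l fun hba y hy => h hba y ⟨by omega, hy.2⟩

/-- `f'` arises from `f` by writing `val i` into the cells `key i` of array `a` for `i < m`. -/
def Tab₁ (a m : ℕ) (key : ℕ → List ℕ) (val : ℕ → F) (f f' : Mem F) : Prop :=
  (∀ i < m, f' a (key i) = val i) ∧
    ∀ b l, (b = a → ∀ i < m, l ≠ key i) → f' b l = f b l

/-- `f'` arises from `f` by writing `val i j` into the cells `key i j` of array `a` for `i < m` and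
`j < m'`. -/
def Tab₂ (a m m' : ℕ) (key : ℕ → ℕ → List ℕ) (val : ℕ → ℕ → F) (f f' : Mem F) : Prop :=
  (∀ i < m, ∀ j < m', f' a (key i j) = val i j) ∧
    ∀ b l, (b = a → ∀ i < m, ∀ j < m', l ≠ key i j) → f' b l = f b l

theorem Tab₁.val {a m : ℕ} {key : ℕ → List ℕ} {val : ℕ → F} {f f' : Mem F}
    (h : Tab₁ a m key val f f') {i : ℕ} (hi : i < m) : f' a (key i) = val i := h.1 i hi

theorem Tab₁.arr {a m : ℕ} {key : ℕ → List ℕ} {val : ℕ → F} {f f' : Mem F}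
    (h : Tab₁ a m key val f f') {b : ℕ} (hb : b ≠ a) : f' b = f b :=
  funext fun l => h.2 b l fun h => absurd h hb

theorem Tab₁.off {a m : ℕ} {key : ℕ → List ℕ} {val : ℕ → F} {f f' : Mem F}
    (h : Tab₁ a m key val f f') {l : List ℕ} (hl : ∀ i, l ≠ key i) : f' a l = f a l :=
  h.2 a l fun _ i _ => hl i

theorem Tab₂.val {a m m' : ℕ} {key : ℕ → ℕ → List ℕ} {val : ℕ → ℕ → F} {f f' : Mem F}
    (h : Tab₂ a m m' key val f f') {i j : ℕ} (hi : i < m) (hj : j < m') :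
    f' a (key i j) = val i j := h.1 i hi j hj

theorem Tab₂.arr {a m m' : ℕ} {key : ℕ → ℕ → List ℕ} {val : ℕ → ℕ → F} {f f' : Mem F}
    (h : Tab₂ a m m' key val f f') {b : ℕ} (hb : b ≠ a) : f' b = f b :=
  funext fun l => h.2 b l fun h => absurd h hb

theorem Tab₂.off {a m m' : ℕ} {key : ℕ → ℕ → List ℕ} {val : ℕ → ℕ → F} {f f' : Mem F}
    (h : Tab₂ a m m' key val f f') {l : List ℕ} (hl : ∀ i < m, ∀ j < m', l ≠ key i j) :
    f' a l = f a l :=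
  h.2 a l fun _ => hl

theorem Tab.loop₁ {a k x : ℕ} {p : Stm} {r : ℕ → ℕ} {f : Mem F} (key : ℕ → List ℕ) (val : ℕ → F)
    (hkey : ∀ i i', key i = key i' → i = i')
    (hb : ∀ i < r x, ∀ g : Mem F, (∀ b, b ≠ a → g b = f b) →
      (∀ l, (∀ i', i' ≠ i → l ≠ key i') → g a l = f a l) →
      p.eval ρ (Function.update r k i) g = g.set a (key i) (val i)) :
    Tab₁ a (r x) key val f ((Stm.loop k x p).eval ρ r f) := by
  have := Tab.loop (ρ := ρ) (a := a) (k := k) (x := x) (p := p) (r := r) (f := f)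
    (dom := fun _ (_ : Unit) => True) (key := fun i _ => key i) (val := fun i _ => val i)
    (fun i i' _ _ h => hkey i i' h) (fun i hi g hg => by
      rw [hb i hi g (fun b h => funext fun l => hg b l fun h' => absurd h' h)
        (fun l h => hg a l fun _ i' hi' _ => h i' hi')]
      exact Tab.set _ _ _ _)
  exact ⟨fun i hi => this.1 (i, ()) ⟨hi, trivial⟩, fun b l h => this.2 b l fun hb i hi =>
    h hb i.1 hi.1⟩

theorem Tab.loop₂ {a k x k' x' : ℕ} {p : Stm} {r : ℕ → ℕ} {f : Mem F} (key : ℕ → ℕ → List ℕ)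
    (val : ℕ → ℕ → F) (hkey : ∀ i i' j j', key i j = key i' j' → i = i' ∧ j = j') (hx : x' ≠ k)
    (hb : ∀ i < r x, ∀ j < r x', ∀ g : Mem F, (∀ b, b ≠ a → g b = f b) →
      (∀ l, (∀ i' j', (i' ≠ i ∨ j' ≠ j) → l ≠ key i' j') → g a l = f a l) →
      p.eval ρ (Function.update (Function.update r k i) k' j) g = g.set a (key i j) (val i j)) :
    Tab₂ a (r x) (r x') key val f ((Stm.loop k x (.loop k' x' p)).eval ρ r f) := by
  have := Tab.loop (ρ := ρ) (a := a) (k := k) (x := x) (p := .loop k' x' p) (r := r) (f := f)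
    (dom := fun _ j => j < r x') (key := key) (val := val)
    (fun i i' j j' h => (hkey i i' j j' h).1) ?_
  · exact ⟨fun i hi j hj => this.1 (i, j) ⟨hi, hj⟩, fun b l h => this.2 b l fun hb y hy =>
      h hb y.1 hy.1 y.2 hy.2⟩
  intro i hi g hg
  have e : Function.update r k i x' = r x' := Function.update_of_ne hx _ _
  have T := Tab.loop₁ (ρ := ρ) (a := a) (k := k') (x := x') (p := p) (r := Function.update r k i)
    (f := g) (key i) (val i) (fun j j' h => (hkey i i j j' h).2) ?_
  · rw [e] at T
    exact T
  intro j hj g' h1 h2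
  refine hb i hi j (e ▸ hj) g' (fun b h => ?_) fun l h => ?_
  · rw [h1 b h]
    exact funext fun l => hg b l fun h' => absurd h' h
  · rw [h2 l fun j' hj' => h i j' (Or.inr hj')]
    exact hg a l fun _ i' hi' j' => h i' j' (Or.inl hi')

end tables

/-! ### Row reduction -/

section reduction

/-- What a reduction of vectors `x 0, …, x (m - 1)` to `y 0, …, y (m - 1)` with coefficients `M` and
pivot functionals `φ` says about linear dependencies. -/
theorem reduction_coefficients {F V : Type*} [Field F] [AddCommGroup V] [Module F V] {m : ℕ}
    {x y : ℕ → V} {M : ℕ → ℕ → F} {φ : ℕ → V →ₗ[F] F} {z : ℕ → Prop}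
    (h1 : ∀ r < m, y r = x r - ∑ q ∈ Finset.range r, M r q • y q)
    (h2 : ∀ r < m, ∀ q < r, z q → M r q = 0) (h3 : ∀ r < m, z r ↔ y r = 0)
    (h4 : ∀ r < m, ∀ q < r, φ q (y r) = 0) (h5 : ∀ r < m, ¬ z r → φ r (y r) = 1) :
    (∃ L : ℕ → ℕ → F, (∀ r < m, ∀ {W : Type _} [AddCommGroup W] [Module F W] (u v : ℕ → W),
        (∀ q ≤ r, v q = u q - ∑ p ∈ Finset.range q, M q p • v p) →
        v r = u r + ∑ q ∈ Finset.range r, L r q • u q) ∧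
      ∀ r < m, ∀ q < r, z q → L r q = 0) ∧
    ∀ r < m, x r ∈ Submodule.span F (x '' Set.Iio r) → z r := by
  constructor
  -- The coefficients depend on `M` only, hence the quantification over all modules: the reduced
  -- rows and the rows that accompany them undergo the same transformation.
  · have : ∀ r, ∃ L : ℕ → F, r < m → (∀ {W : Type _} [AddCommGroup W] [Module F W] (u v : ℕ → W),
        (∀ q ≤ r, v q = u q - ∑ p ∈ Finset.range q, M q p • v p) →
        v r = u r + ∑ q ∈ Finset.range r, L q • u q) ∧ ∀ q < r, z q → L q = 0 := by
      intro r
      induction r using Nat.strong_induction_on with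
      | _ r ih =>
        choose! L hL using ih
        -- Back substitution: `u q` enters `v r` directly through `M r q`, and indirectly through
        -- each `v p` with `q < p < r`.
        refine ⟨fun q => - (M r q + ∑ p ∈ Finset.Ioo q r, M r p * L p q), fun hr => ⟨?_, ?_⟩⟩
        · intro W _ _ u v hv
          have hsum : ∑ p ∈ Finset.range r, M r p • v p = ∑ p ∈ Finset.range r, M r p • u p +
              ∑ p ∈ Finset.range r, ∑ q ∈ Finset.range p, (M r p * L p q) • u q := by
            rw [← Finset.sum_add_distrib]
            refine Finset.sum_congr rfl fun p hp => ?_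
            have hp' := Finset.mem_range.1 hp
            rw [(hL p hp' (by omega)).1 u v fun q hq => hv q (by omega), smul_add, Finset.smul_sum]
            simp only [mul_smul]
          have hswap : ∑ p ∈ Finset.range r, ∑ q ∈ Finset.range p, (M r p * L p q) • u q =
              ∑ q ∈ Finset.range r, ∑ p ∈ Finset.Ioo q r, (M r p * L p q) • u q := by
            refine Finset.sum_comm' fun p q => ?_
            simp only [Finset.mem_range, Finset.mem_Ioo]
            omega
          rw [hv r le_rfl, hsum, hswap]
          simp only [neg_smul, add_smul, Finset.sum_smul, Finset.sum_neg_distrib,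
            Finset.sum_add_distrib]
          abel
        · intro q hq hz
          simp only
          rw [h2 r hr q hq hz, zero_add, neg_eq_zero]
          refine Finset.sum_eq_zero fun p hp => ?_
          have hp' := Finset.mem_Ioo.1 hp
          rw [(hL p hp'.2 (by omega)).2 q hp'.1 hz, mul_zero]
    choose L hL using this
    exact ⟨L, fun r hr => (hL r hr).1, fun r hr => (hL r hr).2⟩
  -- The pivots form a triangular system. Since `φ q` kills all later `y r`, the part of a
  -- combination below the top is shown to vanish first; then `φ r` reads off the top coefficient.
  · have key : ∀ r ≤ m, ∀ v ∈ Submodule.span F (y '' Set.Iio r), (∀ q < r, φ q v = 0) → v = 0 := by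
      intro r
      induction r with
      | zero => intro _ v hv _; simpa using hv
      | succ r ih =>
        intro hr v hv hφ
        have : Set.Iio (r + 1) = insert r (Set.Iio r) := by
          ext q; simp only [Set.mem_Iio, Set.mem_insert_iff]; omega
        rw [this, Set.image_insert_eq, Submodule.mem_span_insert] at hv
        obtain ⟨a, w, hw, rfl⟩ := hv
        have hw0 : w = 0 := by
          refine ih (by omega) w hw fun q hq => ?_
          have := hφ q (by omega)
          rwa [map_add, map_smul, h4 r (by omega) q hq, smul_zero, zero_add] at this
        subst hw0
        by_cases hz : z r
        · rw [(h3 r (by omega)).1 hz]; simp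
        · have := hφ r (by omega)
          rw [map_add, map_smul, h5 r (by omega) hz] at this
          simp only [smul_eq_mul, mul_one, map_zero, add_zero] at this
          simp [this]
    intro r hr hx
    have hxy : ∀ q < r, x q ∈ Submodule.span F (y '' Set.Iio r) := by
      intro q hq
      have : x q = y q + ∑ p ∈ Finset.range q, M q p • y p := by
        rw [h1 q (by omega)]; abel
      rw [this]
      refine add_mem (Submodule.subset_span ⟨q, hq, rfl⟩) (sum_mem fun p hp => ?_)
      have := Finset.mem_range.1 hp
      exact Submodule.smul_mem _ _ (Submodule.subset_span ⟨p, by simp; omega, rfl⟩)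
    have hx' : x r ∈ Submodule.span F (y '' Set.Iio r) := by
      refine Submodule.span_le.2 ?_ hx
      rintro _ ⟨q, hq, rfl⟩
      exact hxy q hq
    rw [h3 r hr]
    refine key r hr.le _ ?_ (h4 r hr)
    rw [h1 r hr]
    refine sub_mem hx' (sum_mem fun p hp => ?_)
    exact Submodule.smul_mem _ _ (Submodule.subset_span ⟨p, by simpa using hp, rfl⟩)

end reduction

/-! ### The row reduction program -/

/-- Reduce the row `r` of `S` by the row `q`, and change the rows of `Y` in the same way. -/
def eliminate (S Y PV t w₁ w₂ w : ℕ) : Stm :=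
  .seq (.asg ⟨t, []⟩ (.sum 12 w₁ (.sum 13 w₂
    (.mul (.cell ⟨PV, [11, 12, 13]⟩) (.cell ⟨S, [10, 12, 13]⟩)))))
  (.seq (.loop 12 w₁ (.loop 13 w₂ (.asg ⟨S, [10, 12, 13]⟩
    (.sub (.cell ⟨S, [10, 12, 13]⟩) (.mul (.cell ⟨t, []⟩) (.cell ⟨S, [11, 12, 13]⟩))))))
  (.loop 12 w (.asg ⟨Y, [10, 12]⟩
    (.sub (.cell ⟨Y, [10, 12]⟩) (.mul (.cell ⟨t, []⟩) (.cell ⟨Y, [11, 12]⟩))))))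

/-- Record the first nonzero entry of row `r` of `S`, and whether there is one. -/
def findPivot (S PV Z w₁ w₂ : ℕ) : Stm :=
  .seq (.loop 12 w₁ (.loop 13 w₂ (.asg ⟨PV, [10, 12, 13]⟩
    (.ifz (.any 14 12 (.any 15 w₂ (.cell ⟨S, [10, 14, 15]⟩)))
      (.ifz (.any 15 13 (.cell ⟨S, [10, 12, 15]⟩))
        (.div .one (.cell ⟨S, [10, 12, 13]⟩)) .zero) .zero))))
  (.asg ⟨Z, [10]⟩ (.any 12 w₁ (.any 13 w₂ (.cell ⟨S, [10, 12, 13]⟩))))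

/-- Reduce the rows `S[r, ·, ·]` one after the other, and change the rows `Y[r, ·]` in the same way;
`Z[r]` tells whether row `r` is nonzero in the end. -/
def rowReduce (S Y PV Z t m w₁ w₂ w : ℕ) : Stm :=
  .loop 10 m (.seq (.loop 11 10 (eliminate S Y PV t w₁ w₂ w)) (findPivot S PV Z w₁ w₂))

/-! ### Elimination, pivots and row reduction over a field. -/

section

variable {F : Type*} [Field F] {ρ : Polynomial F → F}

theorem Stm.eval_seq (p q : Stm) (r : ℕ → ℕ) (f : Mem F) :
    (Stm.seq p q).eval ρ r f = q.eval ρ r (p.eval ρ r f) := rfl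

theorem Stm.eval_letConst (k c : ℕ) (p : Stm) (r : ℕ → ℕ) (f : Mem F) :
    (Stm.letConst k c p).eval ρ r f = p.eval ρ (Function.update r k c) f := rfl

theorem Stm.eval_letAdd (k x y : ℕ) (p : Stm) (r : ℕ → ℕ) (f : Mem F) :
    (Stm.letAdd k x y p).eval ρ r f = p.eval ρ (Function.update r k (r x + r y)) f := rfl

/-- A row of a two-dimensional array. -/
def row₁ (g : Mem F) (Y w r : ℕ) : Fin w → F := fun c => g Y [r, c]

/-- A row of a three-dimensional array. -/
def row₂ (g : Mem F) (S w₁ w₂ r : ℕ) : Fin w₁ × Fin w₂ → F := fun p => g S [r, p.1, p.2]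

/-- A linear functional given by a row. -/
def rowFunctional {w₁ w₂ : ℕ} (v : Fin w₁ × Fin w₂ → F) : (Fin w₁ × Fin w₂ → F) →ₗ[F] F :=
  ∑ p, v p • LinearMap.proj p

theorem rowFunctional_apply {w₁ w₂ : ℕ} (v u : Fin w₁ × Fin w₂ → F) :
    rowFunctional v u = ∑ i : Fin w₁, ∑ c : Fin w₂, v (i, c) * u (i, c) := by
  simp [rowFunctional, Fintype.sum_prod_type]

/-- Pivot positions are never addressed. Array `PV` holds, for each row treated, a linear functional
in the form of a row; pairing it with the row to be reduced gives the multiplier, which is stored in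
its own cell before anything is changed. -/
theorem eliminate_eval {S Y PV t w₁ w₂ w : ℕ} {r : ℕ → ℕ} (hSY : S ≠ Y)
    (hSt : S ≠ t) (hYt : Y ≠ t)
    (hw₁ : w₁ < 10 ∨ 15 < w₁) (hw₂ : w₂ < 10 ∨ 15 < w₂) (hw : w < 10 ∨ 15 < w)
    (hqr : r 11 ≠ r 10) (g : Mem F) :
    ∃ g', (eliminate S Y PV t w₁ w₂ w).eval ρ r g = g' ∧
      (∀ b, b ≠ S → b ≠ Y → b ≠ t → g' b = g b) ∧
      (∀ k, k ≠ r 10 → (∀ i c, g' S [k, i, c] = g S [k, i, c]) ∧ ∀ c, g' Y [k, c] = g Y [k, c]) ∧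
      row₂ g' S (r w₁) (r w₂) (r 10) = row₂ g S (r w₁) (r w₂) (r 10) -
        rowFunctional (row₂ g PV (r w₁) (r w₂) (r 11)) (row₂ g S (r w₁) (r w₂) (r 10)) •
          row₂ g S (r w₁) (r w₂) (r 11) ∧
      row₁ g' Y (r w) (r 10) = row₁ g Y (r w) (r 10) -
        rowFunctional (row₂ g PV (r w₁) (r w₂) (r 11)) (row₂ g S (r w₁) (r w₂) (r 10)) •
          row₁ g Y (r w) (r 11) := by
  have n1 : w₁ ≠ 12 := by omega
  have n1' : w₁ ≠ 13 := by omega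
  have n2 : w₂ ≠ 12 := by omega
  have n2' : w₂ ≠ 13 := by omega
  have n3 : w ≠ 12 := by omega
  set lam := rowFunctional (row₂ g PV (r w₁) (r w₂) (r 11)) (row₂ g S (r w₁) (r w₂) (r 10))
    with hlam
  set g₁ := g.set t [] lam with hg₁
  have e₁ : Stm.eval ρ (.asg ⟨t, []⟩ (.sum 12 w₁ (.sum 13 w₂
      (.mul (.cell ⟨PV, [11, 12, 13]⟩) (.cell ⟨S, [10, 12, 13]⟩))))) r g = g₁ := by
    simp only [Stm.eval, Ex.eval, hg₁, List.map_nil]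
    congr 1
    rw [hlam, rowFunctional_apply, ← Fin.sum_univ_eq_sum_range (fun i => _)]
    refine Finset.sum_congr rfl fun i _ => ?_
    rw [Function.update_of_ne n2, ← Fin.sum_univ_eq_sum_range (fun i => _)]
    refine Finset.sum_congr rfl fun c _ => ?_
    simp [row₂]
  set g₂ := Stm.eval ρ (.loop 12 w₁ (.loop 13 w₂ (.asg ⟨S, [10, 12, 13]⟩
    (.sub (.cell ⟨S, [10, 12, 13]⟩) (.mul (.cell ⟨t, []⟩) (.cell ⟨S, [11, 12, 13]⟩)))))) r g₁
    with hg₂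
  have T₂ : Tab₂ S (r w₁) (r w₂) (fun i j => [r 10, i, j])
      (fun i j => g S [r 10, i, j] - lam * g S [r 11, i, j]) g₁ g₂ := by
    refine Tab.loop₂ (fun i j => [r 10, i, j])
      (fun i j => g S [r 10, i, j] - lam * g S [r 11, i, j]) (by simp) n2 ?_
    intro i hi j hj g' h1 h2
    simp only [Stm.eval, Ex.eval, List.map_cons, List.map_nil, Function.update_apply,
      Nat.reduceEqDiff, reduceIte]
    congr 1
    rw [h1 t hSt.symm, h2 [r 10, i, j] (by simp; grind), h2 [r 11, i, j] (by simp [hqr])]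
    simp [hg₁, Mem.set, hSt]
  set g₃ := Stm.eval ρ (.loop 12 w (.asg ⟨Y, [10, 12]⟩
    (.sub (.cell ⟨Y, [10, 12]⟩) (.mul (.cell ⟨t, []⟩) (.cell ⟨Y, [11, 12]⟩))))) r g₂ with hg₃
  have T₃ : Tab₁ Y (r w) (fun y => [r 10, y])
      (fun y => g Y [r 10, y] - lam * g Y [r 11, y]) g₂ g₃ := by
    refine Tab.loop₁ (fun i => [r 10, i]) (fun i => g Y [r 10, i] - lam * g Y [r 11, i])
      (by simp) ?_
    intro i hi g' h1 h2
    simp only [Stm.eval, Ex.eval, List.map_cons, List.map_nil, Function.update_apply,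
      Nat.reduceEqDiff, reduceIte]
    congr 1
    rw [h1 t hYt.symm, h2 [r 10, i] (by simp; grind), h2 [r 11, i] (by simp [hqr]),
      T₂.arr hSY.symm, T₂.arr hSt.symm]
    simp [hg₁, Mem.set, hYt]
  refine ⟨g₃, ?_, ?_, ?_, ?_, ?_⟩
  · rw [eliminate, Stm.eval_seq, Stm.eval_seq, e₁]
  · intro b h1 h2 h3
    rw [T₃.arr h2, T₂.arr h1, hg₁, Mem.set_arr _ h3]
  · intro k hk
    constructor
    · intro i c
      rw [T₃.arr hSY, T₂.off fun _ _ _ _ h => hk (by simpa using congrArg List.head? h), hg₁,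
        Mem.set_of_ne _ hSt]
    · intro c
      rw [T₃.off fun _ h => hk (by simpa using congrArg List.head? h), T₂.arr hSY.symm, hg₁,
        Mem.set_of_ne _ hYt]
  · funext p
    have := T₂.val p.1.2 p.2.2
    simp only [row₂, Pi.sub_apply, Pi.smul_apply, smul_eq_mul, T₃.arr hSY]
    exact this
  · funext c
    exact T₃.val c.2

-- The functional of a nonzero row has a single nonzero entry, the inverse of the first nonzero
-- entry of the row. The functional of a zero row is zero, so that a zero row is later subtracted
-- with multiplier zero.
open Classical in
theorem findPivot_eval {S PV Z w₁ w₂ : ℕ} {r : ℕ → ℕ} (hSP : S ≠ PV) (hPZ : PV ≠ Z)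
    (hw₁ : w₁ < 10 ∨ 15 < w₁) (hw₂ : w₂ < 10 ∨ 15 < w₂) (g : Mem F) :
    ∃ g', (findPivot S PV Z w₁ w₂).eval ρ r g = g' ∧ (∀ b, b ≠ PV → b ≠ Z → g' b = g b) ∧
      (∀ k, k ≠ r 10 → (∀ i c, g' PV [k, i, c] = g PV [k, i, c]) ∧ g' Z [k] = g Z [k]) ∧
      (g' Z [r 10] = 0 ↔ row₂ g S (r w₁) (r w₂) (r 10) = 0) ∧
      (g' Z [r 10] = 0 → row₂ g' PV (r w₁) (r w₂) (r 10) = 0) ∧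
      (g' Z [r 10] ≠ 0 → rowFunctional (row₂ g' PV (r w₁) (r w₂) (r 10))
        (row₂ g S (r w₁) (r w₂) (r 10)) = 1) := by
  have n1 : w₁ ≠ 12 := by omega
  have n2 : w₂ ≠ 12 := by omega
  have n2a : w₂ ≠ 13 := by omega
  have n2b : w₂ ≠ 14 := by omega
  set s : ℕ → ℕ → F := fun i c => g S [r 10, i, c] with hs
  -- The condition also holds at the positions before the first nonzero entry, but there the value
  -- is `1 / 0 = 0`; so only the pivot remains.
  set val : ℕ → ℕ → F := fun i c =>
    if (∀ i' < i, ∀ c' < r w₂, s i' c' = 0) ∧ ∀ c' < c, s i c' = 0 then 1 / s i c else 0 with hval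
  set g₁ := Stm.eval ρ (.loop 12 w₁ (.loop 13 w₂ (.asg ⟨PV, [10, 12, 13]⟩
    (.ifz (.any 14 12 (.any 15 w₂ (.cell ⟨S, [10, 14, 15]⟩)))
      (.ifz (.any 15 13 (.cell ⟨S, [10, 12, 15]⟩))
        (.div .one (.cell ⟨S, [10, 12, 13]⟩)) .zero) .zero)))) r g with hg₁
  have T₁ : Tab₂ PV (r w₁) (r w₂) (fun i j => [r 10, i, j]) val g g₁ := by
    refine Tab.loop₂ (fun i j => [r 10, i, j]) val (by simp) n2 ?_
    intro i hi j hj g' h1 h2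
    simp only [Stm.eval, Ex.eval, List.map_cons, List.map_nil, Function.update_apply,
      Nat.reduceEqDiff, reduceIte, n2, n2a, n2b, h1 S hSP]
    congr 1
    rw [hval]
    simp only [ite_eq_right_iff, one_ne_zero, imp_false, not_exists, not_and, not_not, hs,
      ite_and]
  set g₂ := Stm.eval ρ (.asg ⟨Z, [10]⟩ (.any 12 w₁ (.any 13 w₂ (.cell ⟨S, [10, 12, 13]⟩)))) r g₁
    with hg₂
  have hZ : g₂ Z [r 10] = if ∃ i < r w₁, ∃ c < r w₂, s i c ≠ 0 then 1 else 0 := by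
    simp only [hg₂, Stm.eval, Ex.eval, List.map_cons, List.map_nil, Function.update_apply,
      Nat.reduceEqDiff, reduceIte, n2, Mem.set_same, T₁.arr hSP]
    congr! 5
    simp [hs]
  have hZ0 : g₂ Z [r 10] = 0 ↔ row₂ g S (r w₁) (r w₂) (r 10) = 0 := by
    rw [hZ]
    simp only [ite_eq_right_iff, one_ne_zero, imp_false, not_exists, not_and, not_not]
    constructor
    · intro h
      funext p
      exact h _ p.1.2 _ p.2.2
    · intro h i hi c hc
      exact congrFun h (⟨i, hi⟩, ⟨c, hc⟩)
  have hgZ : ∀ b, b ≠ Z → g₂ b = g₁ b := fun b hb => by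
    rw [hg₂, Stm.eval, Mem.set_arr _ hb]
  have hPVval : ∀ i < r w₁, ∀ c < r w₂, g₂ PV [r 10, i, c] = val i c := fun i hi c hc => by
    rw [hgZ _ hPZ]
    exact T₁.val hi hc
  refine ⟨g₂, by rw [findPivot, Stm.eval_seq], ?_, ?_, hZ0, ?_, ?_⟩
  · intro b hb hb'
    rw [hgZ b hb', T₁.arr hb]
  · intro k hk
    constructor
    · intro i c
      rw [hgZ _ hPZ]
      exact T₁.off fun _ _ _ _ h => hk (by simpa using congrArg List.head? h)
    · rw [hg₂, Stm.eval, Mem.set]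
      simp [hk, T₁.arr hPZ.symm]
  · intro h
    have h0 := hZ0.1 h
    funext p
    rw [row₂, hPVval _ p.1.2 _ p.2.2]
    have : s p.1 p.2 = 0 := congrFun h0 p
    simp [hval, this]
  · intro h
    rw [hZ] at h
    have hex : ∃ i, i < r w₁ ∧ ∃ c < r w₂, s i c ≠ 0 := by
      by_contra hcon
      exact h (if_neg hcon)
    have hi := Nat.find_spec hex
    have hi' := fun i => Nat.find_min hex (m := i)
    set i₀ := Nat.find hex
    have hc := Nat.find_spec hi.2
    have hc' := fun c => Nat.find_min hi.2 (m := c)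
    set c₀ := Nat.find hi.2
    rw [rowFunctional_apply, Finset.sum_eq_single ⟨i₀, hi.1⟩, Finset.sum_eq_single ⟨c₀, hc.1⟩]
    · simp only [row₂]
      rw [hPVval _ hi.1 _ hc.1, hval]
      simp only
      rw [if_pos, one_div]
      · exact inv_mul_cancel₀ hc.2
      · constructor
        · intro i hlt c hcw
          by_contra hne
          exact hi' i hlt ⟨by omega, c, hcw, hne⟩
        · intro c hlt
          by_contra hne
          exact hc' c hlt ⟨by omega, hne⟩
    · intro c _ hne
      simp only [row₂]
      rw [hPVval _ hi.1 _ c.2]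
      rcases lt_or_gt_of_ne (fun h => hne (Fin.ext h) : (c : ℕ) ≠ c₀) with hlt | hlt
      · have : s i₀ c = 0 := by
          by_contra hne
          exact hc' c hlt ⟨by omega, hne⟩
        simp only [hs] at this
        rw [this, mul_zero]
      · rw [hval]
        simp only
        rw [if_neg, zero_mul]
        exact fun hcon => hc.2 (hcon.2 c₀ hlt)
    · simp
    · intro i _ hne
      refine Finset.sum_eq_zero fun c _ => ?_
      simp only [row₂]
      rw [hPVval _ i.2 _ c.2]
      rcases lt_or_gt_of_ne (fun h => hne (Fin.ext h) : (i : ℕ) ≠ i₀) with hlt | hlt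
      · have : s i c = 0 := by
          by_contra hne
          exact hi' i hlt ⟨by omega, c, c.2, hne⟩
        simp only [hs] at this
        rw [this, mul_zero]
      · rw [hval]
        simp only
        rw [if_neg, zero_mul]
        exact fun hcon => hc.2 (hcon.1 i₀ hlt c₀ hc.1)
    · simp

/-- The effect of the row reduction. -/
theorem rowReduce_eval {S Y PV Z t m w₁ w₂ w : ℕ} {r : ℕ → ℕ} (hd : [S, Y, PV, Z, t].Nodup)
    (hw₁ : w₁ < 10 ∨ 15 < w₁) (hw₂ : w₂ < 10 ∨ 15 < w₂)
    (hw : w < 10 ∨ 15 < w) (f : Mem F) :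
    ∃ f', (rowReduce S Y PV Z t m w₁ w₂ w).eval ρ r f = f' ∧
      (∀ b, b ∉ [S, Y, PV, Z, t] → f' b = f b) ∧
      ∃ L : ℕ → ℕ → F, (∀ i < r m, row₂ f' S (r w₁) (r w₂) i = row₂ f S (r w₁) (r w₂) i +
          ∑ q ∈ Finset.range i, L i q • row₂ f S (r w₁) (r w₂) q) ∧
        (∀ i < r m, row₁ f' Y (r w) i = row₁ f Y (r w) i +
          ∑ q ∈ Finset.range i, L i q • row₁ f Y (r w) q) ∧
        (∀ i < r m, ∀ q < i, f' Z [q] = 0 → L i q = 0) ∧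
        (∀ i < r m, f' Z [i] = 0 → row₂ f' S (r w₁) (r w₂) i = 0) ∧
        ∀ i < r m, row₂ f S (r w₁) (r w₂) i ∈
          Submodule.span F (row₂ f S (r w₁) (r w₂) '' Set.Iio i) → f' Z [i] = 0 := by
  simp only [List.nodup_cons, List.mem_cons, List.not_mem_nil, or_false, not_or, List.nodup_nil,
    not_false_eq_true, and_true] at hd
  obtain ⟨⟨hSY, hSP, hSZ, hSt⟩, ⟨hYP, hYZ, hYt⟩, ⟨hPZ, hPt⟩, hZt⟩ := hd
  set R : Mem F → ℕ → _ := fun g i => row₂ g S (r w₁) (r w₂) i with hR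
  set RY : Mem F → ℕ → _ := fun g i => row₁ g Y (r w) i with hRY
  set φ : Mem F → ℕ → _ := fun g i => rowFunctional (row₂ g PV (r w₁) (r w₂) i) with hφ
  -- Rows from `i` on are untouched, and the rows before `i` satisfy the hypotheses of
  -- `reduction_coefficients`. The last clause, that zero rows have zero functionals, is what makes
  -- the coefficients at zero rows vanish.
  have main := Stm.loop_induction (ρ := ρ) (k := 10) (x := m) (r := r) (f := f)
    (p := .seq (.loop 11 10 (eliminate S Y PV t w₁ w₂ w)) (findPivot S PV Z w₁ w₂))
    (I := fun i g => (∀ b, b ∉ [S, Y, PV, Z, t] → g b = f b) ∧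
      (∀ k, i ≤ k → R g k = R f k ∧ RY g k = RY f k) ∧
      ∃ M : ℕ → ℕ → F, (∀ k < i, R g k = R f k - ∑ q ∈ Finset.range k, M k q • R g q) ∧
        (∀ k < i, RY g k = RY f k - ∑ q ∈ Finset.range k, M k q • RY g q) ∧
        (∀ k < i, ∀ q < k, g Z [q] = 0 → M k q = 0) ∧ (∀ k < i, g Z [k] = 0 ↔ R g k = 0) ∧
        (∀ k < i, ∀ q < k, φ g q (R g k) = 0) ∧ (∀ k < i, g Z [k] ≠ 0 → φ g k (R g k) = 1) ∧
        ∀ k < i, g Z [k] = 0 → φ g k = 0)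
    ⟨fun _ _ => rfl, fun _ _ => ⟨rfl, rfl⟩, 0, by simp⟩ ?_
  · obtain ⟨hfr, -, M, h1, h1', h2, h3, h4, h5, -⟩ := main
    refine ⟨_, rfl, hfr, ?_⟩
    set f' := (rowReduce S Y PV Z t m w₁ w₂ w).eval ρ r f
    obtain ⟨⟨L, hL, hLz⟩, hsp⟩ := reduction_coefficients (m := r m) (x := R f) (y := R f') (M := M)
      (φ := φ f') (z := fun k => f' Z [k] = 0) h1 h2 h3 h4 h5
    exact ⟨L, fun i hi => hL i hi (R f) (R f') fun q hq => h1 q (by omega),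
      fun i hi => hL i hi (RY f) (RY f') fun q hq => h1' q (by omega), hLz,
      fun i hi => (h3 i hi).1, hsp⟩
  · rintro i hi g ⟨hfr, hrest, M, h1, h1', h2, h3, h4, h5, h6⟩
    set r₁ := Function.update r 10 i with hr₁
    have e10 : r₁ 10 = i := by simp [hr₁]
    have ew₁ : r₁ w₁ = r w₁ := Function.update_of_ne (by omega) _ _
    have ew₂ : r₁ w₂ = r w₂ := Function.update_of_ne (by omega) _ _
    have ew : r₁ w = r w := Function.update_of_ne (by omega) _ _
    -- After `q` turns, row `i` is killed by the functionals of the rows before `q`. Subtracting a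
    -- multiple of row `q` does not spoil this, because those functionals kill row `q` too.
    have inner := Stm.loop_induction (ρ := ρ) (k := 11) (x := 10) (r := r₁) (f := g)
      (p := eliminate S Y PV t w₁ w₂ w)
      (I := fun q g' => (∀ b, b ≠ S → b ≠ Y → b ≠ t → g' b = g b) ∧
        (∀ k, k ≠ i → R g' k = R g k ∧ RY g' k = RY g k) ∧
        ∃ N : ℕ → F, R g' i = R f i - ∑ p ∈ Finset.range q, N p • R g p ∧
          RY g' i = RY f i - ∑ p ∈ Finset.range q, N p • RY g p ∧
          (∀ p < q, g Z [p] = 0 → N p = 0) ∧ ∀ p < q, φ g p (R g' i) = 0)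
      ⟨fun _ _ _ _ => rfl, fun _ _ => ⟨rfl, rfl⟩, 0, by simp [(hrest i le_rfl).1], by
        simp [(hrest i le_rfl).2], by simp, by simp⟩ ?_
    · rw [e10] at inner
      obtain ⟨hfr', hk', N, n1, n2, n3, n4⟩ := inner
      rw [Stm.eval_seq]
      set g₁ := (Stm.loop 11 10 (eliminate S Y PV t w₁ w₂ w)).eval ρ r₁ g
      obtain ⟨g₂, eg₂, pfr, pk, pz, pz0, pz1⟩ :=
        findPivot_eval (ρ := ρ) (r := r₁) hSP hPZ hw₁ hw₂ g₁
      rw [eg₂]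
      rw [e10, ew₁, ew₂] at pz pz0 pz1
      rw [e10] at pk
      have R₂ : ∀ k, R g₂ k = R g₁ k := fun k => by
        funext p; simp only [hR, row₂, pfr S hSP hSZ]
      have RY₂ : ∀ k, RY g₂ k = RY g₁ k := fun k => by
        funext p; simp only [hRY, row₁, pfr Y hYP hYZ]
      have Rlt : ∀ k, k ≠ i → R g₂ k = R g k := fun k hk => (R₂ k).trans (hk' k hk).1
      have RYlt : ∀ k, k ≠ i → RY g₂ k = RY g k := fun k hk => (RY₂ k).trans (hk' k hk).2
      have φlt : ∀ k, k ≠ i → φ g₂ k = φ g k := fun k hk => by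
        simp only [hφ]
        congr 1
        funext p
        simp only [row₂]
        rw [(pk k hk).1, hfr' PV (Ne.symm hSP) (Ne.symm hYP) hPt]
      have Zlt : ∀ k, k ≠ i → g₂ Z [k] = g Z [k] := fun k hk => by
        rw [(pk k hk).2, hfr' Z (Ne.symm hSZ) (Ne.symm hYZ) hZt]
      refine ⟨fun b hb => ?_, fun k hk => ?_, fun k => if k = i then N else M k, ?_, ?_, ?_, ?_, ?_,
        ?_, ?_⟩
      · have hb' := hb
        simp only [List.mem_cons, List.not_mem_nil, or_false, not_or] at hb'
        rw [pfr b hb'.2.2.1 hb'.2.2.2.1, hfr' b hb'.1 hb'.2.1 hb'.2.2.2.2, hfr b hb]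
      · rw [Rlt k (by omega), RYlt k (by omega)]
        exact hrest k (by omega)
      · intro k hk
        rw [Finset.sum_congr rfl fun q hq => by
          rw [Rlt q (by have := Finset.mem_range.1 hq; omega)]]
        rcases Nat.lt_succ_iff_lt_or_eq.1 hk with h | rfl
        · simp only [h.ne, if_false]
          rw [Rlt k h.ne, h1 k h]
        · simp only [if_true]
          rw [R₂, n1]
      · intro k hk
        rw [Finset.sum_congr rfl fun q hq => by
          rw [RYlt q (by have := Finset.mem_range.1 hq; omega)]]
        rcases Nat.lt_succ_iff_lt_or_eq.1 hk with h | rfl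
        · simp only [h.ne, if_false]
          rw [RYlt k h.ne, h1' k h]
        · simp only [if_true]
          rw [RY₂, n2]
      · intro k hk q hq
        rw [Zlt q (by omega)]
        rcases Nat.lt_succ_iff_lt_or_eq.1 hk with h | rfl
        · simp only [h.ne, if_false]
          exact h2 k h q hq
        · simp only [if_true]
          exact n3 q hq
      · intro k hk
        rcases Nat.lt_succ_iff_lt_or_eq.1 hk with h | rfl
        · rw [Zlt k h.ne, Rlt k h.ne]; exact h3 k h
        · rw [R₂]; exact pz
      · intro k hk q hq
        rw [φlt q (by omega)]
        rcases Nat.lt_succ_iff_lt_or_eq.1 hk with h | rfl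
        · rw [Rlt k h.ne]; exact h4 k h q hq
        · rw [R₂]; exact n4 q hq
      · intro k hk hz
        rcases Nat.lt_succ_iff_lt_or_eq.1 hk with h | rfl
        · rw [Rlt k h.ne, φlt k h.ne]
          exact h5 k h (by rwa [← Zlt k h.ne])
        · rw [R₂]; exact pz1 hz
      · intro k hk hz
        rcases Nat.lt_succ_iff_lt_or_eq.1 hk with h | rfl
        · rw [φlt k h.ne]
          exact h6 k h (by rwa [← Zlt k h.ne])
        · simp only [hφ, pz0 hz]
          ext; simp [rowFunctional]
    · rintro q hq g' ⟨hfr', hk', N, n1, n2, n3, n4⟩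
      rw [e10] at hq
      set r₂ := Function.update r₁ 11 q with hr₂
      have f10 : r₂ 10 = i := by rw [hr₂, Function.update_of_ne (by omega), e10]
      have f11 : r₂ 11 = q := by simp [hr₂]
      have fw₁ : r₂ w₁ = r w₁ := by rw [hr₂, Function.update_of_ne (by omega), ew₁]
      have fw₂ : r₂ w₂ = r w₂ := by rw [hr₂, Function.update_of_ne (by omega), ew₂]
      have fw : r₂ w = r w := by rw [hr₂, Function.update_of_ne (by omega), ew]
      obtain ⟨g'', eg, efr, ek, eS, eY⟩ := eliminate_eval (ρ := ρ) (r := r₂) hSY hSt hYt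
        hw₁ hw₂ hw (by omega) g'
      rw [f10] at ek
      rw [f10, f11, fw₁, fw₂] at eS eY
      rw [fw] at eY
      rw [eg]
      have hPV : φ g' q = φ g q := by
        simp only [hφ]
        congr 1
        funext p
        simp only [row₂, hfr' PV (Ne.symm hSP) (Ne.symm hYP) hPt]
      have eS' : R g'' i = R g' i - φ g q (R g' i) • R g q := by
        rw [← hPV, ← (hk' q hq.ne).1]; exact eS
      have eY' : RY g'' i = RY g' i - φ g q (R g' i) • RY g q := by
        rw [← hPV, ← (hk' q hq.ne).2]; exact eY
      refine ⟨fun b h1 h2 h3 => ?_, fun k hk => ?_,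
        fun p => if p = q then φ g q (R g' i) else N p, ?_, ?_, ?_, ?_⟩
      · rw [efr b h1 h2 h3, hfr' b h1 h2 h3]
      · rw [← (hk' k hk).1, ← (hk' k hk).2]
        constructor
        · funext p; exact (ek k hk).1 _ _
        · funext c; exact (ek k hk).2 _
      · rw [eS']
        generalize φ g q (R g' i) = c
        rw [n1, Finset.sum_range_succ, sub_sub]
        simp only [if_true]
        congr 2
        exact Finset.sum_congr rfl fun p hp => by rw [if_neg (Finset.mem_range.1 hp).ne]
      · rw [eY']
        generalize φ g q (R g' i) = c
        rw [n2, Finset.sum_range_succ, sub_sub]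
        simp only [if_true]
        congr 2
        exact Finset.sum_congr rfl fun p hp => by rw [if_neg (Finset.mem_range.1 hp).ne]
      · intro p hp hz
        simp only
        split_ifs with h
        · subst h; rw [h6 p hq hz]; rfl
        · exact n3 p (by omega) hz
      · intro p hp
        rw [eS', map_sub, map_smul, smul_eq_mul]
        rcases Nat.lt_succ_iff_lt_or_eq.1 hp with h | rfl
        · rw [n4 p h, h4 q hq p h, mul_zero, sub_zero]
        · by_cases hz : g Z [p] = 0
          · rw [h6 p hq hz]; simp
          · rw [h5 p hq hz, mul_one, sub_self]

end

open Matrix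

/-! ### Simultaneously diagonal matrices -/

section dg

variable {F : Type*} [Field F] {n : ℕ}

/-- The matrix that the change of basis `P`, `Q` makes diagonal with entries `x`. -/
def dg (P Q : Matrix (Fin n) (Fin n) F) (x : Fin n → F) : Matrix (Fin n) (Fin n) F :=
  P * diagonal x * Q

variable {P Q : Matrix (Fin n) (Fin n) F}

theorem dg_mul (h : Q * P = 1) (x y : Fin n → F) : dg P Q x * dg P Q y = dg P Q (x * y) := by
  have : dg P Q x * dg P Q y = P * diagonal x * (Q * P) * diagonal y * Q := by
    simp only [dg, mul_assoc]
  rw [this, h, mul_one, mul_assoc P, diagonal_mul_diagonal]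
  rfl

theorem dg_add (x y : Fin n → F) : dg P Q x + dg P Q y = dg P Q (x + y) := by
  simp only [dg, ← add_mul, ← mul_add, diagonal_add]
  rfl

theorem dg_sub (x y : Fin n → F) : dg P Q x - dg P Q y = dg P Q (x - y) := by
  simp only [dg, ← sub_mul, ← mul_sub, diagonal_sub]
  rfl

theorem dg_zero : dg P Q 0 = 0 := by
  simp only [dg]
  rw [show (diagonal (0 : Fin n → F)) = 0 from diagonal_zero]
  simp

theorem dg_const (h : P * Q = 1) (c : F) : dg P Q (fun _ => c) = c • 1 := by
  have : (diagonal fun _ : Fin n => c) = c • (1 : Matrix (Fin n) (Fin n) F) := by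
    rw [smul_one_eq_diagonal]
  rw [dg, this, Matrix.mul_smul, mul_one, Matrix.smul_mul, h]

theorem dg_one (h : P * Q = 1) : dg P Q 1 = 1 := by
  rw [show (1 : Fin n → F) = fun _ => 1 from rfl, dg_const h, one_smul]

theorem dg_diagonal (h : Q * P = 1) (x : Fin n → F) : Q * dg P Q x * P = diagonal x := by
  have : Q * dg P Q x * P = Q * P * diagonal x * (Q * P) := by simp only [dg, mul_assoc]
  rw [this, h, one_mul, mul_one]

theorem dg_injective (h : Q * P = 1) {x y : Fin n → F} (hxy : dg P Q x = dg P Q y) : x = y := by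
  have := congrArg (fun X => Q * X * P) hxy
  simp only [dg_diagonal h] at this
  exact diagonal_injective this

/-- In the eigenbasis, the equation for `Z` forces the columns at the points with `x j ≠ 0` to be
those of the inverse and says nothing about the others; the factor `dg P Q x` on the right of `Z *
Z` kills these. So any solution `Z` yields the pseudo-inverse, with `0⁻¹ = 0`, and neither `P` nor
`Q` has to be known. -/
theorem dg_inv_eq (h : P * Q = 1) (h' : Q * P = 1) {x : Fin n → F} {Z : Matrix (Fin n) (Fin n) F}
    (hZ : Z * (dg P Q x * dg P Q x) = dg P Q x) : Z * Z * dg P Q x = dg P Q x⁻¹ := by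
  set W := Q * Z * P with hW
  have hZW : Z = P * W * Q := by
    have : P * W * Q = P * Q * Z * (P * Q) := by simp only [hW, mul_assoc]
    rw [this, h, one_mul, mul_one]
  have h1 : W * diagonal (x * x) = diagonal x := by
    rw [← dg_diagonal h' (x * x), ← dg_mul h', ← dg_diagonal h' x]
    have : W * (Q * (dg P Q x * dg P Q x) * P) = Q * Z * (P * Q) * (dg P Q x * dg P Q x) * P := by
      simp only [hW, mul_assoc]
    rw [this, h, mul_one, mul_assoc Q, hZ]
  have h2 : ∀ i j, x j ≠ 0 → W i j = if i = j then (x j)⁻¹ else 0 := by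
    intro i j hj
    have := congrFun (congrFun h1 i) j
    rw [mul_diagonal, diagonal_apply] at this
    simp only [Pi.mul_apply] at this
    split_ifs at this ⊢ with hij
    · subst hij
      field_simp
      field_simp at this
      linear_combination this
    · simpa [hj] using this
  have h3 : W * W * diagonal x = diagonal x⁻¹ := by
    ext i j
    rw [mul_diagonal, mul_apply, diagonal_apply]
    by_cases hj : x j = 0
    · simp [hj]
      intro hij; rw [hij, hj]
    · rw [Finset.sum_eq_single j]
      · rw [h2 j j hj, if_pos rfl, h2 i j hj]
        split_ifs with hij
        · subst hij; simp [hj]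
        · simp
      · intro k _ hk
        rw [h2 k j hj, if_neg hk, mul_zero]
      · simp
  have : Z * Z * dg P Q x = P * W * (Q * P) * W * (Q * P) * diagonal x * Q := by
    rw [hZW]; simp only [dg, mul_assoc]
  rw [this, h', mul_one, mul_one, mul_assoc P, mul_assoc P, h3]
  rfl

/-- Shows that the equation required of `Z` in `dg_inv_eq` has a solution: the rows of a
diagonalizable matrix are combinations of the rows of its square. -/
theorem dg_eq_inv_mul (h' : Q * P = 1) (x : Fin n → F) :
    dg P Q x⁻¹ * (dg P Q x * dg P Q x) = dg P Q x := by
  rw [dg_mul h', dg_mul h']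
  congr 1
  funext i
  simp only [Pi.mul_apply, Pi.inv_apply]
  by_cases hx : x i = 0
  · simp [hx]
  · field_simp

end dg

/-! ### Matrix programs -/

/-- An entry of the matrix with name `a`. -/
def Loc.entry (a : Loc) (i j : ℕ) : Loc := ⟨a.arr, a.idx ++ [i, j]⟩

/-- Fill the matrix `a`; the registers `4` and `5` hold row and column. -/
def matTab (a : Loc) (e : Ex) : Stm := .loop 4 0 (.loop 5 0 (.asg (a.entry 4 5) e))

/-- Array `17` becomes the pseudo-inverse of the diagonalizable matrix `c`. -/
def pinv (c : Loc) : Stm :=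
  .letConst 17 1 (.letConst 18 0 (.letAdd 16 0 0
    (.seq (matTab ⟨15, []⟩ (.sum 6 0 (.mul (.cell (c.entry 4 6)) (.cell (c.entry 6 5)))))
    (.seq (.loop 4 0 (.loop 5 0 (.asg ⟨10, [4, 18, 5]⟩ (.cell ⟨15, [4, 5]⟩))))
    (.seq (.loop 4 0 (.loop 5 0 (.letAdd 19 4 0 (.asg ⟨10, [19, 18, 5]⟩ (.cell (c.entry 4 5))))))
    (.seq (.loop 4 16 (.loop 5 0 (.asg ⟨11, [4, 5]⟩ (.delta 4 5))))
    (.seq (rowReduce 10 11 12 13 14 16 17 0 0)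
    (.seq (.loop 4 0 (.loop 5 0
      (.letAdd 19 4 0 (.asg ⟨16, [4, 5]⟩ (.sub .zero (.cell ⟨11, [19, 5]⟩))))))
    (matTab ⟨17, []⟩ (.sum 6 0 (.sum 7 0
      (.mul (.mul (.cell ⟨16, [4, 6]⟩) (.cell ⟨16, [6, 7]⟩)) (.cell (c.entry 7 5))))))))))))))

/-! ### Filling matrices, and the pseudo-inverse of a diagonalizable matrix. -/

section

variable {F : Type*} [Field F] {ρ : Polynomial F → F}

/-- The matrix in the cells with index list `l` and two more indices. -/
def mat (n : ℕ) (g : Mem F) (a : ℕ) (l : List ℕ) : Matrix (Fin n) (Fin n) F :=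
  Matrix.of fun i j => g a (l ++ [(i : ℕ), (j : ℕ)])

theorem append_pair_inj {l l' : List ℕ} {i j i' j' : ℕ} :
    l ++ [i, j] = l' ++ [i', j'] ↔ l = l' ∧ i = i' ∧ j = j' := by
  constructor
  · intro h
    obtain ⟨h1, h2⟩ := List.append_inj' h rfl
    simp at h2
    exact ⟨h1, h2⟩
  · rintro ⟨rfl, rfl, rfl⟩; rfl

theorem map_update_of_notMem {r : ℕ → ℕ} {k v : ℕ} {l : List ℕ} (h : k ∉ l) :
    l.map (Function.update r k v) = l.map r :=
  List.map_congr_left fun x hx => Function.update_of_ne (by rintro rfl; exact h hx) _ _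

/-- The expression may read, from the array being filled, cells whose last two indices are the
current row and column; this is what permits updates in place. -/
theorem matTab_eval {a : Loc} {e : Ex} {r : ℕ → ℕ} {g : Mem F} {n : ℕ} (hn : r 0 = n)
    (h4 : 4 ∉ a.idx) (h5 : 5 ∉ a.idx) (v : Matrix (Fin n) (Fin n) F)
    (hv : ∀ (i j : Fin n) (g' : Mem F), (∀ b, b ≠ a.arr → g' b = g b) →
      (∀ b l, g' b (l ++ [(i : ℕ), (j : ℕ)]) = g b (l ++ [(i : ℕ), (j : ℕ)])) →
      e.eval (Function.update (Function.update r 4 i) 5 j) g' = v i j) :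
    ∃ g', (matTab a e).eval ρ r g = g' ∧ mat n g' a.arr (a.idx.map r) = v ∧
      ∀ b l, (b = a.arr → ∀ i j, l ≠ a.idx.map r ++ [i, j]) → g' b l = g b l := by
  set V : ℕ → ℕ → F := fun i j => if h : i < n ∧ j < n then v ⟨i, h.1⟩ ⟨j, h.2⟩ else 0 with hV
  have T := Tab.loop₂ (ρ := ρ) (a := a.arr) (k := 4) (x := 0) (k' := 5) (x' := 0)
    (p := .asg (a.entry 4 5) e) (r := r) (f := g) (fun i j => a.idx.map r ++ [i, j]) V
    (fun i i' j j' h => (append_pair_inj.1 h).2) (by norm_num) ?_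
  · refine ⟨_, rfl, ?_, fun b l h => T.2 b l fun hb i _ j _ => h hb i j⟩
    ext i j
    have := T.val (i := i) (j := j) (hn ▸ i.2) (hn ▸ j.2)
    simp only [hV, i.2, j.2, and_self, dif_pos] at this
    exact this
  · intro i hi j hj g' h1 h2
    rw [hn] at hi hj
    have hk : (a.entry 4 5).idx.map (Function.update (Function.update r 4 i) 5 j) =
        a.idx.map r ++ [i, j] := by
      simp only [Loc.entry, List.map_append, List.map_cons, List.map_nil, Function.update_self,
        Function.update_apply, Nat.reduceEqDiff, reduceIte]
      rw [map_update_of_notMem h5, map_update_of_notMem h4]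
    rw [Stm.eval, hk]
    have := hv ⟨i, hi⟩ ⟨j, hj⟩ g' h1 fun b l => by
      by_cases hb : b = a.arr
      · subst hb
        refine h2 _ fun i' j' hij h => ?_
        have := (append_pair_inj.1 h).2
        simp only at this
        omega
      · rw [h1 b hb]
    simp only at this
    simp only [hV, hi, hj, and_self, dif_pos, this]
    rfl

/-- Division in the algebra of all `dg P Q x` without access to `P` and `Q`. The rows of the square
of the matrix and, below them, those of the matrix itself are reduced together; the relations that
make the lower rows vanish are the rows of a matrix `Z` as in `dg_inv_eq`. -/
theorem pinv_eval {c : Loc} {r : ℕ → ℕ} {g : Mem F} {n : ℕ} (hn : r 0 = n)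
    (hc : ∀ x ∈ c.idx, x < 4 ∨ 20 ≤ x) (ha : c.arr < 10 ∨ 17 < c.arr)
    {P Q : Matrix (Fin n) (Fin n) F} (h : P * Q = 1) (h' : Q * P = 1) {x : Fin n → F}
    (hx : mat n g c.arr (c.idx.map r) = dg P Q x) :
    ∃ g', (pinv c).eval ρ r g = g' ∧ mat n g' 17 [] = dg P Q x⁻¹ ∧
      ∀ b, (b < 10 ∨ 17 < b) → g' b = g b := by
  have hm : ∀ k, 4 ≤ k → k < 20 → k ∉ c.idx := fun k h1 h2 h => by have := hc k h; omega
  have m4 := hm 4 (by norm_num) (by norm_num)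
  have m5 := hm 5 (by norm_num) (by norm_num)
  have m6 := hm 6 (by norm_num) (by norm_num)
  have m7 := hm 7 (by norm_num) (by norm_num)
  have m19 := hm 19 (by norm_num) (by norm_num)
  set X := mat n g c.arr (c.idx.map r) with hX
  set r' := Function.update (Function.update (Function.update r 17 1) 18 0) 16 (n + n) with hr'
  have hrc : c.idx.map r' = c.idx.map r := by
    rw [hr', map_update_of_notMem (hm 16 (by norm_num) (by norm_num)),
      map_update_of_notMem (hm 18 (by norm_num) (by norm_num)),
      map_update_of_notMem (hm 17 (by norm_num) (by norm_num))]
  have r0 : r' 0 = n := by simp [hr', hn]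
  have r17 : r' 17 = 1 := by simp [hr']
  have r18 : r' 18 = 0 := by simp [hr']
  have r16 : r' 16 = n + n := by simp [hr']
  clear_value r'
  have hXe : ∀ i j : Fin n, g c.arr (c.idx.map r ++ [(i : ℕ), (j : ℕ)]) = X i j :=
    fun i j => rfl
  have hca : ∀ a, 10 ≤ a → a ≤ 17 → c.arr ≠ a := fun a h1 h2 => by omega
  -- the square
  obtain ⟨g₁, e₁, s₁, f₁⟩ := matTab_eval (ρ := ρ) (a := ⟨15, []⟩)
    (e := .sum 6 0 (.mul (.cell (c.entry 4 6)) (.cell (c.entry 6 5)))) (g := g) r0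
    (by simp) (by simp) (X * X) (by
      intro i j g' hg _
      simp only [Ex.eval, Loc.entry, List.map_append, List.map_cons, List.map_nil,
        Function.update_apply, Nat.reduceEqDiff, reduceIte, map_update_of_notMem m4,
        map_update_of_notMem m5, map_update_of_notMem m6, OfNat.zero_ne_ofNat, r0, hrc,
        hg c.arr (hca 15 (by norm_num) (by norm_num)), mul_apply, ← hXe]
      exact (Fin.sum_univ_eq_sum_range (fun k => g c.arr (c.idx.map r ++ [(i : ℕ), k]) *
        g c.arr (c.idx.map r ++ [k, (j : ℕ)])) n).symm)
  have f₁' : ∀ b, b ≠ 15 → g₁ b = g b := fun b hb => funext fun l => f₁ b l fun h => absurd h hb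
  -- the first rows
  set g₂ := Stm.eval ρ (.loop 4 0 (.loop 5 0 (.asg ⟨10, [4, 18, 5]⟩ (.cell ⟨15, [4, 5]⟩)))) r' g₁
    with e₂
  have T₂ := Tab.loop₂ (ρ := ρ) (a := 10) (k := 4) (x := 0) (k' := 5) (x' := 0)
    (p := .asg ⟨10, [4, 18, 5]⟩ (.cell ⟨15, [4, 5]⟩)) (r := r') (f := g₁) (fun i j => [i, 0, j])
    (fun i j => g₁ 15 [i, j]) (by simp) (by norm_num) (by
      intro i hi j hj g' h1 h2
      simp only [Stm.eval, Ex.eval, List.map_cons, List.map_nil, Function.update_apply,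
        Nat.reduceEqDiff, reduceIte, r18, h1 15 (by norm_num)])
  rw [← e₂, r0] at T₂
  -- the last rows
  set g₃ := Stm.eval ρ (.loop 4 0 (.loop 5 0
    (.letAdd 19 4 0 (.asg ⟨10, [19, 18, 5]⟩ (.cell (c.entry 4 5)))))) r' g₂ with e₃
  have T₃ := Tab.loop₂ (ρ := ρ) (a := 10) (k := 4) (x := 0) (k' := 5) (x' := 0)
    (p := .letAdd 19 4 0 (.asg ⟨10, [19, 18, 5]⟩ (.cell (c.entry 4 5)))) (r := r') (f := g₂)
    (fun i j => [i + n, 0, j]) (fun i j => g c.arr (c.idx.map r ++ [i, j])) (by simp)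
    (by norm_num) (by
      intro i hi j hj g' h1 h2
      simp only [Stm.eval, Ex.eval, List.map_cons, List.map_nil, Function.update_apply,
        Nat.reduceEqDiff, reduceIte, r18, r0, Loc.entry, List.map_append,
        map_update_of_notMem m4, map_update_of_notMem m5, map_update_of_notMem m19, hrc,
        OfNat.zero_ne_ofNat, h1 c.arr (hca 10 (by norm_num) (by norm_num)),
        T₂.arr (hca 10 (by norm_num) (by norm_num)), f₁' c.arr (hca 15 (by norm_num) (by norm_num))])
  rw [← e₃, r0] at T₃
  -- the unit rows
  set g₄ := Stm.eval ρ (.loop 4 16 (.loop 5 0 (.asg ⟨11, [4, 5]⟩ (.delta 4 5)))) r' g₃ with e₄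
  have T₄ := Tab.loop₂ (ρ := ρ) (a := 11) (k := 4) (x := 16) (k' := 5) (x' := 0)
    (p := .asg ⟨11, [4, 5]⟩ (.delta 4 5)) (r := r') (f := g₃)
    (fun i j => [i, j]) (fun i j => if i = j then 1 else 0) (by simp) (by norm_num) (by
      intro i hi j hj g' h1 h2
      simp only [Stm.eval, Ex.eval, List.map_cons, List.map_nil, Function.update_apply,
        Nat.reduceEqDiff, reduceIte])
  rw [← e₄, r0, r16] at T₄
  -- the reduction
  obtain ⟨g₅, e₅, f₅, L, hS, hY, hL0, hZ0, hspan⟩ := rowReduce_eval (ρ := ρ) (S := 10) (Y := 11)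
    (PV := 12) (Z := 13) (t := 14) (m := 16) (w₁ := 17) (w₂ := 0) (w := 0) (r := r') (by decide)
    (by norm_num) (by norm_num) (by norm_num) g₄
  rw [r16, r0] at hY
  rw [r16] at hL0
  rw [r16, r0, r17] at hS hZ0 hspan
  have row_lt : ∀ i : Fin n, row₂ g₄ 10 1 n i = fun p => (X * X) i p.2 := by
    intro i
    funext p
    rw [row₂, T₄.arr (by norm_num), T₃.off fun _ _ _ _ h => by
      have := congrArg List.head? h; simp at this; omega]
    have := T₂.val i.2 p.2.2
    rw [show ((p.1 : Fin 1) : ℕ) = 0 by omega, this, ← s₁]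
    rfl
  have row_ge : ∀ i : Fin n, row₂ g₄ 10 1 n (i + n) = fun p => X i p.2 := by
    intro i
    funext p
    rw [row₂, T₄.arr (by norm_num), show ((p.1 : Fin 1) : ℕ) = 0 by omega, T₃.val i.2 p.2.2]
    rfl
  -- By `dg_eq_inv_mul`, each of the last n rows lies in the span of the first n and is therefore
  -- recorded as dependent.
  have hdep : ∀ i : Fin n, g₅ 13 [i + n] = 0 := by
    intro i
    refine hspan _ (by omega) ?_
    rw [row_ge i]
    have : (fun p : Fin 1 × Fin n => X i p.2) =
        ∑ k : Fin n, dg P Q x⁻¹ i k • row₂ g₄ 10 1 n k := by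
      funext p
      have := congrFun (congrFun (dg_eq_inv_mul h' x (P := P)) i) p.2
      rw [← hx, mul_apply] at this
      rw [← this]
      simp [row_lt]
    rw [this]
    exact sum_mem fun k _ => Submodule.smul_mem _ _
      (Submodule.subset_span ⟨k, by simp; omega, rfl⟩)
  set Z : Matrix (Fin n) (Fin n) F := Matrix.of fun i j => - L (i + n) j with hZ
  have hZX : Z * (X * X) = X := by
    ext i j
    have h0 := hS (i + n) (by omega)
    rw [hZ0 (i + n) (by omega) (hdep i), row_ge i] at h0
    have h1 := congrFun h0 (0, j)
    simp only [Pi.zero_apply, Pi.add_apply, Finset.sum_apply, Pi.smul_apply, smul_eq_mul] at h1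
    -- Earlier rows of the lower half have been reduced to zero, and zero rows enter with
    -- coefficient zero; so only rows of the square contribute.
    have hsplit : ∑ q ∈ Finset.range (i + n), L (i + n) q * row₂ g₄ 10 1 n q (0, j) =
        ∑ q ∈ Finset.range n, L (i + n) q * row₂ g₄ 10 1 n q (0, j) := by
      symm
      refine Finset.sum_subset (Finset.range_mono (by omega)) fun q hq hq' => ?_
      simp only [Finset.mem_range] at hq hq'
      rw [hL0 (i + n) (by omega) q hq, zero_mul]
      have := hdep ⟨q - n, by omega⟩
      simpa [Nat.sub_add_cancel (not_lt.1 hq')] using this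
    rw [hsplit, ← Fin.sum_univ_eq_sum_range (fun q => L (i + n) q * row₂ g₄ 10 1 n q (0, j))] at h1
    simp only [row_lt] at h1
    rw [mul_apply]
    simp only [hZ, of_apply, neg_mul, Finset.sum_neg_distrib]
    linear_combination h1
  -- The accompanying table has 2n rows but only n columns, so its lower half starts as zero and
  -- ends up with exactly the coefficients at the rows of the square.
  have hYv : ∀ i j : Fin n, g₅ 11 [i + n, j] = L (i + n) j := by
    intro i j
    have := congrFun (hY (i + n) (by omega)) j
    simp only [row₁, Pi.add_apply, Finset.sum_apply, Pi.smul_apply, smul_eq_mul] at this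
    rw [this, T₄.val (by omega) j.2, if_neg (by omega), zero_add, Finset.sum_eq_single (j : ℕ)]
    · rw [T₄.val (by omega) j.2, if_pos rfl, mul_one]
    · intro q hq hqj
      rw [T₄.val (by have := Finset.mem_range.1 hq; omega) j.2, if_neg hqj, mul_zero]
    · intro hj
      exact absurd (Finset.mem_range.2 (by omega)) hj
  -- the coefficients
  set g₆ := Stm.eval ρ (.loop 4 0 (.loop 5 0
      (.letAdd 19 4 0 (.asg ⟨16, [4, 5]⟩ (.sub .zero (.cell ⟨11, [19, 5]⟩)))))) r' g₅ with e₆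
  have T₆ := Tab.loop₂ (ρ := ρ) (a := 16) (k := 4) (x := 0) (k' := 5) (x' := 0)
    (p := .letAdd 19 4 0 (.asg ⟨16, [4, 5]⟩ (.sub .zero (.cell ⟨11, [19, 5]⟩)))) (r := r')
    (f := g₅) (fun i j => [i, j]) (fun i j => - g₅ 11 [i + n, j]) (by simp) (by norm_num) (by
      intro i hi j hj g' h1 h2
      simp only [Stm.eval, Ex.eval, List.map_cons, List.map_nil, Function.update_apply,
        Nat.reduceEqDiff, reduceIte, r0, OfNat.zero_ne_ofNat, h1 11 (by norm_num), zero_sub])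
  rw [← e₆, r0] at T₆
  have hZv : ∀ i j : Fin n, g₆ 16 [(i : ℕ), (j : ℕ)] = Z i j := fun i j => by
    rw [T₆.val i.2 j.2, hYv]; rfl
  have hfr : ∀ b, (b < 10 ∨ 17 < b) → g₆ b = g b := fun b hb => by
    rw [T₆.arr (by omega), f₅ b (by simp; omega), T₄.arr (by omega), T₃.arr (by omega),
      T₂.arr (by omega), f₁' b (by omega)]
  obtain ⟨g₇, e₇, s₇, f₇⟩ := matTab_eval (ρ := ρ) (a := ⟨17, []⟩)
    (e := .sum 6 0 (.sum 7 0
      (.mul (.mul (.cell ⟨16, [4, 6]⟩) (.cell ⟨16, [6, 7]⟩)) (.cell (c.entry 7 5))))) (g := g₆) r0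
    (by simp) (by simp) (Z * Z * X) (by
      intro i j g' hg _
      simp only [Ex.eval, Loc.entry, List.map_append, List.map_cons, List.map_nil,
        Function.update_apply, Nat.reduceEqDiff, reduceIte, map_update_of_notMem m4,
        map_update_of_notMem m5, map_update_of_notMem m6, map_update_of_notMem m7,
        OfNat.zero_ne_ofNat, r0, hrc, hg 16 (by norm_num),
        hg c.arr (hca 17 (by norm_num) (by norm_num)), hfr c.arr ha]
      rw [mul_assoc, mul_apply, ← Fin.sum_univ_eq_sum_range (fun k => ∑ l ∈ Finset.range n, _)]
      refine Finset.sum_congr rfl fun k _ => ?_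
      rw [mul_apply, Finset.mul_sum, ← Fin.sum_univ_eq_sum_range (fun l => _)]
      refine Finset.sum_congr rfl fun l _ => ?_
      rw [hZv, hZv, hXe, mul_assoc])
  refine ⟨g₇, ?_, ?_, fun b hb => ?_⟩
  · have er : Function.update (Function.update (Function.update r 17 1) 18 0) 16
        (Function.update (Function.update r 17 1) 18 0 0 +
          Function.update (Function.update r 17 1) 18 0 0) = r' := by
      rw [hr']; simp [hn]
    rw [pinv, Stm.eval_letConst, Stm.eval_letConst, Stm.eval_letAdd, er, Stm.eval_seq, e₁,
      Stm.eval_seq, ← e₂, Stm.eval_seq, ← e₃, Stm.eval_seq, ← e₄, Stm.eval_seq, e₅, Stm.eval_seq,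
      ← e₆, e₇]
  · simp only [List.map_nil] at s₇
    rw [s₇, hx]
    rw [hx] at hZX
    exact dg_inv_eq h h' hZX
  · rw [← hfr b hb]
    exact funext fun l => f₇ b l fun h => by simp at h; omega

end

/-! ### Running a program on all points of a spectrum at once -/

/-- `a := b * c` for matrices. -/
def matMulTo (a b c : Loc) : Stm :=
  matTab a (.sum 6 0 (.mul (.cell (b.entry 4 6)) (.cell (c.entry 6 5))))

/-- The matrix that simulates a cell. Register `2` holds the number of the run. -/
def simLoc (a : Loc) : Loc := ⟨a.arr + 30, 2 :: a.idx.map (· + 20)⟩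

/-- Array `8` tells whether the matrix `a` is nonzero somewhere on the current component, which is
given by the idempotent in array `5`. -/
def testStm (a : Loc) : Stm :=
  .seq (matMulTo ⟨9, []⟩ a ⟨5, []⟩) (.asg ⟨8, []⟩ (.any 4 0 (.any 5 0 (.cell ⟨9, [4, 5]⟩))))

/-- Shrink the current component to the part where the matrix `a` is nonzero. -/
def shrinkStm (a : Loc) : Stm :=
  .seq (pinv a) (.seq (matMulTo ⟨20, []⟩ ⟨9, []⟩ ⟨17, []⟩) (matTab ⟨5, []⟩ (.cell ⟨20, [4, 5]⟩)))

/-- The simulation of an assignment. -/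
def liftAsg : Prog → Stm
  | .fldZero a => matTab (simLoc a) .zero
  | .fldOne a => matTab (simLoc a) (.delta 4 5)
  | .fldAdd a b c => matTab (simLoc a)
      (.add (.cell ((simLoc b).entry 4 5)) (.cell ((simLoc c).entry 4 5)))
  | .fldSub a b c => matTab (simLoc a)
      (.sub (.cell ((simLoc b).entry 4 5)) (.cell ((simLoc c).entry 4 5)))
  | .fldMul a b c => .seq (matMulTo ⟨9, []⟩ (simLoc b) (simLoc c))
      (matTab (simLoc a) (.cell ⟨9, [4, 5]⟩))
  | .fldDiv a b c => .seq (pinv (simLoc c)) (.seq (matMulTo ⟨9, []⟩ (simLoc b) ⟨17, []⟩)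
      (matTab (simLoc a) (.cell ⟨9, [4, 5]⟩)))
  | _ => .skip

/-- The simulation of a program by matrices. -/
def lift : Prog → Prog
  | .natConst x k => .natConst (x + 20) k
  | .natAdd x y z => .natAdd (x + 20) (y + 20) (z + 20)
  | .natSub x y z => .natSub (x + 20) (y + 20) (z + 20)
  | .seq p q => .seq (lift p) (lift q)
  | .ifLt x y p q => .ifLt (x + 20) (y + 20) (lift p) (lift q)
  | .ifZero a p q => .seq (testStm (simLoc a)).compile
      (.ifZero ⟨8, []⟩ (lift p) (.seq (shrinkStm (simLoc a)).compile (lift q)))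
  | .loop x p => .loop (x + 20) (lift p)
  | p => (liftAsg p).compile

/-- A bound for the time that the simulation of one step takes. -/
noncomputable def liftCost : Polynomial ℕ :=
  (liftAsg (.fldZero ⟨0, []⟩)).cost + (liftAsg (.fldOne ⟨0, []⟩)).cost +
  (liftAsg (.fldAdd ⟨0, []⟩ ⟨0, []⟩ ⟨0, []⟩)).cost +
  (liftAsg (.fldMul ⟨0, []⟩ ⟨0, []⟩ ⟨0, []⟩)).cost +
  (liftAsg (.fldDiv ⟨0, []⟩ ⟨0, []⟩ ⟨0, []⟩)).cost +
  (testStm ⟨0, []⟩).cost + (shrinkStm ⟨0, []⟩).cost + 1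

/-- The registers that the simulation statements read and keep. -/
def simRegs : Set ℕ := {x | x = 0 ∨ x = 2 ∨ 20 ≤ x}

/-! ### Correctness of the simulation on a component of the spectrum. -/

section

variable {F : Type*} [Field F] {ρ : Polynomial F → F}

theorem Stm.step {p : Stm} {V B : Set ℕ} {n : ℕ} (hp : p.WF V B) (h0 : 0 ∈ V) (h1 : 1 ∉ V)
    {s : State F} (hB : ∀ y ∈ B, s.nat y ≤ n) :
    p.compile.time ρ s ≤ p.cost.eval n ∧ (∀ y ∈ V, (p.compile.exec ρ s).nat y = s.nat y) ∧
      ∀ a ≠ 3, (p.compile.exec ρ s).fld a = p.eval ρ s.nat s.fld a := by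
  obtain ⟨h, h', h''⟩ := Stm.compile_correct (ρ := ρ) p hp h0 h1 hB
    (⟨fun _ _ => rfl, fun _ _ => rfl⟩ : Shows V s.nat s.fld s)
  exact ⟨h, h', h''⟩

theorem Ex.eval_any_eq_zero (k x : ℕ) (e : Ex) (r : ℕ → ℕ) (f : Mem F) :
    (Ex.any k x e).eval r f = 0 ↔ ∀ i < r x, e.eval (Function.update r k i) f = 0 := by
  rw [Ex.eval]
  split_ifs with h
  · obtain ⟨i, hi, hne⟩ := h
    simp only [one_ne_zero, false_iff]
    exact fun h => hne (h i hi)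
  · simp only [true_iff]
    intro i hi
    by_contra hne
    exact h ⟨i, hi, hne⟩

theorem entry_map {c : Loc} {r : ℕ → ℕ} {i j : ℕ} (h4 : 4 ∉ c.idx) (h5 : 5 ∉ c.idx) :
    (c.entry 4 5).idx.map (Function.update (Function.update r 4 i) 5 j) =
      c.idx.map r ++ [i, j] := by
  simp only [Loc.entry, List.map_append, List.map_cons, List.map_nil, Function.update_self,
    Function.update_apply, Nat.reduceEqDiff, reduceIte]
  rw [map_update_of_notMem h5, map_update_of_notMem h4]

theorem matMulTo_eval {a b c : Loc} {r : ℕ → ℕ} {g : Mem F} {n : ℕ} (hn : r 0 = n)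
    (ha : ∀ x ∈ a.idx, x < 4 ∨ 20 ≤ x) (hb : ∀ x ∈ b.idx, x < 4 ∨ 20 ≤ x)
    (hc : ∀ x ∈ c.idx, x < 4 ∨ 20 ≤ x) (hab : b.arr ≠ a.arr) (hac : c.arr ≠ a.arr) :
    ∃ g', (matMulTo a b c).eval ρ r g = g' ∧ mat n g' a.arr (a.idx.map r) =
        mat n g b.arr (b.idx.map r) * mat n g c.arr (c.idx.map r) ∧
      ∀ b l, (b = a.arr → ∀ i j, l ≠ a.idx.map r ++ [i, j]) → g' b l = g b l := by
  have hm : ∀ {d : Loc} (_ : ∀ x ∈ d.idx, x < 4 ∨ 20 ≤ x) k, 4 ≤ k → k < 20 → k ∉ d.idx :=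
    fun hd k h1 h2 h => by have := hd k h; omega
  refine matTab_eval hn (hm ha 4 (by norm_num) (by norm_num)) (hm ha 5 (by norm_num) (by norm_num))
    _ ?_
  intro i j g' hg _
  simp only [Ex.eval, Loc.entry, List.map_append, List.map_cons, List.map_nil,
    Function.update_apply, Nat.reduceEqDiff, reduceIte,
    map_update_of_notMem (hm hb 4 (by norm_num) (by norm_num)),
    map_update_of_notMem (hm hb 5 (by norm_num) (by norm_num)),
    map_update_of_notMem (hm hb 6 (by norm_num) (by norm_num)),
    map_update_of_notMem (hm hc 4 (by norm_num) (by norm_num)),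
    map_update_of_notMem (hm hc 5 (by norm_num) (by norm_num)),
    map_update_of_notMem (hm hc 6 (by norm_num) (by norm_num)),
    OfNat.zero_ne_ofNat, hn, hg b.arr hab, hg c.arr hac, mul_apply]
  exact (Fin.sum_univ_eq_sum_range (fun k => g b.arr (b.idx.map r ++ [(i : ℕ), k]) *
    g c.arr (c.idx.map r ++ [k, (j : ℕ)])) n).symm

theorem matCopy_eval {a : Loc} {d : ℕ} {r : ℕ → ℕ} {g : Mem F} {n : ℕ} (hn : r 0 = n)
    (ha : ∀ x ∈ a.idx, x < 4 ∨ 20 ≤ x) (hd : d ≠ a.arr) :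
    ∃ g', (matTab a (.cell ⟨d, [4, 5]⟩)).eval ρ r g = g' ∧
      mat n g' a.arr (a.idx.map r) = mat n g d [] ∧
      ∀ b l, (b = a.arr → ∀ i j, l ≠ a.idx.map r ++ [i, j]) → g' b l = g b l := by
  refine matTab_eval hn (fun h => by have := ha 4 h; omega) (fun h => by have := ha 5 h; omega)
    _ ?_
  intro i j g' hg _
  simp only [Ex.eval, List.map_cons, List.map_nil, Function.update_apply, Nat.reduceEqDiff,
    reduceIte, hg d hd]
  rfl

/-- The state `s` simulates the states `σ p` for all points `p` in `S`. -/
structure Sim {n : ℕ} (run : ℕ) (P Q : Matrix (Fin n) (Fin n) F) (S : Finset (Fin n))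
    (s : State F) (σ : Fin n → State F) : Prop where
  size : s.nat 0 = n
  runNo : s.nat 2 = run
  nat : ∀ p ∈ S, ∀ x, s.nat (x + 20) = (σ p).nat x
  fld : ∀ a l, ∃ v, mat n s.fld (a + 30) (run :: l) = dg P Q v ∧ ∀ p ∈ S, v p = (σ p).fld a l
  idem : mat n s.fld 5 [] = dg P Q fun p => if p ∈ S then 1 else 0

/-- What a simulation does not change. -/
def SimFrame (run : ℕ) (s s' : State F) : Prop :=
  (∀ b, b = 0 ∨ b = 6 ∨ b = 7 → s'.fld b = s.fld b) ∧
    ∀ b, 30 ≤ b → ∀ l : List ℕ, l.head? ≠ some run → s'.fld b l = s.fld b l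

theorem SimFrame.refl (run : ℕ) (s : State F) : SimFrame run s s :=
  ⟨fun _ _ => rfl, fun _ _ _ _ => rfl⟩

theorem SimFrame.trans {run : ℕ} {s s' s'' : State F} (h : SimFrame run s s')
    (h' : SimFrame run s' s'') : SimFrame run s s'' :=
  ⟨fun b hb => (h'.1 b hb).trans (h.1 b hb), fun b hb l hl => (h'.2 b hb l hl).trans (h.2 b hb l hl)⟩

variable {n run : ℕ} {P Q : Matrix (Fin n) (Fin n) F} {S : Finset (Fin n)} {s s' : State F}
  {σ : Fin n → State F}

theorem Sim.key (h : Sim run P Q S s σ) (a : Loc) :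
    (simLoc a).idx.map s.nat = run :: a.idx.map fun x => s.nat (x + 20) := by
  simp [simLoc, h.runNo, Function.comp_def]

theorem Sim.key_eq (h : Sim run P Q S s σ) (a : Loc) {p : Fin n} (hp : p ∈ S) :
    (a.idx.map fun x => s.nat (x + 20)) = a.idx.map (σ p).nat :=
  List.map_congr_left fun x _ => h.nat p hp x

theorem Sim.get (h : Sim run P Q S s σ) (a : Loc) :
    ∃ v, mat n s.fld (simLoc a).arr ((simLoc a).idx.map s.nat) = dg P Q v ∧
      ∀ p ∈ S, v p = (σ p).get a := by
  obtain ⟨v, h1, h2⟩ := h.fld a.arr (a.idx.map fun x => s.nat (x + 20))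
  refine ⟨v, by rw [h.key]; exact h1, fun p hp => ?_⟩
  rw [h2 p hp, h.key_eq a hp]; rfl

/-- All points of `S` agree in the natural-number registers, so that one matrix write changes the
same cell in all simulated states. The values of `v` outside of `S` are irrelevant. -/
theorem Sim.put (h : Sim run P Q S s σ) (a : Loc) {v : Fin n → F} {g : Mem F}
    (hnat : ∀ y ∈ simRegs, s'.nat y = s.nat y) (hfld : ∀ b ≠ 3, s'.fld b = g b)
    (hv : mat n g (simLoc a).arr ((simLoc a).idx.map s.nat) = dg P Q v)
    (hg : ∀ b l, (30 ≤ b ∨ b = 5 ∨ b = 0 ∨ b = 6 ∨ b = 7) →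
      (b = (simLoc a).arr → ∀ i j, l ≠ (simLoc a).idx.map s.nat ++ [i, j]) → g b l = s.fld b l) :
    Sim run P Q S s' (fun p => (σ p).put a (v p)) ∧ SimFrame run s s' := by
  rw [h.key] at hv hg
  refine ⟨⟨?_, ?_, ?_, ?_, ?_⟩, ?_, ?_⟩
  · rw [hnat 0 (by simp [simRegs]), h.size]
  · rw [hnat 2 (by simp [simRegs]), h.runNo]
  · intro p hp x
    rw [hnat (x + 20) (by simp [simRegs]), h.nat p hp]
    rfl
  · intro b l
    by_cases hbl : b = a.arr ∧ l = a.idx.map fun x => s.nat (x + 20)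
    · obtain ⟨rfl, rfl⟩ := hbl
      refine ⟨v, ?_, fun p hp => ?_⟩
      · rw [← hv]
        ext i j
        simp only [mat, of_apply, hfld (a.arr + 30) (by omega)]
        rfl
      · rw [State.put_fld, h.key_eq a hp, Mem.set_same]
    · obtain ⟨w, h1, h2⟩ := h.fld b l
      refine ⟨w, ?_, fun p hp => ?_⟩
      · rw [← h1]
        ext i j
        simp only [mat, of_apply, hfld (b + 30) (by omega)]
        refine hg _ _ (Or.inl (by omega)) fun hb i' j' hl => hbl ?_
        simp only [simLoc, Nat.add_right_cancel_iff] at hb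
        rw [append_pair_inj] at hl
        exact ⟨hb, List.cons_injective hl.1⟩
      · rw [h2 p hp, State.put_fld, Mem.set, ← h.key_eq a hp, if_neg hbl]
  · rw [← h.idem]
    ext i j
    simp only [mat, of_apply, hfld 5 (by omega)]
    exact hg 5 _ (by simp) fun hb => by simp [simLoc] at hb
  · intro b hb
    rw [hfld b (by omega)]
    funext l
    exact hg b l (by omega) fun hb' => by simp [simLoc] at hb'; omega
  · intro b hb l hl
    rw [hfld b (by omega)]
    refine hg b l (Or.inl hb) fun _ i j hl' => hl ?_
    simp [hl']

theorem matTab_wf {a : Loc} {e : Ex} {V B : Set ℕ} (h0 : 0 ∈ V) (h0B : 0 ∈ B) (h4 : 4 ∉ V)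
    (h5 : 5 ∉ V) (ha : a.arr ≠ 3) (hai : ∀ x ∈ a.idx, x ∈ V)
    (he : e.WF (insert 5 (insert 4 V)) (insert 5 (insert 4 B))) : (matTab a e).WF V B := by
  refine ⟨h0, h0B, h4, by norm_num, Or.inr h0, Or.inr h0B, ?_, by norm_num, ha, ?_, he⟩
  · simp [h5]
  · intro x hx
    simp only [Loc.entry, List.mem_append, List.mem_cons, List.not_mem_nil, or_false] at hx
    rcases hx with h | rfl | rfl
    · exact Or.inr (Or.inr (hai x h))
    · exact Or.inr (Or.inl rfl)
    · exact Or.inl rfl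

theorem simLoc_mem (a : Loc) : ∀ x ∈ (simLoc a).idx, x ∈ simRegs := by
  intro x hx
  simp only [simLoc, List.mem_cons, List.mem_map] at hx
  rcases hx with rfl | ⟨y, _, rfl⟩ <;> simp [simRegs]

theorem simLoc_bound (a : Loc) : ∀ x ∈ (simLoc a).idx, x < 4 ∨ 20 ≤ x := by
  intro x hx
  have := simLoc_mem a x hx
  simp only [simRegs, Set.mem_ofPred_eq] at this
  omega

/-- The proper registers of the simulation statements. -/
def LocOK (a : Loc) : Prop := a.arr ≠ 3 ∧ ∀ x ∈ a.idx, x ∈ simRegs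

theorem simLoc_ok (a : Loc) : LocOK (simLoc a) := ⟨by simp [simLoc], simLoc_mem a⟩

theorem nil_ok {a : ℕ} (h : a ≠ 3) : LocOK ⟨a, []⟩ := ⟨h, by simp⟩

theorem matTab_wf' {a : Loc} {e : Ex} (ha : LocOK a)
    (he : e.WF (insert 5 (insert 4 simRegs)) (insert 5 (insert 4 {0}))) :
    (matTab a e).WF simRegs {0} :=
  matTab_wf (by simp [simRegs]) rfl (by simp [simRegs]) (by simp [simRegs]) ha.1 ha.2 he

theorem matMulTo_wf {a b c : Loc} (ha : LocOK a) (hb : LocOK b) (hc : LocOK c) :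
    (matMulTo a b c).WF simRegs {0} := by
  refine matTab_wf' ha ⟨by simp [simRegs], by simp, by simp [simRegs], by norm_num,
    ⟨hb.1, fun x hx => ?_⟩, ⟨hc.1, fun x hx => ?_⟩⟩
  · simp only [Loc.entry, List.mem_append, List.mem_cons, List.not_mem_nil, or_false] at hx
    rcases hx with h | rfl | rfl
    · simp [hb.2 x h]
    · simp
    · simp
  · simp only [Loc.entry, List.mem_append, List.mem_cons, List.not_mem_nil, or_false] at hx
    rcases hx with h | rfl | rfl
    · simp [hc.2 x h]
    · simp
    · simp

theorem entry_wf {c : Loc} (hc : LocOK c) :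
    (Ex.cell (c.entry 4 5)).WF (insert 5 (insert 4 simRegs)) (insert 5 (insert 4 {0})) := by
  refine ⟨hc.1, fun x hx => ?_⟩
  simp only [Loc.entry, List.mem_append, List.mem_cons, List.not_mem_nil, or_false] at hx
  rcases hx with h | rfl | rfl
  · simp [hc.2 x h]
  · simp
  · simp

theorem pinv_wf {c : Loc} (hc : LocOK c) : (pinv c).WF simRegs {0} := by
  have hcw : ∀ x ∈ c.idx, x = 0 ∨ x = 2 ∨ 20 ≤ x := hc.2
  have hV : ∀ x, x ∈ simRegs ↔ (x = 0 ∨ x = 2 ∨ 20 ≤ x) := fun x => Iff.rfl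
  simp [pinv, rowReduce, eliminate, findPivot, matTab, Stm.WF, Ex.WF, Loc.entry, hV, hc.1,
    or_imp, forall_and]
  exact ⟨fun x hx => by have := hcw x hx; omega, fun x hx => by have := hcw x hx; omega,
    fun x hx => by have := hcw x hx; omega⟩

theorem shrinkStm_wf {c : Loc} (hc : LocOK c) : (shrinkStm c).WF simRegs {0} :=
  ⟨pinv_wf hc, matMulTo_wf (nil_ok (by norm_num)) (nil_ok (by norm_num)) (nil_ok (by norm_num)),
    matTab_wf' (nil_ok (by norm_num)) (entry_wf (c := ⟨20, []⟩) (nil_ok (by norm_num)))⟩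

theorem testStm_wf {c : Loc} (hc : LocOK c) : (testStm c).WF simRegs {0} :=
  ⟨matMulTo_wf (nil_ok (by norm_num)) hc (nil_ok (by norm_num)), by
    simp [Stm.WF, Ex.WF, simRegs]⟩

theorem liftAsg_wf (p : Prog) : (liftAsg p).WF simRegs {0} := by
  have h9 := entry_wf (c := ⟨9, []⟩) (nil_ok (by norm_num))
  have mul : ∀ b c : Loc, LocOK b → LocOK c → (matMulTo ⟨9, []⟩ b c).WF simRegs {0} :=
    fun b c hb hc => matMulTo_wf (nil_ok (by norm_num)) hb hc
  cases p
  case fldZero a => exact matTab_wf' (simLoc_ok a) trivial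
  case fldOne a => exact matTab_wf' (simLoc_ok a) ⟨by simp, by simp⟩
  case fldAdd a b c =>
    exact matTab_wf' (simLoc_ok a) ⟨entry_wf (simLoc_ok b), entry_wf (simLoc_ok c)⟩
  case fldSub a b c =>
    exact matTab_wf' (simLoc_ok a) ⟨entry_wf (simLoc_ok b), entry_wf (simLoc_ok c)⟩
  case fldMul a b c =>
    exact ⟨mul _ _ (simLoc_ok b) (simLoc_ok c), matTab_wf' (simLoc_ok a) h9⟩
  case fldDiv a b c =>
    exact ⟨pinv_wf (simLoc_ok c), mul _ _ (simLoc_ok b) (nil_ok (by norm_num)),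
      matTab_wf' (simLoc_ok a) h9⟩
  all_goals trivial

theorem Sim.congr (h : Sim run P Q S s σ) (hnat : ∀ y ∈ simRegs, s'.nat y = s.nat y)
    (hfld : ∀ b, 30 ≤ b ∨ b = 5 ∨ b = 0 ∨ b = 6 ∨ b = 7 → s'.fld b = s.fld b) :
    Sim run P Q S s' σ ∧ SimFrame run s s' := by
  refine ⟨⟨?_, ?_, ?_, ?_, ?_⟩, fun b hb => hfld b (by omega),
    fun b hb l _ => by rw [hfld b (Or.inl hb)]⟩
  · rw [hnat 0 (by simp [simRegs]), h.size]
  · rw [hnat 2 (by simp [simRegs]), h.runNo]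
  · intro p hp x
    rw [hnat (x + 20) (by simp [simRegs]), h.nat p hp]
  · intro a l
    have : mat n s'.fld (a + 30) (run :: l) = mat n s.fld (a + 30) (run :: l) := by
      simp only [mat, hfld (a + 30) (by omega)]
    rw [this]
    exact h.fld a l
  · rw [← h.idem]
    simp only [mat, hfld 5 (by omega)]

theorem Sim.mono (h : Sim run P Q S s σ) {σ' : Fin n → State F} (hσ : ∀ p ∈ S, σ' p = σ p) :
    Sim run P Q S s σ' where
  size := h.size
  runNo := h.runNo
  nat p hp x := by rw [h.nat p hp, hσ p hp]
  fld a l := by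
    obtain ⟨v, h1, h2⟩ := h.fld a l
    exact ⟨v, h1, fun p hp => by rw [h2 p hp, hσ p hp]⟩
  idem := h.idem

theorem Sim.putNat (h : Sim run P Q S s σ) (x k : ℕ) :
    Sim run P Q S (s.putNat (x + 20) k) (fun p => (σ p).putNat x k) where
  size := by simp [h.size]
  runNo := by simp [h.runNo]
  nat p hp y := by
    simp only [State.putNat_nat, Function.update_apply, Nat.add_right_cancel_iff]
    rw [h.nat p hp]
  fld a l := h.fld a l
  idem := h.idem

theorem Sim.step (h : Sim run P Q S s σ) {p : Stm} (hp : p.WF simRegs {0}) :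
    p.compile.time ρ s ≤ p.cost.eval n ∧ (∀ y ∈ simRegs, (p.compile.exec ρ s).nat y = s.nat y) ∧
      ∀ a ≠ 3, (p.compile.exec ρ s).fld a = p.eval ρ s.nat s.fld a :=
  Stm.step hp (by simp [simRegs]) (by simp [simRegs]) (by rintro y rfl; exact h.size.le)

/-- `dg P Q` turns pointwise operations on functions into matrix operations. For division, the
conventions `0⁻¹ = 0` of the field and of the pseudo-inverse agree. -/
theorem liftAsg_sim (hPQ : P * Q = 1) (hQP : Q * P = 1) (h : Sim run P Q S s σ) (p : Prog)
    (hp : (∃ a, p = .fldZero a) ∨ (∃ a, p = .fldOne a) ∨ (∃ a b c, p = .fldAdd a b c) ∨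
      (∃ a b c, p = .fldSub a b c) ∨ (∃ a b c, p = .fldMul a b c) ∨ ∃ a b c, p = .fldDiv a b c) :
    Sim run P Q S ((liftAsg p).compile.exec ρ s) (fun q => p.exec ρ (σ q)) ∧
      SimFrame run s ((liftAsg p).compile.exec ρ s) := by
  obtain ⟨-, hnat, hfld⟩ := h.step (ρ := ρ) (liftAsg_wf p)
  have m4 : ∀ a : Loc, 4 ∉ (simLoc a).idx := fun a h => by have := simLoc_bound a 4 h; omega
  have m5 : ∀ a : Loc, 5 ∉ (simLoc a).idx := fun a h => by have := simLoc_bound a 5 h; omega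
  have fin : ∀ (a : Loc) (v : Fin n → F) (w : Fin n → F) (g : Mem F),
      (liftAsg p).eval ρ s.nat s.fld = g →
      mat n g (simLoc a).arr ((simLoc a).idx.map s.nat) = dg P Q v →
      (∀ b l, (30 ≤ b ∨ b = 5 ∨ b = 0 ∨ b = 6 ∨ b = 7) →
        (b = (simLoc a).arr → ∀ i j, l ≠ (simLoc a).idx.map s.nat ++ [i, j]) →
          g b l = s.fld b l) → (∀ q ∈ S, v q = w q) → (∀ q, p.exec ρ (σ q) = (σ q).put a (w q)) →
      Sim run P Q S ((liftAsg p).compile.exec ρ s) (fun q => p.exec ρ (σ q)) ∧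
        SimFrame run s ((liftAsg p).compile.exec ρ s) := by
    intro a v w g e1 e2 e3 e4 e5
    rw [e1] at hfld
    have := h.put a hnat hfld e2 e3
    exact ⟨this.1.mono fun q hq => by rw [e5, e4 q hq], this.2⟩
  have ent : ∀ (b : Loc) (k : ℕ → ℕ) (i j : ℕ), k = Function.update (Function.update s.nat 4 i) 5 j →
      ((simLoc b).entry 4 5).idx.map k = (simLoc b).idx.map s.nat ++ [i, j] :=
    fun b k i j hk => by rw [hk]; exact entry_map (m4 b) (m5 b)
  rcases hp with ⟨a, rfl⟩ | ⟨a, rfl⟩ | ⟨a, b, c, rfl⟩ | ⟨a, b, c, rfl⟩ | ⟨a, b, c, rfl⟩ |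
    ⟨a, b, c, rfl⟩
  · obtain ⟨g, e, hm, hf⟩ := matTab_eval (ρ := ρ) (a := simLoc a) (e := .zero) (g := s.fld) h.size
      (m4 a) (m5 a) 0 (fun _ _ _ _ _ => rfl)
    exact fin a 0 0 g e (by rw [hm, dg_zero]) (fun b l _ hb => hf b l hb) (fun _ _ => rfl)
      fun _ => rfl
  · obtain ⟨g, e, hm, hf⟩ := matTab_eval (ρ := ρ) (a := simLoc a) (e := .delta 4 5) (g := s.fld)
      h.size (m4 a) (m5 a) 1 (fun i j _ _ _ => by
        simp only [Ex.eval, Function.update_apply, Nat.reduceEqDiff, reduceIte, one_apply, Fin.ext_iff])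
    exact fin a 1 1 g e (by rw [hm, dg_one hPQ]) (fun b l _ hb => hf b l hb) (fun _ _ => rfl)
      fun _ => rfl
  · obtain ⟨v, hv, hvS⟩ := h.get b
    obtain ⟨w, hw, hwS⟩ := h.get c
    obtain ⟨g, e, hm, hf⟩ := matTab_eval (ρ := ρ) (a := simLoc a) (e := .add
      (.cell ((simLoc b).entry 4 5)) (.cell ((simLoc c).entry 4 5))) (g := s.fld)
      h.size (m4 a) (m5 a) (dg P Q (v + w)) (fun i j g' _ hg => by
        rw [← dg_add, ← hv, ← hw]
        simp only [Ex.eval, ent b _ i j rfl, ent c _ i j rfl, hg]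
        rfl)
    exact fin a _ (fun q => (σ q).get b + (σ q).get c) g e hm (fun b l _ hb => hf b l hb)
      (fun q hq => by simp [hvS q hq, hwS q hq]) fun _ => rfl
  · obtain ⟨v, hv, hvS⟩ := h.get b
    obtain ⟨w, hw, hwS⟩ := h.get c
    obtain ⟨g, e, hm, hf⟩ := matTab_eval (ρ := ρ) (a := simLoc a) (e := .sub
      (.cell ((simLoc b).entry 4 5)) (.cell ((simLoc c).entry 4 5))) (g := s.fld)
      h.size (m4 a) (m5 a) (dg P Q (v - w)) (fun i j g' _ hg => by
        rw [← dg_sub, ← hv, ← hw]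
        simp only [Ex.eval, ent b _ i j rfl, ent c _ i j rfl, hg]
        rfl)
    exact fin a _ (fun q => (σ q).get b - (σ q).get c) g e hm (fun b l _ hb => hf b l hb)
      (fun q hq => by simp [hvS q hq, hwS q hq]) fun _ => rfl
  · obtain ⟨v, hv, hvS⟩ := h.get b
    obtain ⟨w, hw, hwS⟩ := h.get c
    obtain ⟨g₁, e₁, hm₁, hf₁⟩ := matMulTo_eval (ρ := ρ) (a := ⟨9, []⟩) (g := s.fld) h.size
      (by simp) (simLoc_bound b) (simLoc_bound c) (by simp [simLoc]) (by simp [simLoc])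
    obtain ⟨g, e, hm, hf⟩ := matCopy_eval (ρ := ρ) (g := g₁) (d := 9) h.size (simLoc_bound a)
      (by simp [simLoc])
    rw [List.map_nil] at hm₁
    refine fin a (v * w) (fun q => (σ q).get b * (σ q).get c) g ?_ ?_ (fun b l hb hb' => ?_)
      (fun q hq => by simp [hvS q hq, hwS q hq]) fun _ => rfl
    · rw [liftAsg, Stm.eval_seq, e₁, e]
    · rw [hm, hm₁, hv, hw, dg_mul hQP]
    · rw [hf b l hb', hf₁ b l fun h => by simp at h; omega]
  · obtain ⟨v, hv, hvS⟩ := h.get b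
    obtain ⟨w, hw, hwS⟩ := h.get c
    obtain ⟨g₀, e₀, hm₀, hf₀⟩ := pinv_eval (ρ := ρ) (g := s.fld) h.size (simLoc_bound c)
      (by simp [simLoc]) hPQ hQP hw
    obtain ⟨g₁, e₁, hm₁, hf₁⟩ := matMulTo_eval (ρ := ρ) (a := ⟨9, []⟩) (c := ⟨17, []⟩) (g := g₀)
      h.size (by simp) (simLoc_bound b) (by simp) (by simp [simLoc]) (by simp)
    obtain ⟨g, e, hm, hf⟩ := matCopy_eval (ρ := ρ) (g := g₁) (d := 9) h.size (simLoc_bound a)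
      (by simp [simLoc])
    simp only [List.map_nil] at hm₁
    have hb0 : mat n g₀ (simLoc b).arr ((simLoc b).idx.map s.nat) = dg P Q v := by
      rw [← hv]
      simp only [mat, hf₀ (simLoc b).arr (by simp [simLoc])]
    refine fin a (v * w⁻¹) (fun q => (σ q).get b / (σ q).get c) g ?_ ?_ (fun b l hb hb' => ?_)
      (fun q hq => by simp [hvS q hq, hwS q hq, div_eq_mul_inv]) fun _ => rfl
    · rw [liftAsg, Stm.eval_seq, e₀, Stm.eval_seq, e₁, e]
    · rw [hm, hm₁, hb0, hm₀, dg_mul hQP]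
    · rw [hf b l hb', hf₁ b l fun h => by simp at h; omega, hf₀ b (by omega)]

/-- Multiplication by the idempotent of `S` removes the unknown values outside of `S`, after which
the matrix is zero exactly if the cell is zero at all points of `S`. The product is kept in array
`9` for `shrink_sim`. -/
theorem test_sim (hQP : Q * P = 1) (h : Sim run P Q S s σ) (a : Loc) :
    Sim run P Q S ((testStm (simLoc a)).compile.exec ρ s) σ ∧
      SimFrame run s ((testStm (simLoc a)).compile.exec ρ s) ∧
      (((testStm (simLoc a)).compile.exec ρ s).fld 8 [] = 0 ↔ ∀ p ∈ S, (σ p).get a = 0) ∧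
      ∃ v, mat n ((testStm (simLoc a)).compile.exec ρ s).fld 9 [] = dg P Q v ∧
        ∀ p, v p = if p ∈ S then (σ p).get a else 0 := by
  obtain ⟨-, hnat, hfld⟩ := h.step (ρ := ρ) (testStm_wf (simLoc_ok a))
  obtain ⟨v, hv, hvS⟩ := h.get a
  obtain ⟨g₁, e₁, hm₁, hf₁⟩ := matMulTo_eval (ρ := ρ) (a := ⟨9, []⟩) (c := ⟨5, []⟩) (g := s.fld)
    h.size (by simp) (simLoc_bound a) (by simp) (by simp [simLoc]) (by simp)
  simp only [List.map_nil] at hm₁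
  rw [hv, h.idem, dg_mul hQP] at hm₁
  rw [testStm, Stm.eval_seq, e₁] at hfld
  have hmul : ∀ p, (v * (fun p => if p ∈ S then 1 else 0 : Fin n → F)) p = if p ∈ S then (σ p).get a else 0 := by
    intro p
    simp only [Pi.mul_apply]
    split_ifs with hp
    · rw [hvS p hp, mul_one]
    · simp
  have e9 : mat n ((testStm (simLoc a)).compile.exec ρ s).fld 9 [] =
      dg P Q (v * fun p => if p ∈ S then 1 else 0) := by
    rw [← hm₁]
    simp only [testStm, mat, hfld 9 (by norm_num)]
    rfl
  have := h.congr (s' := (testStm (simLoc a)).compile.exec ρ s) hnat (fun b hb => by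
    rw [testStm, hfld b (by omega), Stm.eval, Mem.set_arr _ (by simp only; omega)]
    funext l
    exact hf₁ b l fun h => by simp only at h; omega)
  refine ⟨this.1, this.2, ?_, _, e9, hmul⟩
  have h8 : ((testStm (simLoc a)).compile.exec ρ s).fld 8 [] = 0 ↔ mat n g₁ 9 [] = 0 := by
    rw [testStm, hfld 8 (by norm_num), Stm.eval, List.map_nil, Mem.set_same]
    simp only [Ex.eval_any_eq_zero]
    simp only [Ex.eval, List.map_cons, List.map_nil, Function.update_apply, Nat.reduceEqDiff,
      reduceIte, OfNat.zero_ne_ofNat, h.size]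
    constructor
    · intro h
      ext i j
      exact h i i.2 j j.2
    · intro h i hi j hj
      exact congrFun (congrFun h ⟨i, hi⟩) ⟨j, hj⟩
  rw [h8, hm₁]
  constructor
  · intro h0 p hp
    rw [← dg_zero (P := P) (Q := Q)] at h0
    have := congrFun (dg_injective hQP h0) p
    rwa [hmul, if_pos hp] at this
  · intro h0
    rw [← dg_zero (P := P) (Q := Q)]
    congr 1
    funext p
    rw [hmul]
    split_ifs with hp
    · exact h0 p hp
    · rfl

-- The product in array `9` vanishes outside of `S` and agrees on `S` with the cell tested.
-- Multiplied by the pseudo-inverse of the cell, it becomes the idempotent of the points of `S`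
-- where the cell is nonzero.
open Classical in
theorem shrink_sim (hPQ : P * Q = 1) (hQP : Q * P = 1) (h : Sim run P Q S s σ) (a : Loc)
    {v : Fin n → F} (h9 : mat n s.fld 9 [] = dg P Q v)
    (hv9 : ∀ p, v p = if p ∈ S then (σ p).get a else 0) :
    Sim run P Q (S.filter fun p => (σ p).get a ≠ 0)
        ((shrinkStm (simLoc a)).compile.exec ρ s) σ ∧
      SimFrame run s ((shrinkStm (simLoc a)).compile.exec ρ s) := by
  obtain ⟨-, hnat, hfld⟩ := h.step (ρ := ρ) (shrinkStm_wf (simLoc_ok a))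
  obtain ⟨w, hw, hwS⟩ := h.get a
  obtain ⟨g₀, e₀, hm₀, hf₀⟩ := pinv_eval (ρ := ρ) (g := s.fld) h.size (simLoc_bound a)
    (by simp [simLoc]) hPQ hQP hw
  obtain ⟨g₁, e₁, hm₁, hf₁⟩ := matMulTo_eval (ρ := ρ) (a := ⟨20, []⟩) (b := ⟨9, []⟩)
    (c := ⟨17, []⟩) (g := g₀) h.size (by simp) (by simp) (by simp) (by simp) (by simp)
  obtain ⟨g, e, hm, hf⟩ := matCopy_eval (ρ := ρ) (g := g₁) (d := 20) (a := ⟨5, []⟩) h.size (by simp)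
    (by simp)
  have h9' : mat n g₀ 9 [] = dg P Q v := by
    rw [← h9]
    simp only [mat, hf₀ 9 (by norm_num)]
  rw [shrinkStm, Stm.eval_seq, e₀, Stm.eval_seq, e₁, e] at hfld
  simp only [List.map_nil] at hm₁ hm
  rw [h9', hm₀, dg_mul hQP] at hm₁
  have hfr : ∀ b, b ≠ 5 → b ≠ 20 → (b < 10 ∨ 17 < b) → g b = s.fld b := fun b h1 h2 h3 => by
    rw [← hf₀ b h3]
    funext l
    rw [hf b l fun h => absurd h h1, hf₁ b l fun h => absurd h h2]
  refine ⟨⟨?_, ?_, ?_, ?_, ?_⟩, ?_, ?_⟩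
  · rw [hnat 0 (by simp [simRegs]), h.size]
  · rw [hnat 2 (by simp [simRegs]), h.runNo]
  · intro p hp x
    rw [hnat (x + 20) (by simp [simRegs]), h.nat p (Finset.mem_filter.1 hp).1]
  · intro b l
    obtain ⟨u, h1, h2⟩ := h.fld b l
    refine ⟨u, ?_, fun p hp => h2 p (Finset.mem_filter.1 hp).1⟩
    rw [← h1]
    simp only [shrinkStm, mat, hfld (b + 30) (by omega),
      hfr (b + 30) (by omega) (by omega) (by omega)]
  · have : mat n ((shrinkStm (simLoc a)).compile.exec ρ s).fld 5 [] = mat n g 5 [] := by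
      simp only [shrinkStm, mat, hfld 5 (by norm_num)]
    rw [this, hm, hm₁]
    congr 1
    funext p
    simp only [Pi.mul_apply, Pi.inv_apply, hv9, Finset.mem_filter]
    by_cases hp : p ∈ S
    · by_cases h0 : (σ p).get a = 0
      · simp [h0]
      · simp [hp, h0, hwS p hp]
    · simp [hp]
  · intro b hb
    rw [shrinkStm, hfld b (by omega), hfr b (by omega) (by omega) (by omega)]
  · intro b hb l _
    rw [shrinkStm, hfld b (by omega), hfr b (by omega) (by omega) (by omega)]

/-- The cost of a statement depends on its shape only, so one choice of addresses represents all. -/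
theorem liftCost_asg (p : Prog) (n : ℕ) : (liftAsg p).cost.eval n ≤ liftCost.eval n := by
  cases p
  case fldZero a =>
    rw [show (liftAsg (.fldZero a)).cost = (liftAsg (.fldZero ⟨0, []⟩)).cost from rfl]
    simp only [liftCost, Polynomial.eval_add]; omega
  case fldOne a =>
    rw [show (liftAsg (.fldOne a)).cost = (liftAsg (.fldOne ⟨0, []⟩)).cost from rfl]
    simp only [liftCost, Polynomial.eval_add]; omega
  case fldAdd a b c =>
    rw [show (liftAsg (.fldAdd a b c)).cost =
      (liftAsg (.fldAdd ⟨0, []⟩ ⟨0, []⟩ ⟨0, []⟩)).cost from rfl]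
    simp only [liftCost, Polynomial.eval_add]; omega
  case fldSub a b c =>
    rw [show (liftAsg (.fldSub a b c)).cost =
      (liftAsg (.fldAdd ⟨0, []⟩ ⟨0, []⟩ ⟨0, []⟩)).cost from rfl]
    simp only [liftCost, Polynomial.eval_add]; omega
  case fldMul a b c =>
    rw [show (liftAsg (.fldMul a b c)).cost =
      (liftAsg (.fldMul ⟨0, []⟩ ⟨0, []⟩ ⟨0, []⟩)).cost from rfl]
    simp only [liftCost, Polynomial.eval_add]; omega
  case fldDiv a b c =>
    rw [show (liftAsg (.fldDiv a b c)).cost =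
      (liftAsg (.fldDiv ⟨0, []⟩ ⟨0, []⟩ ⟨0, []⟩)).cost from rfl]
    simp only [liftCost, Polynomial.eval_add]; omega
  all_goals
    simp only [liftAsg, Stm.cost, liftCost, Polynomial.eval_add, Polynomial.eval_one]; omega

theorem liftCost_test (a : Loc) (n : ℕ) :
    (testStm a).cost.eval n + (shrinkStm a).cost.eval n + 1 ≤ liftCost.eval n := by
  rw [show (testStm a).cost = (testStm ⟨0, []⟩).cost from rfl,
    show (shrinkStm a).cost = (shrinkStm ⟨0, []⟩).cost from rfl]
  simp only [liftCost, Polynomial.eval_add, Polynomial.eval_one]; omega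

/-- The simulation by matrices is correct on a nonempty set of points. -/
theorem lift_sim (hPQ : P * Q = 1) (hQP : Q * P = 1) (p : Prog) : ∀ {S : Finset (Fin n)}
    {s : State F} {σ : Fin n → State F}, p.FieldOperationsOnly → S.Nonempty → Sim run P Q S s σ →
    ∃ S' ⊆ S, S'.Nonempty ∧
      Sim run P Q S' ((lift p).exec ρ s) (fun q => p.exec ρ (σ q)) ∧
      SimFrame run s ((lift p).exec ρ s) ∧
      ∀ q ∈ S', (lift p).time ρ s ≤ liftCost.eval n * p.time ρ (σ q) := by
  have c1 : 1 ≤ liftCost.eval n := by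
    have := liftCost_test ⟨0, []⟩ n
    omega
  have asg : ∀ {S : Finset (Fin n)} {s : State F} {σ : Fin n → State F} (p : Prog),
      S.Nonempty → Sim run P Q S s σ → (lift p = (liftAsg p).compile) →
      ((∃ a, p = .fldZero a) ∨ (∃ a, p = .fldOne a) ∨ (∃ a b c, p = .fldAdd a b c) ∨
      (∃ a b c, p = .fldSub a b c) ∨ (∃ a b c, p = .fldMul a b c) ∨ ∃ a b c, p = .fldDiv a b c) →
      (∀ s, p.time ρ s = 1) →
      ∃ S' ⊆ S, S'.Nonempty ∧ Sim run P Q S' ((lift p).exec ρ s) (fun q => p.exec ρ (σ q)) ∧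
        SimFrame run s ((lift p).exec ρ s) ∧
        ∀ q ∈ S', (lift p).time ρ s ≤ liftCost.eval n * p.time ρ (σ q) := by
    intro S s σ p hS h hl hp ht
    rw [hl]
    have := liftAsg_sim (ρ := ρ) hPQ hQP h p hp
    refine ⟨S, subset_rfl, hS, this.1, this.2, fun q _ => ?_⟩
    rw [ht, mul_one]
    exact (h.step (liftAsg_wf p)).1.trans (liftCost_asg p n)
  induction p with
  | skip =>
    intro S s σ _ hS h
    exact ⟨S, subset_rfl, hS, h, SimFrame.refl _ _, fun q _ => by
      simpa [lift, liftAsg, Stm.compile, Prog.time] using c1⟩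
  | natConst x k =>
    intro S s σ _ hS h
    exact ⟨S, subset_rfl, hS, h.putNat x k, SimFrame.refl _ _, fun q _ => by
      simpa [lift, Prog.time] using c1⟩
  | natAdd x y z =>
    intro S s σ _ hS h
    refine ⟨S, subset_rfl, hS, (h.putNat x (s.nat (y + 20) + s.nat (z + 20))).mono fun q hq => ?_,
      SimFrame.refl _ _, fun q _ => by simpa [lift, Prog.time] using c1⟩
    rw [h.nat q hq, h.nat q hq]; rfl
  | natSub x y z =>
    intro S s σ _ hS h
    refine ⟨S, subset_rfl, hS, (h.putNat x (s.nat (y + 20) - s.nat (z + 20))).mono fun q hq => ?_,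
      SimFrame.refl _ _, fun q _ => by simpa [lift, Prog.time] using c1⟩
    rw [h.nat q hq, h.nat q hq]; rfl
  | fldZero a => intro S s σ _ hS h; exact asg _ hS h rfl (by simp) fun _ => rfl
  | fldOne a => intro S s σ _ hS h; exact asg _ hS h rfl (by simp) fun _ => rfl
  | fldAdd a b c => intro S s σ _ hS h; exact asg _ hS h rfl (by simp) fun _ => rfl
  | fldSub a b c => intro S s σ _ hS h; exact asg _ hS h rfl (by simp) fun _ => rfl
  | fldMul a b c => intro S s σ _ hS h; exact asg _ hS h rfl (by simp) fun _ => rfl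
  | fldDiv a b c => intro S s σ _ hS h; exact asg _ hS h rfl (by simp) fun _ => rfl
  | root a b x => intro S s σ h; exact h.elim
  | seq p q hp hq =>
    intro S s σ hf hS h
    obtain ⟨S₁, hS₁, n₁, h₁, f₁, t₁⟩ := hp hf.1 hS h
    obtain ⟨S₂, hS₂, n₂, h₂, f₂, t₂⟩ := hq hf.2 n₁ h₁
    refine ⟨S₂, hS₂.trans hS₁, n₂, h₂, f₁.trans f₂, fun r hr => ?_⟩
    have := t₁ r (hS₂ hr)
    have := t₂ r hr
    simp only [lift, Prog.time, mul_add]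
    omega
  | ifLt x y p q hp hq =>
    intro S s σ hf hS h
    by_cases hlt : s.nat (x + 20) < s.nat (y + 20)
    · obtain ⟨S₁, hS₁, n₁, h₁, f₁, t₁⟩ := hp hf.1 hS h
      have hσ : ∀ r ∈ S, (σ r).nat x < (σ r).nat y := fun r hr => by
        rwa [← h.nat r hr, ← h.nat r hr]
      simp only [lift, Prog.exec, Prog.time, if_pos hlt]
      refine ⟨S₁, hS₁, n₁, h₁.mono fun r hr => by rw [if_pos (hσ r (hS₁ hr))], f₁, fun r hr => ?_⟩
      rw [if_pos (hσ r (hS₁ hr)), mul_add]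
      have := t₁ r hr
      omega
    · obtain ⟨S₁, hS₁, n₁, h₁, f₁, t₁⟩ := hq hf.2 hS h
      have hσ : ∀ r ∈ S, ¬ (σ r).nat x < (σ r).nat y := fun r hr => by
        rwa [← h.nat r hr, ← h.nat r hr]
      simp only [lift, Prog.exec, Prog.time, if_neg hlt]
      refine ⟨S₁, hS₁, n₁, h₁.mono fun r hr => by rw [if_neg (hσ r (hS₁ hr))], f₁, fun r hr => ?_⟩
      rw [if_neg (hσ r (hS₁ hr)), mul_add]
      have := t₁ r hr
      omega
  | ifZero a p q hp hq =>
    intro S s σ hf hS h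
    obtain ⟨h₀, f₀, hz, v, h9, hv9⟩ := test_sim (ρ := ρ) hQP h a
    have t₀ := (h.step (ρ := ρ) (testStm_wf (simLoc_ok a))).1
    have hc := liftCost_test (simLoc a) n
    set s₀ := (testStm (simLoc a)).compile.exec ρ s with hs₀
    have hget : s₀.get ⟨8, []⟩ = s₀.fld 8 [] := rfl
    -- If the cell is zero on all of `S`, all points take the first branch. Otherwise some point
    -- takes the second, and the points that would have taken the first are dropped, so that the
    -- survivors still share one path.
    by_cases h8 : s₀.fld 8 [] = 0
    · have hσ := hz.1 h8
      obtain ⟨S₁, hS₁, n₁, h₁, f₁, t₁⟩ := hp hf.1 hS h₀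
      rw [lift, Prog.exec_seq, Prog.time_seq, ← hs₀, Prog.exec, Prog.time,
        if_pos (hget.trans h8), if_pos (hget.trans h8)]
      refine ⟨S₁, hS₁, n₁, h₁.mono fun r hr => by rw [Prog.exec, if_pos (hσ r (hS₁ hr))],
        f₀.trans f₁, fun r hr => ?_⟩
      rw [Prog.time]
      rw [if_pos (hσ r (hS₁ hr)), mul_add]
      have := t₁ r hr
      omega
    · classical
      obtain ⟨h', f'⟩ := shrink_sim (ρ := ρ) hPQ hQP h₀ a h9 hv9
      have t' := (h₀.step (ρ := ρ) (shrinkStm_wf (simLoc_ok a))).1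
      have hS' : (S.filter fun p => (σ p).get a ≠ 0).Nonempty := by
        by_contra hcon
        rw [Finset.not_nonempty_iff_eq_empty, Finset.filter_eq_empty_iff] at hcon
        exact h8 (hz.2 fun p hp => not_not.1 (hcon hp))
      obtain ⟨S₁, hS₁, n₁, h₁, f₁, t₁⟩ := hq hf.2 hS' h'
      have hσ : ∀ r ∈ S₁, ¬ (σ r).get a = 0 := fun r hr => (Finset.mem_filter.1 (hS₁ hr)).2
      rw [lift, Prog.exec_seq, Prog.time_seq, ← hs₀, Prog.exec, Prog.time,
        if_neg (fun h => h8 (hget.symm.trans h)), if_neg (fun h => h8 (hget.symm.trans h)),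
        Prog.exec_seq, Prog.time_seq]
      refine ⟨S₁, hS₁.trans (Finset.filter_subset _ _), n₁, h₁.mono fun r hr => by
        rw [Prog.exec, if_neg (hσ r hr)], (f₀.trans f').trans f₁, fun r hr => ?_⟩
      rw [Prog.time, if_neg (hσ r hr), mul_add]
      have := t₁ r hr
      omega
  | loop x p hp =>
    intro S s σ hf hS h
    -- The component may shrink in every turn. The time is compared with that of the survivors only,
    -- for which the path simulated is the true one in all turns.
    have key : ∀ m, ∃ S' ⊆ S, S'.Nonempty ∧
        Sim run P Q S' (((lift p).exec ρ)^[m] s) (fun q => (p.exec ρ)^[m] (σ q)) ∧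
        SimFrame run s (((lift p).exec ρ)^[m] s) ∧
        ∀ q ∈ S', ∑ i ∈ Finset.range m, ((lift p).time ρ (((lift p).exec ρ)^[i] s) + 1) ≤
          liftCost.eval n * ∑ i ∈ Finset.range m, (p.time ρ ((p.exec ρ)^[i] (σ q)) + 1) := by
      intro m
      induction m with
      | zero => exact ⟨S, subset_rfl, hS, h, SimFrame.refl _ _, fun q _ => by simp⟩
      | succ m ih =>
        obtain ⟨S₁, hS₁, n₁, h₁, f₁, t₁⟩ := ih
        obtain ⟨S₂, hS₂, n₂, h₂, f₂, t₂⟩ := hp hf n₁ h₁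
        refine ⟨S₂, hS₂.trans hS₁, n₂, ?_, ?_, fun r hr => ?_⟩
        · simp only [Function.iterate_succ_apply']
          exact h₂
        · rw [Function.iterate_succ_apply']
          exact f₁.trans f₂
        · have := t₁ r (hS₂ hr)
          have := t₂ r hr
          rw [Finset.sum_range_succ, Finset.sum_range_succ, mul_add, mul_add]
          omega
    obtain ⟨S₁, hS₁, n₁, h₁, f₁, t₁⟩ := key (s.nat (x + 20))
    have hσ : ∀ r ∈ S₁, (σ r).nat x = s.nat (x + 20) := fun r hr => (h.nat r (hS₁ hr) x).symm
    refine ⟨S₁, hS₁, n₁, h₁.mono fun r hr => ?_, f₁, fun r hr => ?_⟩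
    · simp only [Prog.exec, hσ r hr]
    · have := t₁ r hr
      simp only [lift, Prog.time, hσ r hr, mul_add] at this ⊢
      omega

theorem lift_fieldOperationsOnly (p : Prog) (h : p.FieldOperationsOnly) :
    (lift p).FieldOperationsOnly := by
  have hT : ∀ a e, (matTab a e).NoRoot := fun _ _ => trivial
  have hM : ∀ a b c, (matMulTo a b c).NoRoot := fun _ _ _ => trivial
  have hP : ∀ c, (pinv c).NoRoot := fun c => by
    simp [pinv, Stm.NoRoot, matTab, rowReduce, eliminate, findPivot]
  have hA : ∀ p, (liftAsg p).NoRoot := fun p => by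
    cases p <;> simp [liftAsg, Stm.NoRoot, hT, hM, hP]
  have hA' := fun p => Stm.compile_fieldOperationsOnly _ (hA p)
  induction p with
  | ifZero a p q hp hq =>
    refine ⟨Stm.compile_fieldOperationsOnly _ ⟨hM _ _ _, trivial⟩, hp h.1,
      Stm.compile_fieldOperationsOnly _ ⟨hP _, hM _ _ _, hT _ _⟩, hq h.2⟩
  | seq p q hp hq => exact ⟨hp h.1, hq h.2⟩
  | ifLt x y p q hp hq => exact ⟨hp h.1, hq h.2⟩
  | loop x p hp => exact hp h
  | natConst x k => trivial
  | natAdd x y z => trivial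
  | natSub x y z => trivial
  | _ => exact hA' _

end

/-! ### Guessing eigenvalues -/

section tables

variable {F : Type*} [Field F] {ρ : Polynomial F → F}

theorem Tab.loop_of_frame {ι : Type*} {a k x : ℕ} {p : Stm} {r : ℕ → ℕ} {f : Mem F}
    {dom : ℕ → ι → Prop} {key : ℕ → ι → List ℕ} {val : ℕ → ι → F}
    (hkey : ∀ i i' j j', key i j = key i' j' → i = i')
    (hb : ∀ i < r x, ∀ g : Mem F, (∀ b, b ≠ a → g b = f b) →
      Tab a (dom i) (key i) (val i) g (p.eval ρ (Function.update r k i) g)) :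
    Tab a (fun y : ℕ × ι => y.1 < r x ∧ dom y.1 y.2) (fun y => key y.1 y.2)
      (fun y => val y.1 y.2) f ((Stm.loop k x p).eval ρ r f) :=
  Tab.loop hkey fun i hi g hg => hb i hi g fun b hb => funext fun l => hg b l fun h => absurd h hb

theorem Tab.loop₃ {a k₁ x₁ k₂ x₂ k₃ x₃ : ℕ} {p : Stm} {r : ℕ → ℕ} {f : Mem F}
    (key : ℕ → ℕ → ℕ → List ℕ) (val : ℕ → ℕ → ℕ → F)
    (hkey : ∀ i j k i' j' k', key i j k = key i' j' k' → i = i' ∧ j = j' ∧ k = k')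
    (h21 : x₂ ≠ k₁) (h31 : x₃ ≠ k₁) (h32 : x₃ ≠ k₂)
    (hb : ∀ i < r x₁, ∀ j < r x₂, ∀ k < r x₃, ∀ g : Mem F, (∀ b, b ≠ a → g b = f b) →
      p.eval ρ (Function.update (Function.update (Function.update r k₁ i) k₂ j) k₃ k) g =
        g.set a (key i j k) (val i j k)) :
    ∃ g, (Stm.loop k₁ x₁ (.loop k₂ x₂ (.loop k₃ x₃ p))).eval ρ r f = g ∧
      (∀ i < r x₁, ∀ j < r x₂, ∀ k < r x₃, g a (key i j k) = val i j k) ∧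
      ∀ b l, (b = a → ∀ i < r x₁, ∀ j < r x₂, ∀ k < r x₃, l ≠ key i j k) →
        g b l = f b l := by
  have T : Tab a (fun y : ℕ × ℕ × ℕ × Unit => y.1 < r x₁ ∧ y.2.1 < r x₂ ∧ y.2.2.1 < r x₃ ∧ True)
      (fun y => key y.1 y.2.1 y.2.2.1) (fun y => val y.1 y.2.1 y.2.2.1) f
      ((Stm.loop k₁ x₁ (.loop k₂ x₂ (.loop k₃ x₃ p))).eval ρ r f) := by
    refine Tab.loop_of_frame (dom := fun i (y : ℕ × ℕ × Unit) => y.1 < r x₂ ∧ y.2.1 < r x₃ ∧ True)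
      (key := fun i y => key i y.1 y.2.1) (val := fun i y => val i y.1 y.2.1)
      (fun i i' y y' h => (hkey _ _ _ _ _ _ h).1) fun i hi g hg => ?_
    have e2 : Function.update r k₁ i x₂ = r x₂ := Function.update_of_ne h21 _ _
    have T := Tab.loop_of_frame (ρ := ρ) (a := a) (k := k₂) (x := x₂)
      (p := .loop k₃ x₃ p) (r := Function.update r k₁ i) (f := g)
      (dom := fun j (y : ℕ × Unit) => y.1 < r x₃ ∧ True)
      (key := fun j y => key i j y.1) (val := fun j y => val i j y.1)
      (fun j j' y y' h => (hkey _ _ _ _ _ _ h).2.1) fun j hj g' hg' => ?_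
    · rw [e2] at T
      exact T
    have e3 : Function.update (Function.update r k₁ i) k₂ j x₃ = r x₃ := by
      rw [Function.update_of_ne h32, Function.update_of_ne h31]
    have T := Tab.loop_of_frame (ρ := ρ) (a := a) (k := k₃) (x := x₃) (p := p)
      (r := Function.update (Function.update r k₁ i) k₂ j) (f := g')
      (dom := fun j (y : Unit) => True) (key := fun k y => key i j k) (val := fun k y => val i j k)
      (fun k k' y y' h => (hkey _ _ _ _ _ _ h).2.2) fun k hk g'' hg'' => ?_
    · rw [e3] at T
      exact T
    rw [e2] at hj
    rw [e3] at hk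
    rw [hb i hi j hj k hk g'' fun b hb => by rw [hg'' b hb, hg' b hb, hg b hb]]
    exact Tab.set _ _ _ _
  exact ⟨_, rfl, fun i hi j hj k hk => T.1 (i, j, k, ()) ⟨hi, hj, hk, trivial⟩,
    fun b l h => T.2 b l fun hb y hy => h hb _ hy.1 _ hy.2.1 _ hy.2.2.1⟩

end tables

/-- Whether the matrix in array `6` is nonzero. -/
def remTest : Stm := .asg ⟨8, []⟩ (.any 4 0 (.any 5 0 (.cell ⟨6, [4, 5]⟩)))

/-- Write the input cells as scalar matrices for the run in register `2`, except that one cell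
becomes the matrix number `m` of the input; the current component is what remains. -/
def load (J m jg rg : ℕ) : Stm :=
  .letConst 18 J (.seq
    (.loop 6 18 (.loop 7 0 (.loop 8 0 (.loop 4 0 (.loop 5 0
      (.asg ⟨30, [2, 6, 7, 8, 4, 5]⟩ (.ifz (.delta 4 5) .zero (.cell ⟨0, [6, 7, 8]⟩))))))))
  (.letConst 16 jg (.letConst 17 rg (.letConst 15 0 (.letConst 14 m
    (.seq (matTab ⟨30, [2, 16, 17, 15]⟩ (.cell ⟨0, [14, 4, 5]⟩))
      (matTab ⟨5, []⟩ (.cell ⟨6, [4, 5]⟩))))))))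

/-- Everything remains, and nothing has been found. -/
def guessInit : Stm := .seq (matTab ⟨6, []⟩ (.delta 4 5)) (.asg ⟨7, []⟩ .zero)

/-- The current component does not remain. -/
def remUpdate : Stm :=
  matTab ⟨6, []⟩ (.sub (.cell ⟨6, [4, 5]⟩) (.cell ⟨5, [4, 5]⟩))

/-- Run the program on what remains. -/
def guessRun (J m jg rg : ℕ) (P : Prog) : Prog :=
  .seq remTest.compile (.ifZero ⟨8, []⟩ .skip
    -- Register `20` is register `0` of the simulated program and has to hold n; it is copied by
    -- adding the zero in register `19`.
    (.seq (load J m jg rg).compile (.seq (.natConst 19 0) (.seq (.natAdd 20 0 19) (.seq (lift P)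
      (.seq (.natConst 19 0) (.seq (.ifLt 19 20 (.fldOne ⟨7, []⟩) .skip) remUpdate.compile)))))))

/-- Decide whether the program accepts for some eigenvalue of the matrix number `m` of the input in
the cell `[jg, rg, 0]`. -/
def exGuess (J m jg rg : ℕ) (P : Prog) : Prog :=
  .seq guessInit.compile (.seq (forP 2 0 (guessRun J m jg rg P))
    (.ifZero ⟨7, []⟩ (.natConst 0 0) (.natConst 0 1)))

/-- A bound for the running time of `exGuess`. -/
noncomputable def exGuessCost (J m jg rg : ℕ) (T : Polynomial ℕ) : Polynomial ℕ :=
  guessInit.cost + Polynomial.X * (remTest.cost + (load J m jg rg).cost + liftCost * T +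
    remUpdate.cost + 9) + 4

/-! ### Correctness of the guess of one eigenvalue. -/

section

variable {F : Type*} [Field F] {ρ : Polynomial F → F} {n J : ℕ}

/-- The contents of the input cells. -/
abbrev Cells (F : Type*) := ℕ → ℕ → ℕ → F

/-- Change a cell in column `0`. -/
def Cells.set (c : Cells F) (jg rg : ℕ) (v : F) : Cells F :=
  fun j r k => if j = jg ∧ r = rg ∧ k = 0 then v else c j r k

/-- A matrix of the input. -/
def Cells.mat (n : ℕ) (c : Cells F) (m : ℕ) : Matrix (Fin n) (Fin n) F :=
  Matrix.of fun i j => c m i j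

/-- The state shows the input cells. -/
structure Start (n J : ℕ) (c : Cells F) (s : State F) : Prop where
  size : s.nat 0 = n
  cells : ∀ j < J, ∀ r < n, ∀ k < n, s.fld 0 [j, r, k] = c j r k
  clean : ∀ b, 30 ≤ b → ∀ l, s.fld b l = 0

/-- Register `0` answers whether `φ` holds. -/
def Answers (φ : Prop) (s : State F) : Prop := (s.nat 0 = 1 ∧ φ) ∨ (s.nat 0 = 0 ∧ ¬ φ)

variable {P Q : Matrix (Fin n) (Fin n) F}

theorem remTest_wf : remTest.WF simRegs {0} := by
  simp [remTest, Stm.WF, Ex.WF, simRegs]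

theorem guessInit_wf : guessInit.WF simRegs {0} := by
  simp [guessInit, matTab, Stm.WF, Ex.WF, simRegs, Loc.entry]

theorem remUpdate_wf : remUpdate.WF simRegs {0} := by
  simp [remUpdate, matTab, Stm.WF, Ex.WF, simRegs, Loc.entry]

theorem load_wf (J m jg rg : ℕ) : (load J m jg rg).WF simRegs {0} := by
  simp [load, matTab, Stm.WF, Ex.WF, simRegs, Loc.entry]

/-- An ordinary input cell becomes a scalar matrix, that is, the same value at every point. The
guessed cell becomes the input matrix itself, that is, the value `x p` at the point `p`. Thus every
point simulates the run with its own eigenvalue. Cells that are not loaded are still zero, since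
each run has a first index of its own. -/
theorem load_eval {m jg rg : ℕ} {r : ℕ → ℕ} {f : Mem F} {run : ℕ} {c : Cells F} {x : Fin n → F}
    (hPQ : P * Q = 1) (hn : r 0 = n) (hr : r 2 = run) (hm : m < J)
    (hc : ∀ j < J, ∀ r < n, ∀ k < n, f 0 [j, r, k] = c j r k) (hx : c.mat n m = dg P Q x)
    (hclean : ∀ b, 30 ≤ b → ∀ l : List ℕ, l.head? = some run → f b l = 0) :
    ∃ g, (load J m jg rg).eval ρ r f = g ∧
      (∀ a l, ∃ v, mat n g (a + 30) (run :: l) = dg P Q v ∧ (a ≠ 0 → v = 0) ∧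
        ∀ j < J, ∀ r < n, ∀ k < n, a = 0 → l = [j, r, k] → ∀ p, v p = c.set jg rg (x p) j r k) ∧
      mat n g 5 [] = mat n f 6 [] ∧
      (∀ b, b ≠ 5 → b < 30 → g b = f b) ∧
      ∀ b, 30 ≤ b → ∀ l : List ℕ, l.head? ≠ some run → g b l = f b l := by
  set r₁ := Function.update r 18 J with hr₁
  have T : Tab 30 (fun y : ℕ × ℕ × ℕ × ℕ × ℕ × Unit => y.1 < J ∧ y.2.1 < n ∧ y.2.2.1 < n ∧
      y.2.2.2.1 < n ∧ y.2.2.2.2.1 < n ∧ True)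
      (fun y => [run, y.1, y.2.1, y.2.2.1, y.2.2.2.1, y.2.2.2.2.1])
      (fun y => if y.2.2.2.1 = y.2.2.2.2.1 then f 0 [y.1, y.2.1, y.2.2.1] else 0) f
      ((Stm.loop 6 18 (.loop 7 0 (.loop 8 0 (.loop 4 0 (.loop 5 0
      (.asg ⟨30, [2, 6, 7, 8, 4, 5]⟩ (.ifz (.delta 4 5) .zero (.cell ⟨0, [6, 7, 8]⟩)))))))).eval
      ρ r₁ f) := by
    have h18 : r₁ 18 = J := by simp [hr₁]
    have h0 : r₁ 0 = n := by simp [hr₁, hn]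
    have h2 : r₁ 2 = run := by simp [hr₁, hr]
    have T₁ := Tab.loop_of_frame (ρ := ρ) (a := 30) (k := 6) (x := 18) (f := f) (r := r₁)
      (p := .loop 7 0 (.loop 8 0 (.loop 4 0 (.loop 5 0
        (.asg ⟨30, [2, 6, 7, 8, 4, 5]⟩ (.ifz (.delta 4 5) .zero (.cell ⟨0, [6, 7, 8]⟩)))))))
      (dom := fun _ (y : ℕ × ℕ × ℕ × ℕ × Unit) => y.1 < n ∧ y.2.1 < n ∧ y.2.2.1 < n ∧
        y.2.2.2.1 < n ∧ True)
      (key := fun j y => [run, j, y.1, y.2.1, y.2.2.1, y.2.2.2.1])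
      (val := fun j y => if y.2.2.1 = y.2.2.2.1 then f 0 [j, y.1, y.2.1] else 0)
      (by intro i i' j j' h; simp at h; exact h.1) ?_
    · rw [h18] at T₁
      exact T₁
    intro j hj g hg
    have T₁ := Tab.loop_of_frame (ρ := ρ) (a := 30) (k := 7) (x := 0) (f := g)
      (r := Function.update r₁ 6 j)
      (p := .loop 8 0 (.loop 4 0 (.loop 5 0
        (.asg ⟨30, [2, 6, 7, 8, 4, 5]⟩ (.ifz (.delta 4 5) .zero (.cell ⟨0, [6, 7, 8]⟩))))))
      (dom := fun _ (y : ℕ × ℕ × ℕ × Unit) => y.1 < n ∧ y.2.1 < n ∧ y.2.2.1 < n ∧ True)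
      (key := fun r y => [run, j, r, y.1, y.2.1, y.2.2.1])
      (val := fun r y => if y.2.1 = y.2.2.1 then f 0 [j, r, y.1] else 0)
      (by intro i i' j j' h; simp at h; exact h.1) ?_
    · rw [show Function.update r₁ 6 j 0 = n by simp [h0]] at T₁
      exact T₁
    intro k₁ hk₁ g₁ hg₁
    have T₁ := Tab.loop_of_frame (ρ := ρ) (a := 30) (k := 8) (x := 0) (f := g₁)
      (r := Function.update (Function.update r₁ 6 j) 7 k₁)
      (p := .loop 4 0 (.loop 5 0
        (.asg ⟨30, [2, 6, 7, 8, 4, 5]⟩ (.ifz (.delta 4 5) .zero (.cell ⟨0, [6, 7, 8]⟩)))))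
      (dom := fun _ (y : ℕ × ℕ × Unit) => y.1 < n ∧ y.2.1 < n ∧ True)
      (key := fun r y => [run, j, k₁, r, y.1, y.2.1])
      (val := fun r y => if y.1 = y.2.1 then f 0 [j, k₁, r] else 0)
      (by intro i i' j j' h; simp at h; exact h.1) ?_
    · rw [show Function.update (Function.update r₁ 6 j) 7 k₁ 0 = n by simp [h0]] at T₁
      exact T₁
    intro k₂ hk₂ g₂ hg₂
    have T₁ := Tab.loop₂ (ρ := ρ) (a := 30) (k := 4) (x := 0) (k' := 5) (x' := 0) (f := g₂)
      (r := Function.update (Function.update (Function.update r₁ 6 j) 7 k₁) 8 k₂)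
      (p := .asg ⟨30, [2, 6, 7, 8, 4, 5]⟩ (.ifz (.delta 4 5) .zero (.cell ⟨0, [6, 7, 8]⟩)))
      (fun a b => [run, j, k₁, k₂, a, b]) (fun a b => if a = b then f 0 [j, k₁, k₂] else 0)
      (by simp) (by norm_num) ?_
    · rw [show Function.update (Function.update (Function.update r₁ 6 j) 7 k₁) 8 k₂ 0 = n by
        simp [h0]] at T₁
      exact ⟨fun y hy => T₁.1 _ hy.1 _ hy.2.1, fun b l h => T₁.2 b l fun hb i hi i' hi' =>
        h hb (i, i', ()) ⟨hi, hi', trivial⟩⟩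
    intro a _ b _ g₃ hg₃ _
    simp only [Stm.eval, Ex.eval, List.map_cons, List.map_nil, Function.update_apply,
      Nat.reduceEqDiff, reduceIte, h2, hg₃ 0 (by norm_num), hg₂ 0 (by norm_num),
      hg₁ 0 (by norm_num), hg 0 (by norm_num)]
    congr 1
    by_cases hab : a = b <;> simp [hab]
  set g₁ := (Stm.loop 6 18 (.loop 7 0 (.loop 8 0 (.loop 4 0 (.loop 5 0
      (.asg ⟨30, [2, 6, 7, 8, 4, 5]⟩ (.ifz (.delta 4 5) .zero (.cell ⟨0, [6, 7, 8]⟩)))))))).eval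
      ρ r₁ f with e₁
  set r₂ := Function.update (Function.update (Function.update (Function.update r₁ 16 jg) 17 rg)
    15 0) 14 m with hr₂
  have i0 : r₂ 0 = n := by simp [hr₂, hr₁, hn]
  have i2 : r₂ 2 = run := by simp [hr₂, hr₁, hr]
  have i14 : r₂ 14 = m := by simp [hr₂]
  have i15 : r₂ 15 = 0 := by simp [hr₂]
  have i16 : r₂ 16 = jg := by simp [hr₂]
  have i17 : r₂ 17 = rg := by simp [hr₂]
  have g₁0 : ∀ b, b ≠ 30 → g₁ b = f b := fun b hb => T.arr hb
  clear_value r₂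
  obtain ⟨g₂, e₂, hm₂, hf₂⟩ := matTab_eval (ρ := ρ) (a := ⟨30, [2, 16, 17, 15]⟩)
    (e := .cell ⟨0, [14, 4, 5]⟩) (g := g₁) i0 (by simp) (by simp) (dg P Q x) (by
      intro i j g' hg _
      simp only [Ex.eval, List.map_cons, List.map_nil, Function.update_apply,
        Nat.reduceEqDiff, reduceIte, i14, hg 0 (by norm_num), g₁0 0 (by norm_num)]
      rw [hc m hm i i.2 j j.2, ← hx]
      rfl)
  simp only [List.map_cons, List.map_nil, i2, i15, i16, i17] at hm₂ hf₂
  obtain ⟨g₃, e₃, hm₃, hf₃⟩ := matCopy_eval (ρ := ρ) (a := ⟨5, []⟩) (d := 6) (g := g₂) i0 (by simp)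
    (by simp)
  simp only [List.map_nil] at hm₃
  have hg₃ : ∀ b, b ≠ 5 → g₃ b = g₂ b := fun b hb => funext fun l => hf₃ b l fun h => absurd h hb
  have hg₂ : ∀ b, b ≠ 30 → g₂ b = g₁ b := fun b hb => funext fun l => hf₂ b l fun h => absurd h hb
  refine ⟨g₃, ?_, fun a l => ?_, ?_, fun b hb hb' => ?_, fun b hb l hl => ?_⟩
  · rw [load, Stm.eval_letConst, ← hr₁, Stm.eval_seq, ← e₁, Stm.eval_letConst, Stm.eval_letConst,
      Stm.eval_letConst, Stm.eval_letConst, ← hr₂, Stm.eval_seq, e₂, e₃]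
  · have hgl : mat n g₃ (a + 30) (run :: l) = mat n g₂ (a + 30) (run :: l) := by
      simp only [mat, hg₃ (a + 30) (by omega)]
    rw [hgl]
    by_cases ha : a = 0
    · subst ha
      by_cases hl : l = [jg, rg, 0]
      · subst hl
        refine ⟨x, hm₂, by simp, ?_⟩
        intro j _ r _ k _ _ hl p
        simp only [List.cons.injEq, and_true] at hl
        simp [Cells.set, ← hl.1, ← hl.2.1, ← hl.2.2]
      · have hgl' : mat n g₂ (0 + 30) (run :: l) = mat n g₁ 30 (run :: l) := by
          ext i j
          simp only [mat, of_apply]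
          refine hf₂ 30 _ fun _ i' j' h => hl ?_
          have : run :: l ++ [(i : ℕ), (j : ℕ)] = [run, jg, rg, 0] ++ [i', j'] := h
          rw [append_pair_inj] at this
          simpa using this.1
        rw [hgl']
        by_cases hin : ∃ j < J, ∃ r < n, ∃ k < n, l = [j, r, k]
        · obtain ⟨j, hj, r, hr, k, hk, rfl⟩ := hin
          refine ⟨fun _ => c j r k, ?_, by simp, ?_⟩
          · rw [dg_const hPQ, ← hc j hj r hr k hk]
            ext i i'
            simp only [mat, of_apply]
            have := T.1 (j, r, k, i, i', ()) ⟨hj, hr, hk, i.2, i'.2, trivial⟩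
            simp only at this
            simp only [List.cons_append, List.nil_append, this, Matrix.smul_apply, one_apply, Fin.ext_iff,
              smul_eq_mul, mul_ite, mul_one, mul_zero]
          · intro j' _ r' _ k' _ _ h p
            simp only [List.cons.injEq, and_true] at h
            obtain ⟨rfl, rfl, rfl⟩ := h
            rw [Cells.set, if_neg]
            rintro ⟨rfl, rfl, rfl⟩
            exact hl rfl
        · refine ⟨0, ?_, fun _ => rfl, fun j hj r hr k hk _ hl => ?_⟩
          · rw [dg_zero]
            ext i i'
            simp only [mat, of_apply, Matrix.zero_apply]
            rw [T.2 30 _ fun _ y hy h => hin ?_]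
            · exact hclean 30 le_rfl _ (by simp)
            · refine ⟨y.1, hy.1, y.2.1, hy.2.1, y.2.2.1, hy.2.2.1, ?_⟩
              have : run :: l ++ [(i : ℕ), (i' : ℕ)] = [run, y.1, y.2.1, y.2.2.1] ++
                [y.2.2.2.1, y.2.2.2.2.1] := h
              rw [append_pair_inj] at this
              simpa using this.1
          · exact absurd ⟨j, hj, r, hr, k, hk, hl⟩ hin
    · refine ⟨0, ?_, fun _ => rfl, fun _ _ _ _ _ _ h => absurd h ha⟩
      rw [dg_zero]
      ext i i'
      simp only [mat, of_apply, Matrix.zero_apply]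
      rw [hg₂ _ (by omega), g₁0 _ (by omega)]
      exact hclean _ (by omega) _ (by simp)
  · rw [hm₃]
    simp only [mat, hg₂ 6 (by norm_num), g₁0 6 (by norm_num)]
  · rw [hg₃ b hb, hg₂ b (by omega), g₁0 b (by omega)]
  · rw [hg₃ b (by omega), hf₂ b l fun _ i j h => hl (by simp [h]),
      T.2 b l fun _ y _ h => hl (by simp [h])]

open Classical in
/-- What holds between the runs: what remains is `R`, the cells of the runs from `k` on are
clean, and it is known whether a point outside of `R` satisfies `φ`. -/
structure GuessInv (P Q : Matrix (Fin n) (Fin n) F) (f₀ : List ℕ → F) (φ : Fin n → Prop)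
    (R : Finset (Fin n)) (i k : ℕ) (s : State F) : Prop where
  size : s.nat 0 = n
  runNo : s.nat 2 = i
  inp : s.fld 0 = f₀
  rem : mat n s.fld 6 [] = dg P Q fun p => if p ∈ R then 1 else 0
  clean : ∀ b, 30 ≤ b → ∀ l : List ℕ, (∀ j < k, l.head? ≠ some j) → s.fld b l = 0
  found : (s.fld 7 [] = 0 ∧ ∀ p, φ p → p ∈ R) ∨ (s.fld 7 [] ≠ 0 ∧ ∃ p, φ p)

theorem remTest_eval {r : ℕ → ℕ} {f : Mem F} (hn : r 0 = n) :
    (remTest.eval ρ r f) 8 [] = 0 ↔ mat n f 6 [] = 0 := by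
  rw [remTest, Stm.eval, List.map_nil, Mem.set_same]
  simp only [Ex.eval_any_eq_zero]
  simp only [Ex.eval, List.map_cons, List.map_nil, Function.update_apply, Nat.reduceEqDiff,
      reduceIte, OfNat.zero_ne_ofNat, hn]
  constructor
  · intro h
    ext i j
    exact h i i.2 j j.2
  · intro h i hi j hj
    exact congrFun (congrFun h ⟨i, hi⟩) ⟨j, hj⟩

theorem simRegs_zero : 0 ∈ simRegs := by simp [simRegs]

/-- One run settles all the points that survive it: they have a common answer, and they form a
nonempty set, which is then taken out of what remains. If nothing remains, the run is skipped. -/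
theorem guessRun_step {m jg rg : ℕ} {p : Prog} {T : Polynomial ℕ} {c : Cells F} {x : Fin n → F}
    {f₀ : List ℕ → F} {φ : Fin n → Prop} {R : Finset (Fin n)} {i : ℕ} {s : State F}
    (hPQ : P * Q = 1) (hQP : Q * P = 1) (hm : m < J) (hp : p.FieldOperationsOnly)
    (hc : ∀ j < J, ∀ r < n, ∀ k < n, f₀ [j, r, k] = c j r k) (hx : c.mat n m = dg P Q x)
    (hrun : ∀ q s, Start n J (c.set jg rg (x q)) s →
      p.time ρ s ≤ T.eval n ∧ Answers (φ q) (p.exec ρ s))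
    (h : GuessInv P Q f₀ φ R i i s) :
    (guessRun J m jg rg p).time ρ s ≤ (remTest.cost + (load J m jg rg).cost + liftCost * T +
      remUpdate.cost + 6 : Polynomial ℕ).eval n ∧
    ∃ R' : Finset (Fin n), (R' = ∅ ∨ R'.card < R.card) ∧
      GuessInv P Q f₀ φ R' i (i + 1) ((guessRun J m jg rg p).exec ρ s) := by
  classical
  obtain ⟨t₁, n₁, f₁⟩ := Stm.step (ρ := ρ) (n := n) remTest_wf simRegs_zero (by simp [simRegs])
    (by rintro y rfl; exact h.size.le)
  have hb : ∀ b, b ≠ 3 → b ≠ 8 → (remTest.compile.exec ρ s).fld b = s.fld b := fun b h3 h8 => by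
    rw [f₁ b h3, remTest, Stm.eval, Mem.set_arr _ h8]
  have h8 : (remTest.compile.exec ρ s).fld 8 [] = 0 ↔ R = ∅ := by
    rw [f₁ 8 (by norm_num), remTest_eval h.size, h.rem, ← dg_zero (P := P) (Q := Q)]
    constructor
    · intro h0
      have := dg_injective hQP h0
      ext q
      have := congrFun this q
      simpa using this
    · rintro rfl
      congr 1
  simp only [Polynomial.eval_add, Polynomial.eval_mul, Polynomial.eval_ofNat]
  set s₁ := remTest.compile.exec ρ s with hs₁
  rw [guessRun, Prog.exec_seq, Prog.time_seq, ← hs₁, Prog.exec, Prog.time]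
  have hget : s₁.get ⟨8, []⟩ = s₁.fld 8 [] := rfl
  by_cases h0 : s₁.fld 8 [] = 0
  · rw [if_pos (hget.trans h0), if_pos (hget.trans h0)]
    simp only [Prog.time, Prog.exec]
    refine ⟨by omega, R, Or.inl (h8.1 h0), ?_, ?_, ?_, ?_, ?_, ?_⟩
    · rw [n₁ 0 (by simp [simRegs]), h.size]
    · rw [n₁ 2 (by simp [simRegs]), h.runNo]
    · rw [hb 0 (by norm_num) (by norm_num), h.inp]
    · simp only [mat, hb 6 (by norm_num) (by norm_num)]
      exact h.rem
    · intro b hb' l hl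
      rw [hb b (by omega) (by omega)]
      exact h.clean b hb' l fun j hj => hl j (by omega)
    · rw [hb 7 (by norm_num) (by norm_num)]
      exact h.found
  rw [if_neg (fun h => h0 (hget.symm.trans h)), if_neg (fun h => h0 (hget.symm.trans h)),
    Prog.exec_seq, Prog.time_seq]
  have hR : R.Nonempty := Finset.nonempty_iff_ne_empty.2 fun h => h0 (h8.2 h)
  have i0 : s₁.nat 0 = n := by rw [n₁ 0 (by simp [simRegs]), h.size]
  have i2 : s₁.nat 2 = i := by rw [n₁ 2 (by simp [simRegs]), h.runNo]
  obtain ⟨t₂, n₂, f₂⟩ := Stm.step (ρ := ρ) (n := n) (load_wf J m jg rg) simRegs_zero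
    (by simp [simRegs]) (s := s₁) (by rintro y rfl; exact i0.le)
  obtain ⟨g, eg, hv, hE, hg, hg'⟩ := load_eval (ρ := ρ) (jg := jg) (rg := rg) (f := s₁.fld) hPQ i0
    i2 hm (by
      intro j hj r hr k hk
      rw [hb 0 (by norm_num) (by norm_num), h.inp]
      exact hc j hj r hr k hk) hx (by
      intro b hb' l hl
      rw [hb b (by omega) (by omega)]
      exact h.clean b hb' l fun j hj => by rw [hl]; simp; omega)
  rw [eg] at f₂
  choose v hv1 hv2 hv3 using hv
  set s₂ := (load J m jg rg).compile.exec ρ s₁ with hs₂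
  rw [Prog.exec_seq, Prog.time_seq, Prog.exec_seq, Prog.time_seq, Prog.exec_seq, Prog.time_seq]
  set s₃ := (Prog.natAdd 20 0 19).exec ρ ((Prog.natConst 19 0).exec ρ s₂) with hs₃
  have s₃f : s₃.fld = s₂.fld := rfl
  have s₃0 : s₃.nat 0 = n := by
    rw [← i0, ← n₂ 0 (by simp [simRegs])]
    simp [hs₃, Prog.exec]
  have s₃2 : s₃.nat 2 = i := by
    rw [← i2, ← n₂ 2 (by simp [simRegs])]
    simp [hs₃, Prog.exec]
  have s₃20 : s₃.nat 20 = n := by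
    rw [← i0, ← n₂ 0 (by simp [simRegs])]
    simp [hs₃, Prog.exec]
  clear_value s₃
  set σ : Fin n → State F := fun q => ⟨fun y => s₃.nat (y + 20), fun a l => v a l q⟩ with hσ
  have hSim : Sim i P Q R s₃ σ := by
    refine ⟨s₃0, s₃2, fun _ _ _ => rfl, fun a l => ⟨v a l, ?_, fun _ _ => rfl⟩, ?_⟩
    · rw [← hv1 a l, s₃f]
      simp only [mat, f₂ (a + 30) (by omega)]
    · rw [s₃f]
      have : mat n s₂.fld 5 [] = mat n g 5 [] := by simp only [mat, f₂ 5 (by norm_num)]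
      rw [this, hE]
      simp only [mat, hb 6 (by norm_num) (by norm_num)]
      exact h.rem
  -- `Start` fixes only the size, the input cells and the zeros in the arrays from `30` on. Other
  -- simulated registers may contain leftovers of previous runs, and the simulated program must be
  -- correct for any such contents.
  have hStart : ∀ q, Start n J (c.set jg rg (x q)) (σ q) := fun q =>
    ⟨s₃20, fun j hj r hr k hk => hv3 0 _ j hj r hr k hk rfl rfl q,
      fun b hb' l => by
        have := congrFun (hv2 b l (by omega)) q
        simpa using this⟩
  obtain ⟨S', hS', ne', hSim', hfr, ht⟩ := lift_sim (ρ := ρ) hPQ hQP p hp hR hSim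
  obtain ⟨q₀, hq₀⟩ := ne'
  have t₃ := (ht q₀ hq₀).trans (Nat.mul_le_mul_left _ (hrun q₀ _ (hStart q₀)).1)
  set s₄ := (lift p).exec ρ s₃ with hs₄
  rw [Prog.exec_seq, Prog.time_seq, Prog.exec_seq, Prog.time_seq]
  set s₅ := (Prog.natConst 19 0).exec ρ s₄ with hs₅
  have s₅f : s₅.fld = s₄.fld := rfl
  have s₅n : ∀ y, y ≠ 19 → s₅.nat y = s₄.nat y := fun y hy => by simp [hs₅, Prog.exec, hy]
  have s₅19 : s₅.nat 19 = 0 := by simp [hs₅, Prog.exec]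
  clear_value s₅
  have hans : ∀ q ∈ S', s₄.nat 20 = (p.exec ρ (σ q)).nat 0 := fun q hq => hSim'.nat q hq 0
  set s₆ := (Prog.ifLt 19 20 (.fldOne ⟨7, []⟩) .skip).exec ρ s₅ with hs₆
  have t₆ : (Prog.ifLt 19 20 (.fldOne ⟨7, []⟩) .skip).time ρ s₅ ≤ 2 := by
    simp only [Prog.time]; split_ifs <;> rfl
  have s₆n : s₆.nat = s₅.nat := by
    simp only [hs₆, Prog.exec]; split_ifs <;> rfl
  have s₆f : ∀ b, b ≠ 7 → s₆.fld b = s₅.fld b := fun b hb => by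
    simp only [hs₆, Prog.exec]
    split_ifs
    · rw [State.put_fld, Mem.set_arr _ hb]
    · rfl
  -- The one answer register speaks for all of `S'`: an acceptance gives a witness, and a rejection
  -- excludes every point of `S'`.
  have s₆7 : (s₆.fld 7 [] = s₅.fld 7 [] ∧ ∀ q ∈ S', ¬ φ q) ∨ (s₆.fld 7 [] = 1 ∧ φ q₀) := by
    simp only [hs₆, Prog.exec]
    rw [s₅19, s₅n 20 (by norm_num)]
    rcases (hrun q₀ _ (hStart q₀)).2 with ⟨ha, hb⟩ | ⟨ha, hb⟩
    · rw [← hans q₀ hq₀] at ha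
      right
      rw [if_pos (by omega), State.put_fld, List.map_nil, Mem.set_same]
      exact ⟨rfl, hb⟩
    · rw [← hans q₀ hq₀] at ha
      left
      rw [if_neg (by omega)]
      refine ⟨rfl, fun q hq hφ => ?_⟩
      rcases (hrun q _ (hStart q)).2 with ⟨ha', hb'⟩ | ⟨ha', hb'⟩
      · rw [← hans q hq] at ha'
        omega
      · exact hb' hφ
  clear_value s₆
  have s₆0 : s₆.nat 0 = n := by rw [s₆n, s₅n 0 (by norm_num), hSim'.size]
  have s₆2 : s₆.nat 2 = i := by rw [s₆n, s₅n 2 (by norm_num), hSim'.runNo]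
  obtain ⟨t₇, n₇, f₇⟩ := Stm.step (ρ := ρ) (n := n) remUpdate_wf simRegs_zero (by simp [simRegs])
    (s := s₆) (by rintro y rfl; exact s₆0.le)
  obtain ⟨g₇, e₇, m₇, r₇⟩ := matTab_eval (ρ := ρ) (a := ⟨6, []⟩) (r := s₆.nat)
    (e := .sub (.cell ⟨6, [4, 5]⟩) (.cell ⟨5, [4, 5]⟩)) (g := s₆.fld) s₆0 (by simp) (by simp)
    (mat n s₆.fld 6 [] - mat n s₆.fld 5 []) (by
      intro i j g' hg hg'
      simp only [Ex.eval, List.map_cons, List.map_nil, Function.update_apply,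
        Nat.reduceEqDiff, reduceIte, hg 5 (by norm_num)]
      have := hg' 6 []
      rw [List.nil_append] at this
      rw [this]
      rfl)
  rw [remUpdate, e₇] at f₇
  simp only [List.map_nil] at m₇
  have r₇' : ∀ b, b ≠ 6 → g₇ b = s₆.fld b := fun b hb => funext fun l => r₇ b l fun h => absurd h hb
  have f06 : ∀ b, b = 0 ∨ b = 6 ∨ b = 7 → s₄.fld b = s.fld b := fun b hb' => by
    rw [hfr.1 b hb', s₃f, f₂ b (by omega), hg b (by omega) (by omega), hb b (by omega) (by omega)]
  refine ⟨?_, R \ S', Or.inr (Finset.card_lt_card ?_), ?_, ?_, ?_, ?_, ?_, ?_⟩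
  · simp only [Prog.time] at t₆ ⊢
    have e1 : (remUpdate.compile).time ρ s₆ ≤ remUpdate.cost.eval n := t₇
    omega
  · exact Finset.sdiff_ssubset hS' ⟨q₀, hq₀⟩
  · rw [n₇ 0 (by simp [simRegs]), s₆0]
  · rw [n₇ 2 (by simp [simRegs]), s₆2]
  · rw [remUpdate, f₇ 0 (by norm_num), r₇' 0 (by norm_num), s₆f 0 (by norm_num), s₅f,
      f06 0 (by norm_num), h.inp]
  · have e1 : mat n (remUpdate.compile.exec ρ s₆).fld 6 [] = mat n g₇ 6 [] := by
      simp only [mat, remUpdate, f₇ 6 (by norm_num)]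
    have e2 : mat n s₆.fld 6 [] = mat n s.fld 6 [] := by
      simp only [mat, s₆f 6 (by norm_num), s₅f, f06 6 (by norm_num)]
    have e3 : mat n s₆.fld 5 [] = mat n s₄.fld 5 [] := by
      simp only [mat, s₆f 5 (by norm_num), s₅f]
    rw [e1, m₇, e2, e3, h.rem, hSim'.idem, dg_sub]
    congr 1
    funext q
    simp only [Pi.sub_apply, Finset.mem_sdiff]
    by_cases hq : q ∈ S'
    · simp [hq, hS' hq]
    · simp [hq]
  · intro b hb' l hl
    rw [remUpdate, f₇ b (by omega), r₇' b (by omega), s₆f b (by omega), s₅f,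
      hfr.2 b hb' l (hl i (by omega)), s₃f, f₂ b (by omega), hg' b hb' l (hl i (by omega)),
      hb b (by omega) (by omega)]
    exact h.clean b hb' l fun j hj => hl j (by omega)
  · rw [remUpdate, f₇ 7 (by norm_num), r₇' 7 (by norm_num)]
    rw [s₅f, f06 7 (by norm_num)] at s₆7
    rcases s₆7 with ⟨ha, hb'⟩ | ⟨ha, hb'⟩
    · rw [ha]
      refine h.found.imp (fun hf => ⟨hf.1, fun q hq => ?_⟩) id
      exact Finset.mem_sdiff.2 ⟨hf.2 q hq, fun hq' => hb' q hq' hq⟩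
    · rw [ha]
      exact Or.inr ⟨one_ne_zero, q₀, hb'⟩

/-- The guessing program is correct. -/
theorem exGuess_correct {m jg rg : ℕ} {p : Prog} {T : Polynomial ℕ} {c : Cells F} {x : Fin n → F}
    {φ : Fin n → Prop} {s : State F}
    (hPQ : P * Q = 1) (hQP : Q * P = 1) (hm : m < J) (hp : p.FieldOperationsOnly)
    (hx : c.mat n m = dg P Q x)
    (hrun : ∀ q s, Start n J (c.set jg rg (x q)) s →
      p.time ρ s ≤ T.eval n ∧ Answers (φ q) (p.exec ρ s))
    (h : Start n J c s) :
    (exGuess J m jg rg p).time ρ s ≤ (exGuessCost J m jg rg T).eval n ∧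
      Answers (∃ q, φ q) ((exGuess J m jg rg p).exec ρ s) := by
  classical
  obtain ⟨t₁, n₁, f₁⟩ := Stm.step (ρ := ρ) (n := n) guessInit_wf simRegs_zero (by simp [simRegs])
    (by rintro y rfl; exact h.size.le)
  obtain ⟨g, eg, mg, hg⟩ := matTab_eval (ρ := ρ) (a := ⟨6, []⟩) (r := s.nat)
    (e := .delta 4 5) (g := s.fld) h.size (by simp) (by simp) 1 (by
      intro i j g' _ _
      simp only [Ex.eval, Function.update_apply, Nat.reduceEqDiff, reduceIte, one_apply,
        Fin.ext_iff])
  rw [guessInit, Stm.eval_seq, eg] at f₁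
  simp only [List.map_nil] at mg
  have hg' : ∀ b, b ≠ 6 → g b = s.fld b := fun b hb => funext fun l => hg b l fun h => absurd h hb
  have hf₁ : ∀ b, b ≠ 3 → b ≠ 7 → (guessInit.compile.exec ρ s).fld b = g b := fun b h3 h7 => by
    rw [guessInit, f₁ b h3, Stm.eval, Mem.set_arr _ h7]
  have h7 : (guessInit.compile.exec ρ s).fld 7 [] = 0 := by
    rw [guessInit, f₁ 7 (by norm_num), Stm.eval, List.map_nil, Mem.set_same]; rfl
  rw [exGuess, Prog.exec_seq, Prog.time_seq, Prog.exec_seq, Prog.time_seq]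
  set s₁ := guessInit.compile.exec ρ s with hs₁
  have i0 : s₁.nat 0 = n := by rw [n₁ 0 (by simp [simRegs]), h.size]
  -- Each run removes at least one of the n points unless none is left, so that after n turns
  -- nothing remains.
  have loop := forP_spec ρ (k := 2) (x := 0) (m := n) (p := guessRun J m jg rg p)
    (t := (remTest.cost + (load J m jg rg).cost + liftCost * T +
      remUpdate.cost + 6 : Polynomial ℕ).eval n) (s := s₁)
    (fun i s' => ∃ R : Finset (Fin n), R.card ≤ n - i ∧ GuessInv P Q (s.fld 0) φ R i i s')
    (by norm_num) (by norm_num) i0 ⟨Finset.univ, by simp, ?_⟩ ?_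
  · obtain ⟨tl, R, hR, hI⟩ := loop
    rw [Nat.sub_self, Nat.le_zero, Finset.card_eq_zero] at hR
    subst hR
    set s₂ := (forP 2 0 (guessRun J m jg rg p)).exec ρ s₁
    constructor
    · have e1 : (Prog.ifZero ⟨7, []⟩ (.natConst 0 0) (.natConst 0 1)).time ρ s₂ = 2 := by
        simp only [Prog.time]; split_ifs <;> rfl
      rw [e1]
      simp only [exGuessCost, Polynomial.eval_add, Polynomial.eval_mul, Polynomial.eval_ofNat,
        Polynomial.eval_X] at tl ⊢
      simp only [add_assoc] at tl ⊢
      norm_num at tl ⊢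
      omega
    · have hget : s₂.get ⟨7, []⟩ = s₂.fld 7 [] := rfl
      rw [Prog.exec, hget]
      rcases hI.found with ⟨ha, hb⟩ | ⟨ha, hb⟩
      · rw [if_pos ha]
        right
        refine ⟨by simp [Prog.exec], ?_⟩
        rintro ⟨q, hq⟩
        simpa using hb q hq
      · rw [if_neg ha]
        left
        exact ⟨by simp [Prog.exec], hb⟩
  · refine ⟨by simp [i0], by simp, ?_, ?_, ?_, Or.inl ⟨h7, by simp⟩⟩
    · rw [State.putNat_fld, hf₁ 0 (by norm_num) (by norm_num), hg' 0 (by norm_num)]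
    · have : mat n (s₁.putNat 2 0).fld 6 [] = mat n g 6 [] := by
        simp only [mat, State.putNat_fld, hf₁ 6 (by norm_num) (by norm_num)]
      rw [this, mg, ← dg_one hPQ]
      congr 1
      funext q
      simp
    · intro b hb l _
      rw [State.putNat_fld, hf₁ b (by omega) (by omega), hg' b (by omega)]
      exact h.clean b hb l
  · rintro i hi s' ⟨R, hR, hI⟩
    obtain ⟨t, R', hR', hI'⟩ := guessRun_step (ρ := ρ) (jg := jg) (rg := rg) hPQ hQP hm hp h.cells
      hx hrun hI
    refine ⟨t, R', ?_, ?_, ?_, hI'.inp, hI'.rem, hI'.clean, hI'.found⟩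
    · rcases hR' with rfl | hR'
      · simp
      · omega
    · simp [hI'.size]
    · simp [hI'.runNo]

end

/-! ### Alternating guesses -/

section

variable {F : Type*} [Field F] {ρ : Polynomial F → F} {n J : ℕ}

/-- The eigenvalues of a matrix. -/
def IsEig (X : Matrix (Fin n) (Fin n) F) (a : F) : Prop := ∃ v ≠ 0, X *ᵥ v = a • v

/-- A change of basis makes the matrix diagonal. -/
def Diagble (X : Matrix (Fin n) (Fin n) F) : Prop :=
  ∃ (P Q : Matrix (Fin n) (Fin n) F) (x : Fin n → F), P * Q = 1 ∧ Q * P = 1 ∧ X = dg P Q x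

theorem isEig_dg {P Q : Matrix (Fin n) (Fin n) F} (hPQ : P * Q = 1) (hQP : Q * P = 1)
    {x : Fin n → F} {a : F} : IsEig (dg P Q x) a ↔ ∃ p, x p = a := by
  constructor
  · rintro ⟨v, hv, h⟩
    have hQv : Q *ᵥ v ≠ 0 := fun h0 => hv (by
      rw [← one_mulVec v, ← hPQ, ← mulVec_mulVec, h0, mulVec_zero])
    obtain ⟨p, hp⟩ := Function.ne_iff.1 hQv
    refine ⟨p, ?_⟩
    have h1 : diagonal x *ᵥ (Q *ᵥ v) = a • (Q *ᵥ v) := by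
      rw [← mulVec_smul, ← h, dg, mulVec_mulVec, mulVec_mulVec, ← mul_assoc, ← mul_assoc, hQP,
        one_mul]
    have := congrFun h1 p
    rw [mulVec_diagonal, Pi.smul_apply, smul_eq_mul] at this
    exact mul_right_cancel₀ hp this
  · rintro ⟨p, rfl⟩
    refine ⟨P *ᵥ Pi.single p 1, fun h0 => ?_, ?_⟩
    · have : Q *ᵥ (P *ᵥ Pi.single p 1) = 0 := by rw [h0, mulVec_zero]
      rw [mulVec_mulVec, hQP, one_mulVec] at this
      have := congrFun this p
      simp at this
    · rw [dg, mulVec_mulVec, mul_assoc, hQP, mul_one, ← mulVec_mulVec, ← mulVec_smul]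
      congr 1
      rw [diagonal_mulVec_single]
      ext q
      by_cases hq : q = p
      · subst hq; simp
      · simp [hq]

theorem Answers.congr {φ ψ : Prop} {s : State F} (h : Answers φ s) (hφ : φ ↔ ψ) : Answers ψ s := by
  rwa [Answers, ← hφ]

/-- Exchange the two answers. -/
def notP (p : Prog) : Prog := .seq p (.seq (.natConst 19 1) (.natSub 0 19 0))

theorem notP_time (p : Prog) (s : State F) : (notP p).time ρ s = p.time ρ s + 2 := rfl

theorem notP_answers {p : Prog} {φ : Prop} {s : State F} (h : Answers φ (p.exec ρ s)) :
    Answers (¬ φ) ((notP p).exec ρ s) := by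
  have : ((notP p).exec ρ s).nat 0 = 1 - (p.exec ρ s).nat 0 := by
    simp [notP, Prog.exec]
  rcases h with ⟨h1, h2⟩ | ⟨h1, h2⟩
  · right; rw [this, h1]; exact ⟨rfl, not_not.2 h2⟩
  · left; rw [this, h1]; exact ⟨rfl, h2⟩

/-- Guess the contents of several cells, each an eigenvalue of a matrix of the input that depends on
the place of the cell. -/
def exGuesses (J : ℕ) (src : ℕ → ℕ → ℕ) : List (ℕ × ℕ) → Prog → Prog
  | [], p => p
  | e :: l, p => exGuess J (src e.1 e.2) e.1 e.2 (exGuesses J src l p)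

/-- A bound for the running time of `exGuesses`. -/
noncomputable def exGuessesCost (J : ℕ) (src : ℕ → ℕ → ℕ) :
    List (ℕ × ℕ) → Polynomial ℕ → Polynomial ℕ
  | [], T => T
  | e :: l, T => exGuessCost J (src e.1 e.2) e.1 e.2 (exGuessesCost J src l T)

theorem exGuess_fieldOperationsOnly {J m jg rg : ℕ} {p : Prog} (h : p.FieldOperationsOnly) :
    (exGuess J m jg rg p).FieldOperationsOnly := by
  have hT : ∀ a e, (matTab a e).compile.FieldOperationsOnly := fun _ _ =>
    Stm.compile_fieldOperationsOnly _ trivial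
  have h1 : guessInit.compile.FieldOperationsOnly :=
    Stm.compile_fieldOperationsOnly _ ⟨trivial, trivial⟩
  have h2 : remTest.compile.FieldOperationsOnly := Stm.compile_fieldOperationsOnly _ trivial
  have h3 : (load J m jg rg).compile.FieldOperationsOnly := Stm.compile_fieldOperationsOnly _ (by
    simp [load, Stm.NoRoot, matTab])
  have h4 : remUpdate.compile.FieldOperationsOnly := hT _ _
  have h5 := lift_fieldOperationsOnly p h
  simp [exGuess, Prog.FieldOperationsOnly, forP, guessRun, incr, h1, h2, h3, h4, h5]

theorem exGuesses_fieldOperationsOnly {J : ℕ} {src : ℕ → ℕ → ℕ} {p : Prog}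
    (h : p.FieldOperationsOnly) (l : List (ℕ × ℕ)) :
    (exGuesses J src l p).FieldOperationsOnly := by
  induction l with
  | nil => exact h
  | cons e l ih => exact exGuess_fieldOperationsOnly ih

/-- The cells `c'` arise from `c` by writing eigenvalues into the cells given by the list. -/
def Guessed (n : ℕ) (src : ℕ → ℕ → ℕ) (l : List (ℕ × ℕ)) (c₀ c c' : Cells F) : Prop :=
  (∀ j r k, (∀ e ∈ l, ¬ (j = e.1 ∧ r = e.2 ∧ k = 0)) → c' j r k = c j r k) ∧
    ∀ e ∈ l, IsEig (c₀.mat n (src e.1 e.2)) (c' e.1 e.2 0)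

/-- If a cell is repeated in the list, the later guess prevails. This is harmless, since the source
matrix is a function of the cell. -/
theorem guessed_cons {src : ℕ → ℕ → ℕ} {e : ℕ × ℕ} {l : List (ℕ × ℕ)} {c₀ c : Cells F}
    {φ : Cells F → Prop} :
    (∃ c', Guessed n src (e :: l) c₀ c c' ∧ φ c') ↔
      ∃ a, IsEig (c₀.mat n (src e.1 e.2)) a ∧
        ∃ c', Guessed n src l c₀ (c.set e.1 e.2 a) c' ∧ φ c' := by
  constructor
  · rintro ⟨c', ⟨h1, h2⟩, hφ⟩
    refine ⟨c' e.1 e.2 0, h2 e (by simp), c', ⟨fun j r k h => ?_, fun e' he' => h2 e' (by simp [he'])⟩,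
      hφ⟩
    rw [Cells.set]
    split_ifs with hjr
    · rw [hjr.1, hjr.2.1, hjr.2.2]
    · exact h1 j r k fun e' he' => by
        rcases List.mem_cons.1 he' with rfl | he'
        · exact hjr
        · exact h e' he'
  · rintro ⟨a, ha, c', ⟨h1, h2⟩, hφ⟩
    refine ⟨c', ⟨fun j r k h => ?_, fun e' he' => ?_⟩, hφ⟩
    · rw [h1 j r k fun e' he' => h e' (by simp [he']), Cells.set, if_neg (h e (by simp))]
    · rcases List.mem_cons.1 he' with rfl | he'
      · by_cases hin : ∃ e'' ∈ l, e'.1 = e''.1 ∧ e'.2 = e''.2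
        · obtain ⟨e'', he'', h', h''⟩ := hin
          rw [h', h'']
          exact h2 e'' he''
        · rw [h1 e'.1 e'.2 0 fun e'' he'' h => hin ⟨e'', he'', h.1, h.2.1⟩, Cells.set,
            if_pos ⟨rfl, rfl, rfl⟩]
          exact ha
      · exact h2 e' he'

/-- Induction on the list. The program for the remaining guesses is itself what is simulated for the
first one, so that simulations are nested as deep as the list is long. No guess is written into a
matrix with number below `M`, so the source matrices stay diagonalizable at all levels. -/
theorem exGuesses_correct {src : ℕ → ℕ → ℕ} {p : Prog} {T : Polynomial ℕ} {M : ℕ} {c₀ : Cells F}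
    {φ : Cells F → Prop} (hMJ : M ≤ J) (hd : ∀ m < M, Diagble (c₀.mat n m))
    (hp : p.FieldOperationsOnly)
    (hrun : ∀ c s, (∀ m < M, ∀ r k, c m r k = c₀ m r k) → Start n J c s →
      p.time ρ s ≤ T.eval n ∧ Answers (φ c) (p.exec ρ s)) (l : List (ℕ × ℕ))
    (hl : ∀ e ∈ l, M ≤ e.1 ∧ src e.1 e.2 < M) :
    ∀ c s, (∀ m < M, ∀ r k, c m r k = c₀ m r k) → Start n J c s →
      (exGuesses J src l p).time ρ s ≤ (exGuessesCost J src l T).eval n ∧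
        Answers (∃ c', Guessed n src l c₀ c c' ∧ φ c') ((exGuesses J src l p).exec ρ s) := by
  induction l with
  | nil =>
    intro c s hc hs
    obtain ⟨h1, h2⟩ := hrun c s hc hs
    refine ⟨h1, h2.congr ⟨fun h => ⟨c, ⟨fun _ _ _ _ => rfl, by simp⟩, h⟩, ?_⟩⟩
    rintro ⟨c', ⟨h1, -⟩, h2⟩
    rwa [show c = c' from funext fun j => funext fun r => funext fun k => (h1 j r k (by simp)).symm]
  | cons e l ih =>
    intro c s hc hs
    have he := hl e (by simp)
    have ih := ih fun e' he' => hl e' (by simp [he'])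
    obtain ⟨P, Q, x, hPQ, hQP, hx⟩ := hd _ he.2
    have hcm : c.mat n (src e.1 e.2) = c₀.mat n (src e.1 e.2) := by
      ext i j
      exact hc _ he.2 _ _
    obtain ⟨h1, h2⟩ := exGuess_correct (ρ := ρ) (jg := e.1) (rg := e.2)
      (φ := fun q => ∃ c', Guessed n src l c₀ (c.set e.1 e.2 (x q)) c' ∧ φ c') hPQ hQP
      (he.2.trans_le hMJ) (exGuesses_fieldOperationsOnly hp l) (hcm.trans hx) (fun q s hs => by
        refine ih _ s (fun m hm r k => ?_) hs
        rw [Cells.set, if_neg (by omega), hc m hm]) hs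
    refine ⟨h1, h2.congr ?_⟩
    rw [guessed_cons, hx]
    simp only [isEig_dg hPQ hQP]
    constructor
    · rintro ⟨q, h⟩
      exact ⟨_, ⟨q, rfl⟩, h⟩
    · rintro ⟨_, ⟨q, rfl⟩, h⟩
      exact ⟨q, h⟩

end

/-! ### Linear relations between reduced vectors -/

section

variable {F V : Type*} [Field F] [AddCommGroup V] [Module F V]

/-- `L` and `z` come from a reduction of the vectors `x 0, …, x (m - 1)`. -/
structure IsReduction (m : ℕ) (x : ℕ → V) (L : ℕ → ℕ → F) (z : ℕ → Prop) : Prop where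
  rel : ∀ i < m, z i → x i + ∑ q ∈ Finset.range i, L i q • x q = 0
  coeff : ∀ i < m, ∀ q < i, z q → L i q = 0
  span : ∀ i < m, x i ∈ Submodule.span F (x '' Set.Iio i) → z i

/-- The coefficients of a linear relation. -/
def relation (L : ℕ → ℕ → F) (i : ℕ) : ℕ → F :=
  fun c => if c = i then 1 else if c < i then L i c else 0

theorem sum_relation {m i : ℕ} (hi : i < m) (L : ℕ → ℕ → F) (x : ℕ → V) :
    ∑ c : Fin m, relation L i c • x c = x i + ∑ q ∈ Finset.range i, L i q • x q := by
  rw [Fin.sum_univ_eq_sum_range (fun c => relation L i c • x c) m,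
    ← Finset.sum_subset (Finset.range_mono (show i + 1 ≤ m by omega)), Finset.sum_range_succ,
    add_comm]
  · congr 1
    · simp [relation]
    · refine Finset.sum_congr rfl fun q hq => ?_
      have := Finset.mem_range.1 hq
      rw [relation, if_neg this.ne, if_pos this]
  · intro c _ hc
    rw [Finset.mem_range] at hc
    rw [relation, if_neg (by omega), if_neg (by omega), zero_smul]

variable {m : ℕ} {x : ℕ → V} {L : ℕ → ℕ → F} {z : ℕ → Prop}

/-- The last nonzero coefficient of a relation would express its vector by earlier ones. The
corresponding row would then be marked by `z`, where the relation was assumed to vanish. -/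
theorem IsReduction.eq_zero (h : IsReduction m x L z) {y : Fin m → F}
    (hy : ∑ i, y i • x i = 0) (hz : ∀ q : Fin m, z q → y q = 0) : y = 0 := by
  classical
  by_contra hne
  obtain ⟨q, hq⟩ := Function.ne_iff.1 hne
  obtain ⟨q, hq, hmax⟩ := (Finset.univ.filter fun q => y q ≠ 0).exists_max_image id
    ⟨q, by simpa using hq⟩
  rw [Finset.mem_filter] at hq
  refine hq.2 (hz q (h.span q q.2 ?_))
  have : x q = ∑ i ∈ Finset.univ.erase q, (-(y q)⁻¹ * y i) • x i := by
    rw [← Finset.add_sum_erase _ _ (Finset.mem_univ q)] at hy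
    simp only [mul_smul, ← Finset.smul_sum]
    rw [eq_neg_of_add_eq_zero_right hy, neg_smul, smul_neg,
      neg_neg, smul_smul, inv_mul_cancel₀ hq.2, one_smul]
  rw [this]
  refine sum_mem fun i hi => ?_
  by_cases hyi : y i = 0
  · simp [hyi]
  · have h1 := hmax i (by simpa using hyi)
    have h2 := Finset.ne_of_mem_erase hi
    exact Submodule.smul_mem _ _ (Submodule.subset_span ⟨i, lt_of_le_of_ne h1 fun h => h2 h,
      rfl⟩)

theorem IsReduction.linearIndependent_iff (h : IsReduction m x L z) :
    LinearIndependent F (fun i : Fin m => x i) ↔ ∀ i < m, ¬ z i := by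
  rw [Fintype.linearIndependent_iff]
  constructor
  · intro hli i hi hz
    have := hli (fun c => relation L i c) (by rw [sum_relation hi]; exact h.rel i hi hz) ⟨i, hi⟩
    simp [relation] at this
  · intro hz y hy i
    exact congrFun (h.eq_zero hy fun q hq => absurd hq (hz q q.2)) i

open Classical in
theorem exists_count_eq {z : ℕ → Prop} {m t : ℕ} (h : t < Nat.count z m) :
    ∃ i < m, z i ∧ Nat.count z i = t := by
  induction m with
  | zero => simp at h
  | succ m ih =>
    rw [Nat.count_succ] at h
    by_cases ht : t < Nat.count z m
    · obtain ⟨i, hi, h1, h2⟩ := ih ht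
      exact ⟨i, by omega, h1, h2⟩
    · split_ifs at h with hz
      · exact ⟨m, by omega, hz, by omega⟩
      · omega

open Classical in
/-- The relations that a reduction finds are a basis of all relations. -/
theorem IsReduction.kernel (h : IsReduction m x L z) {K : Submodule F (Fin m → F)}
    (hK : ∀ y, y ∈ K ↔ ∑ i, y i • x i = 0) {k : ℕ} (hk : Nat.count z m = k) :
    ∃ e : Fin k → ℕ, (∀ t, e t < m ∧ z (e t) ∧ Nat.count z (e t) = t) ∧
      LinearIndependent F (fun t => fun c : Fin m => relation L (e t) c) ∧
      Submodule.span F (Set.range fun t => fun c : Fin m => relation L (e t) c) = K := by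
  subst hk
  choose e he using fun t : Fin (Nat.count z m) => exists_count_eq t.2
  -- On the coordinates marked by `z`, the relations found are the unit vectors. This gives their
  -- independence as well as the coefficients of an arbitrary relation.
  have hval : ∀ t, ∀ q < m, z q → relation L (e t) q = if Nat.count z q = t then 1 else 0 := by
    intro t q hq hzq
    obtain ⟨h1, h2, h3⟩ := he t
    by_cases hqe : q = e t
    · rw [relation, if_pos hqe, if_pos (by rw [hqe, h3])]
    · rw [relation, if_neg hqe, if_neg (show ¬ Nat.count z q = t from
        fun hc => hqe (Nat.count_injective hzq h2 (hc.trans h3.symm)))]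
      split_ifs with hlt
      · exact h.coeff _ h1 q hlt hzq
      · rfl
  refine ⟨e, he, ?_, le_antisymm ?_ ?_⟩
  · rw [Fintype.linearIndependent_iff]
    intro g hg t
    have := congrFun hg ⟨e t, (he t).1⟩
    simp only [Finset.sum_apply, Pi.smul_apply, smul_eq_mul, Pi.zero_apply] at this
    rw [Finset.sum_eq_single t] at this
    · rwa [hval t _ (he t).1 (he t).2.1, if_pos (he t).2.2, mul_one] at this
    · intro t' _ hne
      rw [hval t' _ (he t).1 (he t).2.1, (he t).2.2, if_neg fun h => hne (Fin.ext h.symm), mul_zero]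
    · simp
  · rw [Submodule.span_le]
    rintro _ ⟨t, rfl⟩
    rw [SetLike.mem_coe, hK, sum_relation (he t).1]
    exact h.rel _ (he t).1 (he t).2.1
  · intro y hy
    -- The combination that agrees with `y` on the marked coordinates; the difference is a relation
    -- without marked coordinates, hence zero.
    set w : Fin m → F := ∑ t, y ⟨e t, (he t).1⟩ • fun c : Fin m => relation L (e t) c with hw
    have hwmem : w ∈ Submodule.span F (Set.range fun t => fun c : Fin m => relation L (e t) c) :=
      sum_mem fun t _ => Submodule.smul_mem _ _ (Submodule.subset_span ⟨t, rfl⟩)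
    have hwK : w ∈ K := by
      refine sum_mem fun t _ => Submodule.smul_mem _ _ ?_
      rw [hK, sum_relation (he t).1]
      exact h.rel _ (he t).1 (he t).2.1
    have : y - w = 0 := by
      refine h.eq_zero ((hK _).1 (sub_mem hy hwK)) fun q hq => ?_
      have hlt : Nat.count z q < Nat.count z m := by
        have := Nat.count_monotone z (show (q : ℕ) + 1 ≤ m from q.2)
        rw [Nat.count_succ, if_pos hq] at this
        omega
      rw [Pi.sub_apply, hw, Finset.sum_apply, Finset.sum_eq_single ⟨_, hlt⟩]
      · have heq : e ⟨_, hlt⟩ = q := Nat.count_injective (he _).2.1 hq (he _).2.2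
        rw [Pi.smul_apply, hval _ q q.2 hq, if_pos rfl, smul_eq_mul, mul_one, sub_eq_zero]
        congr 1
        exact Fin.ext heq.symm
      · intro t _ hne
        rw [Pi.smul_apply, hval t q q.2 hq, if_neg fun h => hne (Fin.ext h.symm), smul_zero]
      · simp
    rw [sub_eq_zero.1 this]
    exact hwmem

end

/-! ### The test of a linear map between weights -/

/-- Record a failure unless the expression is zero. -/
def failUnless (e : Ex) : Stm := .asg ⟨21, []⟩ (.ifz e (.cell ⟨21, []⟩) .one)

/-- `1` if the cell is zero. -/
def isZero (a : Loc) : Ex := .ifz (.cell a) .one .zero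

/-- Reduce the rows of `W` and the row `χ`; the rows of `U` follow. -/
def checkW : Stm :=
  .seq (.loop 4 16 (.loop 5 16 (.letAdd 8 4 19 (.asg ⟨10, [4, 9, 5]⟩ (.cell ⟨0, [8, 5, 9]⟩)))))
  (.seq (.loop 5 16 (.asg ⟨10, [16, 9, 5]⟩ (.cell ⟨0, [21, 5, 9]⟩)))
  (.seq (.loop 4 16 (.loop 5 16 (.letAdd 8 4 20 (.asg ⟨11, [4, 5]⟩ (.cell ⟨0, [8, 5, 9]⟩)))))
  (.seq (.loop 5 16 (.asg ⟨11, [16, 5]⟩ .zero))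
  (.seq (rowReduce 10 11 12 13 14 18 17 16 16)
    (failUnless (.any 4 16 (isZero ⟨13, [4]⟩)))))))

/-- Reduce the rows of `U`. -/
def checkU : Stm :=
  .seq (.loop 4 16 (.loop 5 16 (.letAdd 8 4 20 (.asg ⟨10, [4, 9, 5]⟩ (.cell ⟨0, [8, 5, 9]⟩)))))
  -- Register `9` holds zero: the accompanying rows have width zero, and only the rank is of
  -- interest.
  (.seq (rowReduce 10 25 12 26 14 16 17 16 9)
    (failUnless (.any 4 16 (isZero ⟨26, [4]⟩))))

/-- Find the relations between the rows of the matrices `A i - χ i`. -/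
def kernelA : Stm :=
  .seq (.loop 4 0 (.loop 5 16 (.loop 6 0 (.asg ⟨15, [4, 5, 6]⟩
    (.sub (.cell ⟨0, [5, 4, 6]⟩) (.mul (.cell ⟨0, [21, 5, 9]⟩) (.delta 4 6)))))))
  (.seq (.loop 4 0 (.loop 5 0 (.asg ⟨16, [4, 5]⟩ (.delta 4 5))))
    (rowReduce 15 16 12 17 14 0 16 0 0))

/-- Find the relations between the columns of the matrices `B j - ψ j`. -/
def kernelB : Stm :=
  .seq (.loop 4 0 (.loop 5 16 (.loop 6 0 (.letAdd 8 5 16 (.asg ⟨18, [4, 5, 6]⟩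
    -- The indices `6, 4` are exchanged because columns are wanted. The sign is plus because array
    -- `11` contains the negative of the image weight.
    (.add (.cell ⟨0, [8, 6, 4]⟩) (.mul (.cell ⟨11, [16, 5]⟩) (.delta 4 6))))))))
  (.seq (.loop 4 0 (.loop 5 0 (.asg ⟨19, [4, 5]⟩ (.delta 4 5))))
    (rowReduce 18 19 12 20 14 0 16 0 0))

/-- Compare the dimensions of the two weight spaces, and add the products of their bases to array
`22`. -/
def combine : Stm :=
  .seq (failUnless (.ifz (.cntEq 4 5 6 0 0 (isZero ⟨17, [4]⟩) (isZero ⟨20, [4]⟩)) .one .zero))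
  (.seq (.loop 4 0 (.loop 5 0 (.asg ⟨23, [4, 5]⟩ (.ifz (.cell ⟨17, [4]⟩) (.ifz (.cell ⟨20, [5]⟩)
    (.cntEq 6 7 8 4 5 (isZero ⟨17, [6]⟩) (isZero ⟨20, [6]⟩)) .zero) .zero))))
    (.loop 4 0 (.loop 5 0 (.asg ⟨22, [4, 5]⟩ (.add (.cell ⟨22, [4, 5]⟩)
      (.sum 6 0 (.sum 7 0 (.mul (.cell ⟨23, [6, 7]⟩)
        (.mul (.cell ⟨19, [7, 4]⟩) (.cell ⟨16, [6, 5]⟩))))))))))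

/-- The whole test. -/
def check (d : ℕ) : Stm :=
  .letConst 9 0 (.letConst 16 d (.letConst 17 1 (.letConst 18 (d + 1) (.letConst 19 (2 * d)
    (.letConst 20 (3 * d) (.letConst 21 (4 * d)
      (.seq checkW (.seq checkU (.seq kernelA (.seq kernelB combine))))))))))

/-- The registers of the test. -/
structure CheckRegs (n d : ℕ) (r : ℕ → ℕ) : Prop where
  r0 : r 0 = n
  r9 : r 9 = 0
  r16 : r 16 = d
  r17 : r 17 = 1
  r18 : r 18 = d + 1
  r19 : r 19 = 2 * d
  r20 : r 20 = 3 * d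
  r21 : r 21 = 4 * d

/-! ### Correctness of the comparison of weight spaces. -/

section

variable {F : Type*} [Field F] {ρ : Polynomial F → F} {n d : ℕ}

theorem check_wf (d : ℕ) {V B : Set ℕ} (h0 : 0 ∈ V) (h0B : 0 ∈ B)
    (hV : ∀ x ∈ V, x = 0 ∨ 22 ≤ x) (hB : ∀ x ∈ B, x = 0 ∨ 22 ≤ x) : (check d).WF V B := by
  have hV' : ∀ x, x ≠ 0 → x < 22 → x ∉ V := fun x h1 h2 h => by have := hV x h; omega
  have hB' : ∀ x, x ≠ 0 → x < 22 → x ∉ B := fun x h1 h2 h => by have := hB x h; omega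
  simp [check, checkW, checkU, kernelA, kernelB, combine, failUnless, isZero, rowReduce, eliminate,
    findPivot, Stm.WF, Ex.WF, h0, h0B, hV', hB']

theorem check_noRoot (d : ℕ) : (check d).NoRoot := by
  simp [check, checkW, checkU, kernelA, kernelB, combine, failUnless, isZero, rowReduce, eliminate,
    findPivot, Stm.NoRoot]

theorem IsReduction.mono {V : Type*} [AddCommGroup V] [Module F V] {m m' : ℕ} {x : ℕ → V}
    {L : ℕ → ℕ → F} {z : ℕ → Prop} (h : IsReduction m x L z) (hm : m' ≤ m) :
    IsReduction m' x L z :=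
  ⟨fun i hi => h.rel i (by omega), fun i hi => h.coeff i (by omega),
    fun i hi => h.span i (by omega)⟩

theorem rowReduce_isReduction {S Y PV Z t m w₁ w₂ w : ℕ} {r : ℕ → ℕ}
    (hd : [S, Y, PV, Z, t].Nodup) (hw₁ : w₁ < 10 ∨ 15 < w₁) (hw₂ : w₂ < 10 ∨ 15 < w₂)
    (hw : w < 10 ∨ 15 < w) (f : Mem F) :
    ∃ f', (rowReduce S Y PV Z t m w₁ w₂ w).eval ρ r f = f' ∧
      (∀ b, b ∉ [S, Y, PV, Z, t] → f' b = f b) ∧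
      ∃ L : ℕ → ℕ → F,
        IsReduction (r m) (row₂ f S (r w₁) (r w₂)) L (fun i => f' Z [i] = 0) ∧
        ∀ i < r m, row₁ f' Y (r w) i = row₁ f Y (r w) i +
          ∑ q ∈ Finset.range i, L i q • row₁ f Y (r w) q := by
  obtain ⟨f', e, hf, L, h1, h2, h3, h4, h5⟩ := rowReduce_eval (ρ := ρ) (m := m) (r := r) hd hw₁ hw₂
    hw f
  exact ⟨f', e, hf, L, ⟨fun i hi hz => by rw [← h1 i hi, h4 i hi hz], h3, h5⟩, h2⟩

theorem failUnless_eval (e : Ex) (r : ℕ → ℕ) (f : Mem F) :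
    (failUnless e).eval ρ r f 21 [] = 0 ↔ f 21 [] = 0 ∧ e.eval r f = 0 := by
  rw [failUnless, Stm.eval, List.map_nil, Mem.set_same, Ex.eval]
  split_ifs with h
  · simp [Ex.eval, h]
  · simp [Ex.eval, h]

theorem failUnless_frame (e : Ex) (r : ℕ → ℕ) (f : Mem F) {b : ℕ} (hb : b ≠ 21) :
    (failUnless e).eval ρ r f b = f b := by
  rw [failUnless, Stm.eval, Mem.set_arr _ hb]

theorem isZero_eval (a : Loc) (r : ℕ → ℕ) (f : Mem F) :
    (isZero a).eval r f = 0 ↔ f a.arr (a.idx.map r) ≠ 0 := by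
  rw [isZero, Ex.eval]
  split_ifs with h
  · simpa [Ex.eval] using h
  · simpa [Ex.eval] using h

/-- Rows in the last index only are independent if the matrix is invertible. -/
theorem isUnit_iff_reduction {W : Matrix (Fin d) (Fin d) F} {x : ℕ → Fin 1 × Fin d → F}
    {L : ℕ → ℕ → F} {z : ℕ → Prop} (h : IsReduction d x L z)
    (hx : ∀ s : Fin d, x s = fun p => W s p.2) : IsUnit W ↔ ∀ i < d, ¬ z i := by
  rw [← h.linearIndependent_iff, ← linearIndependent_rows_iff_isUnit]
  have : (fun i : Fin d => x i) = LinearMap.funLeft F F (Prod.snd : Fin 1 × Fin d → Fin d) ∘ W.row := by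
    funext s
    rw [hx]
    rfl
  rw [this, LinearMap.linearIndependent_iff]
  exact LinearMap.ker_eq_bot.2 (LinearMap.funLeft_injective_of_surjective _ _ _
    fun i => ⟨(0, i), rfl⟩)

/-- The row `χ` is reduced after the rows of `W`. If `W` is invertible, it is reduced to zero, with
coefficients `l` such that `χ = - (l ᵥ* W)`. Its companion starts as zero and collects `l ᵥ* U`,
which is the image of `χ` up to sign. No inverse matrix has to be computed. -/
theorem checkW_eval {r : ℕ → ℕ} {f : Mem F} (hr : CheckRegs n d r)
    {W U : Matrix (Fin d) (Fin d) F} {χ : Fin d → F}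
    (hW : ∀ s i : Fin d, f 0 [2 * d + s, i, 0] = W s i)
    (hU : ∀ s i : Fin d, f 0 [3 * d + s, i, 0] = U s i) (hχ : ∀ i : Fin d, f 0 [4 * d, i, 0] = χ i) :
    ∃ f', checkW.eval ρ r f = f' ∧ (∀ b, (b < 10 ∨ 14 < b) → b ≠ 21 → f' b = f b) ∧
      (f' 21 [] = 0 ↔ f 21 [] = 0 ∧ IsUnit W) ∧
      (IsUnit W → ∀ j : Fin d, f' 11 [d, j] = - (χ ᵥ* W⁻¹ ᵥ* U) j) := by
  obtain ⟨r0, r9, r16, r17, r18, r19, r20, r21⟩ := hr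
  set f₁ := Stm.eval ρ (.loop 4 16 (.loop 5 16
    (.letAdd 8 4 19 (.asg ⟨10, [4, 9, 5]⟩ (.cell ⟨0, [8, 5, 9]⟩))))) r f with e₁
  have T₁ := Tab.loop₂ (ρ := ρ) (a := 10) (k := 4) (x := 16) (k' := 5) (x' := 16)
    (p := .letAdd 8 4 19 (.asg ⟨10, [4, 9, 5]⟩ (.cell ⟨0, [8, 5, 9]⟩))) (r := r) (f := f)
    (fun i j => [i, 0, j]) (fun i j => f 0 [2 * d + i, j, 0]) (by simp) (by norm_num) (by
      intro i hi j hj g' h1 h2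
      simp only [Stm.eval, Ex.eval, List.map_cons, List.map_nil, Function.update_apply,
        Nat.reduceEqDiff, reduceIte, r9, r19, h1 0 (by norm_num), add_comm i])
  rw [← e₁, r16] at T₁
  set f₂ := Stm.eval ρ (.loop 5 16 (.asg ⟨10, [16, 9, 5]⟩ (.cell ⟨0, [21, 5, 9]⟩))) r f₁ with e₂
  have T₂ := Tab.loop₁ (ρ := ρ) (a := 10) (k := 5) (x := 16)
    (p := .asg ⟨10, [16, 9, 5]⟩ (.cell ⟨0, [21, 5, 9]⟩)) (r := r) (f := f₁)
    (fun j => [d, 0, j]) (fun j => f 0 [4 * d, j, 0]) (by simp) (by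
      intro j hj g' h1 h2
      simp only [Stm.eval, Ex.eval, List.map_cons, List.map_nil, Function.update_apply,
        Nat.reduceEqDiff, reduceIte, r9, r16, r21, h1 0 (by norm_num), T₁.arr (b := 0) (by norm_num)])
  rw [← e₂, r16] at T₂
  set f₃ := Stm.eval ρ (.loop 4 16 (.loop 5 16
    (.letAdd 8 4 20 (.asg ⟨11, [4, 5]⟩ (.cell ⟨0, [8, 5, 9]⟩))))) r f₂ with e₃
  have T₃ := Tab.loop₂ (ρ := ρ) (a := 11) (k := 4) (x := 16) (k' := 5) (x' := 16)
    (p := .letAdd 8 4 20 (.asg ⟨11, [4, 5]⟩ (.cell ⟨0, [8, 5, 9]⟩))) (r := r) (f := f₂)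
    (fun i j => [i, j]) (fun i j => f 0 [3 * d + i, j, 0]) (by simp) (by norm_num) (by
      intro i hi j hj g' h1 h2
      simp only [Stm.eval, Ex.eval, List.map_cons, List.map_nil, Function.update_apply,
        Nat.reduceEqDiff, reduceIte, r9, r20, h1 0 (by norm_num), add_comm i,
        T₁.arr (b := 0) (by norm_num), T₂.arr (b := 0) (by norm_num)])
  rw [← e₃, r16] at T₃
  set f₄ := Stm.eval ρ (.loop 5 16 (.asg ⟨11, [16, 5]⟩ .zero)) r f₃ with e₄
  have T₄ := Tab.loop₁ (ρ := ρ) (a := 11) (k := 5) (x := 16)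
    (p := .asg ⟨11, [16, 5]⟩ .zero) (r := r) (f := f₃)
    (fun j => [d, j]) (fun j => 0) (by simp) (by
      intro j hj g' h1 h2
      simp only [Stm.eval, Ex.eval, List.map_cons, List.map_nil, Function.update_apply,
        Nat.reduceEqDiff, reduceIte, r16])
  rw [← e₄, r16] at T₄
  obtain ⟨f₅, e₅, h₅, L, hL, hY⟩ := rowReduce_isReduction (ρ := ρ) (S := 10) (Y := 11) (PV := 12)
    (Z := 13) (t := 14) (m := 18) (w₁ := 17) (w₂ := 16) (w := 16) (r := r) (by decide)
    (by norm_num) (by norm_num) (by norm_num) f₄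
  rw [r18, r17, r16] at hL
  rw [r18, r16] at hY
  set x := row₂ f₄ 10 1 d with hx
  have hxs : ∀ s : Fin d, x s = fun p => W s p.2 := by
    intro s
    funext p
    rw [hx, row₂, T₄.arr (by norm_num), T₃.arr (by norm_num), show ((p.1 : Fin 1) : ℕ) = 0 by omega,
      T₂.off fun i h => by simp at h; omega, T₁.val s.2 p.2.2]
    exact hW _ _
  have hxd : x d = fun p => χ p.2 := by
    funext p
    rw [hx, row₂, T₄.arr (by norm_num), T₃.arr (by norm_num), show ((p.1 : Fin 1) : ℕ) = 0 by omega,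
      T₂.val p.2.2]
    exact hχ _
  have hyd : row₁ f₄ 11 d d = 0 := by
    funext c
    exact T₄.val c.2
  have hys : ∀ s : Fin d, row₁ f₄ 11 d s = U s := by
    intro s
    funext c
    rw [row₁, T₄.off fun i h => by simp at h; omega, T₃.val s.2 c.2]
    exact hU _ _
  have hfr : ∀ b, (b < 10 ∨ 14 < b) → f₅ b = f b := fun b hb => by
    rw [h₅ b (by simp; omega), T₄.arr (by omega), T₃.arr (by omega), T₂.arr (by omega),
      T₁.arr (by omega)]
  have hWz := isUnit_iff_reduction (hL.mono (Nat.le_succ d)) hxs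
  have ev : checkW.eval ρ r f = (failUnless (.any 4 16 (isZero ⟨13, [4]⟩))).eval ρ r f₅ := by
    rw [checkW, Stm.eval_seq, ← e₁, Stm.eval_seq, ← e₂, Stm.eval_seq, ← e₃, Stm.eval_seq, ← e₄,
      Stm.eval_seq, e₅]
  refine ⟨_, ev, fun b hb hb' => ?_, ?_, fun hu j => ?_⟩
  · rw [failUnless_frame _ _ _ hb', hfr b hb]
  · rw [failUnless_eval, hfr 21 (by norm_num), Ex.eval_any_eq_zero, r16, hWz]
    simp only [isZero_eval, List.map_cons, List.map_nil, Function.update_self]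
  · rw [failUnless_frame _ _ _ (by norm_num)]
    have hY' := congrFun (hY d (by omega)) j
    rw [row₁, hyd, zero_add] at hY'
    rw [hY']
    have hz : f₅ 13 [d] = 0 := by
      refine hL.span d (by omega) ?_
      have : x d = ∑ s : Fin d, (χ ᵥ* W⁻¹) s • x s := by
        rw [hxd]
        funext p
        have : χ ᵥ* W⁻¹ ᵥ* W = χ := by
          rw [vecMul_vecMul, nonsing_inv_mul _ ((isUnit_iff_isUnit_det _).1 hu), vecMul_one]
        conv_lhs => rw [← this]
        simp [hxs, vecMul, dotProduct]
      rw [this]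
      exact sum_mem fun s _ => Submodule.smul_mem _ _ (Submodule.subset_span ⟨s, s.2, rfl⟩)
    have hrel := hL.rel d (by omega) hz
    set l : Fin d → F := fun s => L d s with hl
    have hlW : χ = - (l ᵥ* W) := by
      funext i
      have := congrFun hrel (0, i)
      rw [← Fin.sum_univ_eq_sum_range (fun q => L d q • x q), hxd] at this
      simp only [hxs, Pi.add_apply, Finset.sum_apply, Pi.smul_apply, smul_eq_mul,
        Pi.zero_apply] at this
      rw [Pi.neg_apply, vecMul, dotProduct]
      exact eq_neg_of_add_eq_zero_left this
    rw [hlW, neg_vecMul, vecMul_vecMul, mul_nonsing_inv _ ((isUnit_iff_isUnit_det _).1 hu),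
      vecMul_one, neg_vecMul, Pi.neg_apply, neg_neg,
      ← Fin.sum_univ_eq_sum_range (fun q => L d q • row₁ f₄ 11 d q)]
    simp [hys, vecMul, dotProduct, hl]

theorem checkU_eval {r : ℕ → ℕ} {f : Mem F} (hr : CheckRegs n d r) {U : Matrix (Fin d) (Fin d) F}
    (hU : ∀ s i : Fin d, f 0 [3 * d + s, i, 0] = U s i) :
    ∃ f', checkU.eval ρ r f = f' ∧
      (∀ b, b ≠ 10 → b ≠ 12 → b ≠ 14 → b ≠ 21 → b ≠ 25 → b ≠ 26 → f' b = f b) ∧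
      (f' 21 [] = 0 ↔ f 21 [] = 0 ∧ IsUnit U) := by
  obtain ⟨r0, r9, r16, r17, r18, r19, r20, r21⟩ := hr
  set f₁ := Stm.eval ρ (.loop 4 16 (.loop 5 16
    (.letAdd 8 4 20 (.asg ⟨10, [4, 9, 5]⟩ (.cell ⟨0, [8, 5, 9]⟩))))) r f with e₁
  have T₁ := Tab.loop₂ (ρ := ρ) (a := 10) (k := 4) (x := 16) (k' := 5) (x' := 16)
    (p := .letAdd 8 4 20 (.asg ⟨10, [4, 9, 5]⟩ (.cell ⟨0, [8, 5, 9]⟩))) (r := r) (f := f)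
    (fun i j => [i, 0, j]) (fun i j => f 0 [3 * d + i, j, 0]) (by simp) (by norm_num) (by
      intro i hi j hj g' h1 h2
      simp only [Stm.eval, Ex.eval, List.map_cons, List.map_nil, Function.update_apply,
        Nat.reduceEqDiff, reduceIte, r9, r20, h1 0 (by norm_num), add_comm i])
  rw [← e₁, r16] at T₁
  obtain ⟨f₅, e₅, h₅, L, hL, -⟩ := rowReduce_isReduction (ρ := ρ) (S := 10) (Y := 25) (PV := 12)
    (Z := 26) (t := 14) (m := 16) (w₁ := 17) (w₂ := 16) (w := 9) (r := r) (by decide)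
    (by norm_num) (by norm_num) (by norm_num) f₁
  rw [r17, r16] at hL
  have hxs : ∀ s : Fin d, row₂ f₁ 10 1 d s = fun p => U s p.2 := by
    intro s
    funext p
    rw [row₂, show ((p.1 : Fin 1) : ℕ) = 0 by omega, T₁.val s.2 p.2.2]
    exact hU _ _
  have hWz := isUnit_iff_reduction hL hxs
  have ev : checkU.eval ρ r f = (failUnless (.any 4 16 (isZero ⟨26, [4]⟩))).eval ρ r f₅ := by
    rw [checkU, Stm.eval_seq, ← e₁, Stm.eval_seq, e₅]
  refine ⟨_, ev, fun b h1 h2 h3 h4 h5 h6 => ?_, ?_⟩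
  · rw [failUnless_frame _ _ _ h4, h₅ b (by simp; omega), T₁.arr h1]
  · rw [failUnless_eval, h₅ 21 (by decide), T₁.arr (by norm_num), Ex.eval_any_eq_zero, r16, hWz]
    simp only [isZero_eval, List.map_cons, List.map_nil, Function.update_self]

/-- The row vectors of weight `χ`. -/
def leftEig (A : Fin d → Matrix (Fin n) (Fin n) F) (χ : Fin d → F) : Submodule F (Fin n → F) where
  carrier := {y | ∀ i, y ᵥ* A i = χ i • y}
  add_mem' ha hb i := by rw [add_vecMul, ha i, hb i, smul_add]
  zero_mem' i := by simp
  smul_mem' c y hy i := by rw [smul_vecMul, hy i, smul_comm]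

/-- The column vectors of weight `ψ`. -/
def rightEig (B : Fin d → Matrix (Fin n) (Fin n) F) (ψ : Fin d → F) :
    Submodule F (Fin n → F) where
  carrier := {y | ∀ i, B i *ᵥ y = ψ i • y}
  add_mem' ha hb i := by rw [mulVec_add, ha i, hb i, smul_add]
  zero_mem' i := by simp
  smul_mem' c y hy i := by rw [mulVec_smul, hy i, smul_comm]

/-- Unit rows that accompany a reduction record how each row has been formed from the original ones.
-/
theorem unit_rows_relation {g f : Mem F} {Y i c : ℕ} {L : ℕ → ℕ → F}
    (hf : ∀ i < n, ∀ j < n, f Y [i, j] = if i = j then 1 else 0)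
    (hY : row₁ g Y n i = row₁ f Y n i + ∑ q ∈ Finset.range i, L i q • row₁ f Y n q)
    (hi : i < n) (hc : c < n) : g Y [i, c] = relation L i c := by
  have := congrFun hY ⟨c, hc⟩
  simp only [row₁, Pi.add_apply, Finset.sum_apply, Pi.smul_apply, smul_eq_mul] at this
  rw [this, hf i hi c hc, relation, Finset.sum_congr rfl fun q hq => by
    rw [hf q (by have := Finset.mem_range.1 hq; omega) c hc]]
  simp only [mul_ite, mul_one, mul_zero]
  rw [Finset.sum_ite_eq']
  simp only [Finset.mem_range]
  by_cases h : i = c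
  · subst h; simp
  · rw [if_neg h, if_neg (Ne.symm h), zero_add]

/-- The vector `x i` is the concatenation of the i-th rows of all the matrices `A j - χ j`. A row
vector of weight `χ` is nothing but a linear relation between these vectors. -/
theorem kernelA_eval {r : ℕ → ℕ} {f : Mem F} (hr : CheckRegs n d r)
    {A : Fin d → Matrix (Fin n) (Fin n) F} {χ : Fin d → F}
    (hA : ∀ (i : Fin d) (j k : Fin n), f 0 [i, j, k] = A i j k)
    (hχ : ∀ i : Fin d, f 0 [4 * d, i, 0] = χ i) :
    ∃ f', kernelA.eval ρ r f = f' ∧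
      (∀ b, b ≠ 15 → b ≠ 16 → b ≠ 12 → b ≠ 17 → b ≠ 14 → f' b = f b) ∧
      ∃ (x : ℕ → Fin d × Fin n → F) (L : ℕ → ℕ → F),
        IsReduction n x L (fun i => f' 17 [i] = 0) ∧
        (∀ y, y ∈ leftEig A χ ↔ ∑ i : Fin n, y i • x i = 0) ∧
        ∀ i < n, ∀ c < n, f' 16 [i, c] = relation L i c := by
  obtain ⟨r0, r9, r16, r17, r18, r19, r20, r21⟩ := hr
  obtain ⟨f₁, e₁, v₁, h₁⟩ := Tab.loop₃ (ρ := ρ) (a := 15) (k₁ := 4) (x₁ := 0) (k₂ := 5) (x₂ := 16)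
    (k₃ := 6) (x₃ := 0) (p := .asg ⟨15, [4, 5, 6]⟩
      (.sub (.cell ⟨0, [5, 4, 6]⟩) (.mul (.cell ⟨0, [21, 5, 9]⟩) (.delta 4 6)))) (r := r) (f := f)
    (fun i j k => [i, j, k])
    (fun i j k => f 0 [j, i, k] - f 0 [4 * d, j, 0] * if i = k then 1 else 0)
    (by simp) (by norm_num) (by norm_num) (by norm_num) (by
      intro i hi j hj k hk g hg
      simp only [Stm.eval, Ex.eval, List.map_cons, List.map_nil, Function.update_apply,
        Nat.reduceEqDiff, reduceIte, r9, r21, hg 0 (by norm_num)])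
  rw [r0, r16] at v₁ h₁
  have h₁' : ∀ b, b ≠ 15 → f₁ b = f b := fun b hb => funext fun l => h₁ b l fun h => absurd h hb
  set f₂ := Stm.eval ρ (.loop 4 0 (.loop 5 0 (.asg ⟨16, [4, 5]⟩ (.delta 4 5)))) r f₁ with e₂
  have T₂ := Tab.loop₂ (ρ := ρ) (a := 16) (k := 4) (x := 0) (k' := 5) (x' := 0)
    (p := .asg ⟨16, [4, 5]⟩ (.delta 4 5)) (r := r) (f := f₁)
    (fun i j => [i, j]) (fun i j => if i = j then 1 else 0) (by simp) (by norm_num) (by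
      intro i hi j hj g' h1 h2
      simp only [Stm.eval, Ex.eval, List.map_cons, List.map_nil, Function.update_apply,
        Nat.reduceEqDiff, reduceIte])
  rw [← e₂, r0] at T₂
  obtain ⟨f₃, e₃, h₃, L, hL, hY⟩ := rowReduce_isReduction (ρ := ρ) (S := 15) (Y := 16) (PV := 12)
    (Z := 17) (t := 14) (m := 0) (w₁ := 16) (w₂ := 0) (w := 0) (r := r) (by decide)
    (by norm_num) (by norm_num) (by norm_num) f₂
  rw [r16, r0] at hL
  rw [r0] at hY
  refine ⟨f₃, ?_, fun b b1 b2 b3 b4 b5 => ?_, row₂ f₂ 15 d n, L, hL, fun y => ?_, ?_⟩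
  · rw [kernelA, Stm.eval_seq, e₁, Stm.eval_seq, ← e₂, e₃]
  · rw [h₃ b (by simp; omega), T₂.arr b2, h₁' b b1]
  · have hx : ∀ (i : Fin n) p, row₂ f₂ 15 d n i p = A p.1 i p.2 - χ p.1 * if i = p.2 then 1 else 0 := by
      intro i p
      rw [row₂, T₂.arr (by norm_num), v₁ i i.2 p.1 p.1.2 p.2 p.2.2, hA, hχ]
      simp only [Fin.ext_iff]
    have : ∀ p, (∑ i : Fin n, y i • row₂ f₂ 15 d n i) p = (y ᵥ* A p.1) p.2 - χ p.1 * y p.2 := by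
      intro p
      simp only [Finset.sum_apply, Pi.smul_apply, smul_eq_mul, hx, mul_sub, Finset.sum_sub_distrib]
      congr 1
      rw [Finset.sum_eq_single p.2]
      · simp [mul_comm]
      · intro i _ hi; simp [hi]
      · simp
    constructor
    · intro h
      funext p
      have h2 := congrFun (h p.1) p.2
      rw [this, h2]
      simp
    · intro h i
      funext c
      have h2 := congrFun h (i, c)
      rw [this] at h2
      exact sub_eq_zero.1 h2
  · exact fun i hi c hc => unit_rows_relation (fun i hi j hj => T₂.val hi hj) (hY i hi) hi hc

/-- As in `kernelA_eval`, with columns in place of rows: column vectors of weight `χ` are the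
relations between the concatenated columns. -/
theorem kernelB_eval {r : ℕ → ℕ} {f : Mem F} (hr : CheckRegs n d r)
    {A : Fin d → Matrix (Fin n) (Fin n) F} {χ : Fin d → F}
    (hA : ∀ (i : Fin d) (j k : Fin n), f 0 [d + i, j, k] = A i j k)
    (hχ : ∀ i : Fin d, f 11 [d, i] = - χ i) :
    ∃ f', kernelB.eval ρ r f = f' ∧
      (∀ b, b ≠ 18 → b ≠ 19 → b ≠ 12 → b ≠ 20 → b ≠ 14 → f' b = f b) ∧
      ∃ (x : ℕ → Fin d × Fin n → F) (L : ℕ → ℕ → F),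
        IsReduction n x L (fun i => f' 20 [i] = 0) ∧
        (∀ y, y ∈ rightEig A χ ↔ ∑ i : Fin n, y i • x i = 0) ∧
        ∀ i < n, ∀ c < n, f' 19 [i, c] = relation L i c := by
  obtain ⟨r0, r9, r16, r17, r18, r19, r20, r21⟩ := hr
  obtain ⟨f₁, e₁, v₁, h₁⟩ := Tab.loop₃ (ρ := ρ) (a := 18) (k₁ := 4) (x₁ := 0) (k₂ := 5) (x₂ := 16)
    (k₃ := 6) (x₃ := 0) (p := .letAdd 8 5 16 (.asg ⟨18, [4, 5, 6]⟩
      (.add (.cell ⟨0, [8, 6, 4]⟩) (.mul (.cell ⟨11, [16, 5]⟩) (.delta 4 6))))) (r := r) (f := f)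
    (fun i j k => [i, j, k])
    (fun i j k => f 0 [d + j, k, i] + f 11 [d, j] * if i = k then 1 else 0)
    (by simp) (by norm_num) (by norm_num) (by norm_num) (by
      intro i hi j hj k hk g hg
      simp only [Stm.eval, Ex.eval, List.map_cons, List.map_nil, Function.update_apply,
        Nat.reduceEqDiff, reduceIte, r16, hg 0 (by norm_num), hg 11 (by norm_num), add_comm j])
  rw [r0, r16] at v₁ h₁
  have h₁' : ∀ b, b ≠ 18 → f₁ b = f b := fun b hb => funext fun l => h₁ b l fun h => absurd h hb
  set f₂ := Stm.eval ρ (.loop 4 0 (.loop 5 0 (.asg ⟨19, [4, 5]⟩ (.delta 4 5)))) r f₁ with e₂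
  have T₂ := Tab.loop₂ (ρ := ρ) (a := 19) (k := 4) (x := 0) (k' := 5) (x' := 0)
    (p := .asg ⟨19, [4, 5]⟩ (.delta 4 5)) (r := r) (f := f₁)
    (fun i j => [i, j]) (fun i j => if i = j then 1 else 0) (by simp) (by norm_num) (by
      intro i hi j hj g' h1 h2
      simp only [Stm.eval, Ex.eval, List.map_cons, List.map_nil, Function.update_apply,
        Nat.reduceEqDiff, reduceIte])
  rw [← e₂, r0] at T₂
  obtain ⟨f₃, e₃, h₃, L, hL, hY⟩ := rowReduce_isReduction (ρ := ρ) (S := 18) (Y := 19) (PV := 12)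
    (Z := 20) (t := 14) (m := 0) (w₁ := 16) (w₂ := 0) (w := 0) (r := r) (by decide)
    (by norm_num) (by norm_num) (by norm_num) f₂
  rw [r16, r0] at hL
  rw [r0] at hY
  refine ⟨f₃, ?_, fun b b1 b2 b3 b4 b5 => ?_, row₂ f₂ 18 d n, L, hL, fun y => ?_, ?_⟩
  · rw [kernelB, Stm.eval_seq, e₁, Stm.eval_seq, ← e₂, e₃]
  · rw [h₃ b (by simp; omega), T₂.arr b2, h₁' b b1]
  · have hx : ∀ (i : Fin n) p, row₂ f₂ 18 d n i p = A p.1 p.2 i - χ p.1 * if i = p.2 then 1 else 0 := by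
      intro i p
      rw [row₂, T₂.arr (by norm_num), v₁ i i.2 p.1 p.1.2 p.2 p.2.2, hA, hχ, neg_mul, ← sub_eq_add_neg]
      simp only [Fin.ext_iff]
    have : ∀ p, (∑ i : Fin n, y i • row₂ f₂ 18 d n i) p = (A p.1 *ᵥ y) p.2 - χ p.1 * y p.2 := by
      intro p
      simp only [Finset.sum_apply, Pi.smul_apply, smul_eq_mul, hx, mul_sub, Finset.sum_sub_distrib]
      congr 1
      · simp only [mulVec, dotProduct, mul_comm]
      rw [Finset.sum_eq_single p.2]
      · simp [mul_comm]
      · intro i _ hi; simp [hi]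
      · simp
    constructor
    · intro h
      funext p
      have h2 := congrFun (h p.1) p.2
      rw [this, h2]
      simp
    · intro h i
      funext c
      have h2 := congrFun h (i, c)
      rw [this] at h2
      exact sub_eq_zero.1 h2
  · exact fun i hi c hc => unit_rows_relation (fun i hi j hj => T₂.val hi hj) (hY i hi) hi hc

open Classical in
/-- The weight spaces of `χ` and of its image under the linear map that sends the rows of `W` to the
rows of `U` have the same dimension. -/
def CheckOK (A B : Fin d → Matrix (Fin n) (Fin n) F) (W U : Matrix (Fin d) (Fin d) F)
    (χ : Fin d → F) : Prop :=
  IsUnit W ∧ IsUnit U ∧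
    Module.finrank F (leftEig A χ) = Module.finrank F (rightEig B (χ ᵥ* W⁻¹ ᵥ* U))

-- The coefficient matrix pairs the t-th marked index on one side with the t-th marked index on the
-- other. Thus the program can form a sum over pairs of basis vectors without storing a list of
-- marked indices.
open Classical in
theorem sum_hit {z z' : ℕ → Prop} {k : ℕ} (hz : Nat.count z n = k) (hz' : Nat.count z' n = k)
    {e e' : Fin k → ℕ} (he : ∀ t, e t < n ∧ z (e t) ∧ Nat.count z (e t) = t)
    (he' : ∀ t, e' t < n ∧ z' (e' t) ∧ Nat.count z' (e' t) = t) (g : ℕ → ℕ → F) :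
    ∑ i ∈ Finset.range n, ∑ j ∈ Finset.range n, (if z i then if z' j then
      if Nat.count z i = Nat.count z' j then 1 else 0 else 0 else 0) * g i j =
      ∑ t, g (e t) (e' t) := by
  have inner : ∀ i ∈ Finset.range n, ∑ j ∈ Finset.range n, (if z i then if z' j then
      if Nat.count z i = Nat.count z' j then 1 else 0 else 0 else 0) * g i j =
      if z i then (if h : Nat.count z i < k then g i (e' ⟨_, h⟩) else 0) else 0 := by
    intro i hi
    split_ifs with h1 h2
    · rw [Finset.sum_eq_single (e' ⟨_, h2⟩)]
      · rw [if_pos (he' _).2.1, if_pos (he' ⟨_, h2⟩).2.2.symm, one_mul]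
      · intro j _ hj
        split_ifs with h3 h4
        · exact absurd (Nat.count_injective h3 (he' _).2.1 (h4.symm.trans (he' ⟨_, h2⟩).2.2.symm)) hj
        · simp
        · simp
      · intro h; exact absurd (Finset.mem_range.2 (he' _).1) h
    · exfalso
      have := Nat.count_monotone z (show i + 1 ≤ n from Finset.mem_range.1 hi)
      rw [Nat.count_succ, if_pos h1] at this
      omega
    · simp
  rw [Finset.sum_congr rfl inner]
  symm
  rw [← Finset.sum_filter]
  refine Finset.sum_bij (fun t _ => e t) ?_ ?_ ?_ ?_
  · intro t _
    exact Finset.mem_filter.2 ⟨Finset.mem_range.2 (he t).1, (he t).2.1⟩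
  · intro t _ t' _ h
    have h : e t = e t' := h
    exact Fin.ext ((he t).2.2.symm.trans ((congrArg _ h).trans (he t').2.2))
  · intro i hi
    rw [Finset.mem_filter, Finset.mem_range] at hi
    have := Nat.count_monotone z (show i + 1 ≤ n from hi.1)
    rw [Nat.count_succ, if_pos hi.2] at this
    exact ⟨⟨Nat.count z i, by omega⟩, Finset.mem_univ _,
      Nat.count_injective (he _).2.1 hi.2 (he _).2.2⟩
  · intro t _
    have h := (he t).2.2
    rw [dif_pos (h ▸ t.2)]
    congr 2
    exact Fin.ext h.symm

open Classical in
theorem combine_eval {r : ℕ → ℕ} {f : Mem F} (hr : r 0 = n) {K K' : Submodule F (Fin n → F)}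
    {V V' : Type*} [AddCommGroup V] [Module F V] [AddCommGroup V'] [Module F V']
    {x : ℕ → V} {x' : ℕ → V'} {L L' : ℕ → ℕ → F}
    (h : IsReduction n x L (fun i => f 17 [i] = 0)) (h' : IsReduction n x' L' (fun i => f 20 [i] = 0))
    (hK : ∀ y, y ∈ K ↔ ∑ i : Fin n, y i • x i = 0)
    (hK' : ∀ y, y ∈ K' ↔ ∑ i : Fin n, y i • x' i = 0)
    (hL : ∀ i < n, ∀ c < n, f 16 [i, c] = relation L i c)
    (hL' : ∀ i < n, ∀ c < n, f 19 [i, c] = relation L' i c) :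
    ∃ f', combine.eval ρ r f = f' ∧ (∀ b, b ≠ 21 → b ≠ 22 → b ≠ 23 → f' b = f b) ∧
      (f' 21 [] = 0 ↔ f 21 [] = 0 ∧ Module.finrank F K = Module.finrank F K') ∧
      (Module.finrank F K = Module.finrank F K' → ∃ (k : ℕ) (φ v : Fin k → Fin n → F),
        LinearIndependent F φ ∧ Submodule.span F (Set.range φ) = K ∧
        LinearIndependent F v ∧ Submodule.span F (Set.range v) = K' ∧
        mat n f' 22 [] = mat n f 22 [] + ∑ t, vecMulVec (v t) (φ t)) := by
  obtain ⟨e, he, li, sp⟩ := h.kernel hK rfl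
  obtain ⟨e', he', li', sp'⟩ := h'.kernel hK' rfl
  have d1 : Module.finrank F K = Nat.count (fun i => f 17 [i] = 0) n := by
    rw [← sp, finrank_span_eq_card li, Fintype.card_fin]
  have d2 : Module.finrank F K' = Nat.count (fun i => f 20 [i] = 0) n := by
    rw [← sp', finrank_span_eq_card li', Fintype.card_fin]
  set g₁ := (failUnless (.ifz (.cntEq 4 5 6 0 0 (isZero ⟨17, [4]⟩) (isZero ⟨20, [4]⟩)) .one
    .zero)).eval ρ r f with hg₁
  have f₁ : ∀ b, b ≠ 21 → g₁ b = f b := fun b hb => failUnless_frame _ _ _ hb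
  set g₂ := Stm.eval ρ (.loop 4 0 (.loop 5 0 (.asg ⟨23, [4, 5]⟩ (.ifz (.cell ⟨17, [4]⟩)
    (.ifz (.cell ⟨20, [5]⟩)
      (.cntEq 6 7 8 4 5 (isZero ⟨17, [6]⟩) (isZero ⟨20, [6]⟩)) .zero) .zero)))) r g₁ with hg₂
  have T₂ := Tab.loop₂ (ρ := ρ) (a := 23) (k := 4) (x := 0) (k' := 5) (x' := 0)
    (p := .asg ⟨23, [4, 5]⟩ (.ifz (.cell ⟨17, [4]⟩) (.ifz (.cell ⟨20, [5]⟩)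
    (.cntEq 6 7 8 4 5 (isZero ⟨17, [6]⟩) (isZero ⟨20, [6]⟩)) .zero) .zero)) (r := r) (f := g₁)
    (fun i j => [i, j]) (fun i j => if f 17 [i] = 0 then if f 20 [j] = 0 then
      if Nat.count (fun i => f 17 [i] = 0) i = Nat.count (fun i => f 20 [i] = 0) j then 1 else 0
      else 0 else 0) (by simp) (by norm_num) (by
      intro i hi j hj g' h1 h2
      simp only [Stm.eval, Ex.eval, ne_eq, isZero_eval, not_not, List.map_cons, List.map_nil,
        Function.update_apply, Nat.reduceEqDiff, reduceIte, h1 17 (by norm_num),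
        h1 20 (by norm_num), f₁ 17 (by norm_num), f₁ 20 (by norm_num)])
  rw [← hg₂, hr] at T₂
  set g₃ := Stm.eval ρ (.loop 4 0 (.loop 5 0 (.asg ⟨22, [4, 5]⟩ (.add (.cell ⟨22, [4, 5]⟩)
      (.sum 6 0 (.sum 7 0 (.mul (.cell ⟨23, [6, 7]⟩)
        (.mul (.cell ⟨19, [7, 4]⟩) (.cell ⟨16, [6, 5]⟩))))))))) r g₂ with hg₃
  have T₃ := Tab.loop₂ (ρ := ρ) (a := 22) (k := 4) (x := 0) (k' := 5) (x' := 0)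
    (p := .asg ⟨22, [4, 5]⟩ (.add (.cell ⟨22, [4, 5]⟩)
      (.sum 6 0 (.sum 7 0 (.mul (.cell ⟨23, [6, 7]⟩)
        (.mul (.cell ⟨19, [7, 4]⟩) (.cell ⟨16, [6, 5]⟩))))))) (r := r) (f := g₂)
    (fun i j => [i, j]) (fun i j => f 22 [i, j] + ∑ p ∈ Finset.range n, ∑ q ∈ Finset.range n,
      g₂ 23 [p, q] * (f 19 [q, i] * f 16 [p, j])) (by simp) (by norm_num) (by
      intro i hi j hj g' h1 h2
      simp only [Stm.eval, Ex.eval, List.map_cons, List.map_nil,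
        Function.update_apply, Nat.reduceEqDiff, reduceIte, h1 23 (by norm_num), hr,
        OfNat.zero_ne_ofNat, h1 19 (by norm_num), h1 16 (by norm_num), f₁ 19 (by norm_num),
        f₁ 16 (by norm_num), T₂.arr (b := 19) (by norm_num), T₂.arr (b := 16) (by norm_num)]
      rw [h2 [i, j] (by simp; omega), T₂.arr (by norm_num), f₁ 22 (by norm_num)])
  rw [← hg₃, hr] at T₃
  refine ⟨g₃, by rw [combine, Stm.eval_seq, Stm.eval_seq], fun b b1 b2 b3 => ?_, ?_, fun hd => ?_⟩
  · rw [T₃.arr b2, T₂.arr b3, f₁ b b1]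
  · rw [T₃.arr (by norm_num), T₂.arr (by norm_num), hg₁, failUnless_eval, d1, d2]
    simp only [Ex.eval, ne_eq, isZero_eval, not_not, List.map_cons, List.map_nil,
        Function.update_apply, reduceIte, hr, and_congr_right_iff]
    intro _
    split_ifs <;> simp_all
  · have hc : Nat.count (fun i => f 20 [i] = 0) n = Nat.count (fun i => f 17 [i] = 0) n := by
      rw [← d1, ← d2, hd]
    -- The basis of the second kernel is taken anew, indexed by the same type as that of the first,
    -- so that the two can be paired.
    obtain ⟨e', he', li', sp'⟩ := h'.kernel hK' hc
    refine ⟨_, _, _, li, sp, li', sp', ?_⟩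
    ext i j
    have h3 := T₃.val i.2 j.2
    simp only [mat, of_apply, List.nil_append, Matrix.add_apply, Matrix.sum_apply, vecMulVec_apply]
    rw [h3, Finset.sum_congr rfl fun p hp => Finset.sum_congr rfl fun q hq => by
      rw [T₂.val (Finset.mem_range.1 hp) (Finset.mem_range.1 hq)],
      sum_hit rfl hc he he' fun p q => f 19 [q, i] * f 16 [p, j]]
    congr 1
    refine Finset.sum_congr rfl fun t _ => ?_
    rw [hL _ (he t).1 _ j.2, hL' _ (he' t).1 _ i.2]

/-- The effect of the whole test. -/
theorem check_eval {r : ℕ → ℕ} {f : Mem F} (hr : r 0 = n)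
    {A B : Fin d → Matrix (Fin n) (Fin n) F} {W U : Matrix (Fin d) (Fin d) F} {χ : Fin d → F}
    (hA : ∀ (i : Fin d) (j k : Fin n), f 0 [i, j, k] = A i j k)
    (hB : ∀ (i : Fin d) (j k : Fin n), f 0 [d + i, j, k] = B i j k)
    (hW : ∀ s i : Fin d, f 0 [2 * d + s, i, 0] = W s i)
    (hU : ∀ s i : Fin d, f 0 [3 * d + s, i, 0] = U s i)
    (hχ : ∀ i : Fin d, f 0 [4 * d, i, 0] = χ i) :
    ∃ f', (check d).eval ρ r f = f' ∧ (∀ b, (b < 10 ∨ 26 < b) → f' b = f b) ∧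
      (f' 21 [] = 0 ↔ f 21 [] = 0 ∧ CheckOK A B W U χ) ∧
      (CheckOK A B W U χ → ∃ (k : ℕ) (φ v : Fin k → Fin n → F),
        LinearIndependent F φ ∧ Submodule.span F (Set.range φ) = leftEig A χ ∧
        LinearIndependent F v ∧
        Submodule.span F (Set.range v) = rightEig B (χ ᵥ* W⁻¹ ᵥ* U) ∧
        mat n f' 22 [] = mat n f 22 [] + ∑ t, vecMulVec (v t) (φ t)) := by
  set r' := Function.update (Function.update (Function.update (Function.update (Function.update
    (Function.update (Function.update r 9 0) 16 d) 17 1) 18 (d + 1)) 19 (2 * d)) 20 (3 * d)) 21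
    (4 * d) with hr'
  have R : CheckRegs n d r' := by
    constructor <;> simp [hr', hr]
  obtain ⟨f₁, e₁, h₁, c₁, ψ₁⟩ := checkW_eval (ρ := ρ) R hW hU hχ
  have h0 : f₁ 0 = f 0 := h₁ 0 (by norm_num) (by norm_num)
  obtain ⟨f₂, e₂, h₂, c₂⟩ := checkU_eval (ρ := ρ) (f := f₁) R (by rw [h0]; exact hU)
  have h0' : f₂ 0 = f 0 := by rw [h₂ 0 (by decide) (by decide) (by decide) (by decide) (by decide)
    (by decide), h0]
  have h11 : f₂ 11 = f₁ 11 := h₂ 11 (by decide) (by decide) (by decide) (by decide) (by decide)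
    (by decide)
  obtain ⟨f₃, e₃, h₃, x, L, hL, hK, hY⟩ := kernelA_eval (ρ := ρ) (f := f₂) (A := A) (χ := χ) R
    (by rw [h0']; exact hA) (by rw [h0']; exact hχ)
  have g₃ : ∀ b, b ≠ 15 → b ≠ 16 → b ≠ 12 → b ≠ 17 → b ≠ 14 → f₃ b = f₂ b := h₃
  obtain ⟨f₄, e₄, h₄, x', L', hL', hK', hY'⟩ := kernelB_eval (ρ := ρ) (f := f₃) (A := B)
    (χ := fun j => - f₁ 11 [d, (j : ℕ)]) R (by
      rw [h₃ 0 (by decide) (by decide) (by decide) (by decide) (by decide), h0']; exact hB) (by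
      rw [h₃ 11 (by decide) (by decide) (by decide) (by decide) (by decide), h11]; simp)
  have h17 : f₄ 17 = f₃ 17 := h₄ 17 (by decide) (by decide) (by decide) (by decide) (by decide)
  have h16 : f₄ 16 = f₃ 16 := h₄ 16 (by decide) (by decide) (by decide) (by decide) (by decide)
  obtain ⟨f₅, e₅, h₅, c₅, G⟩ := combine_eval (ρ := ρ) (f := f₄) R.r0 (by rw [h17]; exact hL) hL' hK hK'
    (by rw [h16]; exact hY) hY'
  have h21 : f₄ 21 = f₂ 21 := by
    rw [h₄ 21 (by decide) (by decide) (by decide) (by decide) (by decide),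
      h₃ 21 (by decide) (by decide) (by decide) (by decide) (by decide)]
  have h22 : f₄ 22 = f 22 := by
    rw [h₄ 22 (by decide) (by decide) (by decide) (by decide) (by decide),
      h₃ 22 (by decide) (by decide) (by decide) (by decide) (by decide),
      h₂ 22 (by decide) (by decide) (by decide) (by decide) (by decide) (by decide),
      h₁ 22 (by norm_num) (by norm_num)]
  have hψ : IsUnit W → (fun j : Fin d => - f₁ 11 [d, (j : ℕ)]) = χ ᵥ* W⁻¹ ᵥ* U := fun hu => by
    funext j
    rw [ψ₁ hu, neg_neg]
  refine ⟨f₅, ?_, fun b hb => ?_, ?_, fun hok => ?_⟩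
  · rw [check, Stm.eval_letConst, Stm.eval_letConst, Stm.eval_letConst, Stm.eval_letConst,
      Stm.eval_letConst, Stm.eval_letConst, Stm.eval_letConst, ← hr', Stm.eval_seq, e₁,
      Stm.eval_seq, e₂, Stm.eval_seq, e₃, Stm.eval_seq, e₄, e₅]
  · rw [h₅ b (by omega) (by omega) (by omega),
      h₄ b (by omega) (by omega) (by omega) (by omega) (by omega),
      h₃ b (by omega) (by omega) (by omega) (by omega) (by omega),
      h₂ b (by omega) (by omega) (by omega) (by omega) (by omega) (by omega),
      h₁ b (by omega) (by omega)]
  · rw [c₅, h21, c₂, c₁, CheckOK]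
    constructor
    · rintro ⟨⟨⟨a, b⟩, c⟩, e⟩
      rw [hψ b] at e
      exact ⟨a, b, c, e⟩
    · rintro ⟨a, b, c, e⟩
      rw [← hψ b] at e
      exact ⟨⟨⟨a, b⟩, c⟩, e⟩
  · have := G (by rw [hψ hok.1]; exact hok.2.2)
    rw [hψ hok.1] at this
    obtain ⟨k, φ, v, h1, h2, h3, h4, h5⟩ := this
    refine ⟨k, φ, v, h1, h2, h3, h4, ?_⟩
    rw [h5]
    simp only [mat, h22]

end

/-! ### Conjugacy and weights -/

section

variable {F : Type*} [Field F] {n d : ℕ}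

/-- The matrices are simultaneously diagonalizable, with the given weights. -/
structure Weights (A : Fin d → Matrix (Fin n) (Fin n) F) (P Q : Matrix (Fin n) (Fin n) F)
    (a : Fin n → Fin d → F) : Prop where
  PQ : P * Q = 1
  QP : Q * P = 1
  eq : ∀ i, A i = dg P Q fun p => a p i

variable {A B : Fin d → Matrix (Fin n) (Fin n) F} {P Q P' Q' : Matrix (Fin n) (Fin n) F}
  {a b : Fin n → Fin d → F}

theorem Weights.row_mem (h : Weights A P Q a) (p : Fin n) : Q p ∈ leftEig A (a p) := by
  intro i
  have : Q * A i = diagonal (fun p => a p i) * Q := by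
    rw [h.eq, dg, ← mul_assoc, ← mul_assoc, h.QP, one_mul]
  have := congrFun this p
  funext c
  have h2 := congrFun this c
  rw [diagonal_mul] at h2
  exact h2

theorem Weights.col_mem (h : Weights A P Q a) (p : Fin n) :
    P *ᵥ Pi.single p 1 ∈ rightEig A (a p) := by
  intro i
  rw [h.eq, dg, mulVec_mulVec, mul_assoc, h.QP, mul_one, ← mulVec_mulVec, ← mulVec_smul]
  congr 1
  rw [diagonal_mulVec_single]
  ext q
  by_cases hq : q = p
  · subst hq; simp
  · simp [hq]

theorem Weights.isEig (h : Weights A P Q a) (p : Fin n) (i : Fin d) : IsEig (A i) (a p i) := by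
  rw [h.eq, isEig_dg h.PQ h.QP]
  exact ⟨p, rfl⟩

/-- In the eigenbasis, a vector of weight `ψ` is supported on the points whose weight is `ψ`. -/
theorem Weights.apply_eq_zero (h : Weights B P' Q' b) {ψ : Fin d → F} {v : Fin n → F}
    (hv : v ∈ rightEig B ψ) {p : Fin n} (hp : b p ≠ ψ) : (Q' *ᵥ v) p = 0 := by
  obtain ⟨j, hj⟩ := Function.ne_iff.1 hp
  have h1 : diagonal (fun p => b p j) *ᵥ (Q' *ᵥ v) = ψ j • (Q' *ᵥ v) := by
    rw [← mulVec_smul, ← hv j, h.eq, dg, mulVec_mulVec, mulVec_mulVec, ← mul_assoc, ← mul_assoc,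
      h.QP, one_mul]
  have := congrFun h1 p
  rw [mulVec_diagonal, Pi.smul_apply, smul_eq_mul] at this
  by_contra h0
  exact hj (mul_right_cancel₀ h0 this)

/-- Independence of the weight spaces of distinct weights: at each point of the eigenbasis at most
one summand can have a nonzero coordinate. -/
theorem Weights.sum_eq_zero (h : Weights B P' Q' b) {X : Finset (Fin d → F)}
    {ψ : (Fin d → F) → Fin d → F} (hψ : Function.Injective ψ) {s : (Fin d → F) → Fin n → F}
    (hs : ∀ χ ∈ X, s χ ∈ rightEig B (ψ χ)) (h0 : ∑ χ ∈ X, s χ = 0) {χ : Fin d → F} (hχ : χ ∈ X) :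
    s χ = 0 := by
  have hQ : Q' *ᵥ s χ = 0 := by
    funext p
    by_cases hp : b p = ψ χ
    · have := congrFun (congrArg (fun v => Q' *ᵥ v) h0) p
      simp only [mulVec_sum, mulVec_zero, Finset.sum_apply] at this
      rw [Finset.sum_eq_single χ] at this
      · exact this
      · intro χ' hχ' hne
        exact h.apply_eq_zero (hs χ' hχ') fun h => hne (hψ (h.symm.trans hp))
      · exact fun h => absurd hχ h
    · exact h.apply_eq_zero (hs χ hχ) hp
  rw [← one_mulVec (s χ), ← h.PQ, ← mulVec_mulVec, hQ, mulVec_zero]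

/-- The sum of the products of bases of corresponding weight spaces conjugates `A` into the span of
`B`. -/
theorem conjugating_matrix (hA : Weights A P Q a) (hB : Weights B P' Q' b)
    {W U : Matrix (Fin d) (Fin d) F} (hW : IsUnit W) (hU : IsUnit U) {X : Finset (Fin d → F)}
    (hX : ∀ p, a p ∈ X) {k : (Fin d → F) → ℕ} {φ v : ∀ χ, Fin (k χ) → Fin n → F}
    (hφ : ∀ χ ∈ X, Submodule.span F (Set.range (φ χ)) = leftEig A χ)
    (hv : ∀ χ ∈ X, LinearIndependent F (v χ) ∧
      Submodule.span F (Set.range (v χ)) = rightEig B (χ ᵥ* W⁻¹ ᵥ* U))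
    {G : Matrix (Fin n) (Fin n) F} (hG : G = ∑ χ ∈ X, ∑ t, vecMulVec (v χ t) (φ χ t)) :
    IsUnit G ∧ ∀ i, G * A i = (∑ j, (U⁻¹ * W) j i • B j) * G := by
  have hWd := (isUnit_iff_isUnit_det _).1 hW
  have hUd := (isUnit_iff_isUnit_det _).1 hU
  have hφ' : ∀ χ ∈ X, ∀ t, φ χ t ∈ leftEig A χ := fun χ hχ t => by
    rw [← hφ χ hχ]; exact Submodule.subset_span ⟨t, rfl⟩
  have hv' : ∀ χ ∈ X, ∀ t, v χ t ∈ rightEig B (χ ᵥ* W⁻¹ ᵥ* U) := fun χ hχ t => by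
    rw [← (hv χ hχ).2]; exact Submodule.subset_span ⟨t, rfl⟩
  -- `U⁻¹ * W` inverts the map on weights. This makes the map injective, and it also gives the
  -- coefficients with respect to `B` of the image of `A i`.
  have hback : ∀ χ : Fin d → F, χ ᵥ* W⁻¹ ᵥ* U ᵥ* (U⁻¹ * W) = χ := fun χ => by
    rw [vecMul_vecMul, vecMul_vecMul, ← mul_assoc U, mul_nonsing_inv _ hUd, one_mul,
      nonsing_inv_mul _ hWd, vecMul_one]
  refine ⟨?_, fun i => ?_⟩
  · rw [← mulVec_injective_iff_isUnit]
    refine (injective_iff_map_eq_zero (mulVecLin G)).2 fun x hx => ?_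
    have hx : G *ᵥ x = 0 := hx
    -- `G *ᵥ x = 0` is a vanishing sum of vectors from distinct weight spaces of `B`, so that each
    -- summand vanishes.
    have hterm : ∀ χ ∈ X, ∑ t, (φ χ t ⬝ᵥ x) • v χ t = 0 := by
      intro χ hχ
      refine hB.sum_eq_zero (ψ := fun χ => χ ᵥ* W⁻¹ ᵥ* U)
        (s := fun χ => ∑ t, (φ χ t ⬝ᵥ x) • v χ t) (X := X) ?_ ?_ ?_ hχ
      · intro χ χ' h
        rw [← hback χ, ← hback χ']
        exact congrArg (· ᵥ* (U⁻¹ * W)) h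
      · exact fun χ hχ => sum_mem fun t _ => Submodule.smul_mem _ _ (hv' χ hχ t)
      · rw [← hx, hG, sum_mulVec]
        refine Finset.sum_congr rfl fun χ _ => ?_
        rw [sum_mulVec]
        refine Finset.sum_congr rfl fun t _ => ?_
        rw [vecMulVec_mulVec]
        funext c
        simp [mul_comm]
    -- By independence of the `v χ t`, the vector `x` is orthogonal to all row vectors of the
    -- weights in `X`. Among these are the rows of `Q`, whence `x = 0`.
    have hperp : ∀ χ ∈ X, ∀ y ∈ leftEig A χ, y ⬝ᵥ x = 0 := by
      intro χ hχ y hy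
      rw [← hφ χ hχ] at hy
      have hc := Fintype.linearIndependent_iff.1 (hv χ hχ).1 _ (hterm χ hχ)
      induction hy using Submodule.span_induction with
      | mem y hy => obtain ⟨t, rfl⟩ := hy; exact hc t
      | zero => simp
      | add y z _ _ h1 h2 => rw [add_dotProduct, h1, h2, add_zero]
      | smul c y _ h => rw [smul_dotProduct, h, smul_zero]
    have hQx : Q *ᵥ x = 0 := by
      funext p
      exact hperp _ (hX p) _ (hA.row_mem p)
    rw [← one_mulVec x, ← hA.PQ, ← mulVec_mulVec, hQx, mulVec_zero]
  · rw [hG, Finset.sum_mul, Finset.mul_sum]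
    refine Finset.sum_congr rfl fun χ hχ => ?_
    rw [Finset.sum_mul, Finset.mul_sum]
    refine Finset.sum_congr rfl fun t _ => ?_
    have e1 : vecMulVec (v χ t) (φ χ t) * A i = χ i • vecMulVec (v χ t) (φ χ t) := by
      rw [vecMulVec_mul, hφ' χ hχ t i, vecMulVec_smul]
    have e2 : (∑ j, (U⁻¹ * W) j i • B j) * vecMulVec (v χ t) (φ χ t) =
        χ i • vecMulVec (v χ t) (φ χ t) := by
      rw [mul_vecMulVec, sum_mulVec]
      have : ∑ j, ((U⁻¹ * W) j i • B j) *ᵥ v χ t = χ i • v χ t := by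
        simp only [smul_mulVec, hv' χ hχ t _, smul_smul, ← Finset.sum_smul]
        congr 1
        conv_rhs => rw [← hback χ]
        simp only [vecMul, dotProduct, mul_comm]
      rw [this, smul_vecMulVec]
    rw [e1, e2]

theorem finrank_eq_of_mem_iff {p q : Submodule F (Fin n → F)} {S T : Matrix (Fin n) (Fin n) F}
    (hST : S * T = 1) (hTS : T * S = 1) (h : ∀ y, y ∈ p ↔ S *ᵥ y ∈ q) :
    Module.finrank F p = Module.finrank F q := by
  let e : (Fin n → F) ≃ₗ[F] (Fin n → F) :=
    LinearEquiv.ofLinearMap (mulVecLin S) (mulVecLin T) (by rw [← mulVecLin_mul, hST, mulVecLin_one])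
      (by rw [← mulVecLin_mul, hTS, mulVecLin_one])
  have : p.map (e : (Fin n → F) →ₗ[F] (Fin n → F)) = q := by
    ext y
    rw [Submodule.mem_map]
    constructor
    · rintro ⟨x, hx, rfl⟩
      exact (h x).1 hx
    · intro hy
      refine ⟨T *ᵥ y, ?_, ?_⟩
      · rw [h, mulVec_mulVec, hST, one_mulVec]; exact hy
      · change S *ᵥ (T *ᵥ y) = y
        rw [mulVec_mulVec, hST, one_mulVec]
  rw [← this, LinearEquiv.finrank_map_eq]

/-- The invertible matrix `P * Pᵀ` intertwines the transpose of each `A i` with `A i`, and so it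
maps row vectors of weight `χ` to column vectors of weight `χ`. -/
theorem Weights.finrank_leftEig (h : Weights A P Q a) (χ : Fin d → F) :
    Module.finrank F (leftEig A χ) = Module.finrank F (rightEig A χ) := by
  have hPQt : Pᵀ * Qᵀ = 1 := by rw [← transpose_mul, h.QP, transpose_one]
  have hQPt : Qᵀ * Pᵀ = 1 := by rw [← transpose_mul, h.PQ, transpose_one]
  have hST : P * Pᵀ * (Qᵀ * Q) = 1 := by
    rw [mul_assoc, ← mul_assoc Pᵀ, hPQt, one_mul, h.PQ]
  have hTS : Qᵀ * Q * (P * Pᵀ) = 1 := by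
    rw [mul_assoc, ← mul_assoc Q, h.QP, one_mul, hQPt]
  refine finrank_eq_of_mem_iff hST hTS fun y => ?_
  have key : ∀ i, A i *ᵥ ((P * Pᵀ) *ᵥ y) = (P * Pᵀ) *ᵥ (y ᵥ* A i) := by
    intro i
    rw [← mulVec_transpose, mulVec_mulVec, mulVec_mulVec, h.eq, dg]
    congr 1
    simp only [transpose_mul, diagonal_transpose]
    calc P * diagonal (fun p => a p i) * Q * (P * Pᵀ)
        = P * diagonal (fun p => a p i) * (Q * P) * Pᵀ := by simp only [mul_assoc]
      _ = P * (Pᵀ * Qᵀ) * diagonal (fun p => a p i) * Pᵀ := by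
        rw [h.QP, hPQt, mul_one, mul_one]
      _ = _ := by simp only [mul_assoc]
  constructor
  · intro hy i
    rw [key, hy i, mulVec_smul]
  · intro hy i
    have := hy i
    rw [key, ← mulVec_smul] at this
    have := congrArg (fun z => (Qᵀ * Q) *ᵥ z) this
    simpa only [mulVec_mulVec, hTS, one_mulVec] using this

/-- A nonzero functional that kills all weights would be a nontrivial linear relation between the `A
i`, since its coefficients combine the `A i` to a matrix all of whose eigenvalues are zero. -/
theorem Weights.span_eq_top (hA : Weights A P Q a) (hli : LinearIndependent F A) :
    Submodule.span F (Set.range a) = ⊤ := by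
  by_contra hne
  obtain ⟨f, hf, hle⟩ := Submodule.exists_le_ker_of_lt_top _ (lt_top_iff_ne_top.2 hne)
  refine hf ?_
  have hzero : ∑ i, f (Pi.single i 1) • A i = 0 := by
    have : ∑ i, f (Pi.single i 1) • A i =
        dg P Q fun p => ∑ i, f (Pi.single i 1) * a p i := by
      ext p q
      simp only [hA.eq, dg, Matrix.sum_apply, Matrix.smul_apply, mul_apply (N := Q),
        mul_diagonal, smul_eq_mul, Finset.mul_sum]
      rw [Finset.sum_comm]
      refine Finset.sum_congr rfl fun t _ => ?_
      rw [Finset.sum_mul]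
      exact Finset.sum_congr rfl fun i _ => by ring
    rw [this, ← dg_zero (P := P) (Q := Q)]
    congr 1
    funext p
    have h1 : f (a p) = 0 := hle (Submodule.subset_span ⟨p, rfl⟩)
    rw [Pi.zero_apply, ← h1]
    conv_rhs => rw [pi_eq_sum_univ' (a p), map_sum]
    simp only [map_smul, smul_eq_mul, mul_comm]
  have := Fintype.linearIndependent_iff.1 hli _ hzero
  refine (Pi.basisFun F (Fin d)).ext fun i => ?_
  simpa using this i

/-- Needed for storage: coordinate i of a weight is kept in row i of an n × n table. -/
theorem Weights.card_le (hA : Weights A P Q a) (hli : LinearIndependent F A) : d ≤ n := by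
  have := finrank_range_le_card (R := F) a
  rwa [Set.finrank, hA.span_eq_top hli, finrank_top, Module.finrank_fin_fun,
    Fintype.card_fin] at this

/-- Conjugate algebras have corresponding weights. -/
theorem exists_checkOK (hA : Weights A P Q a) (hli : LinearIndependent F A)
    {h h' : Matrix (Fin n) (Fin n) F} (hh : h * h' = 1) (hh' : h' * h = 1)
    {M N : Matrix (Fin d) (Fin d) F} (hMN : M * N = 1) (hNM : N * M = 1)
    (hM : ∀ i, h * A i * h' = ∑ j, M i j • B j) :
    ∃ W U : Matrix (Fin d) (Fin d) F, (∀ s i, IsEig (A i) (W s i)) ∧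
      (∀ s i, IsEig (B i) (U s i)) ∧ ∀ χ, CheckOK A B W U χ := by
  have hspan := hA.span_eq_top hli
  -- Some of the weights of `A` form a basis of `F^d`; these become the rows of `W`.
  obtain ⟨κ, c, hc, hcs, hcli⟩ := exists_linearIndependent' F a
  rw [hspan] at hcs
  have hb := Module.Basis.mk hcli hcs.ge
  have hfin : Finite κ := Module.Finite.finite_basis hb
  have := Fintype.ofFinite κ
  have hcard : Fintype.card κ = d := by
    rw [← Module.finrank_eq_card_basis hb, Module.finrank_fin_fun]
  obtain ⟨e⟩ : Nonempty (Fin d ≃ κ) := ⟨(Fintype.equivFinOfCardEq hcard).symm⟩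
  set W : Matrix (Fin d) (Fin d) F := Matrix.of fun s => a (c (e s)) with hW
  have hWu : IsUnit W := by
    rw [← linearIndependent_rows_iff_isUnit]
    exact hcli.comp e e.injective
  have hWd := (isUnit_iff_isUnit_det _).1 hWu
  have hNu : IsUnit Nᵀ := by
    rw [isUnit_transpose]; exact ⟨⟨N, M, hNM, hMN⟩, rfl⟩
  have hB : ∀ j, B j * h = h * ∑ i, N j i • A i := by
    intro j
    have : B j = ∑ i, N j i • (h * A i * h') := by
      simp only [hM, Finset.smul_sum, smul_smul]
      rw [Finset.sum_comm]
      simp only [← Finset.sum_smul]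
      have : ∀ k, ∑ i, N j i * M i k = (1 : Matrix (Fin d) (Fin d) F) j k := fun k => by
        rw [← hNM, mul_apply]
      simp only [this, one_apply, ite_smul, one_smul, zero_smul]
      simp
    rw [this]
    simp only [Finset.sum_mul, Finset.mul_sum, Matrix.smul_mul, Matrix.mul_smul, mul_assoc, hh',
      mul_one]
  have hA' : ∀ i, h * A i = (∑ j, M i j • B j) * h := fun i => by
    rw [← hM, mul_assoc, hh', mul_one]
  -- Multiplication by `h` identifies the weight space of `χ` for `A` with that of `χ ᵥ* Nᵀ` for
  -- `B`. Hence dimensions agree for every `χ`, whether it is a weight or not.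
  have hmem : ∀ χ y, y ∈ rightEig A χ ↔ h *ᵥ y ∈ rightEig B (χ ᵥ* Nᵀ) := by
    intro χ y
    constructor
    · intro hy j
      rw [mulVec_mulVec, hB, ← mulVec_mulVec, sum_mulVec]
      simp only [smul_mulVec, hy _, smul_smul, ← Finset.sum_smul]
      rw [mulVec_smul]
      congr 1
      simp only [vecMul, dotProduct, transpose_apply, mul_comm]
    · intro hy i
      have h1 : h *ᵥ (A i *ᵥ y) = h *ᵥ (χ i • y) := by
        rw [mulVec_mulVec, hA', ← mulVec_mulVec, sum_mulVec]
        simp only [smul_mulVec, hy _, smul_smul, ← Finset.sum_smul]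
        rw [mulVec_smul]
        congr 1
        have : χ ᵥ* Nᵀ ᵥ* Mᵀ = χ := by
          rw [vecMul_vecMul, ← transpose_mul, hMN, transpose_one, vecMul_one]
        conv_rhs => rw [← this]
        simp only [vecMul, dotProduct, transpose_apply, mul_comm]
      have := congrArg (fun z => h' *ᵥ z) h1
      simpa only [mulVec_mulVec, ← mul_assoc, hh', one_mul, one_mulVec] using this
  -- The rows of `U` are the images of the rows of `W`. They consist of eigenvalues of the `B i`
  -- because `h` carries weight vectors to weight vectors.
  refine ⟨W, W * Nᵀ, fun s i => hA.isEig _ i, fun s i => ?_, fun χ => ⟨hWu, hWu.mul hNu, ?_⟩⟩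
  · have h1 := (hmem _ _).1 (hA.col_mem (c (e s)))
    refine ⟨h *ᵥ (P *ᵥ Pi.single (c (e s)) 1), fun h0 => ?_, h1 i⟩
    have := congrArg (fun z => Q *ᵥ (h' *ᵥ z)) h0
    simp only [mulVec_mulVec, mulVec_zero] at this
    rw [← mul_assoc, ← mul_assoc, mul_assoc Q, hh', mul_one, hA.QP, one_mulVec] at this
    simpa using congrFun this (c (e s))
  · rw [vecMul_vecMul, ← mul_assoc, nonsing_inv_mul _ hWd, one_mul,
      hA.finrank_leftEig]
    exact finrank_eq_of_mem_iff hh hh' (hmem χ)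

end

open MatrixLie

/-! ### Conjugacy of Lie algebras given by bases -/

section

variable {F : Type*} [Field F] {n d d₁ d₂ : ℕ}
  {L L₁ L₂ : LieSubalgebra F (Matrix (Fin n) (Fin n) F)}

/-- The matrices of a basis. -/
noncomputable def basisMat (b : Module.Basis (Fin d) F L) : Fin d → Matrix (Fin n) (Fin n) F :=
  fun i => (b i : Matrix (Fin n) (Fin n) F)

theorem basisMat_linearIndependent (b : Module.Basis (Fin d) F L) :
    LinearIndependent F (basisMat b) :=
  b.linearIndependent.map' L.toSubmodule.subtype (Submodule.ker_subtype _)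

theorem mem_iff_basisMat (b : Module.Basis (Fin d) F L) (X : Matrix (Fin n) (Fin n) F) :
    X ∈ L ↔ ∃ c : Fin d → F, X = ∑ i, c i • basisMat b i := by
  constructor
  · intro h
    refine ⟨b.repr ⟨X, h⟩, ?_⟩
    have := congrArg (Subtype.val) (b.sum_repr ⟨X, h⟩)
    refine this.symm.trans ?_
    exact map_sum L.toSubmodule.subtype _ _
  · rintro ⟨c, rfl⟩
    exact sum_mem fun i _ => L.smul_mem _ (b i).2

theorem exists_weights (h : AbelianDiagonalizable L) (b : Module.Basis (Fin d) F L) :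
    ∃ P Q a, Weights (basisMat b) P Q a := by
  obtain ⟨g, hg⟩ := h.diagonalizable
  have h1 : (g : Matrix (Fin n) (Fin n) F) * (g⁻¹ : GL (Fin n) F) = 1 := Units.mul_inv g
  have h2 : ((g⁻¹ : GL (Fin n) F) : Matrix (Fin n) (Fin n) F) * g = 1 := Units.inv_mul g
  refine ⟨(g⁻¹ : GL (Fin n) F), g, fun p i => (g * basisMat b i * (g⁻¹ : GL (Fin n) F) :
    Matrix (Fin n) (Fin n) F) p p, h2, h1, fun i => ?_⟩
  have := (hg _ (b i).2).diagonal_diag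
  rw [dg]
  change _ = _ * diagonal (diag ((g : Matrix (Fin n) (Fin n) F) * basisMat b i * _)) * _
  rw [show basisMat b i = (b i : Matrix (Fin n) (Fin n) F) from rfl, this]
  calc (b i : Matrix (Fin n) (Fin n) F)
      = ((g⁻¹ : GL (Fin n) F) : Matrix (Fin n) (Fin n) F) * g * (b i) *
        (((g⁻¹ : GL (Fin n) F) : Matrix (Fin n) (Fin n) F) * g) := by rw [h2, one_mul, mul_one]
    _ = _ := by simp only [mul_assoc]

/-- Conjugation by an invertible matrix. -/
def conjEquiv (g : GL (Fin n) F) : Matrix (Fin n) (Fin n) F ≃ₗ[F] Matrix (Fin n) (Fin n) F where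
  toFun X := g * X * (g⁻¹ : GL (Fin n) F)
  invFun X := (g⁻¹ : GL (Fin n) F) * X * g
  map_add' X Y := by rw [mul_add, add_mul]
  map_smul' c X := by simp
  left_inv X := by
    have h2 : ((g⁻¹ : GL (Fin n) F) : Matrix (Fin n) (Fin n) F) * g = 1 := Units.inv_mul g
    simp only [← mul_assoc, h2, one_mul]
    rw [mul_assoc, h2, mul_one]
  right_inv X := by
    have h1 : (g : Matrix (Fin n) (Fin n) F) * (g⁻¹ : GL (Fin n) F) = 1 := Units.mul_inv g
    simp only [← mul_assoc, h1, one_mul]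
    rw [mul_assoc, h1, mul_one]

theorem conjugatedBy_iff_map (g : GL (Fin n) F) : ConjugatedBy g L₁ L₂ ↔
    L₁.toSubmodule.map (conjEquiv g : Matrix (Fin n) (Fin n) F →ₗ[F] Matrix (Fin n) (Fin n) F) =
      L₂.toSubmodule := by
  rw [← SetLike.coe_set_eq]
  exact Iff.rfl

theorem Conjugate.card_eq (h : Conjugate L₁ L₂) (b₁ : Module.Basis (Fin d₁) F L₁)
    (b₂ : Module.Basis (Fin d₂) F L₂) : d₁ = d₂ := by
  obtain ⟨g, hg⟩ := h
  rw [conjugatedBy_iff_map] at hg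
  have h1 := LinearEquiv.finrank_map_eq (conjEquiv g) L₁.toSubmodule
  rw [hg] at h1
  have e1 : Module.finrank F L₁.toSubmodule = d₁ := 
    (Module.finrank_eq_card_basis b₁).trans (Fintype.card_fin _)
  have e2 : Module.finrank F L₂.toSubmodule = d₂ := 
    (Module.finrank_eq_card_basis b₂).trans (Fintype.card_fin _)
  omega

/-- The hypothesis gives only an inclusion; equality follows because both algebras have dimension d.
-/
theorem conjugatedBy_of_mul_eq (b₁ : Module.Basis (Fin d) F L₁) (b₂ : Module.Basis (Fin d) F L₂)
    (g : GL (Fin n) F) {N : Matrix (Fin d) (Fin d) F} (h : ∀ i,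
      (g : Matrix (Fin n) (Fin n) F) * basisMat b₁ i = (∑ j, N j i • basisMat b₂ j) * g) :
    ConjugatedBy g L₁ L₂ := by
  rw [conjugatedBy_iff_map]
  have e1 : Module.finrank F L₁.toSubmodule = d := 
    (Module.finrank_eq_card_basis b₁).trans (Fintype.card_fin _)
  have e2 : Module.finrank F L₂.toSubmodule = d := 
    (Module.finrank_eq_card_basis b₂).trans (Fintype.card_fin _)
  refine Submodule.eq_of_le_of_finrank_eq ?_ (by rw [LinearEquiv.finrank_map_eq, e1, e2])
  rintro _ ⟨X, hX, rfl⟩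
  obtain ⟨c, rfl⟩ := (mem_iff_basisMat b₁ X).1 hX
  rw [map_sum]
  refine sum_mem fun i _ => ?_
  rw [map_smul]
  refine Submodule.smul_mem _ _ ?_
  have : conjEquiv g (basisMat b₁ i) = ∑ j, N j i • basisMat b₂ j := by
    change (g : Matrix (Fin n) (Fin n) F) * _ * _ = _
    have h1 : (g : Matrix (Fin n) (Fin n) F) * (g⁻¹ : GL (Fin n) F) = 1 := Units.mul_inv g
    rw [h, mul_assoc, h1, mul_one]
  rw [LinearEquiv.coe_coe, this]
  exact (mem_iff_basisMat b₂ _).2 ⟨_, rfl⟩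

/-- Conjugating forth and back expresses each `A i` by the `A k` with coefficients `(M * N) i k`;
independence leaves only the trivial expression. -/
theorem mul_eq_one_of_conj {A B : Fin d → Matrix (Fin n) (Fin n) F} (hA : LinearIndependent F A)
    {h h' : Matrix (Fin n) (Fin n) F} (hh : h' * h = 1) {M N : Matrix (Fin d) (Fin d) F}
    (hM : ∀ i, h * A i * h' = ∑ j, M i j • B j) (hN : ∀ j, h' * B j * h = ∑ i, N j i • A i) :
    M * N = 1 := by
  ext i k
  have h1 : A i = ∑ k, (M * N) i k • A k := by
    calc A i = h' * (h * A i * h') * h := by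
          simp only [← mul_assoc, hh, one_mul]
          rw [mul_assoc, hh, mul_one]
      _ = ∑ j, M i j • (h' * B j * h) := by
          rw [hM, Finset.mul_sum, Finset.sum_mul]
          simp
      _ = _ := by
          simp only [hN, Finset.smul_sum, smul_smul, mul_apply, Finset.sum_smul]
          exact Finset.sum_comm
  have h2 : ∑ k, ((M * N) i k - (1 : Matrix (Fin d) (Fin d) F) i k) • A k = 0 := by
    simp only [sub_smul, Finset.sum_sub_distrib, ← h1, one_apply, ite_smul, one_smul, zero_smul]
    simp
  exact sub_eq_zero.1 (Fintype.linearIndependent_iff.1 hA _ h2 k)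

/-- The test passes for every `χ` and not only for tuples of eigenvalues. The search depends on
this, since its lists may contain field elements that are not eigenvalues. -/
theorem exists_checkOK_of_conjugate (b₁ : Module.Basis (Fin d) F L₁)
    (b₂ : Module.Basis (Fin d) F L₂) (h₁ : AbelianDiagonalizable L₁) (h : Conjugate L₁ L₂) :
    ∃ W U : Matrix (Fin d) (Fin d) F, (∀ s i, IsEig (basisMat b₁ i) (W s i)) ∧
      (∀ s i, IsEig (basisMat b₂ i) (U s i)) ∧ ∀ χ, CheckOK (basisMat b₁) (basisMat b₂) W U χ := by
  obtain ⟨P, Q, a, hA⟩ := exists_weights h₁ b₁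
  obtain ⟨g, hg⟩ := h
  rw [conjugatedBy_iff_map] at hg
  have h1 : (g : Matrix (Fin n) (Fin n) F) * (g⁻¹ : GL (Fin n) F) = 1 := Units.mul_inv g
  have h2 : ((g⁻¹ : GL (Fin n) F) : Matrix (Fin n) (Fin n) F) * g = 1 := Units.inv_mul g
  have hM : ∀ i, ∃ c : Fin d → F, (g : Matrix (Fin n) (Fin n) F) * basisMat b₁ i *
      (g⁻¹ : GL (Fin n) F) = ∑ j, c j • basisMat b₂ j := fun i => by
    refine (mem_iff_basisMat b₂ _).1 ?_
    have : conjEquiv g (basisMat b₁ i) ∈ L₂.toSubmodule := by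
      rw [← hg]
      exact ⟨_, (b₁ i).2, rfl⟩
    exact this
  have hN : ∀ j, ∃ c : Fin d → F, ((g⁻¹ : GL (Fin n) F) : Matrix (Fin n) (Fin n) F) *
      basisMat b₂ j * g = ∑ i, c i • basisMat b₁ i := fun j => by
    refine (mem_iff_basisMat b₁ _).1 ?_
    have : basisMat b₂ j ∈ L₂.toSubmodule := (b₂ j).2
    rw [← hg] at this
    obtain ⟨X, hX, hXe⟩ := this
    have : X = (conjEquiv g).symm (basisMat b₂ j) := by
      rw [← hXe]
      exact ((conjEquiv g).symm_apply_apply X).symm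
    rw [this] at hX
    exact hX
  choose M hM using hM
  choose N hN using hN
  exact exists_checkOK hA (basisMat_linearIndependent b₁) h1 h2
    (mul_eq_one_of_conj (basisMat_linearIndependent b₁) h2 hM hN)
    (mul_eq_one_of_conj (basisMat_linearIndependent b₂) h1 hN hM) hM

/-- Guarantees that the test is made at least once, so that its success includes the invertibility
of `W` and `U`. For n = 0 there are no basis elements, as the zero matrix is not part of a basis. -/
theorem exists_eigenvalues {A : Fin d → Matrix (Fin n) (Fin n) F}
    {P Q : Matrix (Fin n) (Fin n) F} {a : Fin n → Fin d → F} (hA : Weights A P Q a)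
    (hli : LinearIndependent F A) : ∃ χ : Fin d → F, ∀ i, IsEig (A i) (χ i) := by
  rcases Nat.eq_zero_or_pos n with rfl | hn
  · exact ⟨0, fun i => absurd (Subsingleton.elim _ _) (hli.ne_zero i)⟩
  · exact ⟨a ⟨0, hn⟩, fun i => hA.isEig _ i⟩

/-- The matrix that the test has put together conjugates the Lie algebras. -/
theorem conjugatedBy_sum (b₁ : Module.Basis (Fin d) F L₁)
    (b₂ : Module.Basis (Fin d) F L₂) (h₁ : AbelianDiagonalizable L₁)
    (h₂ : AbelianDiagonalizable L₂) {W U : Matrix (Fin d) (Fin d) F} {X : Finset (Fin d → F)}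
    (hX : ∀ χ : Fin d → F, (∀ i, IsEig (basisMat b₁ i) (χ i)) → χ ∈ X)
    (hok : ∀ χ ∈ X, CheckOK (basisMat b₁) (basisMat b₂) W U χ)
    {k : (Fin d → F) → ℕ} {φ v : ∀ χ, Fin (k χ) → Fin n → F}
    (hφ : ∀ χ ∈ X, Submodule.span F (Set.range (φ χ)) = leftEig (basisMat b₁) χ)
    (hv : ∀ χ ∈ X, LinearIndependent F (v χ) ∧
      Submodule.span F (Set.range (v χ)) = rightEig (basisMat b₂) (χ ᵥ* W⁻¹ ᵥ* U))
    {G : Matrix (Fin n) (Fin n) F} (hG : G = ∑ χ ∈ X, ∑ t, vecMulVec (v χ t) (φ χ t)) :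
    ∃ g : GL (Fin n) F, (g : Matrix (Fin n) (Fin n) F) = G ∧ ConjugatedBy g L₁ L₂ := by
  obtain ⟨P, Q, a, hA⟩ := exists_weights h₁ b₁
  obtain ⟨P', Q', a', hB⟩ := exists_weights h₂ b₂
  obtain ⟨χ, hχ⟩ := exists_eigenvalues hA (basisMat_linearIndependent b₁)
  obtain ⟨hW, hU, -⟩ := hok χ (hX χ hχ)
  obtain ⟨⟨g, rfl⟩, hg⟩ := conjugating_matrix hA hB hW hU (fun p => hX _ fun i => hA.isEig p i)
    hφ hv hG
  exact ⟨g, rfl, conjugatedBy_of_mul_eq b₁ b₂ g hg⟩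

theorem IsEig.finite (X : Matrix (Fin n) (Fin n) F) : {a | IsEig X a}.Finite := by
  refine (Module.End.finite_hasEigenvalue (Matrix.toLin' X)).subset ?_
  rintro a ⟨v, hv, h⟩
  exact Module.End.hasEigenvalue_of_hasEigenvector ⟨Module.End.mem_eigenspace_iff.2 h, hv⟩

/-- The form that can be decided: both quantifiers range over eigenvalues of the given basis
matrices, existentially for `W` and `U`, universally for `χ`. For sufficiency, every weight of the
first algebra is one of the tuples. -/
theorem conjugate_iff_exists_checkOK (b₁ : Module.Basis (Fin d) F L₁)
    (b₂ : Module.Basis (Fin d) F L₂) (h₁ : AbelianDiagonalizable L₁)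
    (h₂ : AbelianDiagonalizable L₂) : Conjugate L₁ L₂ ↔
    ∃ W U : Matrix (Fin d) (Fin d) F, (∀ s i, IsEig (basisMat b₁ i) (W s i)) ∧
      (∀ s i, IsEig (basisMat b₂ i) (U s i)) ∧ ∀ χ : Fin d → F,
        (∀ i, IsEig (basisMat b₁ i) (χ i)) → CheckOK (basisMat b₁) (basisMat b₂) W U χ := by
  constructor
  · intro h
    obtain ⟨W, U, hW, hU, h⟩ := exists_checkOK_of_conjugate b₁ b₂ h₁ h
    exact ⟨W, U, hW, hU, fun χ _ => h χ⟩
  · rintro ⟨W, U, -, -, h⟩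
    have hfin : {χ : Fin d → F | ∀ i, IsEig (basisMat b₁ i) (χ i)}.Finite := by
      have := Set.Finite.pi' fun i : Fin d => IsEig.finite (basisMat b₁ i)
      exact this
    have key : ∀ χ, ∃ (k : ℕ) (φ v : Fin k → Fin n → F),
        (∀ i, IsEig (basisMat b₁ i) (χ i)) →
          Submodule.span F (Set.range φ) = leftEig (basisMat b₁) χ ∧ LinearIndependent F v ∧
          Submodule.span F (Set.range v) = rightEig (basisMat b₂) (χ ᵥ* W⁻¹ ᵥ* U) := by
      intro χ
      by_cases hχ : ∀ i, IsEig (basisMat b₁ i) (χ i)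
      · obtain ⟨-, -, he⟩ := h χ hχ
        have basis : ∀ (K : Submodule F (Fin n → F)) (k : ℕ), Module.finrank F K = k →
            ∃ v : Fin k → Fin n → F, LinearIndependent F v ∧
              Submodule.span F (Set.range v) = K := by
          rintro K k rfl
          let b := Module.finBasis F K
          refine ⟨fun t => (b t : Fin n → F),
            b.linearIndependent.map' K.subtype (Submodule.ker_subtype _), ?_⟩
          have : (Set.range fun t => (b t : Fin n → F)) = K.subtype '' Set.range b := by
            rw [← Set.range_comp]; rfl
          rw [this, Submodule.span_image, b.span_eq, Submodule.map_top, Submodule.range_subtype]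
        obtain ⟨φ, -, hφ⟩ := basis (leftEig (basisMat b₁) χ) _ rfl
        obtain ⟨v, hv, hv'⟩ := basis _ _ he.symm
        exact ⟨_, φ, v, fun _ => ⟨hφ, hv, hv'⟩⟩
      · exact ⟨0, 0, 0, fun h => absurd h hχ⟩
    choose k φ v hk using key
    obtain ⟨g, -, hg⟩ := conjugatedBy_sum b₁ b₂ h₁ h₂ (W := W) (U := U) (X := hfin.toFinset)
      (fun χ hχ => by simpa using hχ) (fun χ hχ => h χ (by simpa using hχ)) (k := k) (φ := φ)
      (v := v) (fun χ hχ => (hk χ (by simpa using hχ)).1)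
      (fun χ hχ => (hk χ (by simpa using hχ)).2) rfl
    exact ⟨g, hg⟩

end

/-! ### The decision program -/

/-- The matrix of the input whose eigenvalue is guessed. -/
def guessSource (d j r : ℕ) : ℕ := if j < 3 * d then r else if j < 4 * d then d + r else r

/-- The cells for the weights of the two Lie algebras. -/
def weightCells (d : ℕ) : List (ℕ × ℕ) :=
  (List.range (2 * d)).flatMap fun s => (List.range d).map fun i => (2 * d + s, i)

/-- The cells for a further weight of the first Lie algebra. -/
def testCells (d : ℕ) : List (ℕ × ℕ) := (List.range d).map fun i => (4 * d, i)

/-- Decide whether the test succeeds. -/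
def decideCheck (d : ℕ) : Prog :=
  .seq (.fldZero ⟨21, []⟩) (.seq (check d).compile
    (.ifZero ⟨21, []⟩ (.natConst 0 1) (.natConst 0 0)))

/-- Decide whether the test succeeds for all further weights. -/
def decideWeights (d : ℕ) : Prog :=
  notP (exGuesses (4 * d + 1) (guessSource d) (testCells d) (notP (decideCheck d)))

/-- Decide whether two Lie algebras of dimension `d` are conjugate. -/
def decideConj (d : ℕ) : Prog :=
  exGuesses (4 * d + 1) (guessSource d) (weightCells d) (decideWeights d)

/-- A bound for the running time of `decideWeights`. -/
noncomputable def decideWeightsCost (d : ℕ) : Polynomial ℕ :=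
  exGuessesCost (4 * d + 1) (guessSource d) (testCells d) ((check d).cost + 3 + 2) + 2

/-- A bound for the running time of `decideConj`. -/
noncomputable def decideConjCost (d : ℕ) : Polynomial ℕ :=
  exGuessesCost (4 * d + 1) (guessSource d) (weightCells d) (decideWeightsCost d)

theorem mem_weightCells {d : ℕ} {e : ℕ × ℕ} :
    e ∈ weightCells d ↔ ∃ s < 2 * d, ∃ i < d, e = (2 * d + s, i) := by
  simp [weightCells, eq_comm]

theorem mem_testCells {d : ℕ} {e : ℕ × ℕ} : e ∈ testCells d ↔ ∃ i < d, e = (4 * d, i) := by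
  simp [testCells, eq_comm]

theorem decideCheck_fieldOperationsOnly (d : ℕ) : (decideCheck d).FieldOperationsOnly := by
  simp [decideCheck, Prog.FieldOperationsOnly, Stm.compile_fieldOperationsOnly _ (check_noRoot d)]

theorem notP_fieldOperationsOnly {p : Prog} (h : p.FieldOperationsOnly) :
    (notP p).FieldOperationsOnly := ⟨h, trivial, trivial⟩

theorem decideWeights_fieldOperationsOnly (d : ℕ) : (decideWeights d).FieldOperationsOnly :=
  notP_fieldOperationsOnly (exGuesses_fieldOperationsOnly
    (notP_fieldOperationsOnly (decideCheck_fieldOperationsOnly d)) _)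

theorem decideConj_fieldOperationsOnly (d : ℕ) : (decideConj d).FieldOperationsOnly :=
  exGuesses_fieldOperationsOnly (decideWeights_fieldOperationsOnly d) _

/-! ### Correctness of the alternation of guesses. -/

section

variable {F : Type*} [Field F] {ρ : Polynomial F → F} {n d : ℕ}

/-- The test succeeds for the weights in the cells. -/
def CellsOK (n d : ℕ) (c : Cells F) : Prop :=
  CheckOK (fun i : Fin d => c.mat n i) (fun i : Fin d => c.mat n (d + i))
    (Matrix.of fun s i : Fin d => c (2 * d + s) i 0) (Matrix.of fun s i : Fin d => c (3 * d + s) i 0)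
    (fun i => c (4 * d) i 0)

theorem decideCheck_correct (hdn : d ≤ n) {c : Cells F} {s : State F}
    (h : Start n (4 * d + 1) c s) :
    (decideCheck d).time ρ s ≤ ((check d).cost + 3 : Polynomial ℕ).eval n ∧
      Answers (CellsOK n d c) ((decideCheck d).exec ρ s) := by
  classical
  set s₁ := (Prog.fldZero ⟨21, []⟩).exec ρ s with hs₁
  have hf₁ : s₁.fld = Mem.set s.fld 21 [] 0 := State.put_fld _ _ _
  have hn₁ : s₁.nat = s.nat := rfl
  have h0 : s₁.fld 0 = s.fld 0 := by rw [hf₁, Mem.set_arr _ (by norm_num)]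
  have hcell : ∀ j < 4 * d + 1, ∀ r < n, ∀ k < n, s₁.fld 0 [j, r, k] = c j r k := fun j hj r hr k hk =>
    h0 ▸ h.cells j hj r hr k hk
  obtain ⟨t, -, f⟩ := Stm.step (ρ := ρ) (n := n) (s := s₁) (check_wf d (V := {0}) (B := {0}) rfl rfl
    (fun x hx => Or.inl hx) (fun x hx => Or.inl hx)) rfl (by simp)
    (by rintro y rfl; exact h.size.le)
  obtain ⟨f', e', -, hok, -⟩ := check_eval (ρ := ρ) (n := n) (d := d) (r := s₁.nat) (f := s₁.fld)
    (A := fun i : Fin d => c.mat n i) (B := fun i : Fin d => c.mat n (d + i))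
    (W := Matrix.of fun s i : Fin d => c (2 * d + s) i 0)
    (U := Matrix.of fun s i : Fin d => c (3 * d + s) i 0)
    (χ := fun i => c (4 * d) i 0) h.size
    (fun i j k => hcell _ (by omega) _ j.2 _ k.2) (fun i j k => hcell _ (by omega) _ j.2 _ k.2)
    (fun s i => hcell _ (by omega) _ (i.2.trans_le hdn) _ (i.pos.trans_le hdn))
    (fun s i => hcell _ (by omega) _ (i.2.trans_le hdn) _ (i.pos.trans_le hdn))
    (fun i => hcell _ (by omega) _ (i.2.trans_le hdn) _ (i.pos.trans_le hdn))
  rw [e'] at f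
  have h21 : s₁.fld 21 [] = 0 := by rw [hf₁, Mem.set_same]
  rw [h21, eq_self, true_and, ← f 21 (by norm_num)] at hok
  set s₂ := (check d).compile.exec ρ s₁ with hs₂
  have hget : s₂.get ⟨21, []⟩ = s₂.fld 21 [] := rfl
  constructor
  · simp only [decideCheck, Prog.time, ← hs₁, ← hs₂, Polynomial.eval_add, Polynomial.eval_ofNat,
      ite_self]
    omega
  · simp only [decideCheck, Prog.exec_seq, ← hs₁, ← hs₂]
    rw [Prog.exec, hget]
    split_ifs with h0
    · exact Or.inl ⟨by simp [Prog.exec], hok.1 h0⟩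
    · exact Or.inr ⟨by simp [Prog.exec], fun h => h0 (hok.2 h)⟩

/-- The universal quantifier over `χ` is realized as a negated existential guess of a failure of the
test. -/
theorem decideWeights_correct (hdn : d ≤ n) {c₀ : Cells F} (hd : ∀ m < 2 * d, Diagble (c₀.mat n m))
    {c : Cells F} {s : State F} (hc : ∀ m < 2 * d, ∀ r k, c m r k = c₀ m r k)
    (h : Start n (4 * d + 1) c s) :
    (decideWeights d).time ρ s ≤ (decideWeightsCost d).eval n ∧
      Answers (∀ c', Guessed n (guessSource d) (testCells d) c₀ c c' → CellsOK n d c')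
        ((decideWeights d).exec ρ s) := by
  obtain ⟨t, a⟩ := exGuesses_correct (ρ := ρ) (J := 4 * d + 1) (M := 2 * d) (src := guessSource d)
    (p := notP (decideCheck d)) (T := (check d).cost + 3 + 2) (φ := fun c => ¬ CellsOK n d c)
    (by omega) hd (notP_fieldOperationsOnly (decideCheck_fieldOperationsOnly d))
    (fun c s _ hs => by
      obtain ⟨t, a⟩ := decideCheck_correct (ρ := ρ) hdn hs
      refine ⟨?_, notP_answers a⟩
      rw [notP_time, Polynomial.eval_add, Polynomial.eval_ofNat]
      omega) (testCells d) (fun e he => by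
      obtain ⟨i, hi, rfl⟩ := mem_testCells.1 he
      simp only [guessSource]
      constructor
      · omega
      · split_ifs <;> omega) c s hc h
  constructor
  · rw [decideWeights, notP_time, decideWeightsCost, Polynomial.eval_add, Polynomial.eval_ofNat]
    omega
  · refine (notP_answers a).congr ?_
    push Not
    rfl

/-- Translates between contents of cells and the matrices `W`, `U` and the tuple `χ`. The guesses
occupy column `0` of the tables from `2 * d` to `4 * d`, so the basis matrices in the tables before
remain intact. -/
theorem decideConj_correct {L₁ L₂ : LieSubalgebra F (Matrix (Fin n) (Fin n) F)}
    (b₁ : Module.Basis (Fin d) F L₁) (b₂ : Module.Basis (Fin d) F L₂)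
    (h₁ : AbelianDiagonalizable L₁) (h₂ : AbelianDiagonalizable L₂) {c : Cells F} {s : State F}
    (hc₁ : ∀ i : Fin d, c.mat n i = basisMat b₁ i)
    (hc₂ : ∀ i : Fin d, c.mat n (d + i) = basisMat b₂ i) (h : Start n (4 * d + 1) c s) :
    (decideConj d).time ρ s ≤ (decideConjCost d).eval n ∧
      Answers (Conjugate L₁ L₂) ((decideConj d).exec ρ s) := by
  obtain ⟨P, Q, a, hA⟩ := exists_weights h₁ b₁
  obtain ⟨P', Q', a', hB⟩ := exists_weights h₂ b₂
  have hdn := hA.card_le (basisMat_linearIndependent b₁)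
  have hd : ∀ m < 2 * d, Diagble (c.mat n m) := by
    intro m hm
    by_cases hmd : m < d
    · rw [hc₁ ⟨m, hmd⟩]
      exact ⟨P, Q, _, hA.PQ, hA.QP, hA.eq _⟩
    · obtain ⟨j, rfl⟩ := Nat.exists_eq_add_of_le (not_lt.1 hmd)
      rw [hc₂ ⟨j, by omega⟩]
      exact ⟨P', Q', _, hB.PQ, hB.QP, hB.eq _⟩
  obtain ⟨t, an⟩ := exGuesses_correct (ρ := ρ) (J := 4 * d + 1) (M := 2 * d) (src := guessSource d)
    (p := decideWeights d) (T := decideWeightsCost d)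
    (φ := fun c' => ∀ c'', Guessed n (guessSource d) (testCells d) c c' c'' → CellsOK n d c'')
    (by omega) hd (decideWeights_fieldOperationsOnly d)
    (fun c' s hc hs => decideWeights_correct hdn hd hc hs) (weightCells d) (fun e he => by
      obtain ⟨s, hs, i, hi, rfl⟩ := mem_weightCells.1 he
      simp only [guessSource]
      constructor
      · omega
      · split_ifs <;> omega) c s (fun _ _ _ _ => rfl) h
  refine ⟨t, an.congr ?_⟩
  rw [conjugate_iff_exists_checkOK b₁ b₂ h₁ h₂]
  have hmat : ∀ {c' c'' : Cells F}, Guessed n (guessSource d) (weightCells d) c c c' →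
      Guessed n (guessSource d) (testCells d) c c' c'' →
      (fun i : Fin d => c''.mat n i) = basisMat b₁ ∧
      (fun i : Fin d => c''.mat n (d + i)) = basisMat b₂ ∧
      ∀ j < 4 * d, ∀ i k, c'' j i k = c' j i k := by
    intro c' c'' h1 h2
    have e2 : ∀ j < 4 * d, ∀ i k, c'' j i k = c' j i k := fun j hj i k => by
      refine h2.1 j i k fun e he => ?_
      obtain ⟨i, hi, rfl⟩ := mem_testCells.1 he
      simp only
      omega
    have e1 : ∀ j < 2 * d, ∀ i k, c' j i k = c j i k := fun j hj i k => by
      refine h1.1 j i k fun e he => ?_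
      obtain ⟨s, hs, i, hi, rfl⟩ := mem_weightCells.1 he
      simp only
      omega
    refine ⟨funext fun i => ?_, funext fun i => ?_, e2⟩
    · rw [← hc₁ i]
      ext j k
      exact (e2 _ (by omega) _ _).trans (e1 _ (by omega) _ _)
    · rw [← hc₂ i]
      ext j k
      exact (e2 _ (by omega) _ _).trans (e1 _ (by omega) _ _)
  constructor
  · rintro ⟨c', hg, hall⟩
    refine ⟨Matrix.of fun s i => c' (2 * d + s) i 0, Matrix.of fun s i => c' (3 * d + s) i 0,
      fun s i => ?_, fun s i => ?_, fun χ hχ => ?_⟩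
    · have := hg.2 (2 * d + s, i) (mem_weightCells.2 ⟨s, by omega, i, i.2, rfl⟩)
      simp only [guessSource] at this
      rwa [if_pos (by omega), hc₁] at this
    · have := hg.2 (3 * d + s, i) (mem_weightCells.2 ⟨d + s, by omega, i, i.2, by
        congr 1; omega⟩)
      simp only [guessSource] at this
      rwa [if_neg (by omega), if_pos (by omega), hc₂] at this
    · set c'' : Cells F := fun j i k =>
        if h : j = 4 * d ∧ i < d ∧ k = 0 then χ ⟨i, h.2.1⟩ else c' j i k with hc''
      have hg' : Guessed n (guessSource d) (testCells d) c c' c'' := by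
        constructor
        · intro j i k hne
          rw [hc'']
          refine dif_neg fun h => hne (4 * d, i) (mem_testCells.2 ⟨i, h.2.1, rfl⟩) ⟨h.1, rfl, h.2.2⟩
        · intro e he
          obtain ⟨i, hi, rfl⟩ := mem_testCells.1 he
          simp only [guessSource]
          rw [if_neg (by omega), if_neg (by omega), hc₁ ⟨i, hi⟩]
          simp only [hc'', hi, and_self, dif_pos]
          exact hχ _
      obtain ⟨m1, m2, m3⟩ := hmat hg hg'
      have := hall c'' hg'
      rw [CellsOK, m1, m2] at this
      convert this using 2
      · ext s i
        exact (m3 _ (by omega) _ _).symm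
      · ext s i
        exact (m3 _ (by omega) _ _).symm
      · simp [hc'']
  · rintro ⟨W, U, hW, hU, hall⟩
    -- The given matrices are written into the cells as if they had been guessed.
    set c' : Cells F := fun j i k =>
      if h : i < d ∧ k = 0 ∧ 2 * d ≤ j ∧ j < 4 * d then
        if h' : j < 3 * d then W ⟨j - 2 * d, by omega⟩ ⟨i, h.1⟩ else U ⟨j - 3 * d, by omega⟩ ⟨i, h.1⟩
      else c j i k with hc'
    have vW : ∀ s i : Fin d, c' (2 * d + s) i 0 = W s i := fun s i => by
      simp only [hc']
      have := i.2
      rw [dif_pos (by simp only [true_and]; omega), dif_pos (by omega)]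
      congr
      omega
    have vU : ∀ s i : Fin d, c' (3 * d + s) i 0 = U s i := fun s i => by
      simp only [hc']
      have := i.2
      rw [dif_pos (by simp only [true_and]; omega), dif_neg (by omega)]
      congr
      omega
    have hg : Guessed n (guessSource d) (weightCells d) c c c' := by
      constructor
      · intro j i k hne
        rw [hc']
        refine dif_neg fun h => hne (j, i) (mem_weightCells.2 ⟨j - 2 * d, by omega, i, h.1, ?_⟩)
          ⟨rfl, rfl, h.2.1⟩
        congr 1
        omega
      · intro e he
        obtain ⟨s, hs, i, hi, rfl⟩ := mem_weightCells.1 he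
        simp only [guessSource]
        by_cases hsd : s < d
        · rw [if_pos (by omega), hc₁ ⟨i, hi⟩, vW ⟨s, hsd⟩ ⟨i, hi⟩]
          exact hW _ _
        · obtain ⟨t, rfl⟩ := Nat.exists_eq_add_of_le (not_lt.1 hsd)
          rw [if_neg (by omega), if_pos (by omega), hc₂ ⟨i, hi⟩,
            show 2 * d + (d + t) = 3 * d + t by omega, vU ⟨t, by omega⟩ ⟨i, hi⟩]
          exact hU _ _
    refine ⟨c', hg, fun c'' hg' => ?_⟩
    obtain ⟨m1, m2, m3⟩ := hmat hg hg'
    rw [CellsOK, m1, m2]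
    convert hall (fun i => c'' (4 * d) i 0) fun i => ?_ using 2
    · ext s i
      exact (m3 _ (by omega) _ _).trans (vW s i)
    · ext s i
      exact (m3 _ (by omega) _ _).trans (vU s i)
    · have := hg'.2 (4 * d, i) (mem_testCells.2 ⟨i, i.2, rfl⟩)
      simp only [guessSource] at this
      rwa [if_neg (by omega), if_neg (by omega), hc₁] at this

end

/-! ### Computing eigenvalues by root extraction -/

/-- Array `30` becomes the powers of the matrix in register `22`. -/
def powers : Stm :=
  .seq (.loop 25 0 (.loop 26 0 (.asg ⟨30, [27, 25, 26]⟩ (.delta 25 26))))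
    (.loop 28 0 (.letAdd 29 28 24 (.loop 25 0 (.loop 26 0 (.asg ⟨30, [29, 25, 26]⟩
      (.sum 31 0 (.mul (.cell ⟨30, [28, 25, 31]⟩) (.cell ⟨0, [22, 31, 26]⟩))))))))

/-- Row `0` of array `35` becomes an annihilating polynomial of the matrix in register `22`. -/
def annihilator : Stm :=
  .seq powers (.seq (.loop 25 23 (.loop 26 23 (.asg ⟨31, [25, 26]⟩ (.delta 25 26))))
    (.seq (rowReduce 30 31 32 33 34 23 0 0 23)
      -- Register `0` holds n, so that the row belonging to the n-th power is copied.
      (.loop 25 23 (.asg ⟨35, [27, 25]⟩ (.cell ⟨31, [0, 25]⟩)))))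

/-- Find a root of the polynomial in row `28` of array `35`, and divide by its linear factor. -/
def deflate : Stm :=
  .seq (.root ⟨36, [22, 28]⟩ ⟨35, [28]⟩ 23) (.letAdd 29 28 24
    (.seq (.asg ⟨35, [29, 0]⟩ .zero) (.loop 25 0 (.letSub 26 0 25 (.letSub 31 26 24
      (.asg ⟨35, [29, 31]⟩ (.add (.cell ⟨35, [28, 26]⟩)
        (.mul (.cell ⟨36, [22, 28]⟩) (.cell ⟨35, [29, 26]⟩)))))))))

/-- Array `36` lists the eigenvalues of the first `m` matrices of the input, and array `37` tells
where one occurs for the first time. -/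
def eigenvalues (m : ℕ) : Stm :=
  .letConst 24 1 (.letConst 27 0 (.letAdd 23 0 24 (.letConst 32 m (.seq
    (.loop 22 32 (.seq annihilator (.loop 28 0 deflate)))
    (.loop 22 32 (.loop 28 0 (.asg ⟨37, [22, 28]⟩ (.ifz
      (.any 25 28 (.ifz (.sub (.cell ⟨36, [22, 25]⟩) (.cell ⟨36, [22, 28]⟩)) .one .zero))
        .one .zero))))))))

section

variable {F : Type*} [Field F] {ρ : Polynomial F → F} {n : ℕ}

theorem eigenvalues_wf (m : ℕ) : (eigenvalues m).WF {0} {0} := by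
  simp [eigenvalues, annihilator, powers, deflate, rowReduce, eliminate, findPivot, Stm.WF, Ex.WF]

/-- The registers of the program. -/
structure RootRegs (n j : ℕ) (r : ℕ → ℕ) : Prop where
  r0 : r 0 = n
  r22 : r 22 = j
  r23 : r 23 = n + 1
  r24 : r 24 = 1
  r27 : r 27 = 0

theorem powers_eval {j : ℕ} {r : ℕ → ℕ} {f : Mem F} (hr : RootRegs n j r) :
    ∃ f', powers.eval ρ r f = f' ∧ (∀ b, b ≠ 30 → f' b = f b) ∧
      ∀ k ≤ n, ∀ a b : Fin n, f' 30 [k, a, b] = (mat n f 0 [j] ^ k) a b := by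
  obtain ⟨r0, r22, r23, r24, r27⟩ := hr
  set f₁ := Stm.eval ρ (.loop 25 0 (.loop 26 0 (.asg ⟨30, [27, 25, 26]⟩ (.delta 25 26)))) r f with e₁
  have T₁ := Tab.loop₂ (ρ := ρ) (a := 30) (k := 25) (x := 0) (k' := 26) (x' := 0)
    (p := .asg ⟨30, [27, 25, 26]⟩ (.delta 25 26)) (r := r) (f := f)
    (fun i j => [0, i, j]) (fun i j => if i = j then 1 else 0) (by simp) (by norm_num) (by
      intro i hi j hj g' h1 h2
      simp only [Stm.eval, Ex.eval, List.map_cons, List.map_nil, Function.update_apply,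
        Nat.reduceEqDiff, reduceIte, r27])
  rw [← e₁, r0] at T₁
  have I := Stm.loop_induction (ρ := ρ) (k := 28) (x := 0) (p := .letAdd 29 28 24 (.loop 25 0
    (.loop 26 0 (.asg ⟨30, [29, 25, 26]⟩
      (.sum 31 0 (.mul (.cell ⟨30, [28, 25, 31]⟩) (.cell ⟨0, [22, 31, 26]⟩))))))) (r := r) (f := f₁)
    (fun i g => (∀ b, b ≠ 30 → g b = f b) ∧
      ∀ k ≤ i, ∀ a b : Fin n, g 30 [k, a, b] = (mat n f 0 [j] ^ k) a b) ?_ ?_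
  · rw [r0] at I
    exact ⟨_, by rw [powers, Stm.eval_seq, ← e₁], I.1, I.2⟩
  · refine ⟨fun b hb => T₁.arr hb, fun k hk a b => ?_⟩
    obtain rfl : k = 0 := by omega
    rw [T₁.val a.2 b.2, pow_zero, one_apply]
    simp only [Fin.ext_iff]
  · rintro i hi g ⟨h1, h2⟩
    rw [r0] at hi
    set r' := Function.update (Function.update r 28 i) 29 (i + 1) with hr'
    have r0' : r' 0 = n := by simp [hr', r0]
    have r28' : r' 28 = i := by simp [hr']
    have r29' : r' 29 = i + 1 := by simp [hr']
    have r22' : r' 22 = j := by simp [hr', r22]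
    clear_value r'
    have ev : Stm.eval ρ (.letAdd 29 28 24 (.loop 25 0 (.loop 26 0 (.asg ⟨30, [29, 25, 26]⟩
        (.sum 31 0 (.mul (.cell ⟨30, [28, 25, 31]⟩) (.cell ⟨0, [22, 31, 26]⟩)))))))
        (Function.update r 28 i) g = Stm.eval ρ (.loop 25 0 (.loop 26 0 (.asg ⟨30, [29, 25, 26]⟩
        (.sum 31 0 (.mul (.cell ⟨30, [28, 25, 31]⟩) (.cell ⟨0, [22, 31, 26]⟩)))))) r' g := by
      rw [Stm.eval_letAdd, hr']
      simp [r24]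
    have T := Tab.loop₂ (ρ := ρ) (a := 30) (k := 25) (x := 0) (k' := 26) (x' := 0)
      (p := .asg ⟨30, [29, 25, 26]⟩
        (.sum 31 0 (.mul (.cell ⟨30, [28, 25, 31]⟩) (.cell ⟨0, [22, 31, 26]⟩)))) (r := r') (f := g)
      (fun a b => [i + 1, a, b]) (fun a b => ∑ c ∈ Finset.range n, g 30 [i, a, c] * f 0 [j, c, b])
      (by simp) (by norm_num) (by
        intro a ha b hb g' h1' h2'
        simp only [Stm.eval, Ex.eval, List.map_cons, List.map_nil, Function.update_apply,
          Nat.reduceEqDiff, reduceIte, OfNat.zero_ne_ofNat, r0', r28', r29', r22',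
          h1' 0 (by norm_num), h1 0 (by norm_num)]
        congr 1
        refine Finset.sum_congr rfl fun c _ => ?_
        rw [h2' [i, a, c] (by simp)])
    rw [← ev, r0'] at T
    refine ⟨fun b hb => (T.arr hb).trans (h1 b hb), fun k hk a b => ?_⟩
    rcases Nat.lt_succ_iff_lt_or_eq.1 (Nat.lt_succ_of_le hk) with h | rfl
    · rw [T.off fun _ _ _ _ h' => by simp at h'; omega]
      exact h2 k (by omega) a b
    · rw [T.val a.2 b.2, pow_succ, mul_apply,
        ← Fin.sum_univ_eq_sum_range (fun c => g 30 [i, a, c] * f 0 [j, c, b])]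
      exact Finset.sum_congr rfl fun c _ => by rw [h2 i le_rfl a c]; rfl

/-- The polynomial in a row of array `35`. -/
noncomputable def rowPoly (n : ℕ) (f : Mem F) (k : ℕ) : Polynomial F :=
  ∑ i ∈ Finset.range (n + 1), Polynomial.monomial i (f 35 [k, i])

/-- By Cayley–Hamilton, the n-th power is a combination of the lower ones, so row n of the reduction
is a relation. It has leading coefficient one at the n-th power and gives a nonzero polynomial that
annihilates the matrix; every eigenvalue is a root of it, but other roots are not excluded. -/
theorem annihilator_eval {j : ℕ} {r : ℕ → ℕ} {f : Mem F} (hr : RootRegs n j r) :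
    ∃ f', annihilator.eval ρ r f = f' ∧ (∀ b, (b < 30 ∨ 35 < b) → f' b = f b) ∧
      rowPoly n f' 0 ≠ 0 ∧ (rowPoly n f' 0).natDegree ≤ n ∧
      ∀ a, IsEig (mat n f 0 [j]) a → (rowPoly n f' 0).IsRoot a := by
  obtain ⟨f₁, e₁, h₁, hp⟩ := powers_eval (ρ := ρ) (f := f) hr
  obtain ⟨r0, r22, r23, r24, r27⟩ := hr
  set M := mat n f 0 [j] with hM
  set f₂ := Stm.eval ρ (.loop 25 23 (.loop 26 23 (.asg ⟨31, [25, 26]⟩ (.delta 25 26)))) r f₁ with e₂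
  have T₂ := Tab.loop₂ (ρ := ρ) (a := 31) (k := 25) (x := 23) (k' := 26) (x' := 23)
    (p := .asg ⟨31, [25, 26]⟩ (.delta 25 26)) (r := r) (f := f₁)
    (fun i j => [i, j]) (fun i j => if i = j then 1 else 0) (by simp) (by norm_num) (by
      intro i hi j hj g' h1 h2
      simp only [Stm.eval, Ex.eval, List.map_cons, List.map_nil, Function.update_apply,
        Nat.reduceEqDiff, reduceIte])
  rw [← e₂, r23] at T₂
  obtain ⟨f₃, e₃, h₃, L, hL, hY⟩ := rowReduce_isReduction (ρ := ρ) (S := 30) (Y := 31) (PV := 32)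
    (Z := 33) (t := 34) (m := 23) (w₁ := 0) (w₂ := 0) (w := 23) (r := r) (by decide)
    (by norm_num) (by norm_num) (by norm_num) f₂
  rw [r23, r0] at hL
  rw [r23] at hY
  set f₄ := Stm.eval ρ (.loop 25 23 (.asg ⟨35, [27, 25]⟩ (.cell ⟨31, [0, 25]⟩))) r f₃ with e₄
  have T₄ := Tab.loop₁ (ρ := ρ) (a := 35) (k := 25) (x := 23)
    (p := .asg ⟨35, [27, 25]⟩ (.cell ⟨31, [0, 25]⟩)) (r := r) (f := f₃)
    (fun i => [0, i]) (fun i => f₃ 31 [n, i]) (by simp) (by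
      intro i hi g' h1 h2
      simp only [Stm.eval, Ex.eval, List.map_cons, List.map_nil, Function.update_apply,
        Nat.reduceEqDiff, reduceIte, OfNat.zero_ne_ofNat, r0, r27, h1 31 (by norm_num)])
  rw [← e₄, r23] at T₄
  set x := row₂ f₂ 30 n n with hx
  have hxM : ∀ k ≤ n, ∀ p, x k p = (M ^ k) p.1 p.2 := fun k hk p => by
    rw [hx, row₂, T₂.arr (by norm_num), hp k hk]
  have hcoef : ∀ i < n + 1, f₄ 35 [0, i] = relation L n i := fun i hi => by
    rw [T₄.val hi]
    exact unit_rows_relation (fun i hi j hj => T₂.val hi hj) (hY n (by omega)) (by omega) hi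
  have hz : f₃ 33 [n] = 0 := by
    refine hL.span n (by omega) ?_
    have : x n = ∑ i : Fin n, - M.charpoly.coeff i • x i := by
      funext p
      have h0 := Matrix.aeval_self_charpoly M
      rw [Polynomial.aeval_eq_sum_range, Matrix.charpoly_natDegree_eq_dim, Fintype.card_fin,
        Finset.sum_range_succ] at h0
      have hlead : M.charpoly.coeff n = 1 := by
        have := M.charpoly_monic.coeff_natDegree
        rwa [Matrix.charpoly_natDegree_eq_dim, Fintype.card_fin] at this
      rw [hlead, one_smul, ← Fin.sum_univ_eq_sum_range (fun i => M.charpoly.coeff i • M ^ i)] at h0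
      have h1 := congrFun (congrFun h0 p.1) p.2
      rw [Matrix.add_apply, Matrix.sum_apply, Matrix.zero_apply] at h1
      rw [hxM n le_rfl, Finset.sum_apply]
      simp only [Pi.smul_apply, hxM _ (Fin.is_lt _).le, smul_eq_mul, neg_mul,
        Finset.sum_neg_distrib]
      simp only [Matrix.smul_apply, smul_eq_mul] at h1
      linear_combination h1
    rw [this]
    exact sum_mem fun i _ => Submodule.smul_mem _ _ (Submodule.subset_span ⟨i, i.2, rfl⟩)
  have hrel := hL.rel n (by omega) hz
  rw [← sum_relation (m := n + 1) (by omega)] at hrel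
  have hpoly : rowPoly n f₄ 0 = ∑ i ∈ Finset.range (n + 1), Polynomial.monomial i (relation L n i) :=
    Finset.sum_congr rfl fun i hi => by rw [hcoef i (Finset.mem_range.1 hi)]
  refine ⟨f₄, ?_, fun b hb => ?_, fun h0 => ?_, ?_, ?_⟩
  · rw [annihilator, Stm.eval_seq, e₁, Stm.eval_seq, ← e₂, Stm.eval_seq, e₃]
  · rw [T₄.arr (by omega), h₃ b (by simp; omega), T₂.arr (by omega), h₁ b (by omega)]
  · have := congrArg (fun p => Polynomial.coeff p n) (hpoly.symm.trans h0)
    simp [Polynomial.coeff_monomial, relation] at this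
  · refine Polynomial.natDegree_sum_le_of_forall_le _ _ fun i hi => ?_
    exact (Polynomial.natDegree_monomial_le _).trans (by have := Finset.mem_range.1 hi; omega)
  · rintro a ⟨v, hv, hva⟩
    obtain ⟨p, hp0⟩ := Function.ne_iff.1 hv
    have hpow : ∀ k, (M ^ k) *ᵥ v = a ^ k • v := by
      intro k
      induction k with
      | zero => simp
      | succ k ih => rw [pow_succ, ← mulVec_mulVec, hva, mulVec_smul, ih, smul_smul, pow_succ']
    have h0 : ∑ i : Fin (n + 1), relation L n i • M ^ (i : ℕ) = 0 := by
      ext b c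
      have := congrFun hrel (b, c)
      simp only [Finset.sum_apply, Pi.smul_apply, smul_eq_mul, hxM _ (Fin.is_le _),
        Pi.zero_apply] at this
      simpa only [Matrix.sum_apply, Matrix.smul_apply, smul_eq_mul, Matrix.zero_apply] using this
    have h1 := congrFun (congrArg (fun X => X *ᵥ v) h0) p
    simp only [sum_mulVec, smul_mulVec, hpow, zero_mulVec, Finset.sum_apply, Pi.smul_apply,
      smul_eq_mul, Pi.zero_apply, ← mul_assoc, ← Finset.sum_mul] at h1
    have h2 := (mul_eq_zero.1 h1).resolve_right hp0
    rw [Polynomial.IsRoot, hpoly, Polynomial.eval_finsetSum, ← h2,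
      ← Fin.sum_univ_eq_sum_range (fun i => _)]
    simp only [Polynomial.eval_monomial]

/-- Synthetic division from the top: the coefficient of the quotient at `i` is that of the dividend
at `i + 1` plus the root times the quotient's coefficient at `i + 1`, starting from zero at n. The
remainder is the value of the polynomial at the divisor's root, which vanishes only if the
extraction was successful. -/
theorem deflate_eval {j k : ℕ} {r : ℕ → ℕ} {f : Mem F} (hr : RootRegs n j r) (hk : r 28 = k) :
    ∃ f', deflate.eval ρ r f = f' ∧ (∀ b, b ≠ 35 → b ≠ 36 → f' b = f b) ∧
      (∀ l, l ≠ [j, k] → f' 36 l = f 36 l) ∧ f' 36 [j, k] = ρ (rowPoly n f k) ∧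
      ((rowPoly n f k).IsRoot (ρ (rowPoly n f k)) → rowPoly n f k =
        (Polynomial.X - Polynomial.C (ρ (rowPoly n f k))) * rowPoly n f' (k + 1)) := by
  obtain ⟨r0, r22, r23, r24, r27⟩ := hr
  set lam := ρ (rowPoly n f k) with hlam
  set f₁ := f.set 36 [j, k] lam with hf₁
  have e₁ : Stm.eval ρ (.root ⟨36, [22, 28]⟩ ⟨35, [28]⟩ 23) r f = f₁ := by
    simp only [Stm.eval, List.map_cons, List.map_nil, r22, hk, r23, hf₁, hlam, rowPoly,
      List.cons_append, List.nil_append]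
  set r' := Function.update r 29 (k + 1) with hr'
  have r0' : r' 0 = n := by simp [hr', r0]
  have r28' : r' 28 = k := by simp [hr', hk]
  have r29' : r' 29 = k + 1 := by simp [hr']
  have r24' : r' 24 = 1 := by simp [hr', r24]
  have r22' : r' 22 = j := by simp [hr', r22]
  set p : Stm := .letSub 26 0 25 (.letSub 31 26 24
      (.asg ⟨35, [29, 31]⟩ (.add (.cell ⟨35, [28, 26]⟩)
        (.mul (.cell ⟨36, [22, 28]⟩) (.cell ⟨35, [29, 26]⟩))))) with hp
  set f₂ := f₁.set 35 [k + 1, n] 0 with hf₂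
  have ev : deflate.eval ρ r f = (Stm.loop 25 0 p).eval ρ r' f₂ := by
    rw [deflate, Stm.eval_seq, e₁, Stm.eval_letAdd, hk, r24, ← hr', Stm.eval_seq, ← hp]
    congr 1
    simp only [Stm.eval, Ex.eval, List.map_cons, List.map_nil, r29', r0', hf₂]
  have I := Stm.loop_induction (ρ := ρ) (k := 25) (x := 0) (p := p) (r := r') (f := f₂)
    (fun v g => (∀ b, b ≠ 35 → g b = f₁ b) ∧ (∀ i, g 35 [k, i] = f 35 [k, i]) ∧
      g 35 [k + 1, n] = 0 ∧ ∀ i < n, n ≤ i + v →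
        g 35 [k + 1, i] = f 35 [k, i + 1] + lam * g 35 [k + 1, i + 1]) ?_ ?_
  · rw [← ev, r0'] at I
    obtain ⟨h1, h2, h3, h4⟩ := I
    refine ⟨_, rfl, fun b hb hb' => ?_, fun l hl => ?_, ?_, fun hroot => ?_⟩
    · rw [h1 b hb, hf₁, Mem.set_arr _ hb']
    · rw [h1 36 (by norm_num), hf₁]
      simp [Mem.set, hl]
    · rw [h1 36 (by norm_num), hf₁, Mem.set_same]
    · set q : ℕ → F := fun i => deflate.eval ρ r f 35 [k + 1, i] with hq
      have hc : ∀ i < n, f 35 [k, i + 1] = q i - lam * q (i + 1) := fun i hi => by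
        rw [hq]
        simp only
        rw [h4 i hi (by omega)]
        ring
      have hqn : q n = 0 := h3
      have key : rowPoly n f k = (Polynomial.X - Polynomial.C lam) *
          rowPoly n (deflate.eval ρ r f) (k + 1) + Polynomial.C (f 35 [k, 0] + lam * q 0) := by
        have e1 : rowPoly n f k = ∑ i ∈ Finset.range n,
            Polynomial.monomial (i + 1) (q i - lam * q (i + 1)) +
              Polynomial.C (f 35 [k, 0]) := by
          rw [rowPoly, Finset.sum_range_succ', Polynomial.monomial_zero_left]
          congr 1
          exact Finset.sum_congr rfl fun i hi => by rw [hc i (Finset.mem_range.1 hi)]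
        have e2 : Polynomial.X * rowPoly n (deflate.eval ρ r f) (k + 1) =
            ∑ i ∈ Finset.range n, Polynomial.monomial (i + 1) (q i) := by
          rw [rowPoly, Finset.sum_range_succ]
          change Polynomial.X * (_ + Polynomial.monomial n (q n)) = _
          rw [hqn, Polynomial.monomial_zero_right, add_zero, Finset.mul_sum]
          exact Finset.sum_congr rfl fun i _ => by rw [Polynomial.X_mul_monomial]
        have e3 : Polynomial.C lam * rowPoly n (deflate.eval ρ r f) (k + 1) =
            ∑ i ∈ Finset.range n, Polynomial.monomial (i + 1) (lam * q (i + 1)) +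
              Polynomial.C (lam * q 0) := by
          rw [rowPoly, Finset.sum_range_succ', mul_add, Finset.mul_sum,
            Polynomial.monomial_zero_left, ← Polynomial.C_mul]
          congr 1
          exact Finset.sum_congr rfl fun i _ => by rw [Polynomial.C_mul_monomial]
        rw [sub_mul, e1, e2, e3, Polynomial.C_add]
        simp only [map_sub, Finset.sum_sub_distrib]
        ring
      have hr0 : f 35 [k, 0] + lam * q 0 = 0 := by
        have := hroot
        rw [key, Polynomial.IsRoot] at this
        simpa using this
      rw [hr0, Polynomial.C_0, add_zero] at key
      exact key
  · refine ⟨fun b hb => by rw [hf₂, Mem.set_arr _ hb], fun i => ?_, by rw [hf₂, Mem.set_same],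
      fun i hi hi' => by omega⟩
    simp [hf₂, hf₁, Mem.set]
  · rintro v hv g ⟨h1, h2, h3, h4⟩
    rw [r0'] at hv
    have e : p.eval ρ (Function.update r' 25 v) g = g.set 35 [k + 1, n - v - 1]
        (f 35 [k, n - v] + lam * g 35 [k + 1, n - v]) := by
      simp only [hp, Stm.eval, Ex.eval, List.map_cons, List.map_nil, Function.update_apply,
          Nat.reduceEqDiff, reduceIte, OfNat.zero_ne_ofNat, r0', r28', r29', r22', r24',
          h1 36 (by norm_num), h2, hf₁, Mem.set_same]
    rw [e]
    refine ⟨fun b hb => by rw [Mem.set_arr _ hb, h1 b hb], fun i => ?_, ?_, fun i hi hi' => ?_⟩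
    · rw [← h2 i]; simp [Mem.set]
    · rw [← h3]
      simp only [Mem.set, List.cons.injEq, and_true, true_and]
      rw [if_neg (by omega)]
    · have hne : ¬ (i + 1 = n - v - 1) := by omega
      by_cases hiv : i = n - v - 1
      · subst hiv
        rw [Mem.set_same, show n - v - 1 + 1 = n - v by omega]
        simp only [Mem.set, List.cons.injEq, and_true, true_and]
        rw [if_neg (by omega)]
      · simp only [Mem.set, List.cons.injEq, and_true, true_and, if_neg hiv, if_neg hne]
        exact h4 i hi (by omega)

/-- Invariant: a root of the original polynomial is either listed already or still a root of the
current nonzero quotient, whose degree drops with every division. After n turns the second is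
impossible for a constant. Once a quotient has no root, the value extracted is arbitrary; but then
all roots have been listed, and superfluous entries do no harm. -/
theorem deflate_loop {j : ℕ} {r : ℕ → ℕ} {f : Mem F} (hρ : IsRootFinder ρ) (hr : RootRegs n j r)
    (h0 : rowPoly n f 0 ≠ 0) (hdeg : (rowPoly n f 0).natDegree ≤ n) :
    ∃ f', (Stm.loop 28 0 deflate).eval ρ r f = f' ∧ (∀ b, b ≠ 35 → b ≠ 36 → f' b = f b) ∧
      (∀ i k, i ≠ j → f' 36 [i, k] = f 36 [i, k]) ∧
      ∀ a, (rowPoly n f 0).IsRoot a → ∃ k < n, f' 36 [j, k] = a := by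
  have I := Stm.loop_induction (ρ := ρ) (k := 28) (x := 0) (p := deflate) (r := r) (f := f)
    (fun k g => (∀ b, b ≠ 35 → b ≠ 36 → g b = f b) ∧
      (∀ i k, i ≠ j → g 36 [i, k] = f 36 [i, k]) ∧
      ∀ a, (rowPoly n f 0).IsRoot a → (∃ t < k, g 36 [j, t] = a) ∨
        (rowPoly n g k ≠ 0 ∧ (rowPoly n g k).natDegree + k ≤ n ∧ (rowPoly n g k).IsRoot a)) ?_ ?_
  · rw [hr.r0] at I
    refine ⟨_, rfl, I.1, I.2.1, fun a ha => (I.2.2 a ha).resolve_right ?_⟩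
    rintro ⟨h1, h2, h3⟩
    rw [Polynomial.eq_C_of_natDegree_eq_zero (Nat.le_zero.1 (Nat.le_of_add_le_add_right
      (h2.trans_eq (zero_add n).symm)))] at h1 h3
    rw [Polynomial.IsRoot, Polynomial.eval_C] at h3
    rw [h3] at h1
    exact h1 Polynomial.C_0
  · exact ⟨fun _ _ _ => rfl, fun _ _ _ => rfl, fun a ha => Or.inr ⟨h0, hdeg, ha⟩⟩
  · rintro k hk g ⟨h1, h2, h3⟩
    rw [hr.r0] at hk
    have hr' : RootRegs n j (Function.update r 28 k) := by
      obtain ⟨r0, r22, r23, r24, r27⟩ := hr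
      constructor <;> simpa
    obtain ⟨g', e', f1, f2, f3, f4⟩ := deflate_eval (ρ := ρ) (f := g) hr'
      (Function.update_self _ _ _)
    rw [e']
    refine ⟨fun b hb hb' => by rw [f1 b hb hb', h1 b hb hb'], fun i t hi => ?_, fun a ha => ?_⟩
    · rw [f2 _ (by simp [hi]), h2 i t hi]
    · rcases h3 a ha with ⟨t, ht, h⟩ | ⟨g1, g2, g3⟩
      · exact Or.inl ⟨t, by omega, by rw [f2 _ (by simp; omega), h]⟩
      · have hroot := hρ _ g1 ⟨a, g3⟩
        have hmul := f4 hroot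
        by_cases hae : ρ (rowPoly n g k) = a
        · exact Or.inl ⟨k, by omega, f3.trans hae⟩
        · right
          have hne : rowPoly n g' (k + 1) ≠ 0 := fun h => g1 (by rw [hmul, h, mul_zero])
          refine ⟨hne, ?_, ?_⟩
          · have := congrArg Polynomial.natDegree hmul
            rw [Polynomial.natDegree_mul (Polynomial.X_sub_C_ne_zero _) hne,
              Polynomial.natDegree_X_sub_C] at this
            omega
          · rw [hmul, Polynomial.IsRoot, Polynomial.eval_mul, mul_eq_zero] at g3
            refine g3.resolve_left fun h => hae ?_
            rw [Polynomial.eval_sub, Polynomial.eval_X, Polynomial.eval_C, sub_eq_zero] at h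
            exact h.symm

open Classical in
/-- The lists of eigenvalues are complete. -/
theorem eigenvalues_eval {m : ℕ} {r : ℕ → ℕ} {f : Mem F} (hρ : IsRootFinder ρ) (hr : r 0 = n) :
    ∃ f', (eigenvalues m).eval ρ r f = f' ∧ (∀ b, (b < 30 ∨ 37 < b) → f' b = f b) ∧
      (∀ j < m, ∀ a, IsEig (mat n f 0 [j]) a → ∃ k < n, f' 36 [j, k] = a) ∧
      ∀ j < m, ∀ k < n, f' 37 [j, k] ≠ 0 ↔ ∀ t < k, f' 36 [j, t] ≠ f' 36 [j, k] := by
  set r' := Function.update (Function.update (Function.update (Function.update r 24 1) 27 0) 23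
    (n + 1)) 32 m with hr'
  have r0' : r' 0 = n := by simp [hr', hr]
  have r32' : r' 32 = m := by simp [hr']
  have hR : ∀ j, RootRegs n j (Function.update r' 22 j) := fun j => by
    constructor <;> simp [hr', hr]
  have ev : ∀ p, (Stm.letConst 24 1 (.letConst 27 0 (.letAdd 23 0 24 (.letConst 32 m p)))).eval ρ r f
      = p.eval ρ r' f := fun p => by
    rw [Stm.eval_letConst, Stm.eval_letConst, Stm.eval_letAdd, Stm.eval_letConst, hr']
    simp [hr]
  clear_value r'
  have I := Stm.loop_induction (ρ := ρ) (k := 22) (x := 32)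
    (p := .seq annihilator (.loop 28 0 deflate)) (r := r') (f := f)
    (fun i g => (∀ b, (b < 30 ∨ 36 < b) → g b = f b) ∧
      ∀ j < i, ∀ a, IsEig (mat n f 0 [j]) a → ∃ k < n, g 36 [j, k] = a)
    ⟨fun _ _ => rfl, fun j hj => absurd hj (by omega)⟩ ?_
  · rw [r32'] at I
    set f₁ := (Stm.loop 22 32 (.seq annihilator (.loop 28 0 deflate))).eval ρ r' f with e₁
    have T := Tab.loop₂ (ρ := ρ) (a := 37) (k := 22) (x := 32) (k' := 28) (x' := 0)
      (p := .asg ⟨37, [22, 28]⟩ (.ifz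
        (.any 25 28 (.ifz (.sub (.cell ⟨36, [22, 25]⟩) (.cell ⟨36, [22, 28]⟩)) .one .zero))
        .one .zero)) (r := r') (f := f₁)
      (fun i j => [i, j]) (fun i j => (Ex.ifz
        (.any 25 28 (.ifz (.sub (.cell ⟨36, [22, 25]⟩) (.cell ⟨36, [22, 28]⟩)) .one .zero))
        .one .zero).eval (Function.update (Function.update r' 22 i) 28 j) f₁) (by simp)
      (by norm_num) (by
        intro i hi j hj g' h1 h2
        simp only [Stm.eval, Ex.eval, List.map_cons, List.map_nil, Function.update_apply,
          Nat.reduceEqDiff, reduceIte, h1 36 (by norm_num)])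
    rw [r0', r32'] at T
    refine ⟨_, by rw [eigenvalues, ev, Stm.eval_seq, ← e₁], fun b hb => ?_, fun j hj a ha => ?_,
      fun j hj k hk => ?_⟩
    · rw [T.arr (by omega), I.1 b (by omega)]
    · rw [T.arr (by norm_num)]
      exact I.2 j hj a ha
    · rw [T.val hj hk, T.arr (b := 36) (by norm_num), Ex.eval]
      have := Ex.eval_any_eq_zero 25 28
        (.ifz (.sub (.cell ⟨36, [22, 25]⟩) (.cell ⟨36, [22, 28]⟩)) .one .zero)
        (Function.update (Function.update r' 22 j) 28 k) f₁
      have hite : ∀ p : Prop, (if p then (1 : F) else 0) ≠ 0 ↔ p := fun p => by simp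
      refine (hite _).trans (this.trans ?_)
      simp [Ex.eval, sub_eq_zero]
  · rintro i hi g ⟨h1, h2⟩
    obtain ⟨g₁, e₁, f₁, p1, p2, p3⟩ := annihilator_eval (ρ := ρ) (f := g) (hR i)
    obtain ⟨g₂, e₂, f₂, q1, q2⟩ := deflate_loop hρ (hR i) p1 p2
    rw [Stm.eval_seq, e₁, e₂]
    refine ⟨fun b hb => by rw [f₂ b (by omega) (by omega), f₁ b (by omega), h1 b hb],
      fun j hj a ha => ?_⟩
    rcases Nat.lt_succ_iff_lt_or_eq.1 hj with h | rfl
    · obtain ⟨k, hk, hk'⟩ := h2 j h a ha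
      exact ⟨k, hk, by rw [q1 _ _ h.ne, f₁ 36 (by norm_num), hk']⟩
    · refine q2 a (p3 a ?_)
      have : mat n g 0 [j] = mat n f 0 [j] := by simp only [mat, h1 0 (by norm_num)]
      rwa [this]

end

/-! ### The search program -/

/-- Write an eigenvalue into a cell. -/
def writeCell (e : ℕ × ℕ) (m v : ℕ) : Stm :=
  .letConst 4 e.1 (.letConst 5 e.2 (.letConst 6 0 (.letConst 7 m
    (.asg ⟨0, [4, 5, 6]⟩ (.cell ⟨36, [7, v]⟩)))))

/-- Run the statement for all choices of eigenvalues in the given cells; the registers from `v` on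
count them. -/
def chooseCells (src : ℕ → ℕ → ℕ) : List (ℕ × ℕ) → ℕ → Stm → Stm
  | [], _, p => p
  | e :: l, v, p => .loop v 0 (.seq
      (.letConst 7 (src e.1 e.2) (.asg ⟨39, []⟩ (.cell ⟨37, [7, v]⟩)))
      (.ifz (.cell ⟨39, []⟩) .skip
        (.seq (writeCell e (src e.1 e.2) v) (chooseCells src l (v + 1) p))))

/-- Test the weights in the cells; if they pass, array `2` becomes a conjugating matrix. -/
def searchWeights (d v : ℕ) : Stm :=
  .seq (.asg ⟨21, []⟩ .zero) (.seq (matTab ⟨22, []⟩ .zero)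
    (.seq (chooseCells (guessSource d) (testCells d) v (check d))
      (.ifz (.cell ⟨21, []⟩)
        (.seq (matTab ⟨2, []⟩ (.cell ⟨22, [4, 5]⟩)) (.asg ⟨38, []⟩ .one)) .skip)))

/-- Search for a matrix that conjugates two Lie algebras of dimension `d`. -/
def searchStm (d : ℕ) : Stm :=
  .seq (eigenvalues (2 * d)) (.seq (.asg ⟨38, []⟩ .zero)
    (chooseCells (guessSource d) (weightCells d) 40
      (searchWeights d (40 + (weightCells d).length))))

/-- The registers that are in use. -/
def InUse (v : ℕ) (S : Set ℕ) : Prop := 0 ∈ S ∧ ∀ x ∈ S, x = 0 ∨ (22 ≤ x ∧ x < v)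

theorem InUse.insert {v : ℕ} {S : Set ℕ} (h : InUse v S) (hv : 22 ≤ v) :
    InUse (v + 1) (insert v S) := by
  refine ⟨Or.inr h.1, fun x hx => ?_⟩
  rcases hx with rfl | hx
  · omega
  · have := h.2 x hx
    omega

theorem InUse.notMem {v : ℕ} {S : Set ℕ} (h : InUse v S) {x : ℕ} (hx : x ≠ 0)
    (hx' : x < 22 ∨ v ≤ x) : x ∉ S := fun hm => by
  have := h.2 x hm
  omega

/-- Each nested loop takes the next free register as its counter; the innermost statement has to
respect all of them. -/
theorem chooseCells_wf {src : ℕ → ℕ → ℕ} {p : Stm} (l : List (ℕ × ℕ)) : ∀ {v : ℕ}, 22 ≤ v →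
    (∀ V B, InUse (v + l.length) V → InUse (v + l.length) B → p.WF V B) →
    ∀ {V B : Set ℕ}, InUse v V → InUse v B → (chooseCells src l v p).WF V B := by
  induction l with
  | nil => exact fun _ hp V B hV hB => hp V B hV hB
  | cons e l ih =>
    intro v hv hp V B hV hB
    have hV' := hV.insert hv
    have ih := ih (v := v + 1) (by omega) (fun V B hV hB => hp V B
      (by rwa [List.length_cons, ← add_assoc, add_right_comm])
      (by rwa [List.length_cons, ← add_assoc, add_right_comm])) hV' (hB.insert hv)
    have n4 := hV.notMem (x := 4) (by norm_num) (by norm_num)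
    have n5 := hV.notMem (x := 5) (by norm_num) (by norm_num)
    have n6 := hV.notMem (x := 6) (by norm_num) (by norm_num)
    have n7 := hV.notMem (x := 7) (by norm_num) (by norm_num)
    refine ⟨hV.1, hB.1, hV.notMem (by omega) (Or.inr le_rfl), by omega, ?_, ?_, trivial, ?_, ih⟩
    · simp [Stm.WF, Ex.WF, n7]
      omega
    · simp [Ex.WF]
    · simp [writeCell, Stm.WF, Ex.WF, n4, n5, n6, n7]
      omega

theorem searchWeights_wf (d v : ℕ) (hv : 22 ≤ v) {V B : Set ℕ} (hV : InUse v V) (hB : InUse v B) :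
    (searchWeights d v).WF V B := by
  have n4 := hV.notMem (x := 4) (by norm_num) (by norm_num)
  have n5 := hV.notMem (x := 5) (by norm_num) (by norm_num)
  refine ⟨by simp [Stm.WF, Ex.WF], ?_, chooseCells_wf _ hv (fun V B hV hB => check_wf d hV.1 hB.1
    (fun x hx => (hV.2 x hx).imp id And.left) (fun x hx => (hB.2 x hx).imp id And.left)) hV hB,
    by simp [Ex.WF], ⟨?_, by simp [Stm.WF, Ex.WF]⟩, trivial⟩
  · simp [matTab, Stm.WF, Ex.WF, Loc.entry, hV.1, hB.1, n4, n5]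
  · simp [matTab, Stm.WF, Ex.WF, Loc.entry, hV.1, hB.1, n4, n5]

theorem searchStm_wf (d : ℕ) : (searchStm d).WF {0} {0} := by
  have h : ∀ v, InUse v {0} := fun v => ⟨rfl, fun x hx => Or.inl hx⟩
  exact ⟨eigenvalues_wf _, by simp [Stm.WF, Ex.WF], chooseCells_wf _ (by norm_num)
    (fun V B hV hB => searchWeights_wf d _ (by omega) hV hB) (h _) (h _)⟩

/-! ### Exhaustive search over lists of eigenvalues. -/

section

variable {F : Type*} [Field F] {ρ : Polynomial F → F} {n d : ℕ}

open Classical in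
/-- The distinct values among the first `k` entries of row `m` of a table, where a second table
marks the first occurrences. -/
noncomputable def values (lam lv : List ℕ → F) (k m : ℕ) : List F :=
  ((List.range k).filter fun t => lv [m, t] ≠ 0).map fun t => lam [m, t]

/-- All ways to fill the cells of the list with values. -/
noncomputable def choices (val : ℕ → List F) (src : ℕ → ℕ → ℕ) :
    List (ℕ × ℕ) → Cells F → List (Cells F)
  | [], c => [c]
  | e :: l, c => (val (src e.1 e.2)).flatMap fun a => choices val src l (c.set e.1 e.2 a)

theorem choices_off {val : ℕ → List F} {src : ℕ → ℕ → ℕ} (l : List (ℕ × ℕ)) :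
    ∀ {c c' : Cells F}, c' ∈ choices val src l c →
      ∀ j r k, (∀ e ∈ l, ¬ (j = e.1 ∧ r = e.2 ∧ k = 0)) → c' j r k = c j r k := by
  induction l with
  | nil =>
    intro c c' h j r k _
    rw [List.mem_singleton.1 h]
  | cons e l ih =>
    intro c c' h j r k hl
    obtain ⟨a, -, h⟩ := List.mem_flatMap.1 h
    rw [ih h j r k fun e' he' => hl e' (by simp [he']), Cells.set, if_neg (hl e (by simp))]

theorem mem_choices {val : ℕ → List F} {src : ℕ → ℕ → ℕ} (l : List (ℕ × ℕ)) :
    ∀ {c c' : Cells F}, (∀ j r k, (∀ e ∈ l, ¬ (j = e.1 ∧ r = e.2 ∧ k = 0)) → c' j r k = c j r k) →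
      (∀ e ∈ l, c' e.1 e.2 0 ∈ val (src e.1 e.2)) → c' ∈ choices val src l c := by
  induction l with
  | nil =>
    intro c c' h _
    exact List.mem_singleton.2 (funext fun j => funext fun r => funext fun k => h j r k (by simp))
  | cons e l ih =>
    intro c c' h hv
    refine List.mem_flatMap.2 ⟨_, hv e (by simp), ih (fun j r k hl => ?_)
      fun e' he' => hv e' (by simp [he'])⟩
    rw [Cells.set]
    split_ifs with hjr
    · rw [hjr.1, hjr.2.1, hjr.2.2]
    · exact h j r k fun e' he' => by
        rcases List.mem_cons.1 he' with rfl | he'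
        · exact hjr
        · exact hl e' he'

/-- Repetitions must be excluded: a weight that is tried twice would contribute its block twice to
the conjugating matrix. -/
theorem choices_nodup {val : ℕ → List F} {src : ℕ → ℕ → ℕ} (l : List (ℕ × ℕ)) (hl : l.Nodup) :
    ∀ (c : Cells F), (∀ e ∈ l, (val (src e.1 e.2)).Nodup) → (choices val src l c).Nodup := by
  induction l with
  | nil => exact fun c _ => List.nodup_singleton c
  | cons e l ih =>
    intro c hv
    have hl' := List.nodup_cons.1 hl
    refine List.nodup_flatMap.2 ⟨fun a _ => ih hl'.2 _ fun e' he' => hv e' (by simp [he']), ?_⟩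
    refine (hv e (by simp)).imp fun {a b} hab c' ha hb => hab ?_
    have key : ∀ {x}, c' ∈ choices val src l (c.set e.1 e.2 x) → c' e.1 e.2 0 = x := fun {x} h => by
      rw [choices_off l h e.1 e.2 0 fun e' he' h => hl'.1 ?_, Cells.set, if_pos ⟨rfl, rfl, rfl⟩]
      rwa [show e = e' from Prod.ext h.1 h.2.1]
    rw [← key ha, ← key hb]

theorem values_succ (lam lv : List ℕ → F) (k m : ℕ) [Decidable (lv [m, k] = 0)] :
    values lam lv (k + 1) m = values lam lv k m ++ if lv [m, k] = 0 then [] else [lam [m, k]] := by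
  rw [values, List.range_succ, List.filter_append, List.map_append, values]
  congr 1
  split_ifs with h <;> simp [h]

theorem values_nodup {lam lv : List ℕ → F} {k m : ℕ}
    (h : ∀ t < k, lv [m, t] ≠ 0 ↔ ∀ q < t, lam [m, q] ≠ lam [m, t]) :
    (values lam lv k m).Nodup := by
  refine List.Nodup.map_on (fun x hx y hy hxy => ?_) (List.nodup_range.filter _)
  simp only [List.mem_filter, List.mem_range, decide_eq_true_eq] at hx hy
  rcases lt_trichotomy x y with hlt | heq | hlt
  · exact absurd hxy ((h y hy.1).1 hy.2 x hlt)
  · exact heq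
  · exact absurd hxy.symm ((h x hx.1).1 hx.2 y hlt)

theorem mem_values {lam lv : List ℕ → F} {n m : ℕ} {a : F}
    (h : ∀ t < n, lv [m, t] ≠ 0 ↔ ∀ q < t, lam [m, q] ≠ lam [m, t]) (ha : ∃ t < n, lam [m, t] = a) :
    a ∈ values lam lv n m := by
  classical
  obtain ⟨h1, h2⟩ := Nat.find_spec ha
  refine List.mem_map.2 ⟨Nat.find ha, List.mem_filter.2 ⟨List.mem_range.2 h1, ?_⟩, h2⟩
  rw [decide_eq_true_eq, h _ h1]
  intro q hq hlam
  exact Nat.find_min ha hq ⟨hq.trans h1, hlam.trans h2⟩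

/-- The memory shows the cells in `D`, except for those in the list. -/
def ShownOff (D : ℕ → ℕ → ℕ → Prop) (l : List (ℕ × ℕ)) (c : Cells F) (f : Mem F) : Prop :=
  ∀ j r k, D j r k → (∀ e ∈ l, ¬ (j = e.1 ∧ r = e.2 ∧ k = 0)) → f 0 [j, r, k] = c j r k

/-- The invariant `I` depends on the list of choices already tried, in the order of the loops. Cells
that are still to be chosen may contain anything, which is why `ShownOff` exempts them. -/
theorem chooseCells_eval {D : ℕ → ℕ → ℕ → Prop} {src : ℕ → ℕ → ℕ} {lam lv : List ℕ → F} {p : Stm}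
    (I : List (Cells F) → Mem F → Prop)
    (hI : ∀ done f a l x, a = 0 ∨ a = 39 → I done f → I done (f.set a l x)) (l : List (ℕ × ℕ)) :
    ∀ (v : ℕ) (c : Cells F) (done : List (Cells F)) (r : ℕ → ℕ) (f : Mem F), 22 ≤ v → r 0 = n →
      (∀ c' ∈ choices (values lam lv n) src l c, ∀ done r f, r 0 = n → f 36 = lam → f 37 = lv →
        ShownOff D [] c' f → I done f → p.eval ρ r f 36 = lam ∧ p.eval ρ r f 37 = lv ∧
          ShownOff D [] c' (p.eval ρ r f) ∧ I (done ++ [c']) (p.eval ρ r f)) →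
      f 36 = lam → f 37 = lv → ShownOff D l c f → I done f →
      (chooseCells src l v p).eval ρ r f 36 = lam ∧ (chooseCells src l v p).eval ρ r f 37 = lv ∧
        ShownOff D l c ((chooseCells src l v p).eval ρ r f) ∧
        I (done ++ choices (values lam lv n) src l c) ((chooseCells src l v p).eval ρ r f) := by
  classical
  induction l with
  | nil =>
    intro v c done r f _ hr hp h1 h2 h3 h4
    exact hp c (List.mem_singleton_self c) done r f hr h1 h2 h3 h4
  | cons e l ih =>
    intro v c done r f hv hr hp h1 h2 h3 h4
    set m := src e.1 e.2 with hm
    have L := Stm.loop_induction (ρ := ρ) (k := v) (x := 0) (p := .seq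
      (.letConst 7 m (.asg ⟨39, []⟩ (.cell ⟨37, [7, v]⟩)))
      (.ifz (.cell ⟨39, []⟩) .skip
        (.seq (writeCell e m v) (chooseCells src l (v + 1) p)))) (r := r) (f := f)
      (fun k g => g 36 = lam ∧ g 37 = lv ∧ ShownOff D (e :: l) c g ∧
        I (done ++ (values lam lv k m).flatMap fun a =>
          choices (values lam lv n) src l (c.set e.1 e.2 a)) g) ?_ ?_
    · rw [hr] at L
      exact L
    · exact ⟨h1, h2, h3, by simpa [values] using h4⟩
    · rintro k hk g ⟨g1, g2, g3, g4⟩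
      rw [hr] at hk
      set r' := Function.update r v k with hr'
      have r0' : r' 0 = n := by rw [hr', Function.update_of_ne (by omega), hr]
      have rv' : r' v = k := Function.update_self _ _ _
      clear_value r'
      have up : ∀ {x y : ℕ}, x < 22 → Function.update r' x y v = k := fun {x y} hx => by
        rw [Function.update_of_ne (by omega), rv']
      have e₁ : Stm.eval ρ (.letConst 7 m (.asg ⟨39, []⟩ (.cell ⟨37, [7, v]⟩))) r' g =
          g.set 39 [] (lv [m, k]) := by
        simp only [Stm.eval, Ex.eval, List.map_cons, List.map_nil, g2, Function.update_self,
          up (show 7 < 22 by norm_num)]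
      set g₁ := g.set 39 [] (lv [m, k]) with hg₁
      have a1 : ∀ b, b ≠ 39 → g₁ b = g b := fun b hb => by rw [hg₁, Mem.set_arr _ hb]
      have i1 := hI _ _ 39 [] (lv [m, k]) (Or.inr rfl) g4
      rw [← hg₁] at i1
      have s1 : ShownOff D (e :: l) c g₁ := fun j r k hj h => by
        rw [a1 0 (by norm_num)]; exact g3 j r k hj h
      rw [Stm.eval_seq, e₁, values_succ, Stm.eval]
      have hc : (Ex.cell ⟨39, []⟩).eval r' g₁ = lv [m, k] := Mem.set_same _ _ _ _
      rw [hc]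
      by_cases h0 : lv [m, k] = 0
      · rw [if_pos h0, if_pos h0, List.append_nil]
        exact ⟨by rw [Stm.eval, a1 36 (by norm_num), g1], by rw [Stm.eval, a1 37 (by norm_num), g2],
          s1, i1⟩
      · rw [if_neg h0, if_neg h0, List.flatMap_append, List.flatMap_singleton, ← List.append_assoc]
        have e₂ : (writeCell e m v).eval ρ r' g₁ = g₁.set 0 [e.1, e.2, 0] (lam [m, k]) := by
          have hv4 : v ≠ 4 := by omega
          have hv5 : v ≠ 5 := by omega
          have hv6 : v ≠ 6 := by omega
          have hv7 : v ≠ 7 := by omega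
          simp only [writeCell, Stm.eval, Ex.eval, List.map_cons, List.map_nil,
            Function.update_apply, Nat.reduceEqDiff, reduceIte, hv4, hv5, hv6, hv7, rv',
            a1 36 (by norm_num), g1]
        rw [Stm.eval_seq, e₂]
        set g₂ := g₁.set 0 [e.1, e.2, 0] (lam [m, k]) with hg₂
        have a2 : ∀ b, b ≠ 0 → g₂ b = g₁ b := fun b hb => by rw [hg₂, Mem.set_arr _ hb]
        have s2 : ShownOff D l (c.set e.1 e.2 (lam [m, k])) g₂ := by
          intro j r q hj hl
          rw [Cells.set]
          split_ifs with hjr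
          · rw [hjr.1, hjr.2.1, hjr.2.2, hg₂, Mem.set_same]
          · have : g₂ 0 [j, r, q] = g₁ 0 [j, r, q] := by simp [hg₂, Mem.set, hjr]
            rw [this]
            exact s1 j r q hj fun e' he' => by
              rcases List.mem_cons.1 he' with rfl | he'
              · exact hjr
              · exact hl e' he'
        obtain ⟨q1, q2, q3, q4⟩ := ih (v + 1) (c.set e.1 e.2 (lam [m, k])) _ r' g₂ (by omega) r0'
          (fun c' hc' => hp c' (List.mem_flatMap.2 ⟨lam [m, k], List.mem_map.2 ⟨k, by
            rw [← hm]; simp [hk, h0], rfl⟩, hc'⟩))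
          (by rw [a2 36 (by norm_num), a1 36 (by norm_num), g1])
          (by rw [a2 37 (by norm_num), a1 37 (by norm_num), g2]) s2
          (hI _ _ 0 _ _ (Or.inl rfl) i1)
        refine ⟨q1, q2, fun j r q hj hl => ?_, q4⟩
        rw [q3 j r q hj fun e' he' => hl e' (by simp [he']), Cells.set, if_neg (hl e (by simp))]

/-- The contribution of a weight to the conjugating matrix. -/
def IsBlock (A B : Fin d → Matrix (Fin n) (Fin n) F) (W U : Matrix (Fin d) (Fin d) F)
    (χ : Fin d → F) (K : Matrix (Fin n) (Fin n) F) : Prop :=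
  ∃ (k : ℕ) (φ v : Fin k → Fin n → F), Submodule.span F (Set.range φ) = leftEig A χ ∧
    (LinearIndependent F v ∧ Submodule.span F (Set.range v) = rightEig B (χ ᵥ* W⁻¹ ᵥ* U)) ∧
    K = ∑ t, vecMulVec (v t) (φ t)

/-- The blocks are added up in the order of the choices. Without repetitions, they can be viewed as
a function of the weight, and the sum over the list becomes one over a finite set. -/
theorem exists_map_of_forall₂ {α β : Type*} [Zero β] {R : α → β → Prop} {l : List α} {l' : List β}
    (h : List.Forall₂ R l l') (hl : l.Nodup) :
    ∃ K : α → β, (∀ x ∈ l, R x (K x)) ∧ l' = l.map K := by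
  classical
  induction h with
  | nil => exact ⟨fun _ => 0, by simp, rfl⟩
  | @cons a b l l' hab h ih =>
    obtain ⟨K, h1, rfl⟩ := ih (List.nodup_cons.1 hl).2
    have hne : ∀ x ∈ l, x ≠ a := fun x hx h => (List.nodup_cons.1 hl).1 (h ▸ hx)
    refine ⟨Function.update K a b, fun x hx => ?_, ?_⟩
    · rcases List.mem_cons.1 hx with rfl | hx
      · rwa [Function.update_self]
      · rw [Function.update_of_ne (hne x hx)]
        exact h1 x hx
    · rw [List.map_cons, Function.update_self]
      congr 1
      exact List.map_congr_left fun x hx => by rw [Function.update_of_ne (hne x hx)]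

/-- The weight in the test cells. -/
def Cells.weight (d : ℕ) (c : Cells F) : Fin d → F := fun i => c (4 * d) i 0

theorem choices_weight {val : ℕ → List F} {c c' : Cells F}
    (h : c' ∈ choices val (guessSource d) (testCells d) c) {j : ℕ} (hj : j < 4 * d) (r k : ℕ) :
    c' j r k = c j r k :=
  choices_off _ h j r k fun e he => by
    obtain ⟨i, hi, rfl⟩ := mem_testCells.1 he
    simp only
    omega

/-- Array `21` records whether some weight has failed, and array `22` accumulates the blocks. If the
candidate fails, arrays `2` and `38` stay as they were, so that a previous success is not lost. -/
theorem searchWeights_eval {A B : Fin d → Matrix (Fin n) (Fin n) F}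
    {W U : Matrix (Fin d) (Fin d) F} {lam lv : List ℕ → F} {v : ℕ} {c : Cells F} {r : ℕ → ℕ}
    {f : Mem F} (hv : 22 ≤ v) (hr : r 0 = n) (h36 : f 36 = lam) (h37 : f 37 = lv)
    (hc : ShownOff (fun j _ _ => j < 4 * d) [] c f) (hA : ∀ (i : Fin d) (j k : Fin n), c i j k = A i j k)
    (hB : ∀ (i : Fin d) (j k : Fin n), c (d + i) j k = B i j k)
    (hW : ∀ s i : Fin d, c (2 * d + s) i 0 = W s i) (hU : ∀ s i : Fin d, c (3 * d + s) i 0 = U s i) :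
    ∃ f', (searchWeights d v).eval ρ r f = f' ∧ f' 36 = lam ∧ f' 37 = lv ∧
      ShownOff (fun j _ _ => j < 4 * d) [] c f' ∧
      ((∃ c' ∈ choices (values lam lv n) (guessSource d) (testCells d) c,
          ¬ CheckOK A B W U (c'.weight d)) ∧ f' 38 = f 38 ∧ f' 2 = f 2 ∨
        (∀ c' ∈ choices (values lam lv n) (guessSource d) (testCells d) c,
          CheckOK A B W U (c'.weight d)) ∧ f' 38 [] = 1 ∧
        ∃ Ks, List.Forall₂ (IsBlock A B W U) ((choices (values lam lv n) (guessSource d)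
          (testCells d) c).map (Cells.weight d)) Ks ∧ mat n f' 2 [] = Ks.sum) := by
  classical
  set f₁ := f.set 21 [] 0 with hf₁
  obtain ⟨f₂, e₂, m₂, h₂⟩ := matTab_eval (ρ := ρ) (a := ⟨22, []⟩) (e := .zero) (g := f₁) hr
    (by simp) (by simp) 0 (fun _ _ _ _ _ => rfl)
  have a₂ : ∀ b, b ≠ 21 → b ≠ 22 → f₂ b = f b := fun b hb hb' => by
    rw [funext fun l => h₂ b l fun h => absurd h hb', hf₁, Mem.set_arr _ hb]
  have f21 : f₂ 21 [] = 0 := by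
    rw [h₂ 21 [] (by simp), hf₁, Mem.set_same]
  have L := chooseCells_eval (ρ := ρ) (n := n) (D := fun j r k => j < 4 * d ∨ (j = 4 * d ∧ r < d ∧ k = 0)) (src := guessSource d) (lam := lam)
    (lv := lv) (p := check d)
    (fun done g => g 38 = f 38 ∧ g 2 = f 2 ∧
      (g 21 [] = 0 ↔ ∀ c' ∈ done, CheckOK A B W U (Cells.weight d c')) ∧
      (g 21 [] = 0 → ∃ Ks, List.Forall₂ (IsBlock A B W U) (done.map (Cells.weight d)) Ks ∧
        mat n g 22 [] = Ks.sum)) ?_ (testCells d) v c [] r f₂ hv hr ?_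
      (by rw [a₂ 36 (by norm_num) (by norm_num), h36])
      (by rw [a₂ 37 (by norm_num) (by norm_num), h37]) ?_ ?_
  · set f₃ := (chooseCells (guessSource d) (testCells d) v (check d)).eval ρ r f₂ with e₃
    obtain ⟨l1, l2, l3, l4, l5, l6, l7⟩ := L
    rw [List.nil_append] at l6 l7
    have ev : (searchWeights d v).eval ρ r f = Stm.eval ρ (.ifz (.cell ⟨21, []⟩)
        (.seq (matTab ⟨2, []⟩ (.cell ⟨22, [4, 5]⟩)) (.asg ⟨38, []⟩ .one)) .skip) r f₃ := by
      rw [searchWeights, Stm.eval_seq, Stm.eval_seq, Stm.eval_seq, e₃, ← e₂]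
      rfl
    have hcell : (Ex.cell ⟨21, []⟩).eval r f₃ = f₃ 21 [] := rfl
    have s₃ : ShownOff (fun j _ _ => j < 4 * d) [] c f₃ := fun j r k hj _ => l3 j r k (Or.inl hj) fun e he => by
      obtain ⟨i, hi, rfl⟩ := mem_testCells.1 he
      simp only
      omega
    rw [ev, Stm.eval, hcell]
    by_cases h0 : f₃ 21 [] = 0
    · rw [if_pos h0]
      obtain ⟨f₄, e₄, m₄, h₄⟩ := matTab_eval (ρ := ρ) (a := ⟨2, []⟩) (e := .cell ⟨22, [4, 5]⟩)
        (g := f₃) hr (by simp) (by simp) (mat n f₃ 22 []) (by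
          intro i j g' hg _
          simp only [Ex.eval, List.map_cons, List.map_nil, Function.update_apply,
            Nat.reduceEqDiff, reduceIte, hg 22 (by norm_num)]
          rfl)
      have a₄ : ∀ b, b ≠ 2 → f₄ b = f₃ b := fun b hb => funext fun l => h₄ b l fun h => absurd h hb
      refine ⟨f₄.set 38 [] 1, by rw [Stm.eval_seq, e₄]; rfl, ?_, ?_, fun j r k hj hl => ?_,
        Or.inr ⟨l6.1 h0, Mem.set_same _ _ _ _, ?_⟩⟩
      · rw [Mem.set_arr _ (by norm_num), a₄ 36 (by norm_num), l1]
      · rw [Mem.set_arr _ (by norm_num), a₄ 37 (by norm_num), l2]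
      · rw [Mem.set_arr _ (by norm_num), a₄ 0 (by norm_num)]
        exact s₃ j r k hj hl
      · obtain ⟨Ks, k1, k2⟩ := l7 h0
        refine ⟨Ks, k1, ?_⟩
        rw [← k2]
        simp only [List.map_nil] at m₄
        rw [← m₄]
        simp only [mat, Mem.set_arr f₄ (show 2 ≠ 38 by norm_num)]
    · rw [if_neg h0]
      rw [l6] at h0
      push Not at h0
      exact ⟨f₃, rfl, l1, l2, s₃, Or.inl ⟨h0, l4, l5⟩⟩
  · rintro done g a l x ha ⟨i1, i2, i3, i4⟩
    have a1 : ∀ b, b ≠ 0 → b ≠ 39 → (g.set a l x) b = g b := fun b hb hb' =>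
      Mem.set_arr _ (by omega) _ _
    refine ⟨by rw [a1 38 (by norm_num) (by norm_num), i1], by rw [a1 2 (by norm_num) (by norm_num), i2],
      by rw [a1 21 (by norm_num) (by norm_num), i3], fun h => ?_⟩
    rw [a1 21 (by norm_num) (by norm_num)] at h
    simp only [mat, a1 22 (by norm_num) (by norm_num)]
    exact i4 h
  · rintro c' hc' done r g hr g1 g2 g3 ⟨i1, i2, i3, i4⟩
    have hcell : ∀ j < 4 * d, ∀ r k, g 0 [j, r, k] = c j r k := fun j hj r k =>
      (g3 j r k (Or.inl hj) (by simp)).trans (choices_weight hc' hj r k)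
    obtain ⟨g', e', a', ok', block⟩ := check_eval (ρ := ρ) (n := n) (d := d) (r := r) (f := g)
      (A := A) (B := B) (W := W) (U := U) (χ := Cells.weight d c') hr
      (fun i j k => (hcell _ (by omega) _ _).trans (hA i j k))
      (fun i j k => (hcell _ (by omega) _ _).trans (hB i j k))
      (fun s i => (hcell _ (by omega) _ _).trans (hW s i))
      (fun s i => (hcell _ (by omega) _ _).trans (hU s i))
      (fun i => g3 _ _ _ (Or.inr ⟨rfl, i.2, rfl⟩) (by simp))
    rw [e']
    refine ⟨by rw [a' 36 (by norm_num), g1], by rw [a' 37 (by norm_num), g2], fun j r k hj _ => by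
      rw [a' 0 (by norm_num)]; exact g3 j r k hj (by simp), by rw [a' 38 (by norm_num), i1],
      by rw [a' 2 (by norm_num), i2], ?_, fun h => ?_⟩
    · rw [ok', i3]
      simp only [List.mem_append, List.mem_singleton]
      constructor
      · rintro ⟨h1, h2⟩ x (hx | rfl)
        · exact h1 x hx
        · exact h2
      · exact fun h => ⟨fun x hx => h x (Or.inl hx), h c' (Or.inr rfl)⟩
    · obtain ⟨h1, h2⟩ := ok'.1 h
      obtain ⟨Ks, k1, k2⟩ := i4 h1
      obtain ⟨k, φ, w, b1, b2, b3, b4, b5⟩ := block h2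
      refine ⟨Ks ++ [∑ t, vecMulVec (w t) (φ t)], ?_, ?_⟩
      · rw [List.map_append]
        exact List.rel_append k1 (List.Forall₂.cons ⟨k, φ, w, b2, ⟨b3, b4⟩, rfl⟩ List.Forall₂.nil)
      · rw [b5, k2, List.sum_append, List.sum_singleton]
  · intro j r k hj hl
    rw [a₂ 0 (by norm_num) (by norm_num)]
    refine hc j r k (hj.resolve_right fun h => ?_) (by simp)
    exact hl (4 * d, r) (mem_testCells.2 ⟨r, h.2.1, rfl⟩) ⟨h.1, rfl, h.2.2⟩
  · refine ⟨a₂ 38 (by norm_num) (by norm_num), a₂ 2 (by norm_num) (by norm_num),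
      by simp [f21], fun _ => ⟨[], by simp, ?_⟩⟩
    simpa using m₂

/-- The search is successful if and only if the Lie algebras are conjugate. -/
theorem searchStm_eval {L₁ L₂ : LieSubalgebra F (Matrix (Fin n) (Fin n) F)} (hρ : IsRootFinder ρ)
    (b₁ : Module.Basis (Fin d) F L₁) (b₂ : Module.Basis (Fin d) F L₂)
    (h₁ : AbelianDiagonalizable L₁) (h₂ : AbelianDiagonalizable L₂) {r : ℕ → ℕ} {f : Mem F}
    (hr : r 0 = n) (hf₁ : ∀ i : Fin d, mat n f 0 [i] = basisMat b₁ i)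
    (hf₂ : ∀ i : Fin d, mat n f 0 [d + i] = basisMat b₂ i) :
    ∃ f', (searchStm d).eval ρ r f = f' ∧ ((f' 38 [] = 0 ∧ ¬ Conjugate L₁ L₂) ∨
      (f' 38 [] ≠ 0 ∧ ∃ g : GL (Fin n) F, (g : Matrix (Fin n) (Fin n) F) = mat n f' 2 [] ∧
        ConjugatedBy g L₁ L₂)) := by
  classical
  obtain ⟨f₁, e₁, a₁, hlam, hlv⟩ := eigenvalues_eval (m := 2 * d) (f := f) hρ hr
  set lam := f₁ 36 with hlam'
  set lv := f₁ 37 with hlv'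
  set f₂ := f₁.set 38 [] 0 with hf₂'
  have a₂ : ∀ b, b ≠ 38 → f₂ b = f₁ b := fun b hb => by rw [hf₂', Mem.set_arr _ hb]
  set c₀ : Cells F := fun j r k => f 0 [j, r, k] with hc₀
  set v := 40 + (weightCells d).length with hv
  have hval : ∀ m < 2 * d, ∀ x, IsEig (mat n f 0 [m]) x → x ∈ values lam lv n m :=
    fun m hm x hx => mem_values (hlv m hm) (hlam m hm x hx)
  have hsrc : ∀ i < d, guessSource d (4 * d) i = i := fun i hi => by
    simp only [guessSource]
    rw [if_neg (by omega), if_neg (by omega)]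
  have off : ∀ {c : Cells F}, c ∈ choices (values lam lv n) (guessSource d) (weightCells d) c₀ →
      ∀ j < 2 * d, ∀ r k, c j r k = f 0 [j, r, k] := fun h j hj r k =>
    choices_off _ h j r k fun e he => by
      obtain ⟨s, hs, i, hi, rfl⟩ := mem_weightCells.1 he
      simp only
      omega
  let OK : Cells F → Prop := fun c =>
    ∀ c' ∈ choices (values lam lv n) (guessSource d) (testCells d) c,
      CheckOK (basisMat b₁) (basisMat b₂) (Matrix.of fun s i : Fin d => c (2 * d + s) i 0)
        (Matrix.of fun s i : Fin d => c (3 * d + s) i 0) (c'.weight d)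
  have L := chooseCells_eval (ρ := ρ) (n := n) (D := fun j _ _ => j < 4 * d)
    (src := guessSource d) (lam := lam) (lv := lv) (p := searchWeights d v)
    (fun done g => (g 38 [] = 0 ∧ ∀ c ∈ done, ¬ OK c) ∨
      (g 38 [] ≠ 0 ∧ ∃ g' : GL (Fin n) F, (g' : Matrix (Fin n) (Fin n) F) = mat n g 2 [] ∧
        ConjugatedBy g' L₁ L₂)) ?_ (weightCells d) 40 c₀ [] r f₂ (by norm_num) hr ?_
      (a₂ 36 (by norm_num)) (a₂ 37 (by norm_num)) ?_ ?_
  · refine ⟨_, by rw [searchStm, Stm.eval_seq, e₁, Stm.eval_seq], ?_⟩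
    -- If the algebras were conjugate, the matrices `W` and `U` of a conjugation would consist of
    -- listed eigenvalues. They would have been among the candidates tried, and the test would have
    -- passed for all tuples, including superfluous ones.
    refine L.2.2.2.imp (fun h => ⟨h.1, fun hconj => ?_⟩) id
    obtain ⟨W, U, hW, hU, hall⟩ := exists_checkOK_of_conjugate b₁ b₂ h₁ hconj
    set c : Cells F := fun j i k =>
      if h : i < d ∧ k = 0 ∧ 2 * d ≤ j ∧ j < 4 * d then
        if h' : j < 3 * d then W ⟨j - 2 * d, by omega⟩ ⟨i, h.1⟩ else U ⟨j - 3 * d, by omega⟩ ⟨i, h.1⟩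
      else c₀ j i k with hc
    have vW : ∀ s i : Fin d, c (2 * d + s) i 0 = W s i := fun s i => by
      simp only [hc]
      have := i.2
      rw [dif_pos (by simp only [true_and]; omega), dif_pos (by omega)]
      congr
      omega
    have vU : ∀ s i : Fin d, c (3 * d + s) i 0 = U s i := fun s i => by
      simp only [hc]
      have := i.2
      rw [dif_pos (by simp only [true_and]; omega), dif_neg (by omega)]
      congr
      omega
    refine h.2 c ?_ ?_
    · rw [List.nil_append]
      refine mem_choices _ (fun j i k hne => ?_) fun e he => ?_
      · rw [hc]
        refine dif_neg fun h => hne (j, i) (mem_weightCells.2 ⟨j - 2 * d, by omega, i, h.1, ?_⟩)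
          ⟨rfl, rfl, h.2.1⟩
        congr 1
        omega
      · obtain ⟨s, hs, i, hi, rfl⟩ := mem_weightCells.1 he
        simp only [guessSource]
        by_cases hsd : s < d
        · rw [if_pos (by omega), vW ⟨s, hsd⟩ ⟨i, hi⟩]
          exact hval i (by omega) _ (by rw [hf₁ ⟨i, hi⟩]; exact hW _ _)
        · obtain ⟨t, rfl⟩ := Nat.exists_eq_add_of_le (not_lt.1 hsd)
          rw [if_neg (by omega), if_pos (by omega),
            show 2 * d + (d + t) = 3 * d + t by omega, vU ⟨t, by omega⟩ ⟨i, hi⟩]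
          exact hval (d + i) (by omega) _ (by rw [hf₂ ⟨i, hi⟩]; exact hU _ _)
    · intro c' _
      convert hall (c'.weight d) using 2
      · ext s i; exact vW s i
      · ext s i; exact vU s i
  · rintro done g b l x hb h
    have a1 : ∀ b', b' ≠ 0 → b' ≠ 39 → (g.set b l x) b' = g b' := fun b' hb hb' =>
      Mem.set_arr _ (by omega) _ _
    simpa only [mat, a1 38 (by norm_num) (by norm_num), a1 2 (by norm_num) (by norm_num)] using h
  · intro c hc done r g hr g1 g2 g3 hI
    obtain ⟨g', e', s1, s2, s3, h⟩ := searchWeights_eval (ρ := ρ) (v := v)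
      (A := basisMat b₁) (B := basisMat b₂) (W := Matrix.of fun s i : Fin d => c (2 * d + s) i 0)
      (U := Matrix.of fun s i : Fin d => c (3 * d + s) i 0) (by omega) hr g1 g2 g3
      (fun i j k => by rw [off hc _ (by omega), ← hf₁]; rfl)
      (fun i j k => by rw [off hc _ (by omega), ← hf₂]; rfl) (fun _ _ => rfl) (fun _ _ => rfl)
    rw [e']
    refine ⟨s1, s2, s3, ?_⟩
    rcases h with ⟨⟨c', hc', hno⟩, q1, q2⟩ | ⟨hok, q1, Ks, q2, q3⟩
    · simp only [mat, q1, q2]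
      refine hI.imp (fun h => ⟨h.1, fun x hx => ?_⟩) id
      rcases List.mem_append.1 hx with hx | hx
      · exact h.2 x hx
      · obtain rfl := List.mem_singleton.1 hx
        exact fun hOK => hno (hOK c' hc')
    · refine Or.inr ⟨by rw [q1]; exact one_ne_zero, ?_⟩
      set l := choices (values lam lv n) (guessSource d) (testCells d) c with hl
      -- Two of the choices can differ in the test cells only, and the marks of first occurrences
      -- make the listed values distinct.
      have hnd : (l.map (Cells.weight d)).Nodup := by
        refine List.Nodup.map_on (fun x hx y hy hxy => ?_) (choices_nodup _ ?_ _ fun e he => ?_)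
        · funext j r k
          by_cases h : ∀ e ∈ testCells d, ¬ (j = e.1 ∧ r = e.2 ∧ k = 0)
          · rw [choices_off _ hx j r k h, choices_off _ hy j r k h]
          · push Not at h
            obtain ⟨e, he, rfl, rfl, rfl⟩ := h
            obtain ⟨i, hi, rfl⟩ := mem_testCells.1 he
            exact congrFun hxy ⟨i, hi⟩
        · exact List.nodup_range.map fun i i' h => (Prod.ext_iff.1 h).2
        · obtain ⟨i, hi, rfl⟩ := mem_testCells.1 he
          simp only
          rw [hsrc i hi]
          exact values_nodup (hlv i (by omega))
      obtain ⟨K, hK, rfl⟩ := exists_map_of_forall₂ q2 hnd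
      have hK' : ∀ χ, ∃ (k : ℕ) (φ w : Fin k → Fin n → F), χ ∈ (l.map (Cells.weight d)).toFinset →
          Submodule.span F (Set.range φ) = leftEig (basisMat b₁) χ ∧
          (LinearIndependent F w ∧ Submodule.span F (Set.range w) = rightEig (basisMat b₂)
            (χ ᵥ* (Matrix.of fun s i : Fin d => c (2 * d + s) i 0)⁻¹ ᵥ*
              Matrix.of fun s i : Fin d => c (3 * d + s) i 0)) ∧
          K χ = ∑ t, vecMulVec (w t) (φ t) := by
        intro χ
        by_cases hχ : χ ∈ (l.map (Cells.weight d)).toFinset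
        · obtain ⟨k, φ, w, h⟩ := hK χ (List.mem_toFinset.1 hχ)
          exact ⟨k, φ, w, fun _ => h⟩
        · exact ⟨0, 0, 0, fun h => absurd h hχ⟩
      choose k φ w hkφ using hK'
      refine conjugatedBy_sum b₁ b₂ h₁ h₂ (X := (l.map (Cells.weight d)).toFinset) (fun χ hχ => ?_)
        (fun χ hχ => ?_) (k := k) (φ := φ) (v := w) (fun χ hχ => (hkφ χ hχ).1)
        (fun χ hχ => (hkφ χ hχ).2.1) ?_
      · refine List.mem_toFinset.2 (List.mem_map.2 ⟨fun j r k =>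
          if h : j = 4 * d ∧ r < d ∧ k = 0 then χ ⟨r, h.2.1⟩ else c j r k, ?_, ?_⟩)
        · refine mem_choices _ (fun j r k hne => ?_) fun e he => ?_
          · exact dif_neg fun h => hne (4 * d, r) (mem_testCells.2 ⟨r, h.2.1, rfl⟩)
              ⟨h.1, rfl, h.2.2⟩
          · obtain ⟨i, hi, rfl⟩ := mem_testCells.1 he
            simp only [hi, and_self, dif_pos]
            rw [hsrc i hi]
            exact hval i (by omega) _ (by rw [hf₁ ⟨i, hi⟩]; exact hχ ⟨i, hi⟩)
        · funext i
          simp [Cells.weight]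
      · obtain ⟨c', hc', rfl⟩ := List.mem_map.1 (List.mem_toFinset.1 hχ)
        exact hok c' hc'
      · rw [q3, ← List.sum_toFinset _ hnd]
        exact Finset.sum_congr rfl fun χ hχ => (hkφ χ hχ).2.2
  · intro j r k hj _
    rw [a₂ 0 (by norm_num), a₁ 0 (by norm_num)]
  · exact Or.inl ⟨Mem.set_same _ _ _ _, by simp⟩

end

/-! ### The programs for all dimensions -/

/-- Append the matrices in array `1` to those in array `0`. -/
def merge (d : ℕ) : Stm :=
  .letConst 16 d (.loop 4 16 (.loop 5 0 (.loop 6 0 (.letAdd 8 4 16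
    (.asg ⟨0, [8, 5, 6]⟩ (.cell ⟨1, [4, 5, 6]⟩))))))

/-- Run the program whose number is in register `1` and at most `D`. -/
def pick (f : ℕ → Prog) : ℕ → Prog
  | 0 => f 0
  | D + 1 => .seq (.natConst 3 D) (.ifLt 3 1 (f (D + 1)) (pick f D))

/-- Answer no if the dimensions are different, and else run the program for the dimension. -/
def byDimension (f : ℕ → Prog) (D : ℕ) : Prog :=
  .ifLt 1 2 (.natConst 0 0) (.ifLt 2 1 (.natConst 0 0) (pick f D))

/-- The decision program. -/
def decideProg (D : ℕ) : Prog := byDimension (fun d => .seq (merge d).compile (decideConj d)) D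

/-- The search program. -/
def searchProg (D : ℕ) : Prog :=
  byDimension (fun d => .seq (merge d).compile (.seq (searchStm d).compile
    (.ifZero ⟨38, []⟩ (.natConst 0 0) (.natConst 0 1)))) D

theorem pick_fieldOperationsOnly {f : ℕ → Prog} (h : ∀ d, (f d).FieldOperationsOnly) (D : ℕ) :
    (pick f D).FieldOperationsOnly := by
  induction D with
  | zero => exact h 0
  | succ D ih => exact ⟨trivial, h _, ih⟩

theorem decideProg_fieldOperationsOnly (D : ℕ) : (decideProg D).FieldOperationsOnly :=
  ⟨trivial, trivial, pick_fieldOperationsOnly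
    (f := fun d => .seq (merge d).compile (decideConj d)) (fun d => ⟨Stm.compile_fieldOperationsOnly _ trivial,
    decideConj_fieldOperationsOnly d⟩) D⟩

theorem merge_wf (d : ℕ) : (merge d).WF {0} {0} := by
  simp [merge, Stm.WF, Ex.WF]

/-- A bound for the running time of `byDimension`. -/
noncomputable def byDimensionCost (T : ℕ → Polynomial ℕ) (D : ℕ) : Polynomial ℕ :=
  ∑ d ∈ Finset.range (D + 1), T d + Polynomial.C (2 * D + 3)

section

variable {F : Type*} [Field F] {ρ : Polynomial F → F} {n d d₁ d₂ : ℕ}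

/-- The comparisons cost at most two steps for each dimension passed over, and they touch register
`3` only, so that the chosen program finds its input unchanged. -/
theorem pick_spec (f : ℕ → Prog) (D : ℕ) : ∀ s : State F, s.nat 1 ≤ D →
    ∃ s', s'.nat 0 = s.nat 0 ∧ s'.fld = s.fld ∧
      (pick f D).exec ρ s = (f (s.nat 1)).exec ρ s' ∧
      (pick f D).time ρ s ≤ (f (s.nat 1)).time ρ s' + 2 * D := by
  induction D with
  | zero =>
    intro s hs
    rw [Nat.le_zero.1 hs]
    exact ⟨s, rfl, rfl, rfl, le_rfl⟩
  | succ D ih =>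
    intro s hs
    set s₁ := (Prog.natConst 3 D).exec ρ s with hs₁
    have h1 : s₁.nat 1 = s.nat 1 := by simp [hs₁, Prog.exec]
    have h3 : s₁.nat 3 = D := by simp [hs₁, Prog.exec]
    have h0 : s₁.nat 0 = s.nat 0 := by simp [hs₁, Prog.exec]
    have hf : s₁.fld = s.fld := rfl
    rw [pick, Prog.exec_seq, Prog.time_seq, ← hs₁, Prog.exec, Prog.time, h1, h3]
    have ht : (Prog.natConst 3 D).time ρ s = 1 := rfl
    by_cases hlt : D < s.nat 1
    · rw [if_pos hlt, if_pos hlt, show s.nat 1 = D + 1 by omega]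
      exact ⟨s₁, h0, hf, rfl, by omega⟩
    · rw [if_neg hlt, if_neg hlt]
      obtain ⟨s', i0, i1, i2, i3⟩ := ih s₁ (by omega)
      rw [h1] at i2 i3
      exact ⟨s', i0.trans h0, i1.trans hf, i2, by omega⟩

theorem merge_eval {r : ℕ → ℕ} {f : Mem F} (hr : r 0 = n) :
    ∃ f', (merge d).eval ρ r f = f' ∧ (∀ b, b ≠ 0 → f' b = f b) ∧
      (∀ i < d, ∀ j < n, ∀ k < n, f' 0 [i, j, k] = f 0 [i, j, k]) ∧
      ∀ i < d, ∀ j < n, ∀ k < n, f' 0 [d + i, j, k] = f 1 [i, j, k] := by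
  set r' := Function.update r 16 d with hr'
  have r0 : r' 0 = n := by simp [hr', hr]
  have r16 : r' 16 = d := by simp [hr']
  obtain ⟨g, e, h1, h2⟩ := Tab.loop₃ (ρ := ρ) (a := 0) (k₁ := 4) (x₁ := 16) (k₂ := 5) (x₂ := 0)
    (k₃ := 6) (x₃ := 0) (p := .letAdd 8 4 16 (.asg ⟨0, [8, 5, 6]⟩ (.cell ⟨1, [4, 5, 6]⟩)))
    (r := r') (f := f) (fun i j k => [d + i, j, k]) (fun i j k => f 1 [i, j, k])
    (by simp) (by norm_num) (by norm_num) (by norm_num) (by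
      intro i hi j hj k hk g hg
      simp only [Stm.eval, Ex.eval, List.map_cons, List.map_nil, Function.update_apply,
        Nat.reduceEqDiff, reduceIte, r16, hg 1 (by norm_num), add_comm i])
  rw [r0, r16] at h1 h2
  refine ⟨g, by rw [merge, Stm.eval_letConst, e], fun b hb => funext fun l => h2 b l fun h =>
    absurd h hb, fun i hi j _ k _ => h2 0 _ fun _ i' _ j' _ k' _ h => ?_, h1⟩
  simp at h
  omega

variable {L₁ L₂ : LieSubalgebra F (Matrix (Fin n) (Fin n) F)}

theorem merge_input (b₁ : Module.Basis (Fin d) F L₁) (b₂ : Module.Basis (Fin d) F L₂)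
    {s : State F} (h0 : s.nat 0 = n) (hf : s.fld = (input b₁ b₂).fld) :
    ∃ s', (merge d).compile.exec ρ s = s' ∧
      (merge d).compile.time ρ s ≤ (merge d).cost.eval n ∧ s'.nat 0 = n ∧
      (∀ b, 30 ≤ b → ∀ l, s'.fld b l = 0) ∧
      (∀ i : Fin d, mat n s'.fld 0 [i] = basisMat b₁ i) ∧
      ∀ i : Fin d, mat n s'.fld 0 [d + i] = basisMat b₂ i := by
  obtain ⟨t, hn, hfld⟩ := Stm.step (ρ := ρ) (n := n) (merge_wf d) rfl (by simp) (s := s)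
    (by rintro y rfl; exact h0.le)
  obtain ⟨f', e', g1, g2, g3⟩ := merge_eval (ρ := ρ) (d := d) (f := s.fld) h0
  rw [e'] at hfld
  have hin : ∀ {m : ℕ} (M : Fin m → Matrix (Fin n) (Fin n) F) (i : Fin m) (j k : Fin n),
      matrixCells M [(i : ℕ), (j : ℕ), (k : ℕ)] = M i j k := fun M i j k => by
    simp [matrixCells]
  refine ⟨_, rfl, t, (hn 0 rfl).trans h0, fun b hb l => ?_, fun i => ?_, fun i => ?_⟩
  · rw [hfld b (by omega), g1 b (by omega), hf]
    obtain ⟨b, rfl⟩ := Nat.exists_eq_add_of_le' (show 2 ≤ b by omega)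
    rfl
  · ext j k
    rw [mat, of_apply, hfld 0 (by norm_num)]
    exact (g2 i i.2 j j.2 k k.2).trans (by rw [hf]; exact hin (basisMat b₁) i j k)
  · ext j k
    rw [mat, of_apply, hfld 0 (by norm_num)]
    exact (g3 i i.2 j j.2 k k.2).trans (by rw [hf]; exact hin (basisMat b₂) i j k)

/-- Different dimensions exclude conjugacy. For equal ones, the time is bounded by the sum of the
bounds for all dimensions up to `D`, a polynomial in n that depends on `D` alone. -/
theorem byDimension_spec {D : ℕ} {f : ℕ → Prog} {T : ℕ → Polynomial ℕ}
    (b₁ : Module.Basis (Fin d₁) F L₁) (b₂ : Module.Basis (Fin d₂) F L₂) (hD : d₁ ≤ D)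
    {ψ : State F → Prop} (hno : ∀ s : State F, s.nat 0 = 0 → ¬ Conjugate L₁ L₂ → ψ s)
    (hf : ∀ (b₂ : Module.Basis (Fin d₁) F L₂) (s : State F), s.nat 0 = n →
      s.fld = (input b₁ b₂).fld → (f d₁).time ρ s ≤ (T d₁).eval n ∧ ψ ((f d₁).exec ρ s)) :
    (byDimension f D).time ρ (input b₁ b₂) ≤ (byDimensionCost T D).eval n ∧
      ψ ((byDimension f D).exec ρ (input b₁ b₂)) := by
  set s := input b₁ b₂ with hs
  have s0 : s.nat 0 = n := rfl
  have s1 : s.nat 1 = d₁ := rfl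
  have s2 : s.nat 2 = d₂ := rfl
  have hcost : (byDimensionCost T D).eval n =
      ∑ d ∈ Finset.range (D + 1), (T d).eval n + (2 * D + 3) := by
    rw [byDimensionCost, Polynomial.eval_add, Polynomial.eval_C, Polynomial.eval_finsetSum]
  have hzero : (s.putNat 0 0).nat 0 = 0 := by simp
  simp only [hcost, byDimension, Prog.exec, Prog.time, s1, s2]
  rcases lt_trichotomy d₁ d₂ with h | h | h
  · rw [if_pos h, if_pos h]
    exact ⟨by omega, hno _ hzero fun hc => h.ne (Conjugate.card_eq hc b₁ b₂)⟩
  · subst h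
    simp only [lt_irrefl, if_false]
    obtain ⟨s', h0, h1, h2, h3⟩ := pick_spec (ρ := ρ) f D s (s1.trans_le hD)
    rw [s1] at h2 h3
    obtain ⟨t, hψ⟩ := hf b₂ s' (h0.trans s0) h1
    have := Finset.single_le_sum (f := fun d => (T d).eval n) (fun _ _ => Nat.zero_le _)
      (Finset.mem_range.2 (Nat.lt_succ_of_le hD))
    exact ⟨by rw [Nat.succ_eq_add_one] at this; omega, h2 ▸ hψ⟩
  · rw [if_neg h.not_gt, if_neg h.not_gt, if_pos h, if_pos h]
    exact ⟨by omega, hno _ hzero fun hc => h.ne' (Conjugate.card_eq hc b₁ b₂)⟩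

theorem decideProg_correct {D : ℕ} (b₁ : Module.Basis (Fin d₁) F L₁)
    (b₂ : Module.Basis (Fin d₂) F L₂) (h₁ : AbelianDiagonalizable L₁)
    (h₂ : AbelianDiagonalizable L₂) (hD : d₁ ≤ D) :
    (decideProg D).time ρ (input b₁ b₂) ≤
        (byDimensionCost (fun d => (merge d).cost + decideConjCost d) D).eval n ∧
      Decides L₁ L₂ ((decideProg D).exec ρ (input b₁ b₂)) := by
  refine byDimension_spec (ψ := Decides L₁ L₂) b₁ b₂ hD (fun s h0 h => Or.inr ⟨h0, h⟩)
    fun b₂ s h0 hf => ?_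
  obtain ⟨s', e, t, n', clean, m₁, m₂⟩ := merge_input (ρ := ρ) b₁ b₂ h0 hf
  obtain ⟨t', a⟩ := decideConj_correct (ρ := ρ) b₁ b₂ h₁ h₂ (s := s')
    (c := fun j r k => s'.fld 0 [j, r, k]) m₁ m₂ ⟨n', fun _ _ _ _ _ _ => rfl, clean⟩
  rw [Prog.exec_seq, Prog.time_seq, e, Polynomial.eval_add]
  exact ⟨add_le_add t t', a⟩

theorem searchProg_correct {D : ℕ} (hρ : IsRootFinder ρ) (b₁ : Module.Basis (Fin d₁) F L₁)
    (b₂ : Module.Basis (Fin d₂) F L₂) (h₁ : AbelianDiagonalizable L₁)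
    (h₂ : AbelianDiagonalizable L₂) (hD : d₁ ≤ D) :
    (searchProg D).time ρ (input b₁ b₂) ≤
        (byDimensionCost (fun d => (merge d).cost + ((searchStm d).cost + 2)) D).eval n ∧
      Finds L₁ L₂ ((searchProg D).exec ρ (input b₁ b₂)) := by
  refine byDimension_spec (ψ := Finds L₁ L₂) b₁ b₂ hD (fun s h0 h => Or.inr ⟨h0, h⟩)
    fun b₂ s h0 hf => ?_
  obtain ⟨s₁, e, t, n', -, m₁, m₂⟩ := merge_input (ρ := ρ) b₁ b₂ h0 hf
  obtain ⟨t', -, hfld⟩ := Stm.step (ρ := ρ) (n := n) (searchStm_wf d₁) rfl (by simp) (s := s₁)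
    (by rintro y rfl; exact n'.le)
  obtain ⟨f', e', h⟩ := searchStm_eval (ρ := ρ) hρ b₁ b₂ h₁ h₂ (r := s₁.nat) n' m₁ m₂
  rw [e'] at hfld
  set s₂ := (searchStm d₁).compile.exec ρ s₁ with hs₂
  have hget : s₂.get ⟨38, []⟩ = f' 38 [] := by rw [← hfld 38 (by norm_num)]; rfl
  rw [Prog.exec_seq, Prog.time_seq, e, Prog.exec_seq, Prog.time_seq, ← hs₂, Prog.exec, Prog.time,
    hget]
  constructor
  · simp only [Prog.time, ite_self, Polynomial.eval_add, Polynomial.eval_ofNat]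
    omega
  · rcases h with ⟨hz, hno⟩ | ⟨hz, g, hg, hconj⟩
    · rw [if_pos hz]
      exact Or.inr ⟨by simp [Prog.exec], hno⟩
    · rw [if_neg hz]
      refine Or.inl ⟨by simp [Prog.exec], g, ?_, hconj⟩
      rw [hg]
      ext i j
      change f' 2 _ = s₂.fld 2 _
      rw [hfld 2 (by norm_num)]
      rfl

end
end FieldRAM

theorem corollary2p2 (D : ℕ) :
    -- deciding conjugacy with field operations only
    (∃ (P : FieldRAM.Prog) (T : Polynomial ℕ), P.FieldOperationsOnly ∧
      ∀ (F : Type u) [Field F] (ρ : Polynomial F → F) (n d₁ d₂ : ℕ)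
        (L₁ L₂ : LieSubalgebra F (Matrix (Fin n) (Fin n) F))
        (b₁ : Module.Basis (Fin d₁) F L₁) (b₂ : Module.Basis (Fin d₂) F L₂),
        MatrixLie.AbelianDiagonalizable L₁ → MatrixLie.AbelianDiagonalizable L₂ →
        d₁ ≤ D → d₂ ≤ D →
          P.time ρ (MatrixLie.input b₁ b₂) ≤ T.eval n ∧
          MatrixLie.Decides L₁ L₂ (P.exec ρ (MatrixLie.input b₁ b₂))) ∧
    -- finding a conjugating matrix with field operations and root extraction
    (∃ (P : FieldRAM.Prog) (T : Polynomial ℕ),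
      ∀ (F : Type u) [Field F] (ρ : Polynomial F → F), FieldRAM.IsRootFinder ρ →
        ∀ (n d₁ d₂ : ℕ)
        (L₁ L₂ : LieSubalgebra F (Matrix (Fin n) (Fin n) F))
        (b₁ : Module.Basis (Fin d₁) F L₁) (b₂ : Module.Basis (Fin d₂) F L₂),
        MatrixLie.AbelianDiagonalizable L₁ → MatrixLie.AbelianDiagonalizable L₂ →
        d₁ ≤ D → d₂ ≤ D →
          P.time ρ (MatrixLie.input b₁ b₂) ≤ T.eval n ∧
          MatrixLie.Finds L₁ L₂ (P.exec ρ (MatrixLie.input b₁ b₂))) :=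
  ⟨⟨FieldRAM.decideProg D, _, FieldRAM.decideProg_fieldOperationsOnly D,
    fun _ _ _ _ _ _ _ _ b₁ b₂ h₁ h₂ hD _ => FieldRAM.decideProg_correct b₁ b₂ h₁ h₂ hD⟩,
    FieldRAM.searchProg D, _, fun _ _ _ hρ _ _ _ _ _ b₁ b₂ h₁ h₂ hD _ =>
      FieldRAM.searchProg_correct hρ b₁ b₂ h₁ h₂ hD⟩
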